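/- Let $(M,\pi)$ be a Poisson manifold (smooth, finite-dimensional, Hausdorff, $\sigma$-compact, without boundary), with $\langle\pi^\sharp\alpha,\beta\rangle=\pi(\alpha,\beta)$. Let $T^*M$ carry its Lie algebroid structure with anchor $\pi^\sharp$ and bracket $[\alpha,\beta]_\pi=\mathcal L_{\pi^\sharp\alpha}\beta-\mathcal L_{\pi^\sharp\beta}\alpha-d\,\pi(\alpha,\beta)$, and let $d_\pi$ and $\mathcal L_\alpha$ denote its differential and Lie derivative. Let $L\subset TM\oplus T^*M$ be a Dirac structure on the Lie bialgebroid $(TM,T^*M,\pi)$: a subbundle that is maximally isotropic for $\langle X+\alpha,Y+\beta\rangle_+=\tfrac12(\langle\beta,X\rangle+\langle\alpha,Y\rangle)$ and whose sections are closed under $$[\![X+\alpha,Y+\beta]\!]_\pi=[X,Y]+\mathcal L_\alpha Y-\mathcal L_\beta X-\tfrac12 d_\pi(\langle\alpha,Y\rangle-\langle\beta,X\rangle)+[\alpha,\beta]_\pi+\mathcal L_X\beta-\mathcal L_Y\alpha+\tfrac12 d(\langle\alpha,Y\rangle-\langle\beta,X\rangle).$$ Then $L$ with this bracket and the anchor $X+\alpha\mapsto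 X+\pi^\sharp\alpha$ is a Lie algebroid. Let $\Phi(X+\alpha)=X+\pi^\sharp\alpha+\alpha$. 1. $\Phi(L)$ is an ordinary Dirac structure on $M$ (i.e. the same notion for $\pi=0$: Courant bracket $[X,Y]+\mathcal L_X\beta-\mathcal L_Y\alpha+\tfrac12d(\langle\alpha,Y\rangle-\langle\beta,X\rangle)$ and anchor $X+\alpha\mapsto X$). It has the same characteristic distribution, $\Phi(L)\cap TM=L\cap TM$, and hence the same characteristic foliation. Moreover $\Phi:L\to\Phi(L)$ is an isomorphism of Lie algebroids. 2. Suppose that $L$ is reducible: $L\cap TM$ has constant rank and its foliation $\mathcal F$ is simple, i.e. the leaf space $M/\mathcal F$ is a (Hausdorff) smooth manifold with submersive projection $p:M\to M/\mathcal F$. Then there is exactly one Poisson structure on $M/\mathcal F$ such that, for all $f,g\in C^\infty(M/\mathcal F)$, there is a vector field $X$ with $X+d(f\circ p)\in\Gamma(\Phi(L))$, and $\{f,g\}\circ p=X(g\circ p)$ for each such $X$. With $T^*(M/\mathcal F)$ the corresponding cotangent Lie algebroid, whose anchor is denoted $\pi_{M/\mathcal F}^\sharp$, $L$ is isomorphic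 as a Lie algebroid to the pullback Lie algebroid $$p^{!!}T^*(M/\mathcal F)=\{(X,\beta)\in T_xM\times T^*_{p(x)}(M/\mathcal F):\ p_*X=\pi_{M/\mathcal F}^\sharp\beta,\ x\in M\},$$ whose anchor is the first projection and whose bracket is $$[(X,\textstyle\sum_i f_i\otimes\alpha_i),(Y,\sum_j g_j\otimes\beta_j)]=([X,Y],\ \sum_{i,j}f_ig_j\otimes[\alpha_i,\beta_j]+\sum_jX(g_j)\otimes\beta_j-\sum_iY(f_i)\otimes\alpha_i).$$ The isomorphism sends $X+\alpha\in L$ to $(X+\pi^\sharp\alpha,\beta)$ with $p^*\beta=\alpha$. 3. Under the hypothesis of 2, let $\Psi:L\to T^*(M/\mathcal F)$, $X+\alpha\mapsto\beta$, be the composition of this isomorphism with the second projection. Then the modular class of $L$ is the pullback of that of $T^*(M/\mathcal F)$: $\operatorname{mod}(L)=\Psi^*\operatorname{mod}(T^*(M/\mathcal F))$ in $H^1(L)$. Here, for a Lie algebroid $A\to M$ with anchor $\rho$, $H^1(A)$ is the space of $d_A$-closed sections of $A^*$ modulo the $d_Af$, and $\operatorname{mod}(A)\in H^1(A)$ is the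 class of the form $\alpha_\mu$ with $\nabla_\sigma\mu=\langle\alpha_\mu,\sigma\rangle\mu$, where $\mu$ is a nowhere vanishing section of $L_A=\wedge^{top}A\otimes\wedge^{top}T^*M$ and $\nabla_\sigma(\omega\otimes\nu)=\mathcal L_\sigma\omega\otimes\nu+\omega\otimes\mathcal L_{\rho(\sigma)}\nu$. If $L_A$ is not orientable, $\operatorname{mod}(A)$ is one half of the class defined in the same way by $L_A\otimes L_A$. -/

import Mathlib

open Bundle Set Manifold ContDiff Topology TensorProduct

noncomputable section

namespace DiracGeometry

/-! ### Calculus on a manifold `M` modelled on the vector space `EM` -/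

section Calculus

variable {EM : Type*} [NormedAddCommGroup EM] [NormedSpace ℝ EM]
  {M : Type*} [TopologicalSpace M] [ChartedSpace EM M]

variable (EM) in
/-- The tangent space `T_x M`. -/
abbrev Tan (x : M) : Type _ := TangentSpace 𝓘(ℝ, EM) x

variable (EM) in
/-- The cotangent space `T*_x M`. -/
abbrev Cot (x : M) : Type _ := TangentSpace 𝓘(ℝ, EM) x →L[ℝ] ℝ

variable (EM) in
/-- The fibre `T_x M ⊕ T*_x M` of the generalized tangent bundle. -/
abbrev GenTan (x : M) : Type _ := Tan EM x × Cot EM x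

variable (EM) in
/-- The model fibre of the generalized tangent bundle. -/
abbrev GenModel : Type _ := EM × (EM →L[ℝ] ℝ)

variable (EM) in
/-- The section `σ` of the vector bundle `E` (with model fibre `F`) is smooth over `U`. -/
def SmoothSectionOn (F : Type*) [NormedAddCommGroup F] [NormedSpace ℝ F] {E : M → Type*}
    [TopologicalSpace (TotalSpace F E)] [∀ x, TopologicalSpace (E x)] [FiberBundle F E]
    (U : Set M) (σ : ∀ x, E x) : Prop :=
  ContMDiffOn 𝓘(ℝ, EM) (𝓘(ℝ, EM).prod 𝓘(ℝ, F)) ∞ (fun x => TotalSpace.mk' F x (σ x)) U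

variable (EM) in
/-- The differential `d_x f` of a function. -/
def dFun (f : M → ℝ) (x : M) : Cot EM x := mvfderiv 𝓘(ℝ, EM) f x

/-- The one-form `α`, read in the preferred chart around `x₀` (pullback by the inverse chart). -/
def formInChart (α : ∀ x : M, Cot EM x) (x₀ : M) (e : EM) : EM →L[ℝ] ℝ :=
  (α ((extChartAt 𝓘(ℝ, EM) x₀).symm e)).comp
    (mfderivWithin 𝓘(ℝ, EM) 𝓘(ℝ, EM) (extChartAt 𝓘(ℝ, EM) x₀).symm (range 𝓘(ℝ, EM)) e)

/-- The exterior derivative of a one-form: `dForm α x u v` is `(dα)_x(u, v)`, computed in the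
preferred chart around `x` by `dα(u, v) = (D_u α)(v) - (D_v α)(u)`. -/
def dForm (α : ∀ x : M, Cot EM x) (x : M) (u : Tan EM x) : Cot EM x :=
  let A : EM →L[ℝ] EM →L[ℝ] ℝ :=
    fderiv ℝ (formInChart α x) (extChartAt 𝓘(ℝ, EM) x x)
  let φ : Tan EM x →L[ℝ] EM := mfderiv 𝓘(ℝ, EM) 𝓘(ℝ, EM) (extChartAt 𝓘(ℝ, EM) x) x
  ((A - A.flip) (φ u)).comp φ

/-- The Lie derivative `L_X β = i_X dβ + d(β(X))` of a one-form along a vector field. -/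
def lieForm (X : ∀ x : M, Tan EM x) (β : ∀ x : M, Cot EM x) (x : M) : Cot EM x :=
  dForm β x (X x) + dFun EM (fun y => β y (X y)) x

/-- The Lie bracket of vector fields. -/
abbrev lieVec (X Y : ∀ x : M, Tan EM x) (x : M) : Tan EM x :=
  VectorField.mlieBracket 𝓘(ℝ, EM) X Y x

end Calculus

/-! ### Poisson manifolds -/

variable {EM : Type*} [NormedAddCommGroup EM] [NormedSpace ℝ EM]
  {M : Type*} [TopologicalSpace M] [ChartedSpace EM M] [IsManifold 𝓘(ℝ, EM) ∞ M]

/-! The exterior derivative defined above satisfies the invariant formula. -/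

theorem differentiableAt_formInChart (α : ∀ x : M, Cot EM x) (x : M)
    (hα : MDifferentiableAt 𝓘(ℝ, EM) (𝓘(ℝ, EM).prod 𝓘(ℝ, EM →L[ℝ] ℝ))
      (fun y => TotalSpace.mk' (EM →L[ℝ] ℝ) y (α y)) x) :
    DifferentiableAt ℝ (formInChart α x) (extChartAt 𝓘(ℝ, EM) x x) := by
  have h := ((mdifferentiableAt_hom_bundle (F₁ := EM) (F₂ := ℝ)
    (E₁ := (TangentSpace 𝓘(ℝ, EM) : M → Type _)) (E₂ := Bundle.Trivial M ℝ) (IB := 𝓘(ℝ, EM)) _).1 hα).2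
  have h2 : MDifferentiableAt 𝓘(ℝ, EM) 𝓘(ℝ, EM) (extChartAt 𝓘(ℝ, EM) x).symm
      (extChartAt 𝓘(ℝ, EM) x x) := by
    have := mdifferentiableWithinAt_extChartAt_symm (I := 𝓘(ℝ, EM)) (mem_extChartAt_target (I := 𝓘(ℝ, EM)) x)
    rwa [ModelWithCorners.range_eq_univ, mdifferentiableWithinAt_univ] at this
  have h3 := MDifferentiableAt.comp (extChartAt 𝓘(ℝ, EM) x x) (by rw [extChartAt_to_inv]; exact h) h2
  refine h3.differentiableAt.congr_of_eventuallyEq ?_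
  filter_upwards [extChartAt_target_mem_nhds (I := 𝓘(ℝ, EM)) x] with e he
  have hs : (extChartAt 𝓘(ℝ, EM) x).symm e ∈ (chartAt EM x).source := by
    simpa using (extChartAt 𝓘(ℝ, EM) x).map_target he
  simp only [formInChart, Function.comp, ContinuousLinearMap.inCoordinates]
  rw [TangentBundle.symmL_trivializationAt hs, (extChartAt 𝓘(ℝ, EM) x).right_inv he]
  ext v
  simp


theorem chart_facts [CompleteSpace EM] (α : ∀ x : M, Cot EM x) (Z : ∀ x : M, Tan EM x) (x : M)
    (hα : MDifferentiableAt 𝓘(ℝ, EM) (𝓘(ℝ, EM).prod 𝓘(ℝ, EM →L[ℝ] ℝ))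
      (fun y => TotalSpace.mk' (EM →L[ℝ] ℝ) y (α y)) x)
    (hZ : MDifferentiableAt 𝓘(ℝ, EM) (𝓘(ℝ, EM).prod 𝓘(ℝ, EM))
      (fun y => TotalSpace.mk' EM y (Z y)) x) :
    let Zh : EM → EM := VectorField.mpullbackWithin 𝓘(ℝ, EM) 𝓘(ℝ, EM)
      (extChartAt 𝓘(ℝ, EM) x).symm Z (range 𝓘(ℝ, EM))
    let e₀ := extChartAt 𝓘(ℝ, EM) x x
    DifferentiableAt ℝ Zh e₀ ∧ mfderiv 𝓘(ℝ, EM) 𝓘(ℝ, EM) (extChartAt 𝓘(ℝ, EM) x) x (Z x) = Zh e₀ ∧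
    ∀ w : Tan EM x, dFun EM (fun y => α y (Z y)) x w =
      fderiv ℝ (formInChart α x) e₀ (mfderiv 𝓘(ℝ, EM) 𝓘(ℝ, EM) (extChartAt 𝓘(ℝ, EM) x) x w) (Zh e₀)
      + formInChart α x e₀ (fderiv ℝ Zh e₀
          (mfderiv 𝓘(ℝ, EM) 𝓘(ℝ, EM) (extChartAt 𝓘(ℝ, EM) x) x w)) := by
  intro Zh e₀
  have hd : DifferentiableAt ℝ Zh e₀ := by
    have := MDifferentiableWithinAt.differentiableWithinAt_mpullbackWithin_vectorField
      (I := 𝓘(ℝ, EM)) (V := Z) (s := univ) (x := x) (mdifferentiableWithinAt_univ.2 hZ)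
    rw [preimage_univ, univ_inter] at this
    have h' : DifferentiableWithinAt ℝ Zh (range 𝓘(ℝ, EM)) e₀ := this
    rwa [ModelWithCorners.range_eq_univ, differentiableWithinAt_univ] at h'
  have hA : ∀ e ∈ (extChartAt 𝓘(ℝ, EM) x).target, formInChart α x e (Zh e)
      = α ((extChartAt 𝓘(ℝ, EM) x).symm e) (Z ((extChartAt 𝓘(ℝ, EM) x).symm e)) := by
    intro e he
    have hi := isInvertible_mfderivWithin_extChartAt_symm (I := 𝓘(ℝ, EM)) he
    exact congrArg (α ((extChartAt 𝓘(ℝ, EM) x).symm e)) (hi.self_apply_inverse _)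
  have hD : mfderiv 𝓘(ℝ, EM) 𝓘(ℝ, EM) (extChartAt 𝓘(ℝ, EM) x) x (Z x) = Zh e₀ := by
    let D : EM →L[ℝ] EM := mfderivWithin 𝓘(ℝ, EM) 𝓘(ℝ, EM) (extChartAt 𝓘(ℝ, EM) x).symm
      (range 𝓘(ℝ, EM)) e₀
    let Z' : M → EM := Z
    have hi : D.IsInvertible := isInvertible_mfderivWithin_extChartAt_symm (I := 𝓘(ℝ, EM))
      (mem_extChartAt_target (I := 𝓘(ℝ, EM)) x)
    have hc : D (mfderiv 𝓘(ℝ, EM) 𝓘(ℝ, EM) (extChartAt 𝓘(ℝ, EM) x) x (Z x)) = Z' x :=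
      DFunLike.congr_fun (mfderivWithin_extChartAt_symm_comp_mfderiv_extChartAt' (I := 𝓘(ℝ, EM))
        (mem_extChartAt_source (I := 𝓘(ℝ, EM)) x)) (Z x)
    have h2 : Zh e₀ = D.inverse (Z' ((extChartAt 𝓘(ℝ, EM) x).symm e₀)) := rfl
    rw [h2, extChartAt_to_inv, ← hc]
    exact (hi.inverse_apply_self _).symm
  refine ⟨hd, hD, fun w => ?_⟩
  have hdα := differentiableAt_formInChart α x hα
  have hg : DifferentiableAt ℝ (fun e => formInChart α x e (Zh e)) e₀ := hdα.clm_apply hd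
  have hev : (fun y => α y (Z y)) =ᶠ[𝓝 x]
      (fun e => formInChart α x e (Zh e)) ∘ extChartAt 𝓘(ℝ, EM) x := by
    filter_upwards [extChartAt_source_mem_nhds (I := 𝓘(ℝ, EM)) x] with y hy
    simp only [Function.comp]
    rw [hA _ ((extChartAt 𝓘(ℝ, EM) x).map_source hy), (extChartAt 𝓘(ℝ, EM) x).left_inv hy]
  have h1 : HasMFDerivAt 𝓘(ℝ, EM) 𝓘(ℝ, ℝ) (fun y => α y (Z y)) x
      ((fderiv ℝ (fun e => formInChart α x e (Zh e)) e₀).comp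
        (mfderiv 𝓘(ℝ, EM) 𝓘(ℝ, EM) (extChartAt 𝓘(ℝ, EM) x) x)) :=
    (HasMFDerivAt.comp x hg.hasFDerivAt.hasMFDerivAt
      (mdifferentiableAt_extChartAt (I := 𝓘(ℝ, EM))
        (mem_chart_source EM x)).hasMFDerivAt).congr_of_eventuallyEq hev
  refine (DFunLike.congr_fun h1.mfderiv w).trans ?_
  change fderiv ℝ (fun e => formInChart α x e (Zh e)) e₀ _ = _
  rw [fderiv_clm_apply hdα hd]
  exact add_comm _ _

/-- The exterior derivative satisfies `dα(X, Y) = X(α(Y)) - Y(α(X)) - α([X, Y])`. -/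
theorem dForm_apply (α : ∀ x : M, Cot EM x) (X Y : ∀ x : M, Tan EM x) (x : M) [CompleteSpace EM]
    (hα : MDifferentiableAt 𝓘(ℝ, EM) (𝓘(ℝ, EM).prod 𝓘(ℝ, EM →L[ℝ] ℝ))
      (fun y => TotalSpace.mk' (EM →L[ℝ] ℝ) y (α y)) x)
    (hX : MDifferentiableAt 𝓘(ℝ, EM) (𝓘(ℝ, EM).prod 𝓘(ℝ, EM))
      (fun y => TotalSpace.mk' EM y (X y)) x)
    (hY : MDifferentiableAt 𝓘(ℝ, EM) (𝓘(ℝ, EM).prod 𝓘(ℝ, EM))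
      (fun y => TotalSpace.mk' EM y (Y y)) x) :
    dForm α x (X x) (Y x) = dFun EM (fun y => α y (Y y)) x (X x)
      - dFun EM (fun y => α y (X y)) x (Y x) - α x (lieVec X Y x) := by
  obtain ⟨hX1, hX2, hX3⟩ := chart_facts α X x hα hX
  obtain ⟨hY1, hY2, hY3⟩ := chart_facts α Y x hα hY
  rw [hY3, hX3]
  set Xh : EM → EM := VectorField.mpullbackWithin 𝓘(ℝ, EM) 𝓘(ℝ, EM)
    (extChartAt 𝓘(ℝ, EM) x).symm X (range 𝓘(ℝ, EM)) with hXh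
  set Yh : EM → EM := VectorField.mpullbackWithin 𝓘(ℝ, EM) 𝓘(ℝ, EM)
    (extChartAt 𝓘(ℝ, EM) x).symm Y (range 𝓘(ℝ, EM)) with hYh
  set e₀ := extChartAt 𝓘(ℝ, EM) x x
  have hE : α x (lieVec X Y x)
      = formInChart α x e₀ (fderiv ℝ Yh e₀ (Xh e₀) - fderiv ℝ Xh e₀ (Yh e₀)) := by
    let D : EM →L[ℝ] EM := mfderivWithin 𝓘(ℝ, EM) 𝓘(ℝ, EM) (extChartAt 𝓘(ℝ, EM) x).symm
      (range 𝓘(ℝ, EM)) e₀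
    let Q : EM →L[ℝ] EM := mfderiv 𝓘(ℝ, EM) 𝓘(ℝ, EM) (extChartAt 𝓘(ℝ, EM) x) x
    let α' : M → EM →L[ℝ] ℝ := α
    have hi : Q.IsInvertible := isInvertible_mfderiv_extChartAt (I := 𝓘(ℝ, EM))
      (mem_extChartAt_source (I := 𝓘(ℝ, EM)) x)
    have hc : ∀ w, Q (D w) = w := DFunLike.congr_fun
      (mfderiv_extChartAt_comp_mfderivWithin_extChartAt_symm' (I := 𝓘(ℝ, EM))
        (mem_extChartAt_source (I := 𝓘(ℝ, EM)) x))
    have hl : lieVec X Y x = Q.inverse (VectorField.lieBracketWithin ℝ Xh Yh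
      ((extChartAt 𝓘(ℝ, EM) x).symm ⁻¹' univ ∩ range 𝓘(ℝ, EM)) e₀) := rfl
    have hl2 : VectorField.lieBracketWithin ℝ Xh Yh
      ((extChartAt 𝓘(ℝ, EM) x).symm ⁻¹' univ ∩ range 𝓘(ℝ, EM)) e₀
        = fderiv ℝ Yh e₀ (Xh e₀) - fderiv ℝ Xh e₀ (Yh e₀) := by
      rw [preimage_univ, univ_inter, ModelWithCorners.range_eq_univ,
        VectorField.lieBracketWithin_univ, VectorField.lieBracket]
    have hr : ∀ w, formInChart α x e₀ w = α' ((extChartAt 𝓘(ℝ, EM) x).symm e₀) (D w) :=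
      fun _ => rfl
    rw [hr, extChartAt_to_inv, hl, hl2]
    generalize fderiv ℝ Yh e₀ (Xh e₀) - fderiv ℝ Xh e₀ (Yh e₀) = w
    exact congrArg (α' x) (by rw [← hc w, hi.inverse_apply_self, hc])
  have hF : dForm α x (X x) (Y x) = fderiv ℝ (formInChart α x) e₀ (Xh e₀) (Yh e₀)
      - fderiv ℝ (formInChart α x) e₀ (Yh e₀) (Xh e₀) := by
    rw [← hX2, ← hY2]
    rfl
  rw [hE, hF, hX2, hY2, map_sub]
  ring

variable (EM M) in
/-- A Poisson structure, i.e. a bivector field `π`, encoded by the skew-symmetric bundle map `π♯`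
with `⟨π♯ α, β⟩ = π(α, β)`, such that `{f, g} = π(df, dg)` satisfies the Jacobi identity. -/
structure PoissonStructure where
  sharp : ∀ x : M, Cot EM x →ₗ[ℝ] Tan EM x
  smooth : ∀ U : Set M, IsOpen U → ∀ α : ∀ x : M, Cot EM x,
    SmoothSectionOn EM (EM →L[ℝ] ℝ) U α → SmoothSectionOn EM EM U (fun x => sharp x (α x))
  skew : ∀ (x : M) (α β : Cot EM x), β (sharp x α) = - α (sharp x β)
  jacobi : ∀ f g h : M → ℝ, ContMDiff 𝓘(ℝ, EM) 𝓘(ℝ, ℝ) ∞ f → ContMDiff 𝓘(ℝ, EM) 𝓘(ℝ, ℝ) ∞ g →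
    ContMDiff 𝓘(ℝ, EM) 𝓘(ℝ, ℝ) ∞ h →
    let br : (M → ℝ) → (M → ℝ) → M → ℝ := fun a b x => dFun EM b x (sharp x (dFun EM a x))
    ∀ x, br f (br g h) x + br g (br h f) x + br h (br f g) x = 0

namespace PoissonStructure

variable (P : PoissonStructure EM M)

/-- The bivector `π(α, β)`. -/
def bivector (x : M) (α β : Cot EM x) : ℝ := β (P.sharp x α)

/-- The Poisson bracket `{f, g} = π(df, dg)`. -/
def poissonBracket (f g : M → ℝ) (x : M) : ℝ := P.bivector x (dFun EM f x) (dFun EM g x)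

/-- The vector field `π♯ α`. -/
def sharpField (α : ∀ x : M, Cot EM x) (x : M) : Tan EM x := P.sharp x (α x)

/-- The bracket `[α, β]_π = L_{π♯α} β - L_{π♯β} α - d(π(α, β))` of one-forms. -/
def formBracket (α β : ∀ x : M, Cot EM x) (x : M) : Cot EM x :=
  lieForm (P.sharpField α) β x - lieForm (P.sharpField β) α x
    - dFun EM (fun y => P.bivector y (α y) (β y)) x

/-- The differential `d_π f` of a function in the Lie algebroid `T*M` of `π`: the vector field with
`⟨α, d_π f⟩ = (π♯ α)(f)`. -/
def dPi (f : M → ℝ) (x : M) : Tan EM x := - P.sharp x (dFun EM f x)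

/-- The Lie derivative `L_α Y` of a vector field `Y` (a section of the dual of `T*M`) along the
one-form `α` in the Lie algebroid `T*M` of `π`: the vector field with
`⟨β, L_α Y⟩ = (π♯ α)⟨β, Y⟩ - ⟨[α, β]_π, Y⟩` for all one-forms `β`. -/
def lieDual (α : ∀ x : M, Cot EM x) (Y : ∀ x : M, Tan EM x) (x : M) : Tan EM x :=
  lieVec (P.sharpField α) Y x + P.sharp x (dForm α x (Y x))

theorem apply_dPi (P : PoissonStructure EM M) (f : M → ℝ) (x : M) (α : Cot EM x) :
    α (P.dPi f x) = dFun EM f x (P.sharp x α) := by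
  rw [dPi, map_neg, P.skew, neg_neg]

/-- `L_α Y` is the Lie derivative in the Lie algebroid `T*M`. -/
theorem apply_lieDual [CompleteSpace EM] (P : PoissonStructure EM M) (U : Set M) (hU : IsOpen U)
    (α β : ∀ x : M, Cot EM x) (Y : ∀ x : M, Tan EM x)
    (hα : SmoothSectionOn EM (EM →L[ℝ] ℝ) U α) (hβ : SmoothSectionOn EM (EM →L[ℝ] ℝ) U β)
    (hY : SmoothSectionOn EM EM U Y) (x : M) (hx : x ∈ U) :
    β x (P.lieDual α Y x)
      = dFun EM (fun y => β y (Y y)) x (P.sharpField α x) - P.formBracket α β x (Y x) := by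
  have d1 := ((hα.contMDiffAt (hU.mem_nhds hx)).mdifferentiableAt (by simp))
  have d2 := ((hβ.contMDiffAt (hU.mem_nhds hx)).mdifferentiableAt (by simp))
  have d3 := ((hY.contMDiffAt (hU.mem_nhds hx)).mdifferentiableAt (by simp))
  have d4 := (((P.smooth U hU α hα).contMDiffAt (hU.mem_nhds hx)).mdifferentiableAt (by simp))
  have h1 := dForm_apply β (P.sharpField α) Y x d2 d4 d3
  have h2 : (fun y => α y (P.sharpField β y)) = fun y => - P.bivector y (α y) (β y) :=
    funext fun y => P.skew y (β y) (α y)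
  have h3 : dFun EM (fun y => - P.bivector y (α y) (β y)) x
      = - dFun EM (fun y => P.bivector y (α y) (β y)) x := mvfderiv_fun_neg
  have h4 : β x (P.sharp x (dForm α x (Y x))) = dForm α x (P.sharpField β x) (Y x) := by
    rw [P.skew]
    simp only [dForm, sharpField]
    exact neg_sub _ _
  have h5 : (fun y => β y (P.sharpField α y)) = fun y => P.bivector y (α y) (β y) := rfl
  rw [lieDual, formBracket, lieForm, lieForm, map_add, h4, h2, h3, h5]
  simp only [_root_.add_apply, _root_.sub_apply, _root_.neg_apply]
  rw [h1, h5]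
  ring

end PoissonStructure

/-! ### Lie algebroids -/

section Algebroid

variable (F : Type*) [NormedAddCommGroup F] [NormedSpace ℝ F] (E : M → Type*)
  [∀ x, AddCommGroup (E x)] [∀ x, Module ℝ (E x)]

/-- The raw data of a Lie algebroid over `M`: a family of subspaces, of dimension `rank`, of the
fibres of an ambient vector bundle `E` (with model fibre `F`), an anchor, and a bracket of sections.
The bracket matters only on sections that are smooth over an open set, and only there.
The axioms are in `PreLieAlgebroid.IsLieAlgebroid`. -/
structure PreLieAlgebroid (EM : Type*) [NormedAddCommGroup EM] [NormedSpace ℝ EM] {M : Type*}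
    [TopologicalSpace M] [ChartedSpace EM M] (F : Type*) (E : M → Type*)
    [∀ x, AddCommGroup (E x)] [∀ x, Module ℝ (E x)] where
  rank : ℕ
  fiber : ∀ x : M, Submodule ℝ (E x)
  anchor : ∀ x : M, fiber x →ₗ[ℝ] Tan EM x
  bracket : (∀ x : M, fiber x) → (∀ x : M, fiber x) → ∀ x : M, fiber x

variable {F E} [TopologicalSpace (TotalSpace F E)] [∀ x, TopologicalSpace (E x)] [FiberBundle F E]

variable (EM F) in
/-- The family of subspaces `W` is a smooth subbundle of rank `r` of the vector bundle `E`. -/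
def IsSmoothSubbundle (r : ℕ) (W : ∀ x, Submodule ℝ (E x)) : Prop :=
  ∀ x₀ : M, ∃ U : Set M, IsOpen U ∧ x₀ ∈ U ∧ ∃ e : Fin r → ∀ x, E x,
    (∀ i, SmoothSectionOn EM F U (e i)) ∧
    ∀ x ∈ U, LinearIndependent ℝ (fun i => e i x) ∧ Submodule.span ℝ (range fun i => e i x) = W x

namespace PreLieAlgebroid

variable (A : PreLieAlgebroid EM F E)

/-- The section `σ` of `A` is smooth over `U`. -/
def SmoothOn (U : Set M) (σ : ∀ x, A.fiber x) : Prop :=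
  SmoothSectionOn EM F U (fun x => (σ x : E x))

/-- The axioms of a Lie algebroid, for sections over arbitrary open sets. -/
structure IsLieAlgebroid : Prop where
  subbundle : IsSmoothSubbundle EM F A.rank A.fiber
  anchor_smooth : ∀ U : Set M, IsOpen U → ∀ σ, A.SmoothOn U σ →
    SmoothSectionOn EM EM U (fun x => A.anchor x (σ x))
  bracket_smooth : ∀ U : Set M, IsOpen U → ∀ σ τ, A.SmoothOn U σ → A.SmoothOn U τ →
    A.SmoothOn U (A.bracket σ τ)
  bracket_local : ∀ U : Set M, IsOpen U → ∀ σ σ' τ τ', A.SmoothOn U σ → A.SmoothOn U τ →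
    (∀ x ∈ U, σ x = σ' x) → (∀ x ∈ U, τ x = τ' x) →
    ∀ x ∈ U, A.bracket σ τ x = A.bracket σ' τ' x
  bracket_skew : ∀ U : Set M, IsOpen U → ∀ σ τ, A.SmoothOn U σ → A.SmoothOn U τ →
    ∀ x ∈ U, A.bracket σ τ x = - A.bracket τ σ x
  bracket_add : ∀ U : Set M, IsOpen U → ∀ σ τ τ', A.SmoothOn U σ → A.SmoothOn U τ →
    A.SmoothOn U τ' → ∀ x ∈ U, A.bracket σ (fun y => τ y + τ' y) x
      = A.bracket σ τ x + A.bracket σ τ' x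
  leibniz : ∀ U : Set M, IsOpen U → ∀ (σ τ : ∀ x, A.fiber x) (f : M → ℝ), A.SmoothOn U σ →
    A.SmoothOn U τ → ContMDiffOn 𝓘(ℝ, EM) 𝓘(ℝ, ℝ) ∞ f U → ∀ x ∈ U,
    A.bracket σ (fun y => f y • τ y) x
      = f x • A.bracket σ τ x + dFun EM f x (A.anchor x (σ x)) • τ x
  jacobi : ∀ U : Set M, IsOpen U → ∀ σ τ υ, A.SmoothOn U σ → A.SmoothOn U τ → A.SmoothOn U υ →
    ∀ x ∈ U, A.bracket σ (A.bracket τ υ) x + A.bracket τ (A.bracket υ σ) x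
      + A.bracket υ (A.bracket σ τ) x = 0

/-- The fibrewise linear isomorphisms `Θ x` form an isomorphism of Lie algebroids over the identity
of `M`: an isomorphism of vector bundles compatible with the anchors and the brackets. -/
structure IsIso {F' : Type*} [NormedAddCommGroup F'] [NormedSpace ℝ F'] {E' : M → Type*}
    [∀ x, AddCommGroup (E' x)] [∀ x, Module ℝ (E' x)] [TopologicalSpace (TotalSpace F' E')]
    [∀ x, TopologicalSpace (E' x)] [FiberBundle F' E'] (A : PreLieAlgebroid EM F E)
    (B : PreLieAlgebroid EM F' E') (Θ : ∀ x, A.fiber x ≃ₗ[ℝ] B.fiber x) : Prop where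
  smooth_iff : ∀ U : Set M, IsOpen U → ∀ σ, A.SmoothOn U σ ↔ B.SmoothOn U (fun x => Θ x (σ x))
  anchor : ∀ x v, B.anchor x (Θ x v) = A.anchor x v
  bracket : ∀ U : Set M, IsOpen U → ∀ σ τ, A.SmoothOn U σ → A.SmoothOn U τ → ∀ x ∈ U,
    Θ x (A.bracket σ τ x) = B.bracket (fun y => Θ y (σ y)) (fun y => Θ y (τ y)) x

/-! #### First cohomology -/

/-- Families of linear forms on the fibres of `A`. -/
def Cochain : Type _ := ∀ x, A.fiber x →ₗ[ℝ] ℝ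

instance : AddCommGroup A.Cochain := inferInstanceAs (AddCommGroup (∀ x, A.fiber x →ₗ[ℝ] ℝ))

instance : Module ℝ A.Cochain := inferInstanceAs (Module ℝ (∀ x, A.fiber x →ₗ[ℝ] ℝ))

/-- The family `η` of linear forms on the fibres of `A` is smooth, i.e. it is an `A`-one-form. -/
def IsSmoothForm (η : A.Cochain) : Prop :=
  ∀ U : Set M, IsOpen U → ∀ σ, A.SmoothOn U σ →
    ContMDiffOn 𝓘(ℝ, EM) 𝓘(ℝ, ℝ) ∞ (fun x => η x (σ x)) U

/-- The space of `d_A`-closed `A`-one-forms. -/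
def closedForms : Submodule ℝ A.Cochain where
  carrier := {η | A.IsSmoothForm η ∧ ∀ U : Set M, IsOpen U → ∀ σ τ, A.SmoothOn U σ →
    A.SmoothOn U τ → ∀ x ∈ U,
      dFun EM (fun y => η y (τ y)) x (A.anchor x (σ x))
        - dFun EM (fun y => η y (σ y)) x (A.anchor x (τ x)) - η x (A.bracket σ τ x) = 0}
  zero_mem' := by
    refine ⟨fun U _ σ _ => contMDiffOn_const (c := (0 : ℝ)), fun U _ σ τ _ _ x _ => ?_⟩
    have h : dFun EM (fun _ : M => (0 : ℝ)) x = 0 := mvfderiv_const 0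
    change dFun EM (fun _ : M => (0 : ℝ)) x _ - dFun EM (fun _ : M => (0 : ℝ)) x _ - 0 = 0
    rw [h]
    simp
  add_mem' := by
    rintro η η' ⟨h1, h2⟩ ⟨h1', h2'⟩
    refine ⟨fun U hU σ hσ => (h1 U hU σ hσ).add (h1' U hU σ hσ), fun U hU σ τ hσ hτ x hx => ?_⟩
    have key : ∀ υ, A.SmoothOn U υ → dFun EM (fun y => (η + η') y (υ y)) x
        = dFun EM (fun y => η y (υ y)) x + dFun EM (fun y => η' y (υ y)) x := fun υ hυ =>
      mvfderiv_fun_add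
        (((h1 U hU υ hυ).contMDiffAt (hU.mem_nhds hx)).mdifferentiableAt (by simp))
        (((h1' U hU υ hυ).contMDiffAt (hU.mem_nhds hx)).mdifferentiableAt (by simp))
    have e : (η + η') x (A.bracket σ τ x) = η x (A.bracket σ τ x) + η' x (A.bracket σ τ x) := rfl
    have a := h2 U hU σ τ hσ hτ x hx
    have b := h2' U hU σ τ hσ hτ x hx
    rw [key σ hσ, key τ hτ, e, _root_.add_apply, _root_.add_apply]
    linarith
  smul_mem' := by
    rintro c η ⟨h1, h2⟩
    refine ⟨fun U hU σ hσ => contMDiffOn_const.mul (h1 U hU σ hσ),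
      fun U hU σ τ hσ hτ x hx => ?_⟩
    have key : ∀ υ, A.SmoothOn U υ → dFun EM (fun y => (c • η) y (υ y)) x
        = c • dFun EM (fun y => η y (υ y)) x := fun υ hυ => by
      have h := ((h1 U hU υ hυ).contMDiffAt (hU.mem_nhds hx)).mdifferentiableAt (by simp)
      change mvfderiv 𝓘(ℝ, EM) (fun y => c * η y (υ y)) x = c • mvfderiv 𝓘(ℝ, EM) _ x
      have := mvfderiv_fun_mul (mdifferentiableAt_const (c := c)) h
      rw [this]
      ext v
      simp [mvfderiv_const]
    have e : (c • η) x (A.bracket σ τ x) = c * η x (A.bracket σ τ x) := rfl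
    have a := h2 U hU σ τ hσ hτ x hx
    rw [key σ hσ, key τ hτ, e, _root_.smul_apply, _root_.smul_apply,
      smul_eq_mul, smul_eq_mul]
    linear_combination c * a

/-- The space of exact `A`-one-forms `d_A f`. -/
def exactForms : Submodule ℝ A.Cochain where
  carrier := {η | ∃ f : M → ℝ, ContMDiff 𝓘(ℝ, EM) 𝓘(ℝ, ℝ) ∞ f ∧
    ∀ x v, η x v = dFun EM f x (A.anchor x v)}
  zero_mem' := by
    refine ⟨fun _ => 0, contMDiff_const, fun x v => ?_⟩
    have h : dFun EM (fun _ : M => (0 : ℝ)) x = 0 := mvfderiv_const 0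
    rw [h]
    rfl
  add_mem' := by
    rintro η η' ⟨f, hf, h⟩ ⟨f', hf', h'⟩
    refine ⟨fun y => f y + f' y, hf.add hf', fun x v => ?_⟩
    have key : dFun EM (fun y => f y + f' y) x = dFun EM f x + dFun EM f' x :=
      mvfderiv_fun_add (hf.mdifferentiable (by simp) x) (hf'.mdifferentiable (by simp) x)
    have e : (η + η') x v = η x v + η' x v := rfl
    rw [key, e, h, h']
    rfl
  smul_mem' := by
    rintro c η ⟨f, hf, h⟩
    refine ⟨fun y => c * f y, contMDiff_const.mul hf, fun x v => ?_⟩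
    have key : dFun EM (fun y => c * f y) x = c • dFun EM f x := by
      change mvfderiv 𝓘(ℝ, EM) (fun y => c * f y) x = c • mvfderiv 𝓘(ℝ, EM) _ x
      rw [mvfderiv_fun_mul (mdifferentiableAt_const (c := c)) (hf.mdifferentiable (by simp) x)]
      ext v
      simp [mvfderiv_const]
    have e : (c • η) x v = c * η x v := rfl
    rw [key, e, h]
    rfl

/-- The first Lie algebroid cohomology `H¹(A)` with trivial coefficients. -/
abbrev H1 : Type _ := A.closedForms ⧸ A.exactForms.submoduleOf A.closedForms

/-- The class in `H¹(A)` of a closed `A`-one-form. -/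
def toH1 (η : A.closedForms) : A.H1 := Submodule.Quotient.mk η

/-! #### The modular class -/

/-- The fibre of the line bundle `L_A = ⋀^top A ⊗ ⋀^top T*M`. -/
abbrev CanLine (x : M) : Type _ :=
  (⋀[ℝ]^A.rank (A.fiber x)) ⊗[ℝ] (⋀[ℝ]^(Module.finrank ℝ EM) (Cot EM x))

/-- `e` is a smooth frame of `A` and `θ` a smooth frame of `T*M` over `U`. -/
structure AreFrames (U : Set M) (e : Fin A.rank → ∀ x, A.fiber x)
    (θ : Fin (Module.finrank ℝ EM) → ∀ x : M, Cot EM x) : Prop where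
  smooth : ∀ i, A.SmoothOn U (e i)
  linearIndependent : ∀ x ∈ U, LinearIndependent ℝ (fun i => e i x)
  span : ∀ x ∈ U, Submodule.span ℝ (range fun i => e i x) = ⊤
  smooth' : ∀ j, SmoothSectionOn EM (EM →L[ℝ] ℝ) U (θ j)
  linearIndependent' : ∀ x ∈ U, LinearIndependent ℝ (fun j => θ j x)
  span' : ∀ x ∈ U, Submodule.span ℝ (range fun j => θ j x) = ⊤

/-- The generator `(e₁ ∧ … ∧ e_r) ⊗ (θ₁ ∧ … ∧ θ_m)` of `L_A` given by frames. -/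
def gen (e : Fin A.rank → ∀ x, A.fiber x)
    (θ : Fin (Module.finrank ℝ EM) → ∀ x : M, Cot EM x) (x : M) : A.CanLine x :=
  exteriorPower.ιMulti ℝ A.rank (fun i => e i x)
    ⊗ₜ[ℝ] exteriorPower.ιMulti ℝ (Module.finrank ℝ EM) (fun j => θ j x)

/-- The canonical representation `∇_σ (ω ⊗ μ) = L_σ ω ⊗ μ + ω ⊗ L_{ρ(σ)} μ` on the generator
`ω ⊗ μ = (e₁ ∧ … ∧ e_r) ⊗ (θ₁ ∧ … ∧ θ_m)`, where `L_σ ω = ∑ i, e₁ ∧ … ∧ [σ, e_i] ∧ … ∧ e_r` and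
`L_{ρ(σ)} μ = ∑ j, θ₁ ∧ … ∧ L_{ρ(σ)} θ_j ∧ … ∧ θ_m`. -/
def nablaGen (σ : ∀ x, A.fiber x) (e : Fin A.rank → ∀ x, A.fiber x)
    (θ : Fin (Module.finrank ℝ EM) → ∀ x : M, Cot EM x) (x : M) : A.CanLine x :=
  (∑ i, exteriorPower.ιMulti ℝ A.rank
      (Function.update (fun k => e k x) i (A.bracket σ (e i) x)))
    ⊗ₜ[ℝ] exteriorPower.ιMulti ℝ (Module.finrank ℝ EM) (fun j => θ j x)
  + exteriorPower.ιMulti ℝ A.rank (fun i => e i x)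
    ⊗ₜ[ℝ] (∑ j, exteriorPower.ιMulti ℝ (Module.finrank ℝ EM)
      (Function.update (fun k => θ k x) j (lieForm (fun y => A.anchor y (σ y)) (θ j) x)))

/-- `μ` is a nowhere vanishing smooth section of `L_A`. -/
def IsNonvanishing (μ : ∀ x, A.CanLine x) : Prop :=
  ∀ x₀ : M, ∃ U : Set M, IsOpen U ∧ x₀ ∈ U ∧ ∃ e θ, A.AreFrames U e θ ∧
    ∃ f : M → ℝ, ContMDiffOn 𝓘(ℝ, EM) 𝓘(ℝ, ℝ) ∞ f U ∧
      ∀ x ∈ U, f x ≠ 0 ∧ μ x = f x • A.gen e θ x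

/-- `η` is the characteristic cocycle of `L_A` relative to `μ`, i.e. `∇_σ μ = ⟨η, σ⟩ μ`, where
`∇_σ (f s) = ρ(σ)(f) s + f ∇_σ s`. -/
def IsCocycle (μ : ∀ x, A.CanLine x) (η : A.Cochain) : Prop :=
  ∀ U : Set M, IsOpen U → ∀ e θ, A.AreFrames U e θ → ∀ f : M → ℝ,
    ContMDiffOn 𝓘(ℝ, EM) 𝓘(ℝ, ℝ) ∞ f U → (∀ x ∈ U, μ x = f x • A.gen e θ x) →
    ∀ σ, A.SmoothOn U σ → ∀ x ∈ U,
      dFun EM f x (A.anchor x (σ x)) • A.gen e θ x + f x • A.nablaGen σ e θ x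
        = η x (σ x) • μ x

/-- `S` is a nowhere vanishing smooth section of `L_A ⊗ L_A`. -/
def IsNonvanishingSq (S : ∀ x, A.CanLine x ⊗[ℝ] A.CanLine x) : Prop :=
  ∀ x₀ : M, ∃ U : Set M, IsOpen U ∧ x₀ ∈ U ∧ ∃ e θ, A.AreFrames U e θ ∧
    ∃ f : M → ℝ, ContMDiffOn 𝓘(ℝ, EM) 𝓘(ℝ, ℝ) ∞ f U ∧
      ∀ x ∈ U, f x ≠ 0 ∧ S x = f x • (A.gen e θ x ⊗ₜ[ℝ] A.gen e θ x)

/-- `η` is the characteristic cocycle of the representation `L_A ⊗ L_A` relative to `S`, where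
`∇_σ (s ⊗ t) = ∇_σ s ⊗ t + s ⊗ ∇_σ t`. -/
def IsCocycleSq (S : ∀ x, A.CanLine x ⊗[ℝ] A.CanLine x)
    (η : A.Cochain) : Prop :=
  ∀ U : Set M, IsOpen U → ∀ e θ, A.AreFrames U e θ → ∀ f : M → ℝ,
    ContMDiffOn 𝓘(ℝ, EM) 𝓘(ℝ, ℝ) ∞ f U →
    (∀ x ∈ U, S x = f x • (A.gen e θ x ⊗ₜ[ℝ] A.gen e θ x)) →
    ∀ σ, A.SmoothOn U σ → ∀ x ∈ U,
      dFun EM f x (A.anchor x (σ x)) • (A.gen e θ x ⊗ₜ[ℝ] A.gen e θ x)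
        + f x • (A.nablaGen σ e θ x ⊗ₜ[ℝ] A.gen e θ x + A.gen e θ x ⊗ₜ[ℝ] A.nablaGen σ e θ x)
        = η x (σ x) • S x

/-- `c` is the modular class of `A`: the class of the characteristic cocycle of `L_A` relative to a
nowhere vanishing section if there is one, and in general one half of the class of the
characteristic cocycle of `L_A ⊗ L_A`. -/
def IsModularClass (c : A.H1) : Prop :=
  (∃ μ, A.IsNonvanishing μ ∧ ∃ η : A.closedForms, A.IsCocycle μ η ∧ c = A.toH1 η) ∨
  (∃ S, A.IsNonvanishingSq S ∧ ∃ η : A.closedForms, A.IsCocycleSq S η ∧ (2 : ℝ) • c = A.toH1 η)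

/-- The modular class `mod A ∈ H¹(A)` (meaningful if exactly one class satisfies
`IsModularClass`). -/
def modularClass : A.H1 := Classical.epsilon A.IsModularClass

end PreLieAlgebroid

end Algebroid

/-! ### Pullback along a smooth map -/

section Pullback

variable {EN : Type*} [NormedAddCommGroup EN] [NormedSpace ℝ EN]
  {N : Type*} [TopologicalSpace N] [ChartedSpace EN N] [IsManifold 𝓘(ℝ, EN) ∞ N]
  {F : Type*} [NormedAddCommGroup F] [NormedSpace ℝ F] {E : N → Type*}
  [∀ y, AddCommGroup (E y)] [∀ y, Module ℝ (E y)]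

instance pullbackAddCommGroup (φ : M → N) (x : M) : AddCommGroup ((φ *ᵖ E) x) :=
  inferInstanceAs (AddCommGroup (E (φ x)))

/-- The ambient bundle `TM ⊕ φ^! E` of the pullback algebroid. -/
abbrev PullAmbient (EM : Type*) [NormedAddCommGroup EM] [NormedSpace ℝ EM] {M : Type*}
    [TopologicalSpace M] [ChartedSpace EM M] {N : Type*} (E : N → Type*) (φ : M → N) (x : M) :
    Type _ :=
  Tan EM x × (φ *ᵖ E) x

variable (φ : C^∞⟮𝓘(ℝ, EM), M; 𝓘(ℝ, EN), N⟯) (A : PreLieAlgebroid EN F E)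

/-- The fibre `{(X, v) ∈ T_x M × A_{φ(x)} : a(v) = φ_* X}` of `φ^{!!} A`. -/
def pullbackFiber (x : M) : Submodule ℝ (PullAmbient EM E φ x) where
  carrier := {w | ∃ v : A.fiber (φ x), (v : E (φ x)) = w.2 ∧
    A.anchor (φ x) v = mfderiv 𝓘(ℝ, EM) 𝓘(ℝ, EN) φ x w.1}
  zero_mem' := ⟨0, rfl, by simp⟩
  add_mem' := by
    rintro w w' ⟨v, hv, h⟩ ⟨v', hv', h'⟩
    refine ⟨v + v', ?_, ?_⟩
    · rw [Submodule.coe_add, hv, hv']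
      rfl
    · rw [map_add, h, h', Prod.fst_add, map_add]
  smul_mem' := by
    rintro c w ⟨v, hv, h⟩
    refine ⟨c • v, ?_, ?_⟩
    · rw [Submodule.coe_smul, hv]
      rfl
    · rw [map_smul, h, Prod.smul_fst, map_smul]

/-- The second projection `φ^{!!} A → A`, a bundle map over `φ`. -/
def pullbackProj (x : M) : pullbackFiber φ A x →ₗ[ℝ] A.fiber (φ x) where
  toFun w := ⟨w.1.2, by obtain ⟨v, hv, -⟩ := w.2; exact hv ▸ v.2⟩
  map_add' _ _ := rfl
  map_smul' _ _ := rfl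

variable [TopologicalSpace (TotalSpace F E)] [∀ y, TopologicalSpace (E y)] [FiberBundle F E]

/-- The bracket `br` on sections of `φ^{!!} A` is the pullback bracket: over open sets,
`[(X, ∑ f_i ⊗ α_i), (Y, ∑ g_j ⊗ β_j)]`
`= ([X, Y], ∑ f_i g_j ⊗ [α_i, β_j]_A + ∑ X(g_j) ⊗ β_j - ∑ Y(f_i) ⊗ α_i)`. -/
def IsPullbackBracket
    (br : (∀ x, pullbackFiber φ A x) → (∀ x, pullbackFiber φ A x) → ∀ x, pullbackFiber φ A x) :
    Prop :=
  ∀ (U : Set M) (V : Set N), IsOpen U → IsOpen V → (∀ x ∈ U, φ x ∈ V) →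
  ∀ (k l : ℕ) (f : Fin k → M → ℝ) (α : Fin k → ∀ y, A.fiber y)
    (g : Fin l → M → ℝ) (β : Fin l → ∀ y, A.fiber y) (σ τ : ∀ x, pullbackFiber φ A x),
  (∀ i, ContMDiffOn 𝓘(ℝ, EM) 𝓘(ℝ, ℝ) ∞ (f i) U) → (∀ i, A.SmoothOn V (α i)) →
  (∀ j, ContMDiffOn 𝓘(ℝ, EM) 𝓘(ℝ, ℝ) ∞ (g j) U) → (∀ j, A.SmoothOn V (β j)) →
  SmoothSectionOn EM EM U (fun x => (σ x).1.1) → SmoothSectionOn EM EM U (fun x => (τ x).1.1) →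
  (∀ x ∈ U, pullbackProj φ A x (σ x) = ∑ i, f i x • α i (φ x)) →
  (∀ x ∈ U, pullbackProj φ A x (τ x) = ∑ j, g j x • β j (φ x)) →
  ∀ x ∈ U,
    (br σ τ x).1.1 = lieVec (fun y => (σ y).1.1) (fun y => (τ y).1.1) x ∧
    pullbackProj φ A x (br σ τ x)
      = ∑ i, ∑ j, (f i x * g j x) • A.bracket (α i) (β j) (φ x)
        + ∑ j, dFun EM (g j) x (σ x).1.1 • β j (φ x)
        - ∑ i, dFun EM (f i) x (τ x).1.1 • α i (φ x)

/-- The pullback `φ^{!!} A` along a submersion `φ`, with a given bracket: the anchor is the first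
projection, and the rank is `rank A + dim M - dim N`. -/
def pullbackAlgebroid
    (br : (∀ x, pullbackFiber φ A x) → (∀ x, pullbackFiber φ A x) → ∀ x, pullbackFiber φ A x) :
    PreLieAlgebroid EM (EM × F) (PullAmbient EM E φ) where
  rank := A.rank + Module.finrank ℝ EM - Module.finrank ℝ EN
  fiber := pullbackFiber φ A
  anchor x := (LinearMap.fst ℝ (Tan EM x) ((φ *ᵖ E) x)).comp (pullbackFiber φ A x).subtype
  bracket := br

/-- The map in cohomology induced by the bundle map `Ψ : B → A` over `φ` sends `c` to `c'`: for every
closed form `η` in the class `c`, the form `Ψ^* η` is closed and in the class `c'`. -/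
def IsPullbackClass {F' : Type*} [NormedAddCommGroup F'] [NormedSpace ℝ F'] {E' : M → Type*}
    [∀ x, AddCommGroup (E' x)] [∀ x, Module ℝ (E' x)] [TopologicalSpace (TotalSpace F' E')]
    [∀ x, TopologicalSpace (E' x)] [FiberBundle F' E']
    (B : PreLieAlgebroid EM F' E') (Ψ : ∀ x, B.fiber x →ₗ[ℝ] A.fiber (φ x))
    (c : A.H1) (c' : B.H1) : Prop :=
  ∀ η : A.closedForms, A.toH1 η = c →
    ∃ h : (fun x => (η.1 (φ x)).comp (Ψ x) : B.Cochain) ∈ B.closedForms, B.toH1 ⟨_, h⟩ = c'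

end Pullback

/-! ### Dirac structures -/

section Dirac

/-- The symmetric pairing `⟨X + α, Y + β⟩₊ = (⟨β, X⟩ + ⟨α, Y⟩) / 2`. -/
def pairing (x : M) (u v : GenTan EM x) : ℝ := (1 / 2) * (v.2 u.1 + u.2 v.1)

/-- The subspace `W` of `T_x M ⊕ T*_x M` is isotropic. -/
def IsIsotropic (x : M) (W : Submodule ℝ (GenTan EM x)) : Prop :=
  ∀ u ∈ W, ∀ v ∈ W, pairing x u v = 0

/-- The Courant bracket on sections `X + α` of `TM ⊕ T*M`. -/
def courantBracket (σ τ : ∀ x : M, GenTan EM x) (x : M) : GenTan EM x :=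
  let X : ∀ x : M, Tan EM x := fun y => (σ y).1
  let α : ∀ x : M, Cot EM x := fun y => (σ y).2
  let Y : ∀ x : M, Tan EM x := fun y => (τ y).1
  let β : ∀ x : M, Cot EM x := fun y => (τ y).2
  (lieVec X Y x,
   lieForm X β x - lieForm Y α x + (1 / 2 : ℝ) • dFun EM (fun y => α y (Y y) - β y (X y)) x)

/-- The Courant bracket of the Lie bialgebroid `(TM, T*M, π)`. -/
def courantBracketPoisson (P : PoissonStructure EM M) (σ τ : ∀ x : M, GenTan EM x) (x : M) :
    GenTan EM x :=
  let X : ∀ x : M, Tan EM x := fun y => (σ y).1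
  let α : ∀ x : M, Cot EM x := fun y => (σ y).2
  let Y : ∀ x : M, Tan EM x := fun y => (τ y).1
  let β : ∀ x : M, Cot EM x := fun y => (τ y).2
  (lieVec X Y x + P.lieDual α Y x - P.lieDual β X x
     - (1 / 2 : ℝ) • P.dPi (fun y => α y (Y y) - β y (X y)) x,
   P.formBracket α β x + lieForm X β x - lieForm Y α x
     + (1 / 2 : ℝ) • dFun EM (fun y => α y (Y y) - β y (X y)) x)

/-- `L` is a maximally isotropic subbundle of `TM ⊕ T*M` that is integrable: its sections (over open
sets) are closed under the bracket `br`. -/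
structure IsDirac (br : (∀ x : M, GenTan EM x) → (∀ x : M, GenTan EM x) → ∀ x : M, GenTan EM x)
    (L : ∀ x : M, Submodule ℝ (GenTan EM x)) : Prop where
  subbundle : ∃ r : ℕ, IsSmoothSubbundle EM (GenModel EM) r L
  maximal : ∀ x, Maximal (IsIsotropic x) (L x)
  integrable : ∀ U : Set M, IsOpen U → ∀ σ τ : ∀ x : M, GenTan EM x,
    SmoothSectionOn EM (GenModel EM) U σ → SmoothSectionOn EM (GenModel EM) U τ →
    (∀ x ∈ U, σ x ∈ L x) → (∀ x ∈ U, τ x ∈ L x) → ∀ x ∈ U, br σ τ x ∈ L x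

/-- An ordinary Dirac structure on `M`. -/
def IsDiracStructure (L : ∀ x : M, Submodule ℝ (GenTan EM x)) : Prop := IsDirac courantBracket L

/-- A Dirac structure on the Lie bialgebroid `(TM, T*M, π)`. -/
def IsDiracStructurePoisson (P : PoissonStructure EM M)
    (L : ∀ x : M, Submodule ℝ (GenTan EM x)) : Prop :=
  IsDirac (courantBracketPoisson P) L

open Classical in
/-- The algebroid (of rank `dim M`) obtained by restricting an anchor and a bracket to `L`. The
second branch never occurs for smooth sections of an integrable `L`. -/
def restrictAlgebroid (a : ∀ x : M, GenTan EM x →ₗ[ℝ] Tan EM x)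
    (br : (∀ x : M, GenTan EM x) → (∀ x : M, GenTan EM x) → ∀ x : M, GenTan EM x)
    (L : ∀ x : M, Submodule ℝ (GenTan EM x)) :
    PreLieAlgebroid EM (GenModel EM) (GenTan EM : M → Type _) where
  rank := Module.finrank ℝ EM
  fiber := L
  anchor x := (a x).comp (L x).subtype
  bracket σ τ x :=
    if h : br (fun y => (σ y : GenTan EM y)) (fun y => (τ y : GenTan EM y)) x ∈ L x
    then ⟨_, h⟩ else 0

/-- The Lie algebroid of an ordinary Dirac structure: anchor `X + α ↦ X`, Courant bracket. -/
def diracAlgebroid (L : ∀ x : M, Submodule ℝ (GenTan EM x)) :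
    PreLieAlgebroid EM (GenModel EM) (GenTan EM : M → Type _) :=
  restrictAlgebroid (fun x => LinearMap.fst ℝ (Tan EM x) (Cot EM x)) courantBracket L

/-- The Lie algebroid of a Dirac structure on `(TM, T*M, π)`: anchor `X + α ↦ X + π♯ α`. -/
def diracAlgebroidPoisson (P : PoissonStructure EM M)
    (L : ∀ x : M, Submodule ℝ (GenTan EM x)) :
    PreLieAlgebroid EM (GenModel EM) (GenTan EM : M → Type _) :=
  restrictAlgebroid
    (fun x => LinearMap.fst ℝ (Tan EM x) (Cot EM x)
      + (P.sharp x).comp (LinearMap.snd ℝ (Tan EM x) (Cot EM x)))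
    (courantBracketPoisson P) L

/-- The cotangent Lie algebroid `T*M` of a Poisson manifold: anchor `π♯`, bracket `[·,·]_π`. -/
def cotangentAlgebroid (P : PoissonStructure EM M) :
    PreLieAlgebroid EM (EM →L[ℝ] ℝ) (Cot EM : M → Type _) where
  rank := Module.finrank ℝ EM
  fiber _ := ⊤
  anchor x := (P.sharp x).comp (Submodule.subtype ⊤)
  bracket σ τ x := ⟨P.formBracket (fun y => (σ y : Cot EM y)) (fun y => (τ y : Cot EM y)) x, trivial⟩

/-- The bundle map `X + α ↦ X + π♯ α + α`. -/
def shift (P : PoissonStructure EM M) (x : M) : GenTan EM x →ₗ[ℝ] GenTan EM x :=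
  (LinearMap.fst ℝ (Tan EM x) (Cot EM x)
      + (P.sharp x).comp (LinearMap.snd ℝ (Tan EM x) (Cot EM x))).prod
    (LinearMap.snd ℝ (Tan EM x) (Cot EM x))

/-- The image of `L` under `X + α ↦ X + π♯ α + α`. -/
def shiftImage (P : PoissonStructure EM M) (L : ∀ x : M, Submodule ℝ (GenTan EM x)) (x : M) :
    Submodule ℝ (GenTan EM x) :=
  (L x).map (shift P x)

/-- The characteristic distribution `L ∩ TM`. -/
def charDist (L : ∀ x : M, Submodule ℝ (GenTan EM x)) (x : M) : Submodule ℝ (Tan EM x) :=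
  (L x).comap (LinearMap.inl ℝ (Tan EM x) (Cot EM x))

/-- The partition of `M` into the leaves of the distribution `D`: two points are in the same leaf if
they can be joined by finitely many smooth curves tangent to `D`. -/
def leaves (D : ∀ x : M, Submodule ℝ (Tan EM x)) : Setoid M :=
  Relation.EqvGen.setoid fun x y => ∃ γ : ℝ → M, ContMDiff 𝓘(ℝ, ℝ) 𝓘(ℝ, EM) ∞ γ ∧
    (∀ t, mfderiv 𝓘(ℝ, ℝ) 𝓘(ℝ, EM) γ t (1 : ℝ) ∈ D (γ t)) ∧ γ 0 = x ∧ γ 1 = y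

/-- The characteristic foliation of `L`, as the partition of `M` into leaves. -/
def charFoliation (L : ∀ x : M, Submodule ℝ (GenTan EM x)) : Setoid M := leaves (charDist L)

variable {EN : Type*} [NormedAddCommGroup EN] [NormedSpace ℝ EN]
  {N : Type*} [TopologicalSpace N] [ChartedSpace EN N] [IsManifold 𝓘(ℝ, EN) ∞ N]

/-- `L` is reducible, with leaf space `N = M/F` and projection `p`: the characteristic distribution
is regular, and `p` is a surjective submersion onto the manifold `N` whose fibres are the leaves of
the characteristic foliation, with the characteristic distribution as tangent spaces. -/
structure IsReduction (L : ∀ x : M, Submodule ℝ (GenTan EM x))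
    (p : C^∞⟮𝓘(ℝ, EM), M; 𝓘(ℝ, EN), N⟯) : Prop where
  regular : ∃ k : ℕ, ∀ x, Module.finrank ℝ (charDist L x) = k
  surjective : Function.Surjective p
  submersion : ∀ x, Function.Surjective (mfderiv 𝓘(ℝ, EM) 𝓘(ℝ, EN) p x)
  fibres : ∀ x y, p x = p y ↔ charFoliation L x y
  tangent : ∀ x (v : Tan EM x),
    mfderiv 𝓘(ℝ, EM) 𝓘(ℝ, EN) p x v = 0 ↔ v ∈ charDist L x

/-- The Poisson structure on `N` is the one induced by the ordinary Dirac structure `L` on `M`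
through `p : M → N`: for every smooth function `f` on `N` the function `f ∘ p` is `L`-admissible,
and `{f, g} ∘ p = X (g ∘ p)` for every vector field `X` such that `X + d(f ∘ p)` is a section
of `L`. -/
def IsInducedPoisson (L : ∀ x : M, Submodule ℝ (GenTan EM x))
    (p : C^∞⟮𝓘(ℝ, EM), M; 𝓘(ℝ, EN), N⟯) (PN : PoissonStructure EN N) : Prop :=
  ∀ f : N → ℝ, ContMDiff 𝓘(ℝ, EN) 𝓘(ℝ, ℝ) ∞ f →
    (∃ X : ∀ x : M, Tan EM x, SmoothSectionOn EM EM univ X ∧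
      ∀ x, (X x, dFun EM (f ∘ p) x) ∈ L x) ∧
    ∀ X : ∀ x : M, Tan EM x, SmoothSectionOn EM EM univ X →
      (∀ x, (X x, dFun EM (f ∘ p) x) ∈ L x) →
      ∀ g : N → ℝ, ContMDiff 𝓘(ℝ, EN) 𝓘(ℝ, ℝ) ∞ g →
        ∀ x, PN.poissonBracket f g (p x) = dFun EM (g ∘ p) x (X x)

end Dirac

end DiracGeometry

end

open DiracGeometry

set_option linter.unusedSectionVars false

open Bundle Set Manifold ContDiff Topology TensorProduct

noncomputable section

namespace DiracGeometry

variable {EM : Type*} [NormedAddCommGroup EM] [NormedSpace ℝ EM]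
  {M : Type*} [TopologicalSpace M] [ChartedSpace EM M] [IsManifold 𝓘(ℝ, EM) ∞ M]


/-! ### Dual bases -/

/-! The shift by π♯ preserves the pairing, because π is skew, and it carries the bracket of the
bialgebroid to the ordinary Courant bracket (`shift_courantBracketPoisson`). The expansion is formal
except for one fact, that π♯ sends the bracket of forms to the bracket of fields
(`PoissonStructure.sharp_formBracket`). This is the Jacobi identity of π: the defect is a tensor
(`schouten`), so it may be tested on exact forms, where Jacobi kills it. The shift fixes TM, hence
also the characteristic distribution. The Lie algebroid axioms are checked only for ordinary Dirac
structures and transported to the rest. On isotropic sections the Courant bracket is the Dorfman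
bracket, whose Jacobi identity is pure algebra (`dorfmanPairing_leibniz`).

For the reduction, maximal isotropy says that the covectors occurring in L are exactly the
annihilator of L ∩ TM = ker dp, that is, the covectors pulled back from N. So d(f ∘ p) has lifts X
to L, unique modulo L ∩ TM, and local lifts glue because the possible values form affine spaces
(`exists_lift`). Integrability makes X(g ∘ p) constant along the leaves (`dFun_lift_eq_zero`), which
defines {f, g}. Isotropy gives its skewness and integrability its Jacobi identity. It follows that
the Dirac structure consists of the pairs (X, p^*β) with p_*X = π_N♯β (`mem_comp_mfderiv_iff`),
which is the fibre of the pullback algebroid. The bracket formula holds because d commutes with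
pullback (`lieForm_sub_dForm_pullback`).

For the modular class, a section acts on a generator of L_A by the trace of its bracket matrix plus
the trace of its Lie derivative matrix on forms (`nablaGen_eq`). The terms that are not linear over
functions cancel between the two traces (`AreFrames.nablaGen_combination`), and traces of
commutators vanish, so a nonvanishing section has a closed cocycle
(`IsNonvanishing.exists_isCocycle`). Rescaling the section by g changes the cocycle by d log|g|, so
the class is unique. Along p one uses frames consisting of lifts from N together with vertical
sections, and the pulled back forms together with forms dual to the vertical directions. The
vertical block and its dual have inverse determinants and opposite traces (`IsAdapted.gen_change`,
`IsAdapted.nablaGen`). Hence a nonvanishing section on N pulls back to one on M, and its cocycle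
pulls back too. A section on N always exists, since the canonical line of T^*N is the square of a
line bundle (`exists_isNonvanishing_cotangentAlgebroid`). -/

theorem eq_sum_of_dual {V ι : Type*} [AddCommGroup V] [Module ℝ V] [FiniteDimensional ℝ V]
    [Fintype ι] [DecidableEq ι] (l : ι → V →ₗ[ℝ] ℝ) (w : ι → V)
    (hc : Fintype.card ι = Module.finrank ℝ V)
    (h : ∀ i j, l i (w j) = if i = j then 1 else 0) (v : V) : v = ∑ i, l i v • w i := by
  have hli : LinearIndependent ℝ w := by
    rw [Fintype.linearIndependent_iff]
    intro g hg i
    have := congrArg (l i) hg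
    simpa [map_sum, h] using this
  let b := basisOfLinearIndependentOfCardEqFinrank' w hli hc
  have hb : ⇑b = w := coe_basisOfLinearIndependentOfCardEqFinrank' w hli hc
  have hr : ∀ i, l i v = b.repr v i := fun i => by
    conv_lhs => rw [← b.sum_repr v]
    simp [map_sum, hb, h]
  conv_lhs => rw [← b.sum_repr v]
  simp [hr, hb]

/-! ### Smooth sections -/

section Sections

variable {F : Type*} [NormedAddCommGroup F] [NormedSpace ℝ F] {E : M → Type*}
  [∀ x, AddCommGroup (E x)] [∀ x, Module ℝ (E x)]
  [TopologicalSpace (TotalSpace F E)] [∀ x, TopologicalSpace (E x)] [FiberBundle F E]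
  {U V : Set M} {σ τ : ∀ x, E x} {x : M}

theorem SmoothSectionOn.mono (h : SmoothSectionOn EM F U σ) (hV : V ⊆ U) :
    SmoothSectionOn EM F V σ := ContMDiffOn.mono h hV

theorem SmoothSectionOn.congr (h : SmoothSectionOn EM F U σ) (hs : ∀ x ∈ U, τ x = σ x) :
    SmoothSectionOn EM F U τ :=
  ContMDiffOn.congr h fun x hx => by rw [hs x hx]


theorem SmoothSectionOn.contMDiffAt (h : SmoothSectionOn EM F U σ) (hU : IsOpen U) (hx : x ∈ U) :
    ContMDiffAt 𝓘(ℝ, EM) (𝓘(ℝ, EM).prod 𝓘(ℝ, F)) ∞ (fun x => TotalSpace.mk' F x (σ x)) x :=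
  ContMDiffOn.contMDiffAt h (hU.mem_nhds hx)

theorem SmoothSectionOn.mdifferentiableAt (h : SmoothSectionOn EM F U σ) (hU : IsOpen U)
    (hx : x ∈ U) :
    MDifferentiableAt 𝓘(ℝ, EM) (𝓘(ℝ, EM).prod 𝓘(ℝ, F)) (fun x => TotalSpace.mk' F x (σ x)) x :=
  (h.contMDiffAt hU hx).mdifferentiableAt (by simp)

/-- Smoothness of a section is a local property. -/
theorem smoothSectionOn_of_local
    (h : ∀ x ∈ U, ∃ V, IsOpen V ∧ x ∈ V ∧ SmoothSectionOn EM F V σ) :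
    SmoothSectionOn EM F U σ := fun x hx => by
  obtain ⟨V, hV, hxV, hs⟩ := h x hx
  exact (hs.contMDiffAt hV hxV).contMDiffWithinAt

variable [VectorBundle ℝ F E]

theorem SmoothSectionOn.add (h : SmoothSectionOn EM F U σ) (h' : SmoothSectionOn EM F U τ) :
    SmoothSectionOn EM F U (fun x => σ x + τ x) := ContMDiffOn.add_section h h'

theorem SmoothSectionOn.sub (h : SmoothSectionOn EM F U σ) (h' : SmoothSectionOn EM F U τ) :
    SmoothSectionOn EM F U (fun x => σ x - τ x) := ContMDiffOn.sub_section h h'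

theorem SmoothSectionOn.smul {f : M → ℝ} (hf : ContMDiffOn 𝓘(ℝ, EM) 𝓘(ℝ, ℝ) ∞ f U)
    (h : SmoothSectionOn EM F U σ) :
    SmoothSectionOn EM F U (fun x => f x • σ x) := ContMDiffOn.smul_section hf h

theorem SmoothSectionOn.sum {ι : Type*} {s : Finset ι} {t : ι → ∀ x, E x}
    (h : ∀ i ∈ s, SmoothSectionOn EM F U (t i)) :
    SmoothSectionOn EM F U (fun x => ∑ i ∈ s, t i x) := ContMDiffOn.sum_section h

theorem smoothSectionOn_zero : SmoothSectionOn EM F U (fun x => (0 : E x)) :=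
  (contMDiff_zeroSection ℝ E).contMDiffOn

/-- A smooth local section agrees near each point with a smooth global one. -/
theorem SmoothSectionOn.exists_global [T2Space M] [FiniteDimensional ℝ EM] (hU : IsOpen U)
    (hx : x ∈ U) (h : SmoothSectionOn EM F U σ) :
    ∃ σ' : ∀ x, E x, SmoothSectionOn EM F univ σ' ∧ ∀ᶠ y in 𝓝 x, σ' y = σ y := by
  obtain ⟨f, -, hf⟩ := (SmoothBumpFunction.nhds_basis_tsupport (I := 𝓘(ℝ, EM)) x).mem_iff.1
    (hU.mem_nhds hx)
  refine ⟨fun y => f y • σ y, ?_, ?_⟩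
  · exact (ContMDiffOn.smul_section_of_tsupport (f.contMDiff.contMDiffOn) hU hf h).contMDiffOn
  · filter_upwards [f.eventuallyEq_one] with y hy
    rw [hy, Pi.one_apply, one_smul]

end Sections

/-- A smooth local function agrees near each point with a smooth global one. -/
theorem exists_global_fun [T2Space M] [FiniteDimensional ℝ EM] {U : Set M} {x : M} (hU : IsOpen U)
    (hx : x ∈ U) {f : M → ℝ} (h : ContMDiffOn 𝓘(ℝ, EM) 𝓘(ℝ, ℝ) ∞ f U) :
    ∃ f' : M → ℝ, ContMDiff 𝓘(ℝ, EM) 𝓘(ℝ, ℝ) ∞ f' ∧ f' =ᶠ[𝓝 x] f := by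
  obtain ⟨χ, -, hχ⟩ := (SmoothBumpFunction.nhds_basis_tsupport (I := 𝓘(ℝ, EM)) x).mem_iff.1
    (hU.mem_nhds hx)
  refine ⟨fun y => χ y • f y, ?_, ?_⟩
  · refine contMDiff_of_tsupport fun y hy => ?_
    have hy' : y ∈ U := hχ (tsupport_smul_subset_left _ _ hy)
    exact χ.contMDiff.contMDiffAt.smul (h.contMDiffAt (hU.mem_nhds hy'))
  · filter_upwards [χ.eventuallyEq_one] with y hy
    rw [hy, Pi.one_apply, one_smul]

/-! ### Tangent and cotangent bundles -/

instance finiteDimensional_tan [FiniteDimensional ℝ EM] (x : M) :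
    FiniteDimensional ℝ (Tan EM x) := inferInstanceAs (FiniteDimensional ℝ EM)

instance finiteDimensional_cot [FiniteDimensional ℝ EM] (x : M) :
    FiniteDimensional ℝ (Cot EM x) := inferInstanceAs (FiniteDimensional ℝ (EM →L[ℝ] ℝ))

section Tangent

variable {U : Set M} {x : M} {X : ∀ x : M, Tan EM x} {α : ∀ x : M, Cot EM x}

theorem SmoothSectionOn.apply (hα : SmoothSectionOn EM (EM →L[ℝ] ℝ) U α)
    (hX : SmoothSectionOn EM EM U X) :
    ContMDiffOn 𝓘(ℝ, EM) 𝓘(ℝ, ℝ) ∞ (fun x => α x (X x)) U := fun y hy => by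
  have := ContMDiffWithinAt.clm_bundle_apply (E₂ := Bundle.Trivial M ℝ) (F₂ := ℝ) (hα y hy) (hX y hy)
  exact Bundle.contMDiffWithinAt_section.1 this


theorem smoothSectionOn_dFun {f : M → ℝ} (hU : IsOpen U)
    (hf : ContMDiffOn 𝓘(ℝ, EM) 𝓘(ℝ, ℝ) ∞ f U) :
    SmoothSectionOn EM (EM →L[ℝ] ℝ) U (dFun EM f) := fun y hy => by
  have h := (hf.contMDiffAt (hU.mem_nhds hy)).mfderiv_const (m := ∞) (by simp)
  refine ContMDiffAt.contMDiffWithinAt ?_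
  refine (contMDiffAt_hom_bundle _).2 ⟨contMDiffAt_id, h.congr_of_eventuallyEq ?_⟩
  refine Filter.Eventually.of_forall fun x => ?_
  ext v
  simp only [inTangentCoordinates, ContinuousLinearMap.inCoordinates,
    TangentBundle.continuousLinearMapAt_model_space]
  simp only [ContinuousLinearMap.comp_apply]
  exact DFunLike.congr_fun (Bundle.Trivial.continuousLinearMapAt_trivialization ℝ M ℝ x) _

section Product

variable {σ : ∀ x : M, GenTan EM x}

theorem smoothSectionOn_gen_iff : SmoothSectionOn EM (GenModel EM) U σ ↔
    SmoothSectionOn EM EM U (fun x => (σ x).1) ∧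
      SmoothSectionOn EM (EM →L[ℝ] ℝ) U (fun x => (σ x).2) := by
  constructor
  · intro h
    constructor
    · intro y hy
      exact Bundle.contMDiffWithinAt_section.2
        ((ContinuousLinearMap.fst ℝ EM (EM →L[ℝ] ℝ)).contMDiff.contMDiffAt.comp_contMDiffWithinAt y
          (Bundle.contMDiffWithinAt_section.1 (h y hy)))
    · intro y hy
      exact Bundle.contMDiffWithinAt_section.2
        ((ContinuousLinearMap.snd ℝ EM (EM →L[ℝ] ℝ)).contMDiff.contMDiffAt.comp_contMDiffWithinAt y
          (Bundle.contMDiffWithinAt_section.1 (h y hy)))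
  · rintro ⟨h1, h2⟩ y hy
    exact Bundle.contMDiffWithinAt_section.2 ((Bundle.contMDiffWithinAt_section.1 (h1 y hy)).prodMk_space
      (Bundle.contMDiffWithinAt_section.1 (h2 y hy)))

end Product

/-- Global functions `f i` whose differentials are dual, near a point, to global fields `W j`. -/
theorem exists_coordinates [T2Space M] [FiniteDimensional ℝ EM] (x₀ : M) :
    ∃ (f : Fin (Module.finrank ℝ EM) → M → ℝ) (W : Fin (Module.finrank ℝ EM) → ∀ x : M, Tan EM x),
      (∀ i, ContMDiff 𝓘(ℝ, EM) 𝓘(ℝ, ℝ) ∞ (f i)) ∧ (∀ i, SmoothSectionOn EM EM univ (W i)) ∧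
      ∀ᶠ y in 𝓝 x₀, ∀ i j, dFun EM (f i) y (W j y) = if i = j then 1 else 0 := by
  let b := Module.finBasis ℝ EM
  let e := trivializationAt EM (TangentSpace 𝓘(ℝ, EM) : M → Type _) x₀
  have hf : ∀ i, ∃ f : M → ℝ, ContMDiff 𝓘(ℝ, EM) 𝓘(ℝ, ℝ) ∞ f ∧
      f =ᶠ[𝓝 x₀] fun y => LinearMap.toContinuousLinearMap (b.coord i) (extChartAt 𝓘(ℝ, EM) x₀ y) :=
    fun i => by
    refine exists_global_fun (chartAt EM x₀).open_source (mem_chart_source EM x₀) ?_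
    exact (ContinuousLinearMap.contMDiff _).comp_contMDiffOn contMDiffOn_extChartAt
  have hW : ∀ i, ∃ W : ∀ x : M, Tan EM x, SmoothSectionOn EM EM univ W ∧
      ∀ᶠ y in 𝓝 x₀, W y = e.localFrame b i y := fun i => by
    refine SmoothSectionOn.exists_global e.open_baseSet
      (FiberBundle.mem_baseSet_trivializationAt' x₀) ?_
    exact e.contMDiffOn_localFrame_baseSet ∞ b i
  choose f hf1 hf2 using hf
  choose W hW1 hW2 using hW
  refine ⟨f, W, hf1, hW1, ?_⟩
  have h1 : ∀ᶠ y in 𝓝 x₀, ∀ i, f i =ᶠ[𝓝 y]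
      fun y => LinearMap.toContinuousLinearMap (b.coord i) (extChartAt 𝓘(ℝ, EM) x₀ y) :=
    Filter.eventually_all.2 fun i => (hf2 i).eventuallyEq_nhds
  filter_upwards [h1, Filter.eventually_all.2 hW2, (chartAt EM x₀).open_source.mem_nhds
    (mem_chart_source EM x₀)] with y hy1 hy2 hys i j
  have hd : HasMFDerivAt 𝓘(ℝ, EM) 𝓘(ℝ, ℝ) (f i) y
      ((LinearMap.toContinuousLinearMap (b.coord i)).comp
        (mfderiv 𝓘(ℝ, EM) 𝓘(ℝ, EM) (extChartAt 𝓘(ℝ, EM) x₀) y)) :=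
    (HasMFDerivAt.comp y (ContinuousLinearMap.hasMFDerivAt _)
      (mdifferentiableAt_extChartAt hys).hasMFDerivAt).congr_of_eventuallyEq (hy1 i)
  rw [hy2 j]
  refine (DFunLike.congr_fun hd.mfderiv _).trans ?_
  have hyb : y ∈ e.baseSet := hys
  -- The local frame is the image of the basis `b` under the derivative of the inverse chart, so the
  -- differential of the chart takes it back to `b`.
  have hv : e.localFrame b j y = mfderivWithin 𝓘(ℝ, EM) 𝓘(ℝ, EM) (extChartAt 𝓘(ℝ, EM) x₀).symm
      (range 𝓘(ℝ, EM)) (extChartAt 𝓘(ℝ, EM) x₀ y) (b j) := by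
    rw [e.localFrame_apply_of_mem_baseSet b hyb, Trivialization.basisAt, Module.Basis.map_apply,
      ← TangentBundle.symmL_trivializationAt hys]
    exact (e.symmL_apply (R := ℝ) hyb (b j)).symm
  have hc := DFunLike.congr_fun (mfderiv_extChartAt_comp_mfderivWithin_extChartAt_symm'
    (I := 𝓘(ℝ, EM)) (x := x₀) (by rwa [extChartAt_source])) (b j)
  rw [hv]
  refine (congrArg (b.coord i) hc).trans ?_
  change b.coord i (b j) = _
  rw [b.coord_apply, b.repr_self, Finsupp.single_apply]
  simp [eq_comm]


/-- Global coordinates near a point, with the resulting expansions. -/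
theorem exists_coordinates_expand [T2Space M] [FiniteDimensional ℝ EM] (x₀ : M) :
    ∃ (f : Fin (Module.finrank ℝ EM) → M → ℝ) (W : Fin (Module.finrank ℝ EM) → ∀ x : M, Tan EM x)
      (U : Set M), (∀ i, ContMDiff 𝓘(ℝ, EM) 𝓘(ℝ, ℝ) ∞ (f i)) ∧
      (∀ i, SmoothSectionOn EM EM univ (W i)) ∧ IsOpen U ∧ x₀ ∈ U ∧
      (∀ y ∈ U, ∀ i j, dFun EM (f i) y (W j y) = if i = j then 1 else 0) ∧
      (∀ y ∈ U, ∀ v : Tan EM y, v = ∑ i, dFun EM (f i) y v • W i y) ∧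
      ∀ y ∈ U, ∀ α : Cot EM y, α = ∑ i, α (W i y) • dFun EM (f i) y := by
  obtain ⟨f, W, hf, hW, h⟩ := exists_coordinates (EM := EM) x₀
  obtain ⟨U, hU, hUo, hx⟩ := eventually_nhds_iff.1 h
  have key : ∀ y ∈ U, ∀ v : Tan EM y, v = ∑ i, dFun EM (f i) y v • W i y := fun y hy v =>
    eq_sum_of_dual (fun i => (dFun EM (f i) y).toLinearMap) (fun i => W i y)
      (by simp; rfl) (hU y hy) v
  refine ⟨f, W, U, hf, hW, hUo, hx, hU, key, fun y hy α => ?_⟩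
  ext v
  conv_lhs => rw [key y hy v]
  rw [map_sum, _root_.sum_apply]
  exact Finset.sum_congr rfl fun i _ => by
    rw [map_smul, _root_.smul_apply, smul_eq_mul, smul_eq_mul, mul_comm]

/-- A family of covectors is smooth if it takes smooth values on global smooth fields. -/
theorem smoothSectionOn_form_of_apply [T2Space M] [FiniteDimensional ℝ EM]
    (h : ∀ W : ∀ x : M, Tan EM x, SmoothSectionOn EM EM univ W →
      ContMDiffOn 𝓘(ℝ, EM) 𝓘(ℝ, ℝ) ∞ (fun x => α x (W x)) U) :
    SmoothSectionOn EM (EM →L[ℝ] ℝ) U α := by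
  intro x hx
  obtain ⟨f, W, V, hf, hW, hV, hxV, -, -, hα⟩ := exists_coordinates_expand (EM := EM) x
  have h1 : SmoothSectionOn EM (EM →L[ℝ] ℝ) U (fun y => ∑ i, α y (W i y) • dFun EM (f i) y) :=
    SmoothSectionOn.sum fun i _ => (h (W i) (hW i)).smul_section
      ((smoothSectionOn_dFun isOpen_univ (hf i).contMDiffOn).mono (subset_univ _))
  refine (h1 x hx).congr_of_eventuallyEq ?_ ?_
  · filter_upwards [mem_nhdsWithin_of_mem_nhds (hV.mem_nhds hxV)] with y hy
    rw [← hα y hy]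
  · exact congrArg (TotalSpace.mk' _ x) (hα x hxV (α x))

/-- A family of vectors is smooth if global smooth functions have smooth derivatives along it. -/
theorem smoothSectionOn_field_of_apply [T2Space M] [FiniteDimensional ℝ EM]
    (h : ∀ f : M → ℝ, ContMDiff 𝓘(ℝ, EM) 𝓘(ℝ, ℝ) ∞ f →
      ContMDiffOn 𝓘(ℝ, EM) 𝓘(ℝ, ℝ) ∞ (fun x => dFun EM f x (X x)) U) :
    SmoothSectionOn EM EM U X := by
  intro x hx
  obtain ⟨f, W, V, hf, hW, hV, hxV, -, hX, -⟩ := exists_coordinates_expand (EM := EM) x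
  have h1 : SmoothSectionOn EM EM U (fun y => ∑ i, dFun EM (f i) y (X y) • W i y) :=
    SmoothSectionOn.sum fun i _ => (h (f i) (hf i)).smul_section ((hW i).mono (subset_univ _))
  refine (h1 x hx).congr_of_eventuallyEq ?_ ?_
  · filter_upwards [mem_nhdsWithin_of_mem_nhds (hV.mem_nhds hxV)] with y hy
    rw [← hX y hy]
  · exact congrArg (TotalSpace.mk' _ x) (hX x hxV (X x))

theorem exists_field_eq [T2Space M] [FiniteDimensional ℝ EM] (v : Tan EM x) :
    ∃ W : ∀ x : M, Tan EM x, SmoothSectionOn EM EM univ W ∧ W x = v := by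
  obtain ⟨f, W, V, hf, hW, hV, hxV, -, hX, -⟩ := exists_coordinates_expand (EM := EM) x
  exact ⟨fun y => ∑ i, dFun EM (f i) x v • W i y,
    SmoothSectionOn.sum fun i _ => SmoothSectionOn.smul contMDiffOn_const (hW i), (hX x hxV v).symm⟩

theorem dFun_add {f g : M → ℝ} (hf : MDifferentiableAt 𝓘(ℝ, EM) 𝓘(ℝ, ℝ) f x)
    (hg : MDifferentiableAt 𝓘(ℝ, EM) 𝓘(ℝ, ℝ) g x) :
    dFun EM (fun y => f y + g y) x = dFun EM f x + dFun EM g x := mvfderiv_fun_add hf hg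

theorem dFun_sub {f g : M → ℝ} (hf : MDifferentiableAt 𝓘(ℝ, EM) 𝓘(ℝ, ℝ) f x)
    (hg : MDifferentiableAt 𝓘(ℝ, EM) 𝓘(ℝ, ℝ) g x) :
    dFun EM (fun y => f y - g y) x = dFun EM f x - dFun EM g x := mvfderiv_fun_sub hf hg

theorem dFun_neg {f : M → ℝ} : dFun EM (fun y => - f y) x = - dFun EM f x := mvfderiv_fun_neg

theorem dFun_const (c : ℝ) : dFun EM (fun _ : M => c) x = 0 := mvfderiv_const c

theorem dFun_mul {f g : M → ℝ} (hf : MDifferentiableAt 𝓘(ℝ, EM) 𝓘(ℝ, ℝ) f x)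
    (hg : MDifferentiableAt 𝓘(ℝ, EM) 𝓘(ℝ, ℝ) g x) :
    dFun EM (fun y => f y * g y) x = f x • dFun EM g x + g x • dFun EM f x := by
  have := mvfderiv_fun_mul hf hg
  exact this

theorem dFun_const_mul {f : M → ℝ} (c : ℝ) (hf : MDifferentiableAt 𝓘(ℝ, EM) 𝓘(ℝ, ℝ) f x) :
    dFun EM (fun y => c * f y) x = c • dFun EM f x := by
  rw [dFun_mul (mdifferentiableAt_const) hf, dFun_const, smul_zero, add_zero]

theorem mdifferentiableAt_finset_sum {ι : Type*} {s : Finset ι} {f : ι → M → ℝ}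
    (hf : ∀ i ∈ s, MDifferentiableAt 𝓘(ℝ, EM) 𝓘(ℝ, ℝ) (f i) x) :
    MDifferentiableAt 𝓘(ℝ, EM) 𝓘(ℝ, ℝ) (fun y => ∑ i ∈ s, f i y) x := by
  classical
  induction s using Finset.induction_on with
  | empty => simpa using mdifferentiableAt_const
  | insert a s ha ih =>
    simp only [Finset.sum_insert ha]
    exact (hf a (Finset.mem_insert_self a s)).add
      (ih fun i hi => hf i (Finset.mem_insert_of_mem hi))

theorem dFun_sum {ι : Type*} {s : Finset ι} {f : ι → M → ℝ}
    (hf : ∀ i ∈ s, MDifferentiableAt 𝓘(ℝ, EM) 𝓘(ℝ, ℝ) (f i) x) :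
    dFun EM (fun y => ∑ i ∈ s, f i y) x = ∑ i ∈ s, dFun EM (f i) x := by
  classical
  induction s using Finset.induction_on with
  | empty => simpa using dFun_const (EM := EM) (x := x) 0
  | insert a s ha ih =>
    have h2 : MDifferentiableAt 𝓘(ℝ, EM) 𝓘(ℝ, ℝ) (fun y => ∑ i ∈ s, f i y) x :=
      mdifferentiableAt_finset_sum fun i hi => hf i (Finset.mem_insert_of_mem hi)
    simp only [Finset.sum_insert ha]
    rw [dFun_add (hf a (Finset.mem_insert_self a s)) h2,
      ih fun i hi => hf i (Finset.mem_insert_of_mem hi)]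

theorem dFun_congr {f g : M → ℝ} (h : f =ᶠ[𝓝 x] g) : dFun EM f x = dFun EM g x := by
  have : mfderiv 𝓘(ℝ, EM) 𝓘(ℝ, ℝ) f x = mfderiv 𝓘(ℝ, EM) 𝓘(ℝ, ℝ) g x := h.mfderiv_eq
  exact this

theorem exists_fun_dFun_eq [T2Space M] [FiniteDimensional ℝ EM] (β : Cot EM x) :
    ∃ f : M → ℝ, ContMDiff 𝓘(ℝ, EM) 𝓘(ℝ, ℝ) ∞ f ∧ dFun EM f x = β := by
  obtain ⟨f, W, V, hf, hW, hV, hxV, -, -, hα⟩ := exists_coordinates_expand (EM := EM) x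
  refine ⟨fun y => ∑ i, β (W i x) * f i y, ?_, ?_⟩
  · exact ContMDiff.sum fun i _ => contMDiff_const.mul (hf i)
  · rw [dFun_sum (f := fun i y => β (W i x) * f i y) fun i _ =>
      mdifferentiableAt_const.mul ((hf i).mdifferentiable (by simp) x)]
    conv_rhs => rw [hα x hxV β]
    exact Finset.sum_congr rfl fun i _ =>
      dFun_const_mul _ ((hf i).mdifferentiable (by simp) x)

/-- Vectors are separated by global functions. -/
theorem tan_ext [T2Space M] [FiniteDimensional ℝ EM] {v w : Tan EM x}
    (h : ∀ f : M → ℝ, ContMDiff 𝓘(ℝ, EM) 𝓘(ℝ, ℝ) ∞ f → dFun EM f x v = dFun EM f x w) : v = w := by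
  obtain ⟨f, W, V, hf, hW, hV, hxV, -, hX, -⟩ := exists_coordinates_expand (EM := EM) x
  rw [hX x hxV v, hX x hxV w]
  exact Finset.sum_congr rfl fun i _ => by rw [h (f i) (hf i)]

end Tangent

/-! ### Cartan calculus -/

theorem two_le_infty : (2 : WithTop ℕ∞) ≤ ∞ := WithTop.coe_le_coe.2 (le_top : (2 : ℕ∞) ≤ ⊤)

theorem isManifold_minSmoothness_two : IsManifold 𝓘(ℝ, EM) (minSmoothness ℝ 2) M :=
  IsManifold.of_le (n := ∞) (by simpa using two_le_infty)

attribute [local instance] isManifold_minSmoothness_two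

section Cartan

variable [FiniteDimensional ℝ EM] {U : Set M} {x : M} {X Y Z W : ∀ x : M, Tan EM x}
  {α β γ : ∀ x : M, Cot EM x}

theorem dForm_congr (h : ∀ᶠ y in 𝓝 x, α y = β y) : dForm α x = dForm β x := by
  have h1 : formInChart α x =ᶠ[𝓝 (extChartAt 𝓘(ℝ, EM) x x)] formInChart β x := by
    have hc : Filter.Tendsto (extChartAt 𝓘(ℝ, EM) x).symm (𝓝 (extChartAt 𝓘(ℝ, EM) x x)) (𝓝 x) := by
      have := continuousAt_extChartAt_symm (I := 𝓘(ℝ, EM)) x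
      rwa [ContinuousAt, extChartAt_to_inv] at this
    filter_upwards [hc.eventually h] with e he
    simp only [formInChart, he]
  ext u v
  simp only [dForm, h1.fderiv_eq]

theorem lieVec_congr {X' Y' : ∀ x : M, Tan EM x} (h : ∀ᶠ y in 𝓝 x, X y = X' y)
    (h' : ∀ᶠ y in 𝓝 x, Y y = Y' y) : lieVec X Y x = lieVec X' Y' x :=
  Filter.EventuallyEq.mlieBracket_vectorField_eq h h'

theorem lieForm_congr {X' : ∀ x : M, Tan EM x} (h : ∀ᶠ y in 𝓝 x, X y = X' y)
    (h' : ∀ᶠ y in 𝓝 x, α y = β y) : lieForm X α x = lieForm X' β x := by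
  have h2 : (fun y => α y (X y)) =ᶠ[𝓝 x] fun y => β y (X' y) := by
    filter_upwards [h, h'] with y hy hy'
    rw [hy, hy']
  simp only [lieForm]
  rw [dForm_congr h', h.self_of_nhds, dFun_congr h2]

/-- Mixed second derivatives commute. -/
theorem dForm_dFun (hU : IsOpen U) (hx : x ∈ U) {f : M → ℝ}
    (hf : ContMDiffOn 𝓘(ℝ, EM) 𝓘(ℝ, ℝ) ∞ f U) : dForm (dFun EM f) x = 0 := by
  let g : EM → ℝ := f ∘ (extChartAt 𝓘(ℝ, EM) x).symm
  have hg : ContDiffAt ℝ ∞ g (extChartAt 𝓘(ℝ, EM) x x) := by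
    rw [← contMDiffAt_iff_contDiffAt]
    refine ContMDiffAt.comp _ (I' := 𝓘(ℝ, EM)) ?_ ?_
    · rw [extChartAt_to_inv]
      exact hf.contMDiffAt (hU.mem_nhds hx)
    · have := contMDiffOn_extChartAt_symm (I := 𝓘(ℝ, EM)) (n := ∞) x
      exact this.contMDiffAt (extChartAt_target_mem_nhds x)
  -- Read in the chart, df is the ordinary derivative of `g`, so the exterior derivative is the
  -- antisymmetrised second derivative of `g`.
  have hev : formInChart (dFun EM f) x =ᶠ[𝓝 (extChartAt 𝓘(ℝ, EM) x x)] fderiv ℝ g := by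
    have hc : Filter.Tendsto (extChartAt 𝓘(ℝ, EM) x).symm (𝓝 (extChartAt 𝓘(ℝ, EM) x x)) (𝓝 x) := by
      have := continuousAt_extChartAt_symm (I := 𝓘(ℝ, EM)) x
      rwa [ContinuousAt, extChartAt_to_inv] at this
    filter_upwards [extChartAt_target_mem_nhds (I := 𝓘(ℝ, EM)) x, hc (hU.mem_nhds hx)] with e he heU
    have h1 : MDifferentiableAt 𝓘(ℝ, EM) 𝓘(ℝ, ℝ) f ((extChartAt 𝓘(ℝ, EM) x).symm e) :=
      (hf.contMDiffAt (hU.mem_nhds heU)).mdifferentiableAt (by simp)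
    have h2 : MDifferentiableAt 𝓘(ℝ, EM) 𝓘(ℝ, EM) (extChartAt 𝓘(ℝ, EM) x).symm e := by
      have := mdifferentiableWithinAt_extChartAt_symm (I := 𝓘(ℝ, EM)) he
      rwa [ModelWithCorners.range_eq_univ, mdifferentiableWithinAt_univ] at this
    have h3 := mfderiv_comp e h1 h2
    rw [mfderiv_eq_fderiv] at h3
    rw [h3, formInChart, ModelWithCorners.range_eq_univ, mfderivWithin_univ]
    rfl
  have hs : IsSymmSndFDerivAt ℝ g (extChartAt 𝓘(ℝ, EM) x x) :=
    hg.isSymmSndFDerivAt (by simpa using two_le_infty)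
  ext u v
  simp only [dForm, hev.fderiv_eq]
  exact sub_eq_zero.2 (hs _ _)

/-- `[X, Y] f = X (Y f) - Y (X f)`. -/
theorem dFun_lieVec (hU : IsOpen U) (hx : x ∈ U) {f : M → ℝ}
    (hf : ContMDiffOn 𝓘(ℝ, EM) 𝓘(ℝ, ℝ) ∞ f U) (hX : SmoothSectionOn EM EM U X)
    (hY : SmoothSectionOn EM EM U Y) :
    dFun EM f x (lieVec X Y x) = dFun EM (fun y => dFun EM f y (Y y)) x (X x)
      - dFun EM (fun y => dFun EM f y (X y)) x (Y x) := by
  have h := dForm_apply (dFun EM f) X Y x ((smoothSectionOn_dFun hU hf).mdifferentiableAt hU hx)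
    (hX.mdifferentiableAt hU hx) (hY.mdifferentiableAt hU hx)
  rw [dForm_dFun hU hx hf] at h
  change (0 : ℝ) = _ at h
  linarith

theorem SmoothSectionOn.lieVec (hU : IsOpen U) (hX : SmoothSectionOn EM EM U X)
    (hY : SmoothSectionOn EM EM U Y) : SmoothSectionOn EM EM U (lieVec X Y) := fun y hy =>
  haveI : IsManifold 𝓘(ℝ, EM) (((⊤ : ℕ∞) : WithTop ℕ∞) + 1) M := inferInstanceAs (IsManifold _ ∞ M)
  ((hX.contMDiffAt hU hy).mlieBracket_vectorField (n := ⊤) (m := ⊤) (hY.contMDiffAt hU hy)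
    (by simp)).contMDiffWithinAt

theorem lieForm_apply (hU : IsOpen U) (hx : x ∈ U) (hX : SmoothSectionOn EM EM U X)
    (hα : SmoothSectionOn EM (EM →L[ℝ] ℝ) U α) (hW : SmoothSectionOn EM EM U W) :
    lieForm X α x (W x) = dFun EM (fun y => α y (W y)) x (X x) - α x (DiracGeometry.lieVec X W x) := by
  have h := dForm_apply α X W x (hα.mdifferentiableAt hU hx) (hX.mdifferentiableAt hU hx)
    (hW.mdifferentiableAt hU hx)
  simp only [lieForm, _root_.add_apply, h]
  ring


theorem dForm_add (hα : MDifferentiableAt 𝓘(ℝ, EM) (𝓘(ℝ, EM).prod 𝓘(ℝ, EM →L[ℝ] ℝ))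
      (fun y => TotalSpace.mk' (EM →L[ℝ] ℝ) y (α y)) x)
    (hβ : MDifferentiableAt 𝓘(ℝ, EM) (𝓘(ℝ, EM).prod 𝓘(ℝ, EM →L[ℝ] ℝ))
      (fun y => TotalSpace.mk' (EM →L[ℝ] ℝ) y (β y)) x) (u : Tan EM x) :
    dForm (fun y => α y + β y) x u = dForm α x u + dForm β x u := by
  have h : formInChart (fun y => α y + β y) x = fun e => formInChart α x e + formInChart β x e := by
    funext e
    rfl
  have hf := fderiv_fun_add (differentiableAt_formInChart α x hα)
    (differentiableAt_formInChart β x hβ)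
  ext v
  simp only [dForm, h, hf]
  exact add_sub_add_comm _ _ _ _

theorem dForm_map_add (u v : Tan EM x) : dForm α x (u + v) = dForm α x u + dForm α x v := by
  let B : EM →L[ℝ] EM →L[ℝ] ℝ := fderiv ℝ (formInChart α x) (extChartAt 𝓘(ℝ, EM) x x)
    - (fderiv ℝ (formInChart α x) (extChartAt 𝓘(ℝ, EM) x x)).flip
  let φ : Tan EM x →L[ℝ] EM := mfderiv 𝓘(ℝ, EM) 𝓘(ℝ, EM) (extChartAt 𝓘(ℝ, EM) x) x
  have e : B (φ (u + v)) = B (φ u) + B (φ v) := by rw [map_add, map_add]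
  ext w
  exact DFunLike.congr_fun e (φ w)

theorem dForm_map_smul (c : ℝ) (u : Tan EM x) : dForm α x (c • u) = c • dForm α x u := by
  let B : EM →L[ℝ] EM →L[ℝ] ℝ := fderiv ℝ (formInChart α x) (extChartAt 𝓘(ℝ, EM) x x)
    - (fderiv ℝ (formInChart α x) (extChartAt 𝓘(ℝ, EM) x x)).flip
  let φ : Tan EM x →L[ℝ] EM := mfderiv 𝓘(ℝ, EM) 𝓘(ℝ, EM) (extChartAt 𝓘(ℝ, EM) x) x
  have e : B (φ (c • u)) = c • B (φ u) := by rw [map_smul, map_smul]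
  ext w
  exact DFunLike.congr_fun e (φ w)

section Global

variable [T2Space M]

theorem dForm_smul (hU : IsOpen U) (hx : x ∈ U) {f : M → ℝ}
    (hf : ContMDiffOn 𝓘(ℝ, EM) 𝓘(ℝ, ℝ) ∞ f U) (hα : SmoothSectionOn EM (EM →L[ℝ] ℝ) U α)
    (u v : Tan EM x) :
    dForm (fun y => f y • α y) x u v
      = f x * dForm α x u v + dFun EM f x u * α x v - dFun EM f x v * α x u := by
  obtain ⟨X, hX, rfl⟩ := exists_field_eq u
  obtain ⟨Y, hY, rfl⟩ := exists_field_eq v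
  have hfα := SmoothSectionOn.smul hf hα
  have h1 := hX.mdifferentiableAt isOpen_univ (mem_univ x)
  have h2 := hY.mdifferentiableAt isOpen_univ (mem_univ x)
  have hf' := (hf.contMDiffAt (hU.mem_nhds hx)).mdifferentiableAt (by simp)
  have h3 : ∀ Z : ∀ x : M, Tan EM x, SmoothSectionOn EM EM univ Z →
      dFun EM (fun y => (f y • α y) (Z y)) x
        = f x • dFun EM (fun y => α y (Z y)) x + α x (Z x) • dFun EM f x := fun Z hZ =>
    dFun_mul hf' (((hα.apply (hZ.mono (subset_univ U))).contMDiffAt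
      (hU.mem_nhds hx)).mdifferentiableAt (by simp))
  rw [dForm_apply _ X Y x (hfα.mdifferentiableAt hU hx) h1 h2, h3 X hX, h3 Y hY,
    dForm_apply α X Y x (hα.mdifferentiableAt hU hx) h1 h2]
  simp only [_root_.add_apply, _root_.smul_apply, smul_eq_mul]
  ring

/-- `dForm` is computed in a chart that varies with the point, so smoothness cannot be read off its
definition. Testing on global fields and using the invariant formula removes the charts. -/
theorem SmoothSectionOn.dForm (hU : IsOpen U) (hα : SmoothSectionOn EM (EM →L[ℝ] ℝ) U α)
    (hX : SmoothSectionOn EM EM U X) :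
    SmoothSectionOn EM (EM →L[ℝ] ℝ) U (fun x => dForm α x (X x)) := by
  refine smoothSectionOn_form_of_apply fun W hW => ?_
  have hW' := hW.mono (subset_univ U)
  have h1 := ((smoothSectionOn_dFun hU (hα.apply hW')).apply hX).sub
    ((smoothSectionOn_dFun hU (hα.apply hX)).apply hW')
  refine (h1.sub (hα.apply (hX.lieVec hU hW'))).congr fun y hy => ?_
  exact dForm_apply α X W y (hα.mdifferentiableAt hU hy) (hX.mdifferentiableAt hU hy)
    (hW'.mdifferentiableAt hU hy)

theorem SmoothSectionOn.lieForm (hU : IsOpen U) (hX : SmoothSectionOn EM EM U X)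
    (hα : SmoothSectionOn EM (EM →L[ℝ] ℝ) U α) :
    SmoothSectionOn EM (EM →L[ℝ] ℝ) U (lieForm X α) :=
  (hα.dForm hU hX).add (smoothSectionOn_dFun hU (hα.apply hX))

/-! ### The Lie ring of vector fields -/

variable (EM M) in
/-- Smooth vector fields. -/
abbrev Fields : Type _ := Cₛ^∞⟮𝓘(ℝ, EM); EM, (TangentSpace 𝓘(ℝ, EM) : M → Type _)⟯

variable (EM M) in
/-- Smooth functions. -/
abbrev Functions : Type _ := C^∞⟮𝓘(ℝ, EM), M; 𝓘(ℝ, ℝ), ℝ⟯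

theorem Fields.smooth (X : Fields EM M) : SmoothSectionOn EM EM univ X :=
  X.contMDiff.contMDiffOn

/-- A globally smooth family of vectors as an element of `Fields EM M`. -/
def Fields.of (hX : SmoothSectionOn EM EM univ X) : Fields EM M := ⟨X, contMDiffOn_univ.1 hX⟩

instance : Bracket (Fields EM M) (Fields EM M) where
  bracket X Y := Fields.of (X.smooth.lieVec isOpen_univ Y.smooth)

instance : Bracket (Fields EM M) (Functions EM M) where
  bracket X f := ⟨fun x => dFun EM f x (X x), contMDiffOn_univ.1
    ((smoothSectionOn_dFun isOpen_univ f.contMDiff.contMDiffOn).apply X.smooth)⟩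

theorem Functions.lie_lie (X Y : Fields EM M) (f : Functions EM M) :
    ⁅⁅X, Y⁆, f⁆ = ⁅X, ⁅Y, f⁆⁆ - ⁅Y, ⁅X, f⁆⁆ := by
  ext x
  exact dFun_lieVec isOpen_univ (mem_univ x) f.contMDiff.contMDiffOn X.smooth Y.smooth

theorem Functions.lie_add (X : Fields EM M) (f g : Functions EM M) :
    ⁅X, f + g⁆ = ⁅X, f⁆ + ⁅X, g⁆ := by
  ext x
  have := dFun_add (f.mdifferentiableAt (x := x)) (g.mdifferentiableAt (x := x))
  exact DFunLike.congr_fun this (X x)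

theorem Functions.add_lie (X Y : Fields EM M) (f : Functions EM M) :
    ⁅X + Y, f⁆ = ⁅X, f⁆ + ⁅Y, f⁆ := by
  ext x
  exact map_add (dFun EM f x) (X x) (Y x)

/-- Vector fields act faithfully on global functions, so most of the Lie ring axioms become
identities between commutators of operators. -/
theorem Fields.ext_of_lie {X Y : Fields EM M} (h : ∀ f : Functions EM M, ⁅X, f⁆ = ⁅Y, f⁆) :
    X = Y := by
  ext x
  exact tan_ext fun f hf => DFunLike.congr_fun (h ⟨f, hf⟩) x

instance : LieRing (Fields EM M) where
  add_lie X Y Z := Fields.ext_of_lie fun f => by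
    simp only [Functions.lie_lie, Functions.add_lie, Functions.lie_add]
    abel
  lie_add X Y Z := Fields.ext_of_lie fun f => by
    simp only [Functions.lie_lie, Functions.add_lie, Functions.lie_add]
    abel
  lie_self X := by
    ext x
    exact congrFun VectorField.mlieBracket_self x
  leibniz_lie X Y Z := Fields.ext_of_lie fun f => by
    have hs : ∀ (V : Fields EM M) (f g : Functions EM M), ⁅V, f - g⁆ = ⁅V, f⁆ - ⁅V, g⁆ :=
      fun V f g => by
        rw [eq_sub_iff_add_eq, ← Functions.lie_add, sub_add_cancel]
    simp only [Functions.lie_lie, Functions.add_lie, hs]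
    abel

instance : LieRingModule (Fields EM M) (Functions EM M) where
  add_lie := Functions.add_lie
  lie_add := Functions.lie_add
  leibniz_lie X Y f := by
    rw [Functions.lie_lie, sub_add_cancel]

/-- A smooth one-form as an additive map from fields to functions. -/
def formHom (hα : SmoothSectionOn EM (EM →L[ℝ] ℝ) univ α) : Fields EM M →+ Functions EM M where
  toFun X := ⟨fun x => α x (X x), contMDiffOn_univ.1 (hα.apply X.smooth)⟩
  map_zero' := by
    ext x
    exact map_zero (α x)
  map_add' X Y := by
    ext x
    exact map_add (α x) _ _

end Global

end Cartan

/-! ### The Dorfman bracket -/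

section Dorfman

/-- The pairing of the cotangent part of `(X + α) ∘ (Y + β)` with `W`, in abstract form. -/
def dorfmanPairing {V R : Type*} [LieRing V] [AddCommGroup R] [LieRingModule V R]
    (X : V) (α : V → R) (Y : V) (β : V → R) (W : V) : R :=
  ⁅X, β W⁆ - β ⁅X, W⁆ - (⁅Y, α W⁆ - ⁅W, α Y⁆ - α ⁅Y, W⁆)

/-- Only the axioms of a module over a Lie ring and the additivity of the forms are used: after
expansion all terms cancel. Linearity over functions plays no role. -/
theorem dorfmanPairing_leibniz {V R : Type*} [LieRing V] [AddCommGroup R] [LieRingModule V R]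
    (X Y Z : V) (α β γ : V →+ R) (W : V) :
    dorfmanPairing X α ⁅Y, Z⁆ (dorfmanPairing Y β Z γ) W
      = dorfmanPairing ⁅X, Y⁆ (dorfmanPairing X α Y β) Z γ W
        + dorfmanPairing Y β ⁅X, Z⁆ (dorfmanPairing X α Z γ) W := by
  simp only [dorfmanPairing, lie_sub, lie_lie, map_sub]
  abel

variable [FiniteDimensional ℝ EM] [T2Space M] {U : Set M} {x : M}

/-- The Dorfman bracket on sections `X + α` of `TM ⊕ T*M`. -/
def dorfman (σ τ : ∀ x : M, GenTan EM x) (x : M) : GenTan EM x :=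
  (lieVec (fun y => (σ y).1) (fun y => (τ y).1) x,
    lieForm (fun y => (σ y).1) (fun y => (τ y).2) x - dForm (fun y => (σ y).2) x (τ x).1)


variable {σ τ υ σ' τ' υ' : ∀ x : M, GenTan EM x}

theorem SmoothSectionOn.fst (h : SmoothSectionOn EM (GenModel EM) U σ) :
    SmoothSectionOn EM EM U (fun x => (σ x).1) := (smoothSectionOn_gen_iff.1 h).1

theorem SmoothSectionOn.snd (h : SmoothSectionOn EM (GenModel EM) U σ) :
    SmoothSectionOn EM (EM →L[ℝ] ℝ) U (fun x => (σ x).2) := (smoothSectionOn_gen_iff.1 h).2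

theorem SmoothSectionOn.dorfman (hU : IsOpen U) (hσ : SmoothSectionOn EM (GenModel EM) U σ)
    (hτ : SmoothSectionOn EM (GenModel EM) U τ) :
    SmoothSectionOn EM (GenModel EM) U (dorfman σ τ) :=
  smoothSectionOn_gen_iff.2 ⟨hσ.fst.lieVec hU hτ.fst,
    (hσ.fst.lieForm hU hτ.snd).sub (hσ.snd.dForm hU hτ.fst)⟩

theorem dorfman_congr (h : ∀ᶠ y in 𝓝 x, σ y = σ' y) (h' : ∀ᶠ y in 𝓝 x, τ y = τ' y) :
    DiracGeometry.dorfman σ τ x = DiracGeometry.dorfman σ' τ' x := by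
  have h1 := h.mono fun y hy => congrArg Prod.fst hy
  have h2 := h.mono fun y hy => congrArg Prod.snd hy
  have h1' := h'.mono fun y hy => congrArg Prod.fst hy
  have h2' := h'.mono fun y hy => congrArg Prod.snd hy
  unfold DiracGeometry.dorfman
  rw [lieVec_congr h1 h1', lieForm_congr h1 h2', dForm_congr h2, h1'.self_of_nhds]

/-- The invariant formulas for `lieForm` and `dForm` turn the Dorfman bracket, evaluated on a field,
into the abstract expression to which `dorfmanPairing_leibniz` applies. -/
theorem dorfman_snd_apply (hσ : SmoothSectionOn EM (GenModel EM) univ σ)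
    (hτ : SmoothSectionOn EM (GenModel EM) univ τ) (W : Fields EM M) (x : M) :
    (DiracGeometry.dorfman σ τ x).2 (W x) = dorfmanPairing (Fields.of hσ.fst) (formHom hσ.snd)
      (Fields.of hτ.fst) (formHom hτ.snd) W x := by
  have h1 := lieForm_apply isOpen_univ (mem_univ x) hσ.fst hτ.snd W.smooth
  have h2 := dForm_apply (fun y => (σ y).2) (fun y => (τ y).1) W x
    (hσ.snd.mdifferentiableAt isOpen_univ (mem_univ x))
    (hτ.fst.mdifferentiableAt isOpen_univ (mem_univ x))
    (W.smooth.mdifferentiableAt isOpen_univ (mem_univ x))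
  change lieForm (fun y => (σ y).1) (fun y => (τ y).2) x (W x)
    - DiracGeometry.dForm (fun y => (σ y).2) x (τ x).1 (W x) = _
  rw [h1, h2]
  rfl

theorem formHom_dorfman (hσ : SmoothSectionOn EM (GenModel EM) univ σ)
    (hτ : SmoothSectionOn EM (GenModel EM) univ τ) :
    ⇑(formHom (hσ.dorfman isOpen_univ hτ).snd) = dorfmanPairing (Fields.of hσ.fst)
      (formHom hσ.snd) (Fields.of hτ.fst) (formHom hτ.snd) := by
  ext W x
  exact dorfman_snd_apply hσ hτ W x

/-- The Jacobi identity for the Dorfman bracket. -/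
theorem dorfman_leibniz (hU : IsOpen U) (hx : x ∈ U) (hσ : SmoothSectionOn EM (GenModel EM) U σ)
    (hτ : SmoothSectionOn EM (GenModel EM) U τ) (hυ : SmoothSectionOn EM (GenModel EM) U υ) :
    DiracGeometry.dorfman σ (DiracGeometry.dorfman τ υ) x
      = DiracGeometry.dorfman (DiracGeometry.dorfman σ τ) υ x
        + DiracGeometry.dorfman τ (DiracGeometry.dorfman σ υ) x := by
  -- The algebraic identity lives in the Lie ring of global fields. The bracket depends only on
  -- germs, so the sections may be replaced by global ones that agree with them near `x`.
  obtain ⟨σ', gσ, eσ⟩ := hσ.exists_global hU hx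
  obtain ⟨τ', gτ, eτ⟩ := hτ.exists_global hU hx
  obtain ⟨υ', gυ, eυ⟩ := hυ.exists_global hU hx
  have key : ∀ {a b c d : ∀ x : M, GenTan EM x}, (∀ᶠ y in 𝓝 x, a y = b y) →
      (∀ᶠ y in 𝓝 x, c y = d y) →
      ∀ᶠ y in 𝓝 x, DiracGeometry.dorfman a c y = DiracGeometry.dorfman b d y := fun h h' => by
    filter_upwards [eventually_eventually_nhds.2 h, eventually_eventually_nhds.2 h'] with y hy hy'
    exact dorfman_congr hy hy'
  rw [← dorfman_congr eσ (key eτ eυ), ← dorfman_congr (key eσ eτ) eυ,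
    ← dorfman_congr eτ (key eσ eυ)]
  have o := isOpen_univ (X := M)
  have hj := leibniz_lie (Fields.of gσ.fst) (Fields.of gτ.fst) (Fields.of gυ.fst)
  refine Prod.ext (DFunLike.congr_fun hj x) ?_
  ext v
  obtain ⟨W, hW, rfl⟩ := exists_field_eq v
  have e1 := dorfman_snd_apply gσ (gτ.dorfman o gυ) (Fields.of hW) x
  have e2 := dorfman_snd_apply (gσ.dorfman o gτ) gυ (Fields.of hW) x
  have e3 := dorfman_snd_apply gτ (gσ.dorfman o gυ) (Fields.of hW) x
  rw [formHom_dorfman gτ gυ] at e1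
  rw [formHom_dorfman gσ gτ] at e2
  rw [formHom_dorfman gσ gυ] at e3
  have := DFunLike.congr_fun (dorfmanPairing_leibniz (Fields.of gσ.fst) (Fields.of gτ.fst)
    (Fields.of gυ.fst) (formHom gσ.snd) (formHom gτ.snd) (formHom gυ.snd) (Fields.of hW)) x
  exact e1.trans (this.trans (congrArg₂ (· + ·) e2 e3).symm)

/-- On an isotropic pair of sections the Courant and Dorfman brackets agree. -/
theorem courantBracket_eq_dorfman (hU : IsOpen U) (hx : x ∈ U)
    (hσ : SmoothSectionOn EM (GenModel EM) U σ) (hτ : SmoothSectionOn EM (GenModel EM) U τ)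
    (h : ∀ y ∈ U, pairing y (σ y) (τ y) = 0) :
    courantBracket σ τ x = DiracGeometry.dorfman σ τ x := by
  -- Isotropy gives β(X) = -α(Y), so the symmetric term of the Courant bracket is d(α(Y)). It
  -- cancels the exact part of -L_Y α and leaves -i_Y dα.
  have h1 : (fun y => (τ y).2 (σ y).1) =ᶠ[𝓝 x] fun y => - (σ y).2 (τ y).1 := by
    filter_upwards [hU.mem_nhds hx] with y hy
    have := h y hy
    simp only [pairing] at this
    linarith
  have h2 : (fun y => (σ y).2 (τ y).1 - (τ y).2 (σ y).1) =ᶠ[𝓝 x] fun y => 2 * (σ y).2 (τ y).1 := by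
    filter_upwards [h1] with y hy
    rw [hy]
    ring
  have hd := ((hσ.snd.apply hτ.fst).contMDiffAt (hU.mem_nhds hx)).mdifferentiableAt (by simp)
  refine Prod.ext rfl ?_
  simp only [courantBracket, DiracGeometry.dorfman, DiracGeometry.lieForm]
  rw [dFun_congr h2, dFun_congr h1, dFun_neg, dFun_const_mul _ hd]
  module

/-- In the second argument no isotropy is needed: the term -β(X) df coming from i_X d(fβ) cancels
the one in d(f β(X)). -/
theorem dorfman_smul_right (hU : IsOpen U) (hx : x ∈ U)
    (hσ : SmoothSectionOn EM (GenModel EM) U σ) (hτ : SmoothSectionOn EM (GenModel EM) U τ)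
    {f : M → ℝ} (hf : ContMDiffOn 𝓘(ℝ, EM) 𝓘(ℝ, ℝ) ∞ f U) :
    DiracGeometry.dorfman σ (fun y => f y • τ y) x
      = f x • DiracGeometry.dorfman σ τ x + dFun EM f x (σ x).1 • τ x := by
  have hf' := (hf.contMDiffAt (hU.mem_nhds hx)).mdifferentiableAt (by simp)
  have h1 : lieVec (fun y => (σ y).1) (fun y => f y • (τ y).1) x
      = dFun EM f x (σ x).1 • (τ x).1 + f x • lieVec (fun y => (σ y).1) (fun y => (τ y).1) x :=
    VectorField.mlieBracket_smul_right hf' (hτ.fst.mdifferentiableAt hU hx)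
  refine Prod.ext (h1.trans (add_comm _ _)) ?_
  ext v
  have hd := ((hτ.snd.apply hσ.fst).contMDiffAt (hU.mem_nhds hx)).mdifferentiableAt (by simp)
  have h2 := dForm_smul hU hx hf hτ.snd (σ x).1 v
  have h3 : dFun EM (fun y => f y * (τ y).2 (σ y).1) x
      = f x • dFun EM (fun y => (τ y).2 (σ y).1) x + (τ x).2 (σ x).1 • dFun EM f x :=
    dFun_mul hf' hd
  simp only [DiracGeometry.dorfman, DiracGeometry.lieForm, Prod.smul_snd, Prod.smul_fst,
    Prod.snd_add, _root_.add_apply, _root_.sub_apply, _root_.smul_apply,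
    dForm_map_smul, smul_eq_mul, h2, h3]
  ring

theorem dorfman_add_right (hU : IsOpen U) (hx : x ∈ U)
    (hτ : SmoothSectionOn EM (GenModel EM) U τ) (hσ : SmoothSectionOn EM (GenModel EM) U σ)
    (hυ : SmoothSectionOn EM (GenModel EM) U υ) :
    DiracGeometry.dorfman σ (fun y => τ y + υ y) x
      = DiracGeometry.dorfman σ τ x + DiracGeometry.dorfman σ υ x := by
  have h1 : lieVec (fun y => (σ y).1) (fun y => (τ y).1 + (υ y).1) x
      = lieVec (fun y => (σ y).1) (fun y => (τ y).1) x
        + lieVec (fun y => (σ y).1) (fun y => (υ y).1) x :=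
    VectorField.mlieBracket_add_right (hτ.fst.mdifferentiableAt hU hx)
      (hυ.fst.mdifferentiableAt hU hx)
  refine Prod.ext h1 ?_
  have h2 := dForm_add (hτ.snd.mdifferentiableAt hU hx) (hυ.snd.mdifferentiableAt hU hx) (σ x).1
  have h3 : dFun EM (fun y => ((τ y).2 + (υ y).2) (σ y).1) x
      = dFun EM (fun y => (τ y).2 (σ y).1) x + dFun EM (fun y => (υ y).2 (σ y).1) x :=
    dFun_add (((hτ.snd.apply hσ.fst).contMDiffAt (hU.mem_nhds hx)).mdifferentiableAt (by simp))
      (((hυ.snd.apply hσ.fst).contMDiffAt (hU.mem_nhds hx)).mdifferentiableAt (by simp))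
  simp only [DiracGeometry.dorfman, DiracGeometry.lieForm, Prod.snd_add, Prod.fst_add, dForm_map_add]
  rw [h2, h3]
  abel

end Dorfman

/-! ### The cotangent bracket of a Poisson structure -/

section Tensorial

variable [FiniteDimensional ℝ EM] [T2Space M]

/-- A local operation on one-forms that is linear over functions depends on values only. -/
theorem eq_of_tensorial {x : M} (Φ : (∀ x : M, Cot EM x) → ℝ)
    (hadd : ∀ α β, SmoothSectionOn EM (EM →L[ℝ] ℝ) univ α →
      SmoothSectionOn EM (EM →L[ℝ] ℝ) univ β → Φ (fun y => α y + β y) = Φ α + Φ β)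
    (hsmul : ∀ (f : M → ℝ) α, ContMDiff 𝓘(ℝ, EM) 𝓘(ℝ, ℝ) ∞ f →
      SmoothSectionOn EM (EM →L[ℝ] ℝ) univ α → Φ (fun y => f y • α y) = f x * Φ α)
    (hloc : ∀ α β, (∀ᶠ y in 𝓝 x, α y = β y) → Φ α = Φ β)
    {α β : ∀ x : M, Cot EM x} (hα : SmoothSectionOn EM (EM →L[ℝ] ℝ) univ α)
    (hβ : SmoothSectionOn EM (EM →L[ℝ] ℝ) univ β) (h : α x = β x) : Φ α = Φ β := by
  obtain ⟨f, W, V, hf, hW, hV, hxV, -, -, he⟩ := exists_coordinates_expand (EM := EM) x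
  have hdf : ∀ i, SmoothSectionOn EM (EM →L[ℝ] ℝ) univ (dFun EM (f i)) := fun i =>
    smoothSectionOn_dFun isOpen_univ (hf i).contMDiffOn
  -- The coordinate expansion is a global smooth form that agrees with `γ` only on `V`. Locality of
  -- `Φ` makes this enough.
  have key : ∀ γ : ∀ x : M, Cot EM x, SmoothSectionOn EM (EM →L[ℝ] ℝ) univ γ →
      Φ γ = ∑ i, γ x (W i x) * Φ (dFun EM (f i)) := fun γ hγ => by
    have h0 : Φ (fun _ => 0) = 0 := by
      have := hsmul (fun _ => 0) (fun _ => 0) contMDiff_const smoothSectionOn_zero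
      simpa using this
    have hsum : ∀ s : Finset (Fin (Module.finrank ℝ EM)),
        Φ (fun y => ∑ i ∈ s, γ y (W i y) • dFun EM (f i) y)
          = ∑ i ∈ s, γ x (W i x) * Φ (dFun EM (f i)) := fun s => by
      classical
      induction s using Finset.induction_on with
      | empty => simpa using h0
      | insert a s ha ih =>
        simp only [Finset.sum_insert ha]
        rw [hadd _ _ (SmoothSectionOn.smul (hγ.apply (hW a)) (hdf a))
          (SmoothSectionOn.sum fun i _ => SmoothSectionOn.smul (hγ.apply (hW i)) (hdf i)), ih,
          hsmul (fun y => γ y (W a y)) _ (contMDiffOn_univ.1 (hγ.apply (hW a))) (hdf a)]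
    rw [← hsum, hloc]
    filter_upwards [hV.mem_nhds hxV] with y hy
    exact he y hy (γ y)
  rw [key α hα, key β hβ, h]

end Tensorial

namespace PoissonStructure

variable [FiniteDimensional ℝ EM] [T2Space M] (P : PoissonStructure EM M) {U : Set M} {x : M}
  {α β : ∀ x : M, Cot EM x}

theorem smooth_sharpField (hU : IsOpen U) (hα : SmoothSectionOn EM (EM →L[ℝ] ℝ) U α) :
    SmoothSectionOn EM EM U (P.sharpField α) := P.smooth U hU α hα

theorem sharpField_congr (h : ∀ᶠ y in 𝓝 x, α y = β y) :
    ∀ᶠ y in 𝓝 x, P.sharpField α y = P.sharpField β y :=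
  h.mono fun y hy => by simp only [sharpField, hy]

/-- The trivector `[π, π]`, evaluated on two one-forms and the differential with Hamiltonian
field `Z`. -/
def schouten (Z : ∀ x : M, Tan EM x) (x : M) (α β : ∀ x : M, Cot EM x) : ℝ :=
  β x (lieVec (P.sharpField α) Z x) - α x (lieVec (P.sharpField β) Z x)
    + dFun EM (fun y => β y (P.sharpField α y)) x (Z x)

/-- This transfers tensoriality from the first form to the second. -/
theorem schouten_swap (Z : ∀ x : M, Tan EM x) : P.schouten Z x β α = - P.schouten Z x α β := by
  have h : (fun y => α y (P.sharpField β y)) = fun y => - β y (P.sharpField α y) :=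
    funext fun y => P.skew y _ _
  simp only [schouten, h, dFun_neg, _root_.neg_apply]
  ring

theorem schouten_congr {Z : ∀ x : M, Tan EM x} {α' β' : ∀ x : M, Cot EM x}
    (h : ∀ᶠ y in 𝓝 x, α y = α' y) (h' : ∀ᶠ y in 𝓝 x, β y = β' y) :
    P.schouten Z x α β = P.schouten Z x α' β' := by
  have h1 := P.sharpField_congr h
  have h2 := P.sharpField_congr h'
  have h3 : (fun y => β y (P.sharpField α y)) =ᶠ[𝓝 x] fun y => β' y (P.sharpField α' y) := by
    filter_upwards [h1, h'] with y hy hy'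
    rw [hy, hy']
  have hZ : ∀ᶠ y in 𝓝 x, Z y = Z y := Filter.Eventually.of_forall fun _ => rfl
  rw [schouten, schouten, lieVec_congr h1 hZ, lieVec_congr h2 hZ, dFun_congr h3, h.self_of_nhds,
    h'.self_of_nhds]

/-- The derivative of a coefficient f along `Z` enters twice, through the bracket [f π♯α, Z] and
through the derivative of β(f π♯α). The two contributions cancel, so the expression is tensorial in
the first form. -/
theorem schouten_eq_of_eq (Z : ∀ x : M, Tan EM x)
    {α' : ∀ x : M, Cot EM x} (hα : SmoothSectionOn EM (EM →L[ℝ] ℝ) univ α)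
    (hα' : SmoothSectionOn EM (EM →L[ℝ] ℝ) univ α')
    (hβ : SmoothSectionOn EM (EM →L[ℝ] ℝ) univ β) (h : α x = α' x) :
    P.schouten Z x α β = P.schouten Z x α' β := by
  have o := isOpen_univ (X := M)
  have hx := mem_univ x
  have hd : ∀ {α β : ∀ x : M, Cot EM x}, SmoothSectionOn EM (EM →L[ℝ] ℝ) univ α →
      SmoothSectionOn EM (EM →L[ℝ] ℝ) univ β →
      MDifferentiableAt 𝓘(ℝ, EM) 𝓘(ℝ, ℝ) (fun y => β y (P.sharpField α y)) x := fun hα hβ =>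
    ((hβ.apply (P.smooth_sharpField o hα)).contMDiffAt (o.mem_nhds hx)).mdifferentiableAt (by simp)
  refine eq_of_tensorial (fun α => P.schouten Z x α β) (fun α γ hα hγ => ?_)
    (fun f α hf hα => ?_) (fun α γ h => P.schouten_congr h (.of_forall fun _ => rfl)) hα hα' h
  · have h1 : P.sharpField (fun y => α y + γ y) = P.sharpField α + P.sharpField γ :=
      funext fun y => map_add (P.sharp y) _ _
    have h2 : lieVec (P.sharpField α + P.sharpField γ) Z x
        = lieVec (P.sharpField α) Z x + lieVec (P.sharpField γ) Z x :=
      VectorField.mlieBracket_add_left ((P.smooth_sharpField o hα).mdifferentiableAt o hx)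
      ((P.smooth_sharpField o hγ).mdifferentiableAt o hx)
    have h3 : dFun EM (fun y => β y ((P.sharpField α + P.sharpField γ) y)) x
        = dFun EM (fun y => β y (P.sharpField α y)) x
          + dFun EM (fun y => β y (P.sharpField γ y)) x := by
      have := dFun_add (hd hα hβ) (hd hγ hβ)
      simp only [Pi.add_apply, map_add]
      exact this
    simp only [schouten]
    rw [h1, h2, h3]
    simp only [map_add, _root_.add_apply]
    ring
  · have h1 : P.sharpField (fun y => f y • α y) = f • P.sharpField α :=
      funext fun y => map_smul (P.sharp y) _ _
    have h2 : lieVec (f • P.sharpField α) Z x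
        = -(dFun EM f x (Z x)) • P.sharpField α x + f x • lieVec (P.sharpField α) Z x :=
      VectorField.mlieBracket_smul_left (hf.mdifferentiable (by simp) x)
      ((P.smooth_sharpField o hα).mdifferentiableAt o hx)
    have h3 : dFun EM (fun y => β y ((f • P.sharpField α) y)) x
        = f x • dFun EM (fun y => β y (P.sharpField α y)) x
          + β x (P.sharpField α x) • dFun EM f x := by
      have := dFun_mul (hf.mdifferentiable (by simp) x) (hd hα hβ)
      simp only [Pi.smul_apply', map_smul, smul_eq_mul]
      exact this
    have h4 : α x (P.sharpField β x) = - β x (P.sharpField α x) := P.skew x _ _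
    simp only [schouten]
    rw [h1, h2, h3]
    simp only [map_add, map_smul, _root_.add_apply, _root_.smul_apply, smul_eq_mul]
    ring

end PoissonStructure

namespace PoissonStructure

variable [FiniteDimensional ℝ EM] [T2Space M] (P : PoissonStructure EM M) {U : Set M} {x : M}
  {α β : ∀ x : M, Cot EM x}

/-- By tensoriality both forms may be replaced by exact ones df and dg with the same values at `x`.
For three Hamiltonian fields the expression is a form of the Jacobi identity of f, g and `h`. -/
theorem schouten_eq_zero {h : M → ℝ} (hh : ContMDiff 𝓘(ℝ, EM) 𝓘(ℝ, ℝ) ∞ h)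
    (hα : SmoothSectionOn EM (EM →L[ℝ] ℝ) univ α) (hβ : SmoothSectionOn EM (EM →L[ℝ] ℝ) univ β) :
    P.schouten (P.sharpField (dFun EM h)) x α β = 0 := by
  have o := isOpen_univ (X := M)
  have hx := mem_univ x
  have hd : ∀ {f : M → ℝ}, ContMDiff 𝓘(ℝ, EM) 𝓘(ℝ, ℝ) ∞ f →
      SmoothSectionOn EM (EM →L[ℝ] ℝ) univ (dFun EM f) := fun hf =>
    smoothSectionOn_dFun o hf.contMDiffOn
  obtain ⟨f, hf, hfx⟩ := exists_fun_dFun_eq (α x)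
  obtain ⟨g, hg, hgx⟩ := exists_fun_dFun_eq (β x)
  have hZ := P.smooth_sharpField o (hd hh)
  have hA := P.smooth_sharpField o (hd hf)
  have hB := P.smooth_sharpField o (hd hg)
  rw [P.schouten_eq_of_eq _ hα (hd hf) hβ hfx.symm, schouten_swap,
    P.schouten_eq_of_eq _ hβ (hd hg) (hd hf) hgx.symm, schouten_swap, neg_neg, schouten,
    dFun_lieVec o hx hg.contMDiffOn hA hZ, dFun_lieVec o hx hf.contMDiffOn hB hZ]
  have hs : ∀ a b : M → ℝ, (fun y => dFun EM a y (P.sharpField (dFun EM b) y))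
      = fun y => - dFun EM b y (P.sharpField (dFun EM a) y) := fun a b => funext fun y => P.skew y _ _
  have hj := P.jacobi f g h hf hg hh x
  change dFun EM (fun y => dFun EM h y (P.sharpField (dFun EM g) y)) x (P.sharpField (dFun EM f) x)
    + dFun EM (fun y => dFun EM f y (P.sharpField (dFun EM h) y)) x (P.sharpField (dFun EM g) x)
    + dFun EM (fun y => dFun EM g y (P.sharpField (dFun EM f) y)) x (P.sharpField (dFun EM h) x)
    = 0 at hj
  rw [hs g h, hs f g]
  simp only [dFun_neg, _root_.neg_apply]
  linarith

theorem formBracket_congr {α' β' : ∀ x : M, Cot EM x} (h : ∀ᶠ y in 𝓝 x, α y = α' y)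
    (h' : ∀ᶠ y in 𝓝 x, β y = β' y) : P.formBracket α β x = P.formBracket α' β' x := by
  have h3 : (fun y => P.bivector y (α y) (β y)) =ᶠ[𝓝 x] fun y => P.bivector y (α' y) (β' y) := by
    filter_upwards [h, h'] with y hy hy'
    rw [hy, hy']
  rw [formBracket, formBracket, lieForm_congr (P.sharpField_congr h) h',
    lieForm_congr (P.sharpField_congr h') h, dFun_congr h3]

/-- Both sides are paired with the differential of a function `h`. Moving the sharp map across by
skewness leaves `schouten` along the Hamiltonian field of `h`, which vanishes. This is how the
Jacobi identity of `P` enters the comparison of brackets. -/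
theorem sharp_formBracket (hU : IsOpen U) (hx : x ∈ U)
    (hα : SmoothSectionOn EM (EM →L[ℝ] ℝ) U α) (hβ : SmoothSectionOn EM (EM →L[ℝ] ℝ) U β) :
    P.sharp x (P.formBracket α β x) = lieVec (P.sharpField α) (P.sharpField β) x := by
  obtain ⟨α', hα', hαe⟩ := hα.exists_global hU hx
  obtain ⟨β', hβ', hβe⟩ := hβ.exists_global hU hx
  rw [← P.formBracket_congr hαe hβe,
    ← lieVec_congr (P.sharpField_congr hαe) (P.sharpField_congr hβe)]
  have o := isOpen_univ (X := M)
  have hx := mem_univ x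
  refine tan_ext fun h hh => ?_
  have hdh : SmoothSectionOn EM (EM →L[ℝ] ℝ) univ (dFun EM h) :=
    smoothSectionOn_dFun o hh.contMDiffOn
  have hZ := P.smooth_sharpField o hdh
  have hA := P.smooth_sharpField o hα'
  have hB := P.smooth_sharpField o hβ'
  have hs := P.schouten_eq_zero (x := x) hh hα' hβ'
  rw [schouten] at hs
  have hk : ∀ γ : ∀ x : M, Cot EM x, (fun y => dFun EM h y (P.sharpField γ y))
      = fun y => - γ y (P.sharpField (dFun EM h) y) := fun γ => funext fun y => P.skew y _ _
  have h1 := P.skew x (P.formBracket α' β' x) (dFun EM h x)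
  have h2 : P.formBracket α' β' x (P.sharpField (dFun EM h) x)
      = lieForm (P.sharpField α') β' x (P.sharpField (dFun EM h) x)
        - lieForm (P.sharpField β') α' x (P.sharpField (dFun EM h) x)
        - dFun EM (fun y => β' y (P.sharpField α' y)) x (P.sharpField (dFun EM h) x) := rfl
  rw [dFun_lieVec o hx hh.contMDiffOn hA hB, hk, hk, dFun_neg, dFun_neg, h1]
  change - P.formBracket α' β' x (P.sharpField (dFun EM h) x) = _
  rw [h2, lieForm_apply o hx hA hβ' hZ, lieForm_apply o hx hB hα' hZ]
  simp only [_root_.neg_apply]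
  linarith

end PoissonStructure

/-! ### The shift intertwines the Courant brackets -/

section Shift

variable [FiniteDimensional ℝ EM] (P : PoissonStructure EM M) {U : Set M} {x : M}
  {σ τ : ∀ x : M, GenTan EM x}

theorem shift_apply (u : GenTan EM x) : shift P x u = (u.1 + P.sharp x u.2, u.2) := rfl

theorem smooth_shift_iff (hU : IsOpen U) :
    SmoothSectionOn EM (GenModel EM) U (fun x => shift P x (σ x)) ↔
      SmoothSectionOn EM (GenModel EM) U σ := by
  rw [smoothSectionOn_gen_iff, smoothSectionOn_gen_iff]
  simp only [shift_apply]
  refine ⟨fun h => ⟨?_, h.2⟩, fun h => ⟨h.1.add (P.smooth U hU _ h.2), h.2⟩⟩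
  exact (h.1.sub (P.smooth U hU _ h.2)).congr fun y _ => (add_sub_cancel_right _ _).symm

theorem lieForm_add_left {X Y : ∀ x : M, Tan EM x} {β : ∀ x : M, Cot EM x} (hU : IsOpen U)
    (hx : x ∈ U) (hX : SmoothSectionOn EM EM U X) (hY : SmoothSectionOn EM EM U Y)
    (hβ : SmoothSectionOn EM (EM →L[ℝ] ℝ) U β) :
    lieForm (fun y => X y + Y y) β x = lieForm X β x + lieForm Y β x := by
  have hd : ∀ {X : ∀ x : M, Tan EM x}, SmoothSectionOn EM EM U X →
      MDifferentiableAt 𝓘(ℝ, EM) 𝓘(ℝ, ℝ) (fun y => β y (X y)) x := fun hX =>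
    ((hβ.apply hX).contMDiffAt (hU.mem_nhds hx)).mdifferentiableAt (by simp)
  have := dFun_add (hd hX) (hd hY)
  simp only [lieForm, dForm_map_add, map_add, this]
  abel

theorem lieVec_add_add {X Y A B : ∀ x : M, Tan EM x} (hU : IsOpen U) (hx : x ∈ U)
    (hX : SmoothSectionOn EM EM U X) (hY : SmoothSectionOn EM EM U Y)
    (hA : SmoothSectionOn EM EM U A) (hB : SmoothSectionOn EM EM U B) :
    lieVec (fun y => X y + A y) (fun y => Y y + B y) x
      = lieVec X Y x + lieVec X B x + lieVec A Y x + lieVec A B x := by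
  have h1 : lieVec (fun y => X y + A y) (fun y => Y y + B y) x
      = lieVec (fun y => X y + A y) Y x + lieVec (fun y => X y + A y) B x :=
    VectorField.mlieBracket_add_right (hY.mdifferentiableAt hU hx) (hB.mdifferentiableAt hU hx)
  have h2 : ∀ Y : ∀ x : M, Tan EM x, lieVec (fun y => X y + A y) Y x
      = lieVec X Y x + lieVec A Y x := fun Y =>
    VectorField.mlieBracket_add_left (hX.mdifferentiableAt hU hx) (hA.mdifferentiableAt hU hx)
  rw [h1, h2, h2]
  abel

/-- After bilinear expansion, the terms of π♯ applied to the form part cancel the exterior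
derivative terms of `lieDual` and the term `dPi`. What remains in the vector part is
`sharp_formBracket`. Isotropy is not needed. -/
theorem shift_courantBracketPoisson [T2Space M] (hU : IsOpen U) (hx : x ∈ U)
    (hσ : SmoothSectionOn EM (GenModel EM) U σ) (hτ : SmoothSectionOn EM (GenModel EM) U τ) :
    shift P x (courantBracketPoisson P σ τ x)
      = courantBracket (fun y => shift P y (σ y)) (fun y => shift P y (τ y)) x := by
  obtain ⟨X, hX⟩ : ∃ X : ∀ x : M, Tan EM x, X = fun y => (σ y).1 := ⟨_, rfl⟩
  obtain ⟨α, hα⟩ : ∃ α : ∀ x : M, Cot EM x, α = fun y => (σ y).2 := ⟨_, rfl⟩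
  obtain ⟨Y, hY⟩ : ∃ Y : ∀ x : M, Tan EM x, Y = fun y => (τ y).1 := ⟨_, rfl⟩
  obtain ⟨β, hβ⟩ : ∃ β : ∀ x : M, Cot EM x, β = fun y => (τ y).2 := ⟨_, rfl⟩
  obtain rfl : σ = fun y => (X y, α y) := by subst hX hα; rfl
  obtain rfl : τ = fun y => (Y y, β y) := by subst hY hβ; rfl
  have sX : SmoothSectionOn EM EM U X := hσ.fst
  have sα : SmoothSectionOn EM (EM →L[ℝ] ℝ) U α := hσ.snd
  have sY : SmoothSectionOn EM EM U Y := hτ.fst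
  have sβ : SmoothSectionOn EM (EM →L[ℝ] ℝ) U β := hτ.snd
  have sA := P.smooth_sharpField hU sα
  have sB := P.smooth_sharpField hU sβ
  have hd : ∀ {β : ∀ x : M, Cot EM x} {X : ∀ x : M, Tan EM x},
      SmoothSectionOn EM (EM →L[ℝ] ℝ) U β → SmoothSectionOn EM EM U X →
      MDifferentiableAt 𝓘(ℝ, EM) 𝓘(ℝ, ℝ) (fun y => β y (X y)) x := fun hβ hX =>
    ((hβ.apply hX).contMDiffAt (hU.mem_nhds hx)).mdifferentiableAt (by simp)
  have e1 : lieVec (fun y => X y + P.sharpField α y) (fun y => Y y + P.sharpField β y) x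
      = lieVec X Y x + lieVec X (P.sharpField β) x + lieVec (P.sharpField α) Y x
        + lieVec (P.sharpField α) (P.sharpField β) x := lieVec_add_add hU hx sX sY sA sB
  have e2 : lieForm (fun y => X y + P.sharpField α y) β x
      = lieForm X β x + lieForm (P.sharpField α) β x := lieForm_add_left hU hx sX sA sβ
  have e3 : lieForm (fun y => Y y + P.sharpField β y) α x
      = lieForm Y α x + lieForm (P.sharpField β) α x := lieForm_add_left hU hx sY sB sα
  -- The shift changes α(Y) - β(X) by α(π♯β) - β(π♯α) = -2π(α, β). With the factor one half this is
  -- the term -dπ(α, β) of the bracket of forms.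
  have e4 : dFun EM (fun y => α y (Y y + P.sharpField β y) - β y (X y + P.sharpField α y)) x
      = dFun EM (fun y => α y (Y y) - β y (X y)) x
        - (2 : ℝ) • dFun EM (fun y => P.bivector y (α y) (β y)) x := by
    have h1 : (fun y => α y (Y y + P.sharpField β y) - β y (X y + P.sharpField α y))
        = fun y => (α y (Y y) - β y (X y)) - 2 * P.bivector y (α y) (β y) := funext fun y => by
      have h2 : α y (P.sharpField β y) = - P.bivector y (α y) (β y) := P.skew y _ _
      have h3 : β y (P.sharpField α y) = P.bivector y (α y) (β y) := rfl
      rw [map_add, map_add, h2, h3]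
      ring
    have h2 := dFun_sub (f := fun y => α y (Y y) - β y (X y))
      (g := fun y => 2 * P.bivector y (α y) (β y)) ((hd sα sY).sub (hd sβ sX))
      (mdifferentiableAt_const.mul (hd sβ sA))
    have h3 := dFun_const_mul (f := fun y => P.bivector y (α y) (β y)) 2 (hd sβ sA)
    rw [h1, h2, h3]
  have e5 := dFun_sub (hd sα sY) (hd sβ sX)
  have e6 := P.sharp_formBracket hU hx sα sβ
  have e7 : lieVec X (P.sharpField β) x = - lieVec (P.sharpField β) X x :=
    VectorField.mlieBracket_swap_apply
  refine Prod.ext ?_ ?_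
  · change (lieVec X Y x + (lieVec (P.sharpField α) Y x + P.sharp x (dForm α x (Y x)))
        - (lieVec (P.sharpField β) X x + P.sharp x (dForm β x (X x)))
        - (1 / 2 : ℝ) • (- P.sharp x (dFun EM (fun y => α y (Y y) - β y (X y)) x)))
        + P.sharp x (P.formBracket α β x + (dForm β x (X x) + dFun EM (fun y => β y (X y)) x)
          - (dForm α x (Y x) + dFun EM (fun y => α y (Y y)) x)
          + (1 / 2 : ℝ) • dFun EM (fun y => α y (Y y) - β y (X y)) x)
      = lieVec (fun y => X y + P.sharpField α y) (fun y => Y y + P.sharpField β y) x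
    rw [e1, e5, e7]
    simp only [map_add, map_sub, map_smul, e6]
    module
  · change P.formBracket α β x + lieForm X β x - lieForm Y α x
        + (1 / 2 : ℝ) • dFun EM (fun y => α y (Y y) - β y (X y)) x
      = lieForm (fun y => X y + P.sharpField α y) β x
        - lieForm (fun y => Y y + P.sharpField β y) α x
        + (1 / 2 : ℝ) • dFun EM
          (fun y => α y (Y y + P.sharpField β y) - β y (X y + P.sharpField α y)) x
    rw [e2, e3, e4, PoissonStructure.formBracket]
    module

end Shift

/-! ### Lagrangian subspaces -/

section Lagrangian

variable [FiniteDimensional ℝ EM] {x : M} {W : Submodule ℝ (GenTan EM x)}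

theorem pairing_comm (u v : GenTan EM x) : pairing x u v = pairing x v u := by
  simp only [pairing]
  ring

theorem pairing_add_right (u v w : GenTan EM x) :
    pairing x u (v + w) = pairing x u v + pairing x u w := by
  simp only [pairing, Prod.fst_add, Prod.snd_add, map_add, _root_.add_apply]
  ring

theorem pairing_smul_right (c : ℝ) (u v : GenTan EM x) :
    pairing x u (c • v) = c * pairing x u v := by
  simp only [pairing, Prod.smul_fst, Prod.smul_snd, map_smul, _root_.smul_apply, smul_eq_mul]
  ring

/-- Adjoining `u` to `W` preserves isotropy, so maximality forces `u` into `W`. -/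
theorem mem_of_pairing_eq_zero (hW : Maximal (IsIsotropic x) W) {u : GenTan EM x}
    (hu : pairing x u u = 0) (h : ∀ v ∈ W, pairing x u v = 0) : u ∈ W := by
  have key : IsIsotropic x (W ⊔ Submodule.span ℝ {u}) := by
    intro a ha b hb
    obtain ⟨v, hv, w, hw, rfl⟩ := Submodule.mem_sup.1 ha
    obtain ⟨v', hv', w', hw', rfl⟩ := Submodule.mem_sup.1 hb
    obtain ⟨c, rfl⟩ := Submodule.mem_span_singleton.1 hw
    obtain ⟨c', rfl⟩ := Submodule.mem_span_singleton.1 hw'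
    rw [pairing_add_right, pairing_smul_right, pairing_comm _ v', pairing_comm _ u,
      pairing_add_right, pairing_add_right, pairing_smul_right, pairing_smul_right, hu,
      pairing_comm v' u, h v hv, h v' hv', hW.prop v' hv' v hv]
    ring
  exact hW.le_of_ge key le_sup_left (Submodule.mem_sup_right (Submodule.mem_span_singleton_self u))

theorem mem_charDist_of_forall {W : ∀ x : M, Submodule ℝ (GenTan EM x)}
    (hW : Maximal (IsIsotropic x) (W x)) {v : Tan EM x} (h : ∀ u ∈ W x, u.2 v = 0) :
    v ∈ charDist W x := by
  refine mem_of_pairing_eq_zero hW ?_ fun u hu => ?_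
  · simp [pairing]
  · simp [pairing, h u hu]

end Lagrangian

/-! ### Dimension of maximal isotropic subspaces and their behaviour under the shift. -/

section LagrangianDimension

variable [FiniteDimensional ℝ EM] {x : M}

theorem mem_of_forall_apply_eq_zero {V : Type*} [NormedAddCommGroup V] [NormedSpace ℝ V]
    [FiniteDimensional ℝ V] (S : Submodule ℝ (V →L[ℝ] ℝ)) {α : V →L[ℝ] ℝ}
    (h : ∀ v, (∀ s ∈ S, s v = 0) → α v = 0) : α ∈ S := by
  let e : (V →ₗ[ℝ] ℝ) ≃ₗ[ℝ] (V →L[ℝ] ℝ) := LinearMap.toContinuousLinearMap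
  have h1 : e.symm α ∈ (S.comap e.toLinearMap).dualCoannihilator.dualAnnihilator := by
    rw [Submodule.mem_dualAnnihilator]
    intro v hv
    refine h v fun s hs => ?_
    exact (Submodule.mem_dualCoannihilator v).1 hv (e.symm s)
      (by rw [Submodule.mem_comap]; exact (e.apply_symm_apply s).symm ▸ hs)
  rw [Subspace.dualCoannihilator_dualAnnihilator_eq, Submodule.mem_comap] at h1
  exact (e.apply_symm_apply α) ▸ h1

variable {W : ∀ x : M, Submodule ℝ (GenTan EM x)}

theorem apply_eq_zero_of_mem_charDist (hW : IsIsotropic x (W x)) {u : GenTan EM x} (hu : u ∈ W x)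
    {v : Tan EM x} (hv : v ∈ charDist W x) : u.2 v = 0 := by
  have := hW u hu _ hv
  simpa [pairing] using this

/-- By maximality, a vector killed by every covector occurring in `W x` lies in `charDist`. The
double annihilator theorem turns this round: the covectors occurring in `W x` fill the annihilator
of `charDist`. -/
theorem exists_mem_of_forall_charDist (hW : Maximal (IsIsotropic x) (W x)) {α : Cot EM x}
    (h : ∀ v ∈ charDist W x, α v = 0) : ∃ X, (X, α) ∈ W x := by
  have h1 : α ∈ (W x).map (LinearMap.snd ℝ (Tan EM x) (Cot EM x)) :=
    mem_of_forall_apply_eq_zero (V := EM) _ fun v hv => h v <| mem_charDist_of_forall hW fun u hu =>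
      hv u.2 ⟨u, hu, rfl⟩
  obtain ⟨u, hu, rfl⟩ := h1
  exact ⟨u.1, hu⟩

/-- By rank and nullity dim W = dim D + dim(range s), and D is the space annihilated by the range of
s, so the latter has dimension dim V - dim D. -/
theorem finrank_eq_of_ker_eq_range {V W : Type*} [AddCommGroup V] [Module ℝ V]
    [FiniteDimensional ℝ V] [AddCommGroup W] [Module ℝ W] [FiniteDimensional ℝ W]
    (s : W →ₗ[ℝ] Module.Dual ℝ V) (D : Submodule ℝ V) (i : D →ₗ[ℝ] W)
    (hi : Function.Injective i) (h1 : ∀ w, s w = 0 ↔ w ∈ LinearMap.range i)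
    (h2 : ∀ v, v ∈ D ↔ ∀ w, s w v = 0) : Module.finrank ℝ W = Module.finrank ℝ V := by
  have h3 := s.finrank_range_add_finrank_ker
  have h4 := Subspace.finrank_add_finrank_dualCoannihilator_eq (LinearMap.range s)
  have h5 : (LinearMap.range s).dualCoannihilator = D := by
    ext v
    rw [Submodule.mem_dualCoannihilator, h2]
    refine ⟨fun h w => h _ ⟨w, rfl⟩, ?_⟩
    rintro h _ ⟨w, rfl⟩
    exact h w
  have h6 : LinearMap.ker s = LinearMap.range i := by
    ext w
    rw [LinearMap.mem_ker, h1]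
  rw [h5] at h4
  rw [h6, LinearMap.finrank_range_of_inj hi] at h3
  omega

/-- The map s is the projection to covectors: its kernel is `charDist`, and its image annihilates
exactly `charDist`. -/
theorem finrank_of_maximal (hW : Maximal (IsIsotropic x) (W x)) :
    Module.finrank ℝ (W x) = Module.finrank ℝ EM := by
  refine finrank_eq_of_ker_eq_range (V := Tan EM x) (W := W x)
    { toFun := fun w => (w : GenTan EM x).2.toLinearMap
      map_add' := fun _ _ => rfl
      map_smul' := fun _ _ => rfl } (charDist W x)
    { toFun := fun v => ⟨(v.1, 0), v.2⟩
      map_add' := fun _ _ => by ext <;> simp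
      map_smul' := fun _ _ => by ext <;> simp }
    (fun v w h => Subtype.ext (congrArg Prod.fst (congrArg Subtype.val h))) (fun w => ?_)
    (fun v => ⟨fun hv w => apply_eq_zero_of_mem_charDist hW.prop w.2 hv, fun h =>
      mem_charDist_of_forall hW fun u hu => h ⟨u, hu⟩⟩)
  constructor
  · intro h
    have h0 : (w : GenTan EM x).2 = 0 := by
      ext v
      exact DFunLike.congr_fun h v
    exact ⟨⟨w.1.1, by
      change (w.1.1, (0 : Cot EM x)) ∈ W x
      rw [← h0]
      exact w.2⟩, Subtype.ext (Prod.ext rfl h0.symm)⟩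
  · rintro ⟨v, rfl⟩
    rfl

theorem pairing_shift (P : PoissonStructure EM M) (u v : GenTan EM x) :
    pairing x (shift P x u) (shift P x v) = pairing x u v := by
  have := P.skew x u.2 v.2
  simp only [pairing, shift_apply, map_add, this]
  ring

/-- The shift as a linear equivalence. -/
def shiftEquiv (P : PoissonStructure EM M) (x : M) : GenTan EM x ≃ₗ[ℝ] GenTan EM x :=
  LinearEquiv.ofBijective (shift P x) ⟨fun u v (h : shift P x u = shift P x v) => by
    have h2 : (shift P x u).2 = (shift P x v).2 := congrArg Prod.snd h
    have h1 : (shift P x u).1 = (shift P x v).1 := congrArg Prod.fst h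
    simp only [shift_apply] at h1 h2
    rw [h2] at h1
    exact Prod.ext (add_right_cancel h1) h2, fun u => ⟨(u.1 - P.sharp x u.2, u.2), by
      simp [shift_apply]⟩⟩

theorem shiftEquiv_apply (P : PoissonStructure EM M) (u : GenTan EM x) :
    shiftEquiv P x u = shift P x u := rfl

theorem shift_mem_shiftImage {P : PoissonStructure EM M} {u : GenTan EM x} :
    shift P x u ∈ shiftImage P W x ↔ u ∈ W x := by
  refine ⟨?_, fun h => ⟨u, h, rfl⟩⟩
  rintro ⟨v, hv, h⟩
  exact (shiftEquiv P x).injective h ▸ hv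

/-- The shift is injective and fixes tangent vectors. -/
theorem charDist_shiftImage (P : PoissonStructure EM M) :
    charDist (shiftImage P W) x = charDist W x := by
  ext v
  have h : LinearMap.inl ℝ (Tan EM x) (Cot EM x) v
      = shift P x (LinearMap.inl ℝ (Tan EM x) (Cot EM x) v) := by simp [shift_apply]
  rw [charDist, Submodule.mem_comap, h, shift_mem_shiftImage]
  rfl

/-- The shift is a bijective isometry, so a larger isotropic space upstairs would pull back to one
containing `W x`. -/
theorem maximal_shiftImage (P : PoissonStructure EM M) (hW : Maximal (IsIsotropic x) (W x)) :
    Maximal (IsIsotropic x) (shiftImage P W x) := by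
  refine ⟨?_, fun V hV hle u hu => ?_⟩
  · rintro _ ⟨u, hu, rfl⟩ _ ⟨v, hv, rfl⟩
    rw [pairing_shift]
    exact hW.prop u hu v hv
  · obtain ⟨w, rfl⟩ := (shiftEquiv P x).surjective u
    rw [shiftEquiv_apply, shift_mem_shiftImage]
    have h1 : IsIsotropic x (V.comap (shift P x)) := fun a ha b hb => by
      rw [← pairing_shift P]
      exact hV _ ha _ hb
    exact hW.le_of_ge h1 (fun a ha => hle ⟨a, ha, rfl⟩) hu

end LagrangianDimension

/-! ### Frames and transport of Lie algebroids -/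

section Transport

variable {F : Type*} [NormedAddCommGroup F] [NormedSpace ℝ F] {E : M → Type*}
  [∀ x, AddCommGroup (E x)] [∀ x, Module ℝ (E x)] [TopologicalSpace (TotalSpace F E)]
  [∀ x, TopologicalSpace (E x)] [FiberBundle F E]
  {F' : Type*} [NormedAddCommGroup F'] [NormedSpace ℝ F'] {E' : M → Type*}
  [∀ x, AddCommGroup (E' x)] [∀ x, Module ℝ (E' x)] [TopologicalSpace (TotalSpace F' E')]
  [∀ x, TopologicalSpace (E' x)] [FiberBundle F' E']

namespace PreLieAlgebroid

/-- `e` is a smooth frame of `A` over `U`. -/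
structure IsFrame (A : PreLieAlgebroid EM F E) (U : Set M) {r : ℕ}
    (e : Fin r → ∀ x, A.fiber x) : Prop where
  smooth : ∀ i, A.SmoothOn U (e i)
  linearIndependent : ∀ x ∈ U, LinearIndependent ℝ (fun i => e i x)
  span : ∀ x ∈ U, Submodule.span ℝ (range fun i => e i x) = ⊤

theorem exists_isFrame {A : PreLieAlgebroid EM F E} {r : ℕ}
    (h : IsSmoothSubbundle EM F r A.fiber) (x₀ : M) :
    ∃ U : Set M, IsOpen U ∧ x₀ ∈ U ∧ ∃ e : Fin r → ∀ x, A.fiber x, A.IsFrame U e := by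
  classical
  obtain ⟨U, hU, hx, e, he, h⟩ := h x₀
  have hm : ∀ x ∈ U, ∀ i, e i x ∈ A.fiber x := fun x hx i =>
    (h x hx).2 ▸ Submodule.subset_span ⟨i, rfl⟩
  -- Outside `U` the given sections need not take values in the subbundle, so they are replaced by
  -- zero where they leave it.
  let e' : Fin r → ∀ x, A.fiber x := fun i x => if h : e i x ∈ A.fiber x then ⟨e i x, h⟩ else 0
  have hc : ∀ x ∈ U, ∀ i, (e' i x : E x) = e i x := fun x hx i => by
    simp only [e', dif_pos (hm x hx i)]
  refine ⟨U, hU, hx, e', fun i => (he i).congr fun x hx => hc x hx i, fun x hx => ?_,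
    fun x hx => ?_⟩
  · refine LinearIndependent.of_comp (A.fiber x).subtype ?_
    have : (A.fiber x).subtype ∘ (fun i => e' i x) = fun i => e i x :=
      funext fun i => hc x hx i
    rw [this]
    exact (h x hx).1
  · refine Submodule.map_injective_of_injective (A.fiber x).injective_subtype ?_
    rw [Submodule.map_span, Submodule.map_top, Submodule.range_subtype, ← range_comp]
    refine Eq.trans ?_ (h x hx).2
    exact congrArg _ (congrArg _ (funext fun i => hc x hx i))

theorem IsFrame.isSmoothSubbundle {A : PreLieAlgebroid EM F E} {r : ℕ}
    (h : ∀ x₀ : M, ∃ U : Set M, IsOpen U ∧ x₀ ∈ U ∧ ∃ e : Fin r → ∀ x, A.fiber x, A.IsFrame U e) :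
    IsSmoothSubbundle EM F r A.fiber := fun x₀ => by
  obtain ⟨U, hU, hx, e, he⟩ := h x₀
  refine ⟨U, hU, hx, fun i x => e i x, he.smooth, fun x hx => ⟨?_, ?_⟩⟩
  · exact (he.linearIndependent x hx).map' (A.fiber x).subtype (by simp)
  · have := congrArg (Submodule.map (A.fiber x).subtype) (he.span x hx)
    rwa [Submodule.map_span, Submodule.map_top, Submodule.range_subtype, ← range_comp] at this

variable {A : PreLieAlgebroid EM F E} {B : PreLieAlgebroid EM F' E'}
  {Θ : ∀ x, A.fiber x ≃ₗ[ℝ] B.fiber x}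

theorem IsIso.smooth_symm (h : IsIso A B Θ) {U : Set M} (hU : IsOpen U) (σ : ∀ x, B.fiber x) :
    A.SmoothOn U (fun x => (Θ x).symm (σ x)) ↔ B.SmoothOn U σ := by
  rw [h.smooth_iff U hU]
  simp

theorem IsFrame.map {U : Set M} {r : ℕ} {e : Fin r → ∀ x, A.fiber x} (he : A.IsFrame U e)
    (h : ∀ σ, A.SmoothOn U σ → B.SmoothOn U (fun x => Θ x (σ x))) :
    B.IsFrame U (fun i x => Θ x (e i x)) := by
  refine ⟨fun i => h _ (he.smooth i), fun x hx => ?_, fun x hx => ?_⟩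
  · exact (he.linearIndependent x hx).map' (Θ x).toLinearMap (Θ x).ker
  · have := congrArg (Submodule.map (Θ x).toLinearMap) (he.span x hx)
    rwa [Submodule.map_span, Submodule.map_top, LinearEquiv.range, ← range_comp] at this

/-- On smooth sections the bracket of `B` is the conjugate of that of `A` by `Θ`, so the axioms
carry over one by one. All further algebroids here get their axioms in this way from ordinary Dirac
structures. -/
theorem IsIso.isLieAlgebroid [VectorBundle ℝ F E] [ContMDiffVectorBundle ∞ F E 𝓘(ℝ, EM)] (h : IsIso A B Θ) (hr : A.rank = B.rank) (hA : A.IsLieAlgebroid)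
    (hb : ∀ U : Set M, IsOpen U → ∀ σ σ' τ τ', B.SmoothOn U σ → B.SmoothOn U τ →
      (∀ x ∈ U, σ x = σ' x) → (∀ x ∈ U, τ x = τ' x) →
      ∀ x ∈ U, B.bracket σ τ x = B.bracket σ' τ' x) : B.IsLieAlgebroid := by
  have key : ∀ U : Set M, IsOpen U → ∀ σ τ, B.SmoothOn U σ → B.SmoothOn U τ → ∀ x ∈ U,
      B.bracket σ τ x
        = Θ x (A.bracket (fun y => (Θ y).symm (σ y)) (fun y => (Θ y).symm (τ y)) x) := by
    intro U hU σ τ hσ hτ x hx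
    rw [h.bracket U hU _ _ ((h.smooth_symm hU _).2 hσ) ((h.smooth_symm hU _).2 hτ) x hx]
    simp
  have hsm : ∀ U : Set M, IsOpen U → ∀ σ τ, B.SmoothOn U σ → B.SmoothOn U τ →
      B.SmoothOn U (B.bracket σ τ) := by
    intro U hU σ τ hσ hτ
    have h1 := (h.smooth_iff U hU _).1 (hA.bracket_smooth U hU _ _ ((h.smooth_symm hU _).2 hσ)
      ((h.smooth_symm hU _).2 hτ))
    exact SmoothSectionOn.congr h1 fun x hx => congrArg Subtype.val (key U hU σ τ hσ hτ x hx)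
  -- The conjugation formula for the inner bracket is known only on `U`, so the outer bracket is
  -- compared by locality in `A`.
  have key2 : ∀ U : Set M, IsOpen U → ∀ σ τ υ, B.SmoothOn U σ → B.SmoothOn U τ → B.SmoothOn U υ →
      ∀ x ∈ U, B.bracket σ (B.bracket τ υ) x
        = Θ x (A.bracket (fun y => (Θ y).symm (σ y)) (A.bracket (fun y => (Θ y).symm (τ y))
          (fun y => (Θ y).symm (υ y))) x) := by
    intro U hU σ τ υ hσ hτ hυ x hx
    rw [key U hU _ _ hσ (hsm U hU _ _ hτ hυ) x hx]
    refine congrArg _ (hA.bracket_local U hU _ _ _ _ ((h.smooth_symm hU _).2 hσ)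
      ((h.smooth_symm hU _).2 (hsm U hU _ _ hτ hυ)) (fun _ _ => rfl) (fun y hy => ?_) x hx)
    rw [key U hU _ _ hτ hυ y hy, LinearEquiv.symm_apply_apply]
  refine ⟨?_, fun U hU σ hσ => ?_, hsm, hb, ?_, ?_, ?_, ?_⟩
  · refine IsFrame.isSmoothSubbundle fun x₀ => ?_
    obtain ⟨U, hU, hx, e, he⟩ := exists_isFrame hA.subbundle x₀
    rw [← hr]
    exact ⟨U, hU, hx, _, he.map (Θ := Θ) fun σ => (h.smooth_iff U hU σ).1⟩
  · refine (hA.anchor_smooth U hU _ ((h.smooth_symm hU _).2 hσ)).congr fun x _ => ?_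
    rw [← h.anchor, LinearEquiv.apply_symm_apply]
  · intro U hU σ τ hσ hτ x hx
    rw [key U hU _ _ hσ hτ x hx, key U hU _ _ hτ hσ x hx, hA.bracket_skew U hU _ _
      ((h.smooth_symm hU _).2 hσ) ((h.smooth_symm hU _).2 hτ) x hx, map_neg]
  · intro U hU σ τ τ' hσ hτ hτ' x hx
    have := hA.bracket_add U hU _ _ _ ((h.smooth_symm hU _).2 hσ) ((h.smooth_symm hU _).2 hτ)
      ((h.smooth_symm hU _).2 hτ') x hx
    rw [key U hU _ _ hσ hτ x hx, key U hU _ _ hσ hτ' x hx, ← map_add, ← this]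
    have hs : B.SmoothOn U (fun y => τ y + τ' y) := by
      rw [← h.smooth_symm hU]
      simp only [map_add]
      exact SmoothSectionOn.add ((h.smooth_symm hU _).2 hτ) ((h.smooth_symm hU _).2 hτ')
    rw [key U hU _ _ hσ hs x hx]
    simp
  · intro U hU σ τ f hσ hτ hf x hx
    have hs : B.SmoothOn U (fun y => f y • τ y) := by
      rw [← h.smooth_symm hU]
      simp only [map_smul]
      exact SmoothSectionOn.smul hf ((h.smooth_symm hU _).2 hτ)
    have := hA.leibniz U hU _ _ f ((h.smooth_symm hU _).2 hσ) ((h.smooth_symm hU _).2 hτ) hf x hx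
    rw [key U hU _ _ hσ hs x hx, key U hU _ _ hσ hτ x hx]
    simp only [map_smul]
    rw [this, map_add, map_smul, map_smul, LinearEquiv.apply_symm_apply, ← h.anchor,
      LinearEquiv.apply_symm_apply]
  · intro U hU σ τ υ hσ hτ hυ x hx
    rw [key2 U hU _ _ _ hσ hτ hυ x hx, key2 U hU _ _ _ hτ hυ hσ x hx, key2 U hU _ _ _ hυ hσ hτ x hx,
      ← map_add, ← map_add, hA.jacobi U hU _ _ _ ((h.smooth_symm hU _).2 hσ)
      ((h.smooth_symm hU _).2 hτ) ((h.smooth_symm hU _).2 hυ) x hx, map_zero]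

end PreLieAlgebroid

end Transport

/-! ### The Lie algebroid of a Dirac structure -/

section DiracAlgebroid

variable [FiniteDimensional ℝ EM] {L : ∀ x : M, Submodule ℝ (GenTan EM x)} {U : Set M} {x : M}

theorem IsDirac.isSmoothSubbundle
    {br : (∀ x : M, GenTan EM x) → (∀ x : M, GenTan EM x) → ∀ x : M, GenTan EM x}
    (h : IsDirac br L) : IsSmoothSubbundle EM (GenModel EM) (Module.finrank ℝ EM) L := by
  obtain ⟨r, hr⟩ := h.subbundle
  intro x₀
  obtain ⟨U, hU, hx, e, he, h'⟩ := hr x₀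
  have h1 : Module.finrank ℝ (L x₀) = r := by
    rw [← (h' x₀ hx).2, finrank_span_eq_card (h' x₀ hx).1, Fintype.card_fin]
  obtain rfl : r = Module.finrank ℝ EM := by rw [← h1, finrank_of_maximal (h.maximal x₀)]
  exact ⟨U, hU, hx, e, he, h'⟩

theorem restrictAlgebroid_bracket {a : ∀ x : M, GenTan EM x →ₗ[ℝ] Tan EM x}
    {br : (∀ x : M, GenTan EM x) → (∀ x : M, GenTan EM x) → ∀ x : M, GenTan EM x}
    (h : IsDirac br L) (hU : IsOpen U) (hx : x ∈ U) {σ τ : ∀ x, L x}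
    (hσ : SmoothSectionOn EM (GenModel EM) U fun x => (σ x : GenTan EM x))
    (hτ : SmoothSectionOn EM (GenModel EM) U fun x => (τ x : GenTan EM x)) :
    ((restrictAlgebroid a br L).bracket σ τ x : GenTan EM x)
      = br (fun y => (σ y : GenTan EM y)) (fun y => (τ y : GenTan EM y)) x := by
  have := h.integrable U hU _ _ hσ hτ (fun x _ => (σ x).2) (fun x _ => (τ x).2) x hx
  simp only [restrictAlgebroid, dif_pos this]

theorem courantBracket_swap (σ τ : ∀ x : M, GenTan EM x) :
    courantBracket τ σ x = - courantBracket σ τ x := by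
  refine Prod.ext ?_ ?_
  · exact VectorField.mlieBracket_swap_apply
  · have h : (fun y => (τ y).2 (σ y).1 - (σ y).2 (τ y).1)
        = fun y => - ((σ y).2 (τ y).1 - (τ y).2 (σ y).1) := funext fun y => by ring
    simp only [courantBracket, Prod.snd_neg]
    rw [h, dFun_neg]
    module

theorem IsDiracStructure.coe_bracket [T2Space M] (h : IsDiracStructure L) (hU : IsOpen U) (hx : x ∈ U)
    {σ τ : ∀ x, L x} (hσ : (diracAlgebroid L).SmoothOn U σ) (hτ : (diracAlgebroid L).SmoothOn U τ) :
    ((diracAlgebroid L).bracket σ τ x : GenTan EM x)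
      = dorfman (fun y => (σ y : GenTan EM y)) (fun y => (τ y : GenTan EM y)) x := by
  refine (restrictAlgebroid_bracket h hU hx hσ hτ).trans ?_
  exact courantBracket_eq_dorfman hU hx hσ hτ fun y _ => (h.maximal y).prop _ (σ y).2 _ (τ y).2

theorem dorfman_neg_right [T2Space M] {σ τ : ∀ x : M, GenTan EM x} (hU : IsOpen U) (hx : x ∈ U)
    (hσ : SmoothSectionOn EM (GenModel EM) U σ) (hτ : SmoothSectionOn EM (GenModel EM) U τ) :
    dorfman σ (fun y => - τ y) x = - dorfman σ τ x := by
  have h := dorfman_smul_right hU hx hσ hτ (f := fun _ => (-1 : ℝ)) contMDiffOn_const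
  have e : ∀ u : GenTan EM x, (-1 : ℝ) • u = - u := fun u => neg_one_smul ℝ u
  have e' : (fun y => (-1 : ℝ) • τ y) = fun y => - τ y := funext fun y => neg_one_smul ℝ (τ y)
  rw [dFun_const, e, e'] at h
  exact h.trans ((congrArg _ (zero_smul ℝ (τ x))).trans (add_zero _))

/-- Each of the two brackets supplies what the other lacks. Skewness holds for the Courant bracket,
while additivity, the Leibniz rule and Jacobi hold for the Dorfman bracket. On sections of the
isotropic `L` the two coincide. -/
theorem IsDiracStructure.isLieAlgebroid [T2Space M] (h : IsDiracStructure L) :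
    (diracAlgebroid L).IsLieAlgebroid := by
  have hs : ∀ U : Set M, IsOpen U → ∀ σ τ, (diracAlgebroid L).SmoothOn U σ →
      (diracAlgebroid L).SmoothOn U τ →
      (diracAlgebroid L).SmoothOn U ((diracAlgebroid L).bracket σ τ) := fun U hU σ τ hσ hτ =>
    (SmoothSectionOn.dorfman hU hσ hτ).congr fun x hx => h.coe_bracket hU hx hσ hτ
  have hk : ∀ U : Set M, IsOpen U → ∀ σ τ, (diracAlgebroid L).SmoothOn U σ →
      (diracAlgebroid L).SmoothOn U τ → ∀ x ∈ U,
      (diracAlgebroid L).bracket σ τ x = - (diracAlgebroid L).bracket τ σ x := by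
    intro U hU σ τ hσ hτ x hx
    refine Subtype.ext ?_
    have h1 := restrictAlgebroid_bracket (a := fun x => LinearMap.fst ℝ (Tan EM x) (Cot EM x)) h
      hU hx hσ hτ
    have h2 := restrictAlgebroid_bracket (a := fun x => LinearMap.fst ℝ (Tan EM x) (Cot EM x)) h
      hU hx hτ hσ
    exact h1.trans ((courantBracket_swap _ _).trans (congrArg Neg.neg h2.symm))
  have hJ : ∀ U : Set M, IsOpen U → ∀ σ τ υ, (diracAlgebroid L).SmoothOn U σ →
      (diracAlgebroid L).SmoothOn U τ → (diracAlgebroid L).SmoothOn U υ → ∀ x ∈ U,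
      ((diracAlgebroid L).bracket σ ((diracAlgebroid L).bracket τ υ) x : GenTan EM x)
        = dorfman (fun y => (σ y : GenTan EM y))
          (dorfman (fun y => (τ y : GenTan EM y)) (fun y => (υ y : GenTan EM y))) x := by
    intro U hU σ τ υ hσ hτ hυ x hx
    rw [h.coe_bracket hU hx hσ (hs U hU _ _ hτ hυ)]
    refine dorfman_congr (.of_forall fun _ => rfl) ?_
    filter_upwards [hU.mem_nhds hx] with y hy
    exact h.coe_bracket hU hy hτ hυ
  refine ⟨h.isSmoothSubbundle, fun U hU σ hσ => hσ.fst, hs, ?_, hk, ?_, ?_, ?_⟩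
  · intro U hU σ σ' τ τ' hσ hτ h1 h2 x hx
    refine Subtype.ext ?_
    rw [h.coe_bracket hU hx hσ hτ, h.coe_bracket (σ := σ') (τ := τ') hU hx
      (SmoothSectionOn.congr hσ fun y hy => by rw [h1 y hy])
      (SmoothSectionOn.congr hτ fun y hy => by rw [h2 y hy])]
    refine dorfman_congr ?_ ?_
    · filter_upwards [hU.mem_nhds hx] with y hy
      rw [h1 y hy]
    · filter_upwards [hU.mem_nhds hx] with y hy
      rw [h2 y hy]
  · intro U hU σ τ τ' hσ hτ hτ' x hx
    refine Subtype.ext ?_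
    have h1 := dorfman_add_right hU hx hτ hσ hτ'
    rw [Submodule.coe_add, h.coe_bracket hU hx hσ hτ, h.coe_bracket hU hx hσ hτ', ← h1,
      h.coe_bracket (τ := fun y => τ y + τ' y) hU hx hσ (SmoothSectionOn.add hτ hτ')]
    rfl
  · intro U hU σ τ f hσ hτ hf x hx
    refine Subtype.ext ?_
    have h1 := dorfman_smul_right hU hx hσ hτ hf
    rw [h.coe_bracket (τ := fun y => f y • τ y) hU hx hσ (SmoothSectionOn.smul hf hτ),
      Submodule.coe_add, Submodule.coe_smul, h.coe_bracket hU hx hσ hτ]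
    exact h1
  · intro U hU σ τ υ hσ hτ hυ x hx
    have h1 := dorfman_leibniz hU hx hσ hτ hυ
    rw [hk U hU υ _ hυ (hs U hU _ _ hσ hτ) x hx]
    -- The cyclic Jacobi identity follows from the Leibniz form by reversing an inner bracket.
    -- Skewness is available on `U` and is carried inside by locality of the Dorfman bracket.
    have h2 : (diracAlgebroid L).bracket τ ((diracAlgebroid L).bracket υ σ) x
        = - (diracAlgebroid L).bracket τ ((diracAlgebroid L).bracket σ υ) x := by
      refine Subtype.ext ?_
      rw [Submodule.coe_neg, hJ U hU _ _ _ hτ hσ hυ x hx,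
        h.coe_bracket hU hx hτ (hs U hU _ _ hυ hσ)]
      have h4 : ∀ᶠ y in 𝓝 x, ((diracAlgebroid L).bracket υ σ y : GenTan EM y)
          = - dorfman (fun y => (σ y : GenTan EM y)) (fun y => (υ y : GenTan EM y)) y := by
        filter_upwards [hU.mem_nhds hx] with y hy
        exact (congrArg Subtype.val (hk U hU _ _ hυ hσ y hy)).trans
          (congrArg Neg.neg (h.coe_bracket hU hy hσ hυ))
      exact (dorfman_congr (.of_forall fun _ => rfl) h4).trans
        (dorfman_neg_right hU hx hτ (SmoothSectionOn.dorfman hU hσ hυ))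
    have h5 : ((diracAlgebroid L).bracket ((diracAlgebroid L).bracket σ τ) υ x : GenTan EM x)
        = dorfman (dorfman (fun y => (σ y : GenTan EM y)) (fun y => (τ y : GenTan EM y)))
          (fun y => (υ y : GenTan EM y)) x := by
      rw [h.coe_bracket hU hx (hs U hU _ _ hσ hτ) hυ]
      refine dorfman_congr ?_ (.of_forall fun _ => rfl)
      filter_upwards [hU.mem_nhds hx] with y hy
      exact h.coe_bracket hU hy hσ hτ
    refine Subtype.ext ?_
    rw [h2, Submodule.coe_add, Submodule.coe_add, Submodule.coe_neg, Submodule.coe_neg,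
      hJ U hU _ _ _ hσ hτ hυ x hx, hJ U hU _ _ _ hτ hσ hυ x hx, h5, h1, Submodule.coe_zero]
    abel

variable [T2Space M] {P : PoissonStructure EM M}

theorem IsDiracStructurePoisson.isDiracStructure (h : IsDiracStructurePoisson P L) :
    IsDiracStructure (shiftImage P L) := by
  refine ⟨⟨Module.finrank ℝ EM, fun x₀ => ?_⟩, fun x => maximal_shiftImage P (h.maximal x), ?_⟩
  · obtain ⟨U, hU, hx, e, he, h'⟩ := h.isSmoothSubbundle x₀
    refine ⟨U, hU, hx, fun i x => shift P x (e i x), fun i => (smooth_shift_iff P hU).2 (he i),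
      fun x hx => ⟨?_, ?_⟩⟩
    · exact (h' x hx).1.map' (shiftEquiv P x).toLinearMap (shiftEquiv P x).ker
    · rw [shiftImage, ← (h' x hx).2, Submodule.map_span, ← range_comp]
      rfl
  · intro U hU σ τ hσ hτ h1 h2 x hx
    -- Every section is the shift of a section, so integrability can be tested before shifting.
    have hc : ∀ σ : ∀ x : M, GenTan EM x,
        σ = fun x => shift P x ((shiftEquiv P x).symm (σ x)) := fun σ =>
      funext fun x => ((shiftEquiv P x).apply_symm_apply _).symm
    rw [hc σ] at hσ h1 ⊢
    rw [hc τ] at hτ h2 ⊢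
    rw [smooth_shift_iff P hU] at hσ hτ
    rw [← shift_courantBracketPoisson P hU hx hσ hτ, shift_mem_shiftImage]
    exact h.integrable U hU _ _ hσ hτ (fun y hy => shift_mem_shiftImage.1 (h1 y hy))
      (fun y hy => shift_mem_shiftImage.1 (h2 y hy)) x hx

/-- The shift as a bundle map from a Dirac structure onto its image. -/
def shiftImageEquiv (P : PoissonStructure EM M) (L : ∀ x : M, Submodule ℝ (GenTan EM x)) (x : M) :
    (diracAlgebroidPoisson P L).fiber x ≃ₗ[ℝ] (diracAlgebroid (shiftImage P L)).fiber x :=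
  (shiftEquiv P x).submoduleMap (L x)

theorem IsDiracStructurePoisson.isIso (h : IsDiracStructurePoisson P L) :
    PreLieAlgebroid.IsIso (diracAlgebroidPoisson P L) (diracAlgebroid (shiftImage P L))
      (shiftImageEquiv P L) := by
  refine ⟨fun U hU σ => (smooth_shift_iff P hU).symm, fun x v => rfl, ?_⟩
  intro U hU σ τ hσ hτ x hx
  refine Subtype.ext ?_
  refine (congrArg (shift P x) (restrictAlgebroid_bracket h hU hx hσ hτ)).trans
    ((shift_courantBracketPoisson P hU hx hσ hτ).trans ?_)
  exact (restrictAlgebroid_bracket h.isDiracStructure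
    (σ := fun y => shiftImageEquiv P L y (σ y)) (τ := fun y => shiftImageEquiv P L y (τ y)) hU
    hx ((smooth_shift_iff P hU).2 hσ) ((smooth_shift_iff P hU).2 hτ)).symm

theorem PreLieAlgebroid.IsIso.symm {F : Type*} [NormedAddCommGroup F] [NormedSpace ℝ F]
    {E : M → Type*} [∀ x, AddCommGroup (E x)] [∀ x, Module ℝ (E x)]
    [TopologicalSpace (TotalSpace F E)] [∀ x, TopologicalSpace (E x)] [FiberBundle F E]
    {F' : Type*} [NormedAddCommGroup F'] [NormedSpace ℝ F'] {E' : M → Type*}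
    [∀ x, AddCommGroup (E' x)] [∀ x, Module ℝ (E' x)] [TopologicalSpace (TotalSpace F' E')]
    [∀ x, TopologicalSpace (E' x)] [FiberBundle F' E']
    {A : PreLieAlgebroid EM F E} {B : PreLieAlgebroid EM F' E'}
    {Θ : ∀ x, A.fiber x ≃ₗ[ℝ] B.fiber x} (h : IsIso A B Θ) : IsIso B A fun x => (Θ x).symm := by
  refine ⟨fun U hU σ => (h.smooth_symm hU σ).symm, fun x v => ?_, fun U hU σ τ hσ hτ x hx => ?_⟩
  · rw [← h.anchor, LinearEquiv.apply_symm_apply]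
  · rw [LinearEquiv.symm_apply_eq, h.bracket U hU _ _ ((h.smooth_symm hU σ).2 hσ)
      ((h.smooth_symm hU τ).2 hτ) x hx]
    simp

/-- The axioms come back from the image along the inverse shift, so no Jacobi identity has to be
verified for the bialgebroid bracket itself. -/
theorem IsDiracStructurePoisson.isLieAlgebroid (h : IsDiracStructurePoisson P L) :
    (diracAlgebroidPoisson P L).IsLieAlgebroid := by
  refine h.isIso.symm.isLieAlgebroid rfl h.isDiracStructure.isLieAlgebroid ?_
  intro U hU σ σ' τ τ' hσ hτ h1 h2 x hx
  have hc := h.isIso.bracket U hU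
  have hσ' : (diracAlgebroidPoisson P L).SmoothOn U σ' :=
    SmoothSectionOn.congr hσ fun y hy => by rw [h1 y hy]
  have hτ' : (diracAlgebroidPoisson P L).SmoothOn U τ' :=
    SmoothSectionOn.congr hτ fun y hy => by rw [h2 y hy]
  refine (shiftImageEquiv P L x).injective ?_
  rw [hc _ _ hσ hτ x hx, hc _ _ hσ' hτ' x hx]
  refine h.isDiracStructure.isLieAlgebroid.bracket_local U hU _ _ _ _
    ((h.isIso.smooth_iff U hU _).1 hσ) ((h.isIso.smooth_iff U hU _).1 hτ) ?_ ?_ x hx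
  · exact fun y hy => by rw [h1 y hy]
  · exact fun y hy => by rw [h2 y hy]

/-- The anchor of a Lie algebroid preserves brackets. -/
def PreLieAlgebroid.AnchorHom {F : Type*} [NormedAddCommGroup F] [NormedSpace ℝ F]
    {E : M → Type*} [∀ x, AddCommGroup (E x)] [∀ x, Module ℝ (E x)]
    [TopologicalSpace (TotalSpace F E)] [∀ x, TopologicalSpace (E x)] [FiberBundle F E]
    (A : PreLieAlgebroid EM F E) : Prop :=
  ∀ U : Set M, IsOpen U → ∀ σ τ, A.SmoothOn U σ → A.SmoothOn U τ → ∀ x ∈ U,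
    A.anchor x (A.bracket σ τ x)
      = lieVec (fun y => A.anchor y (σ y)) (fun y => A.anchor y (τ y)) x

theorem IsDiracStructure.anchorHom (h : IsDiracStructure L) : (diracAlgebroid L).AnchorHom :=
  fun _ hU _ _ hσ hτ _ hx => congrArg Prod.fst (restrictAlgebroid_bracket h hU hx hσ hτ)

theorem IsDiracStructurePoisson.anchorHom (h : IsDiracStructurePoisson P L) :
    (diracAlgebroidPoisson P L).AnchorHom := fun U hU σ τ hσ hτ x hx => by
  have := h.isDiracStructure.anchorHom U hU _ _ ((h.isIso.smooth_iff U hU _).1 hσ)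
    ((h.isIso.smooth_iff U hU _).1 hτ) x hx
  rw [← h.isIso.bracket U hU _ _ hσ hτ x hx, h.isIso.anchor] at this
  exact this

end DiracAlgebroid

/-! ### The cotangent Lie algebroid -/

section Cotangent

variable [FiniteDimensional ℝ EM] [T2Space M] (P : PoissonStructure EM M)

variable (EM M) in
/-- The Dirac structure `T*M`. -/
def cotangentDirac (x : M) : Submodule ℝ (GenTan EM x) :=
  LinearMap.ker (LinearMap.fst ℝ (Tan EM x) (Cot EM x))

theorem courantBracketPoisson_fst_eq_zero {σ τ : ∀ x : M, GenTan EM x} {U : Set M} {x : M}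
    (hU : IsOpen U) (hx : x ∈ U) (h : ∀ y ∈ U, (σ y).1 = 0) (h' : ∀ y ∈ U, (τ y).1 = 0) :
    courantBracketPoisson P σ τ x = (0, P.formBracket (fun y => (σ y).2) (fun y => (τ y).2) x) := by
  have e : ∀ᶠ y in 𝓝 x, (σ y).1 = 0 := by
    filter_upwards [hU.mem_nhds hx] with y hy using h y hy
  have e' : ∀ᶠ y in 𝓝 x, (τ y).1 = 0 := by
    filter_upwards [hU.mem_nhds hx] with y hy using h' y hy
  have h1 : (fun y => (σ y).2 (τ y).1 - (τ y).2 (σ y).1) =ᶠ[𝓝 x] fun _ => (0 : ℝ) := by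
    filter_upwards [e, e'] with y hy hy'
    rw [hy, hy', map_zero, map_zero, sub_zero]
  have h2 : ∀ X : ∀ x : M, Tan EM x, lieVec X (fun y => (0 : Tan EM y)) x = 0 := fun X =>
    congrFun (VectorField.mlieBracket_zero_right (W := X)) x
  have h3 : ∀ X Y : ∀ x : M, Tan EM x, (∀ᶠ y in 𝓝 x, Y y = 0) → lieVec X Y x = 0 :=
    fun X Y hY => (lieVec_congr (.of_forall fun _ => rfl) hY).trans (h2 X)
  have h4 : ∀ α : ∀ x : M, Cot EM x, dForm α x 0 = 0 := fun α => by
    simpa using dForm_map_smul (α := α) (x := x) 0 0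
  have h5 : ∀ (X : ∀ x : M, Tan EM x) (α : ∀ x : M, Cot EM x), (∀ᶠ y in 𝓝 x, X y = 0) →
      lieForm X α x = 0 := fun X α hX => by
    have : (fun y => α y (X y)) =ᶠ[𝓝 x] fun _ => (0 : ℝ) := by
      filter_upwards [hX] with y hy
      rw [hy, map_zero]
    rw [lieForm, hX.self_of_nhds, h4, dFun_congr this, dFun_const, zero_add]
  refine Prod.ext ?_ ?_
  · change lieVec (fun y => (σ y).1) (fun y => (τ y).1) x
      + (lieVec _ (fun y => (τ y).1) x + P.sharp x (dForm _ x (τ x).1))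
      - (lieVec _ (fun y => (σ y).1) x + P.sharp x (dForm _ x (σ x).1))
      - (1 / 2 : ℝ) • (- P.sharp x (dFun EM _ x)) = (0 : Tan EM x)
    rw [h3 _ _ e', h3 _ _ e', h3 _ _ e, e.self_of_nhds, e'.self_of_nhds, h4, h4, dFun_congr h1,
      dFun_const]
    simp
  · change P.formBracket _ _ x + lieForm (fun y => (σ y).1) _ x - lieForm (fun y => (τ y).1) _ x
      + (1 / 2 : ℝ) • dFun EM _ x = P.formBracket _ _ x
    rw [h5 _ _ e, h5 _ _ e', dFun_congr h1, dFun_const]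
    simp

/-- The bialgebroid bracket restricts on T*M to the bracket of forms. Viewing T*M as a Dirac
structure of the bialgebroid therefore gives the axioms of the cotangent algebroid as a special
case. -/
theorem isDiracStructurePoisson_cotangentDirac :
    IsDiracStructurePoisson P (cotangentDirac EM M) := by
  refine ⟨⟨Module.finrank ℝ EM, fun x₀ => ?_⟩, fun x => ⟨?_, ?_⟩, ?_⟩
  · obtain ⟨f, W, U, hf, hW, hU, hx, hd, -, he⟩ := exists_coordinates_expand (EM := EM) x₀
    refine ⟨U, hU, hx, fun i x => (0, dFun EM (f i) x), fun i => ?_, fun x hx => ⟨?_, ?_⟩⟩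
    · exact smoothSectionOn_gen_iff.2 ⟨smoothSectionOn_zero,
        smoothSectionOn_dFun hU (hf i).contMDiffOn⟩
    · rw [Fintype.linearIndependent_iff]
      intro g hg i
      have h1 := congrArg (fun u : GenTan EM x => u.2 (W i x)) hg
      simpa [Prod.snd_sum, hd x hx] using h1
    · refine le_antisymm (Submodule.span_le.2 ?_) fun u hu => ?_
      · rintro _ ⟨i, rfl⟩
        rfl
      · have h0 : u = ∑ i, u.2 (W i x) • ((0 : Tan EM x), dFun EM (f i) x) := by
          refine Prod.ext ?_ ?_
          · have h1 : u.1 = 0 := hu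
            rw [Prod.fst_sum, h1]
            simp
          · rw [Prod.snd_sum]
            exact he x hx u.2
        rw [h0]
        exact Submodule.sum_mem _ fun i _ => Submodule.smul_mem _ _ (Submodule.subset_span ⟨i, rfl⟩)
  · intro u hu v hv
    have h1 : u.1 = 0 := hu
    have h2 : v.1 = 0 := hv
    simp [pairing, h1, h2]
  · intro V hV hle u hu
    -- The space `V` contains all the covectors (0, df), and pairing `u` with them detects its
    -- vector component.
    refine tan_ext fun f hf => ?_
    have := hV u hu (0, dFun EM f x) (hle (show _ = _ from rfl))
    simpa [pairing] using this
  · intro U hU σ τ hσ hτ h1 h2 x hx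
    rw [courantBracketPoisson_fst_eq_zero P hU hx h1 h2]
    rfl

/-- The cotangent Lie algebroid as a Dirac structure. -/
def cotangentEquiv (x : M) : (diracAlgebroidPoisson P (cotangentDirac EM M)).fiber x ≃ₗ[ℝ]
    (cotangentAlgebroid P).fiber x where
  toFun u := ⟨u.1.2, trivial⟩
  map_add' _ _ := rfl
  map_smul' _ _ := rfl
  invFun α := ⟨(0, α.1), rfl⟩
  left_inv u := Subtype.ext (Prod.ext (show _ = _ from u.2).symm rfl)
  right_inv _ := rfl

theorem isIso_cotangentEquiv : PreLieAlgebroid.IsIso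
    (diracAlgebroidPoisson P (cotangentDirac EM M)) (cotangentAlgebroid P) (cotangentEquiv P) := by
  have h0 : ∀ x, ∀ u : (diracAlgebroidPoisson P (cotangentDirac EM M)).fiber x, u.1.1 = 0 :=
    fun x u => u.2
  refine ⟨fun U hU σ => ?_, fun x u => ?_, fun U hU σ τ hσ hτ x hx => ?_⟩
  · refine smoothSectionOn_gen_iff.trans ⟨fun h => h.2, fun h => ⟨?_, h⟩⟩
    exact smoothSectionOn_zero.congr fun x _ => h0 x (σ x)
  · change P.sharp x u.1.2 = u.1.1 + P.sharp x u.1.2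
    rw [h0, zero_add]
  · refine Subtype.ext ?_
    have h1 := restrictAlgebroid_bracket (a := fun x => LinearMap.fst ℝ (Tan EM x) (Cot EM x)
      + (P.sharp x).comp (LinearMap.snd ℝ (Tan EM x) (Cot EM x)))
      (isDiracStructurePoisson_cotangentDirac P) hU hx hσ hτ
    have h2 := courantBracketPoisson_fst_eq_zero P hU hx (fun y _ => h0 y (σ y))
      (fun y _ => h0 y (τ y))
    exact congrArg Prod.snd (h1.trans h2)

theorem isLieAlgebroid_cotangentAlgebroid : (cotangentAlgebroid P).IsLieAlgebroid := by
  refine (isIso_cotangentEquiv P).isLieAlgebroid rfl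
    (isDiracStructurePoisson_cotangentDirac P).isLieAlgebroid ?_
  intro U hU σ σ' τ τ' hσ hτ h1 h2 x hx
  refine Subtype.ext (P.formBracket_congr ?_ ?_)
  · filter_upwards [hU.mem_nhds hx] with y hy
    rw [h1 y hy]
  · filter_upwards [hU.mem_nhds hx] with y hy
    rw [h2 y hy]

theorem anchorHom_cotangentAlgebroid : (cotangentAlgebroid P).AnchorHom :=
  fun _ hU _ _ hσ hτ _ hx => P.sharp_formBracket hU hx hσ hτ

end Cotangent

/-! ### Smooth families of matrices -/

section Matrices

variable {ι : Type*} [Fintype ι] [DecidableEq ι] {U : Set M} {A : M → Matrix ι ι ℝ}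

theorem contMDiffOn_det (h : ∀ i j, ContMDiffOn 𝓘(ℝ, EM) 𝓘(ℝ, ℝ) ∞ (fun x => A x i j) U) :
    ContMDiffOn 𝓘(ℝ, EM) 𝓘(ℝ, ℝ) ∞ (fun x => (A x).det) U := by
  simp only [Matrix.det_apply']
  exact contMDiffOn_finsetSum fun s _ => contMDiffOn_const.mul
    (contMDiffOn_finsetProd fun i _ => h _ _)

/-- By Cramer's rule the entries of the inverse are cofactors divided by the determinant. -/
theorem contMDiffOn_inv_apply (h : ∀ i j, ContMDiffOn 𝓘(ℝ, EM) 𝓘(ℝ, ℝ) ∞ (fun x => A x i j) U)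
    (hd : ∀ x ∈ U, (A x).det ≠ 0) (i j : ι) :
    ContMDiffOn 𝓘(ℝ, EM) 𝓘(ℝ, ℝ) ∞ (fun x => (A x)⁻¹ i j) U := by
  have h1 : ContMDiffOn 𝓘(ℝ, EM) 𝓘(ℝ, ℝ) ∞ (fun x => (A x).adjugate i j) U := by
    simp only [Matrix.adjugate_apply]
    refine contMDiffOn_det fun a b => ?_
    by_cases hab : a = j
    · subst hab
      simp only [Matrix.updateRow_self]
      exact contMDiffOn_const
    · simp only [Matrix.updateRow_ne hab]
      exact h a b
  refine (((contMDiffOn_det h).inv₀ hd).mul h1).congr fun x _ => ?_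
  rw [Matrix.inv_def, Ring.inverse_eq_inv', Matrix.smul_apply, smul_eq_mul]
  rfl

theorem exists_open_det_ne_zero (hU : IsOpen U) {x₀ : M} (hx : x₀ ∈ U)
    (h : ∀ i j, ContMDiffOn 𝓘(ℝ, EM) 𝓘(ℝ, ℝ) ∞ (fun x => A x i j) U) (hd : (A x₀).det ≠ 0) :
    ∃ V ⊆ U, IsOpen V ∧ x₀ ∈ V ∧ ∀ x ∈ V, (A x).det ≠ 0 := by
  refine ⟨_, inter_subset_left, (contMDiffOn_det h).continuousOn.isOpen_inter_preimage hU
    (isOpen_compl_singleton (x := (0 : ℝ))), ⟨hx, hd⟩, fun x hx => hx.2⟩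

end Matrices

/-! ### Coefficients with respect to independent sections -/

section Coefficients

variable {F : Type*} [NormedAddCommGroup F] [NormedSpace ℝ F] {E : M → Type*}
  [∀ x, AddCommGroup (E x)] [∀ x, Module ℝ (E x)]
  [TopologicalSpace (TotalSpace F E)] [∀ x, TopologicalSpace (E x)] [FiberBundle F E]
  {U : Set M} {σ τ : ∀ x, E x} {x : M}

theorem exists_dual_of_linearIndependent {V : Type*} [AddCommGroup V] [Module ℝ V] {r : ℕ}
    {v : Fin r → V} (h : LinearIndependent ℝ v) :
    ∃ l : Fin r → V →ₗ[ℝ] ℝ, ∀ i j, l i (v j) = if i = j then 1 else 0 := by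
  obtain ⟨g, hg⟩ := (Fintype.linearCombination ℝ v).exists_leftInverse_of_injective
    (LinearMap.ker_eq_bot.2 h.fintypeLinearCombination_injective)
  refine ⟨fun i => (LinearMap.proj i).comp g, fun i j => ?_⟩
  have h1 := LinearMap.congr_fun hg (Pi.single j 1)
  rw [LinearMap.comp_apply, Fintype.linearCombination_apply_single, one_smul] at h1
  rw [LinearMap.comp_apply, h1]
  simp [Pi.single_apply]

/-- Independent sections have smooth local dual forms. -/
theorem exists_dual_forms [FiniteDimensional ℝ F] [VectorBundle ℝ F E]
    [ContMDiffVectorBundle ∞ F E 𝓘(ℝ, EM)] {r : ℕ} {e : Fin r → ∀ x, E x} (hU : IsOpen U)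
    (hx : x ∈ U) (he : ∀ i, SmoothSectionOn EM F U (e i))
    (h : LinearIndependent ℝ fun i => e i x) :
    ∃ V ⊆ U, IsOpen V ∧ x ∈ V ∧ ∃ l : Fin r → ∀ x, E x →ₗ[ℝ] ℝ,
      (∀ i W σ, IsOpen W → W ⊆ V → SmoothSectionOn EM F W σ →
        ContMDiffOn 𝓘(ℝ, EM) 𝓘(ℝ, ℝ) ∞ (fun y => l i y (σ y)) W) ∧
      ∀ y ∈ V, ∀ i j, l i y (e j y) = if i = j then 1 else 0 := by
  classical
  let T := trivializationAt F E x
  have hxT : x ∈ T.baseSet := FiberBundle.mem_baseSet_trivializationAt' x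
  have h1 : LinearIndependent ℝ fun i => T.linearMapAt ℝ x (e i x) := by
    refine h.map' (T.linearMapAt ℝ x) ?_
    rw [LinearMap.ker_eq_bot, T.linearMapAt_def_of_mem hxT]
    exact (T.linearEquivAt ℝ x hxT).injective
  -- The forms `m`, dual to the sections at the point `x`, are kept constant in the trivialization.
  -- Their matrix on the sections is the identity at `x`, hence invertible nearby, and multiplying
  -- by its inverse restores duality.
  obtain ⟨m, hm⟩ := exists_dual_of_linearIndependent h1
  have hs : ∀ i W σ, IsOpen W → W ⊆ T.baseSet → SmoothSectionOn EM F W σ →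
      ContMDiffOn 𝓘(ℝ, EM) 𝓘(ℝ, ℝ) ∞ (fun y => m i (T.linearMapAt ℝ y (σ y))) W := by
    intro i W σ hW hWT hσ
    refine ((LinearMap.toContinuousLinearMap (m i)).contMDiff.comp_contMDiffOn
      ((T.contMDiffOn_section_iff hW hWT).1 hσ)).congr fun y hy => ?_
    rw [T.coe_linearMapAt_of_mem (R := ℝ) (hWT hy)]
    rfl
  obtain ⟨V, hVU, hV, hxV, hd⟩ := exists_open_det_ne_zero (EM := EM)
    (A := fun y => Matrix.of fun i j => m i (T.linearMapAt ℝ y (e j y)))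
    (hU.inter T.open_baseSet) ⟨hx, hxT⟩
    (fun i j => hs i _ _ (hU.inter T.open_baseSet) inter_subset_right
      ((he j).mono inter_subset_left)) (by
      have : (Matrix.of fun i j => m i (T.linearMapAt ℝ x (e j x))) = 1 := by
        ext i j
        simp [hm, Matrix.one_apply]
      simp [this])
  have hsm : ∀ i j, ContMDiffOn 𝓘(ℝ, EM) 𝓘(ℝ, ℝ) ∞
      (fun y => m i (T.linearMapAt ℝ y (e j y))) V := fun i j =>
    hs i V _ hV (hVU.trans inter_subset_right) ((he j).mono (hVU.trans inter_subset_left))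
  refine ⟨V, hVU.trans inter_subset_left, hV, hxV, fun i y =>
    ∑ k, (Matrix.of fun i j => m i (T.linearMapAt ℝ y (e j y)))⁻¹ i k • (m k).comp
      (T.linearMapAt ℝ y), fun i W σ hW hWV hσ => ?_, fun y hy i j => ?_⟩
  · simp only [LinearMap.sum_apply, LinearMap.smul_apply, LinearMap.comp_apply, smul_eq_mul]
    exact contMDiffOn_finsetSum fun k _ =>
      ((contMDiffOn_inv_apply hsm hd i k).mono hWV).mul
        (hs k W σ hW (hWV.trans (hVU.trans inter_subset_right)) hσ)
  · have h2 := Matrix.nonsing_inv_mul _ (isUnit_iff_ne_zero.2 (hd y hy))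
    have h3 := congrFun (congrFun h2 i) j
    rw [Matrix.mul_apply, Matrix.one_apply] at h3
    simp only [LinearMap.sum_apply, LinearMap.smul_apply, LinearMap.comp_apply, smul_eq_mul]
    exact h3

namespace PreLieAlgebroid

/-- Smooth sections have smooth coefficients in a smooth frame. -/
theorem IsFrame.exists_coefficients [FiniteDimensional ℝ F] [VectorBundle ℝ F E]
    [ContMDiffVectorBundle ∞ F E 𝓘(ℝ, EM)] {A : PreLieAlgebroid EM F E} {r : ℕ}
    {e : Fin r → ∀ x, A.fiber x} (he : A.IsFrame U e) (hU : IsOpen U) {σ : ∀ x, A.fiber x}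
    (hσ : A.SmoothOn U σ) : ∃ c : Fin r → M → ℝ,
      (∀ i, ContMDiffOn 𝓘(ℝ, EM) 𝓘(ℝ, ℝ) ∞ (c i) U) ∧ ∀ x ∈ U, σ x = ∑ i, c i x • e i x := by
  have h0 : ∀ x, ∃ c : Fin r → ℝ, x ∈ U → σ x = ∑ i, c i • e i x := fun x => by
    by_cases hx : x ∈ U
    · have h1 : σ x ∈ Submodule.span ℝ (range fun i => e i x) := by
        rw [he.span x hx]
        trivial
      obtain ⟨c, hc⟩ := (Submodule.mem_span_range_iff_exists_fun ℝ).1 h1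
      exact ⟨c, fun _ => hc.symm⟩
    · exact ⟨0, fun h => absurd h hx⟩
  choose c hc using h0
  -- The coefficients were chosen point by point. They are smooth because near each point they are
  -- the values of the smooth dual forms.
  refine ⟨fun i x => c x i, fun i x hx => ?_, fun x hx => hc x hx⟩
  obtain ⟨V, hVU, hV, hxV, l, hl, hd⟩ := exists_dual_forms (E := E) hU hx he.smooth
    ((he.linearIndependent x hx).map' (A.fiber x).subtype (by simp))
  refine ((hl i V _ hV subset_rfl (SmoothSectionOn.mono hσ hVU)).congr fun y hy => ?_).contMDiffAt
    (hV.mem_nhds hxV) |>.contMDiffWithinAt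
  rw [hc y (hVU hy), Submodule.coe_sum, map_sum]
  simp [hd y hy]

end PreLieAlgebroid

end Coefficients

/-! ### Submersions -/

section Submersion

variable {EN : Type*} [NormedAddCommGroup EN] [NormedSpace ℝ EN]
  {N : Type*} [TopologicalSpace N] [ChartedSpace EN N] [IsManifold 𝓘(ℝ, EN) ∞ N]
  {p : M → N}

theorem dFun_comp (hp : ContMDiff 𝓘(ℝ, EM) 𝓘(ℝ, EN) ∞ p) {g : N → ℝ} {x : M}
    (hg : MDifferentiableAt 𝓘(ℝ, EN) 𝓘(ℝ, ℝ) g (p x)) :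
    dFun EM (g ∘ p) x = (dFun EN g (p x)).comp (mfderiv 𝓘(ℝ, EM) 𝓘(ℝ, EN) p x) :=
  mfderiv_comp x hg (hp.mdifferentiable (by simp) x)

/-- Submersions have local sections. -/
theorem exists_local_section [FiniteDimensional ℝ EM] [FiniteDimensional ℝ EN]
    (hp : ContMDiff 𝓘(ℝ, EM) 𝓘(ℝ, EN) ∞ p) {x : M}
    (hs : Function.Surjective (mfderiv 𝓘(ℝ, EM) 𝓘(ℝ, EN) p x)) :
    ∃ s : N → M, ContMDiffAt 𝓘(ℝ, EN) 𝓘(ℝ, EM) ∞ s (p x) ∧ s (p x) = x ∧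
      ∀ᶠ y in 𝓝 (p x), p (s y) = y := by
  have hc : CompleteSpace EN := FiniteDimensional.complete ℝ EN
  let φ := extChartAt 𝓘(ℝ, EM) x
  let ψ := extChartAt 𝓘(ℝ, EN) (p x)
  let L : EM →L[ℝ] EN := mfderiv 𝓘(ℝ, EM) 𝓘(ℝ, EN) p x
  obtain ⟨R, hR⟩ := L.toLinearMap.exists_rightInverse_of_surjective (LinearMap.range_eq_top.2 hs)
  let R' : EN →L[ℝ] EM := LinearMap.toContinuousLinearMap R
  -- An affine slice through the point in the direction of a right inverse of dp. In charts `p`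
  -- restricted to the slice has derivative the identity, so the inverse function theorem applies.
  let c : EN → EM := fun w => φ x + R' w
  have hc0 : c 0 = φ x := by simp [c]
  have hcd : ContDiff ℝ ∞ c := contDiff_const.add R'.contDiff
  have hcf : HasFDerivAt c R' 0 := R'.hasFDerivAt.const_add _
  have h1 : ContDiffAt ℝ ∞ (ψ ∘ p ∘ φ.symm) (c 0) := by
    have := (contMDiffAt_iff.1 (hp.contMDiffAt (x := x))).2
    rw [ModelWithCorners.range_eq_univ, contDiffWithinAt_univ] at this
    rwa [hc0]
  have h2 : HasFDerivAt (ψ ∘ p ∘ φ.symm) L (c 0) := by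
    have := (hp.mdifferentiable (by simp) x).hasMFDerivAt.2
    rw [ModelWithCorners.range_eq_univ] at this
    rw [hc0]
    exact hasFDerivWithinAt_univ.1 this
  have h3 : ContDiffAt ℝ ∞ ((ψ ∘ p ∘ φ.symm) ∘ c) 0 := h1.comp 0 hcd.contDiffAt
  have h4 : HasFDerivAt ((ψ ∘ p ∘ φ.symm) ∘ c) (ContinuousLinearEquiv.refl ℝ EN : EN →L[ℝ] EN) 0 := by
    have := h2.comp 0 hcf
    have e : L.comp R' = ContinuousLinearEquiv.refl ℝ EN := by
      ext w
      exact LinearMap.congr_fun hR w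
    rwa [e] at this
  have hn : (∞ : WithTop ℕ∞) ≠ 0 := by simp
  let q := h3.localInverse h4 hn
  have hq0 : ((ψ ∘ p ∘ φ.symm) ∘ c) 0 = ψ (p x) := by
    simp only [Function.comp_apply, hc0]
    rw [extChartAt_to_inv]
  have hq : ContDiffAt ℝ ∞ q (ψ (p x)) := hq0 ▸ h3.to_localInverse h4 hn
  have hq1 : q (ψ (p x)) = 0 := hq0 ▸ h3.localInverse_apply_image h4 hn
  have hq2 : ∀ᶠ w in 𝓝 (ψ (p x)), ((ψ ∘ p ∘ φ.symm) ∘ c) (q w) = w :=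
    hq0 ▸ (h3.hasStrictFDerivAt' h4 hn).eventually_right_inverse
  have hs1 : ContMDiffAt 𝓘(ℝ, EN) 𝓘(ℝ, EM) ∞ (fun y => c (q (ψ y))) (p x) :=
    hcd.contMDiff.contMDiffAt.comp (p x) (ContMDiffAt.comp (p x) hq.contMDiffAt contMDiffAt_extChartAt)
  have hs0 : c (q (ψ (p x))) = φ x := by rw [hq1, hc0]
  have hs2 : ContMDiffAt 𝓘(ℝ, EN) 𝓘(ℝ, EM) ∞ (fun y => φ.symm (c (q (ψ y)))) (p x) := by
    refine ContMDiffAt.comp (p x) (g := φ.symm) ?_ hs1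
    rw [hs0]
    exact (contMDiffOn_extChartAt_symm x).contMDiffAt (extChartAt_target_mem_nhds x)
  have hs3 : φ.symm (c (q (ψ (p x)))) = x := by rw [hs0, extChartAt_to_inv]
  refine ⟨_, hs2, hs3, ?_⟩
  have h5 := (continuousAt_extChartAt (I := 𝓘(ℝ, EN)) (p x)).eventually hq2
  have h6 : ∀ᶠ y in 𝓝 (p x), p (φ.symm (c (q (ψ y)))) ∈ ψ.source := by
    refine ContinuousAt.eventually_mem (hp.continuous.continuousAt.comp hs2.continuousAt) ?_
    simp only [Function.comp_apply, hs3]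
    exact extChartAt_source_mem_nhds (p x)
  filter_upwards [h5, h6, extChartAt_source_mem_nhds (I := 𝓘(ℝ, EN)) (p x)] with y h5 h6 h7
  exact ψ.injOn h6 h7 h5

/-- Functions descend smoothly along surjective submersions. -/
theorem contMDiff_of_comp [FiniteDimensional ℝ EM] [FiniteDimensional ℝ EN]
    (hp : ContMDiff 𝓘(ℝ, EM) 𝓘(ℝ, EN) ∞ p) (hsurj : Function.Surjective p)
    (hs : ∀ x, Function.Surjective (mfderiv 𝓘(ℝ, EM) 𝓘(ℝ, EN) p x)) {F : N → ℝ}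
    (hF : ContMDiff 𝓘(ℝ, EM) 𝓘(ℝ, ℝ) ∞ (F ∘ p)) : ContMDiff 𝓘(ℝ, EN) 𝓘(ℝ, ℝ) ∞ F := by
  intro y
  obtain ⟨x, rfl⟩ := hsurj y
  obtain ⟨s, hs1, hs2, hs3⟩ := exists_local_section hp (hs x)
  have h1 : ContMDiffAt 𝓘(ℝ, EN) 𝓘(ℝ, ℝ) ∞ ((F ∘ p) ∘ s) (p x) := hF.contMDiffAt.comp _ hs1
  refine h1.congr_of_eventuallyEq ?_
  filter_upwards [hs3] with y hy
  rw [Function.comp_apply, Function.comp_apply, hy]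

/-- Coordinates on the base of a submersion, with local lifts of the coordinate fields. -/
theorem exists_adapted_coordinates [T2Space M] [FiniteDimensional ℝ EM] [T2Space N]
    [FiniteDimensional ℝ EN] (hp : ContMDiff 𝓘(ℝ, EM) 𝓘(ℝ, EN) ∞ p) {x₀ : M}
    (hs : Function.Surjective (mfderiv 𝓘(ℝ, EM) 𝓘(ℝ, EN) p x₀)) :
    ∃ (f : Fin (Module.finrank ℝ EN) → N → ℝ) (W : Fin (Module.finrank ℝ EN) → ∀ y : N, Tan EN y)
      (V : Set N) (H : Fin (Module.finrank ℝ EN) → ∀ x : M, Tan EM x) (U : Set M),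
      (∀ i, ContMDiff 𝓘(ℝ, EN) 𝓘(ℝ, ℝ) ∞ (f i)) ∧ (∀ i, SmoothSectionOn EN EN univ (W i)) ∧
      IsOpen V ∧ IsOpen U ∧ x₀ ∈ U ∧ (∀ x ∈ U, p x ∈ V) ∧
      (∀ y ∈ V, ∀ i j, dFun EN (f i) y (W j y) = if i = j then 1 else 0) ∧
      (∀ y ∈ V, ∀ v : Tan EN y, v = ∑ i, dFun EN (f i) y v • W i y) ∧
      (∀ y ∈ V, ∀ α : Cot EN y, α = ∑ i, α (W i y) • dFun EN (f i) y) ∧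
      (∀ i, SmoothSectionOn EM EM U (H i)) ∧
      ∀ x ∈ U, ∀ i, mfderiv 𝓘(ℝ, EM) 𝓘(ℝ, EN) p x (H i x) = W i (p x) := by
  classical
  obtain ⟨f, W, V, hf, hW, hV, hxV, hd, hv, ha⟩ := exists_coordinates_expand (EM := EN) (p x₀)
  choose u hu using fun i => hs (W i (p x₀))
  choose H₀ hH₀ hH₀u using fun i => exists_field_eq (u i)
  have hc : ∀ i x, dFun EM (f i ∘ p) x
      = (dFun EN (f i) (p x)).comp (mfderiv 𝓘(ℝ, EM) 𝓘(ℝ, EN) p x) := fun i x =>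
    dFun_comp hp ((hf i).mdifferentiable (by simp) _)
  have hsm : ∀ i j, ContMDiffOn 𝓘(ℝ, EM) 𝓘(ℝ, ℝ) ∞ (fun x => dFun EM (f i ∘ p) x (H₀ j x)) univ :=
    fun i j => (smoothSectionOn_dFun isOpen_univ ((hf i).comp hp).contMDiffOn).apply (hH₀ j)
  have hpV : IsOpen (p ⁻¹' V) := hV.preimage hp.continuous
  -- The fields `H₀ j` lift the coordinate fields at `x₀` only. The matrix of their derivatives of
  -- the pulled back coordinates is the identity there, and its inverse corrects them to lifts on a
  -- neighbourhood.
  obtain ⟨U, hUp, hU, hxU, hdet⟩ := exists_open_det_ne_zero (EM := EM)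
    (A := fun x => Matrix.of fun i j => dFun EM (f i ∘ p) x (H₀ j x)) hpV hxV
    (fun i j => (hsm i j).mono (subset_univ _)) (by
      have : (Matrix.of fun i j => dFun EM (f i ∘ p) x₀ (H₀ j x₀)) = 1 := by
        ext i j
        rw [Matrix.of_apply, hc, Matrix.one_apply, ← hd (p x₀) hxV i j, ← hu, ← hH₀u]
        rfl
      simp [this])
  have hinv := contMDiffOn_inv_apply (fun i j => (hsm i j).mono (subset_univ U)) hdet
  refine ⟨f, W, V, fun j x => ∑ k, (Matrix.of fun i j => dFun EM (f i ∘ p) x (H₀ j x))⁻¹ k j • H₀ k x,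
    U, hf, hW, hV, hU, hxU, hUp, hd, hv, ha, fun j => SmoothSectionOn.sum fun k _ =>
      SmoothSectionOn.smul (hinv k j) ((hH₀ k).mono (subset_univ _)), fun x hx j => ?_⟩
  have key : ∀ i, dFun EN (f i) (p x) (mfderiv 𝓘(ℝ, EM) 𝓘(ℝ, EN) p x
      (∑ k, (Matrix.of fun i j => dFun EM (f i ∘ p) x (H₀ j x))⁻¹ k j • H₀ k x))
      = if i = j then 1 else 0 := fun i => by
    have h2 := Matrix.mul_nonsing_inv _ (isUnit_iff_ne_zero.2 (hdet x hx))
    have h3 := congrFun (congrFun h2 i) j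
    rw [Matrix.mul_apply, Matrix.one_apply] at h3
    rw [← h3, map_sum, map_sum]
    refine Finset.sum_congr rfl fun k _ => ?_
    rw [map_smul, map_smul, smul_eq_mul, mul_comm, Matrix.of_apply, hc]
    rfl
  rw [hv (p x) (hUp hx) (mfderiv 𝓘(ℝ, EM) 𝓘(ℝ, EN) p x _)]
  simp only [key]
  simp

/-- Tangent vectors killed by a submersion extend to local vertical fields. -/
theorem exists_vertical_field [T2Space M] [FiniteDimensional ℝ EM] [T2Space N]
    [FiniteDimensional ℝ EN] (hp : ContMDiff 𝓘(ℝ, EM) 𝓘(ℝ, EN) ∞ p) {x₀ : M}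
    (hs : Function.Surjective (mfderiv 𝓘(ℝ, EM) 𝓘(ℝ, EN) p x₀)) {v : Tan EM x₀}
    (hv : mfderiv 𝓘(ℝ, EM) 𝓘(ℝ, EN) p x₀ v = 0) :
    ∃ (U : Set M) (X : ∀ x : M, Tan EM x), IsOpen U ∧ x₀ ∈ U ∧ SmoothSectionOn EM EM U X ∧
      X x₀ = v ∧ ∀ x ∈ U, mfderiv 𝓘(ℝ, EM) 𝓘(ℝ, EN) p x (X x) = 0 := by
  obtain ⟨f, W, V, H, U, hf, hW, hV, hU, hxU, hUV, hd, he, -, hH, hHW⟩ :=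
    exists_adapted_coordinates hp hs
  obtain ⟨X, hX, hXv⟩ := exists_field_eq v
  have hc : ∀ i x, dFun EM (f i ∘ p) x
      = (dFun EN (f i) (p x)).comp (mfderiv 𝓘(ℝ, EM) 𝓘(ℝ, EN) p x) := fun i x =>
    dFun_comp hp ((hf i).mdifferentiable (by simp) _)
  -- The horizontal part of an arbitrary extension is subtracted. This does not change the value at
  -- `x₀`, since `v` is vertical.
  refine ⟨U, fun x => X x - ∑ i, dFun EM (f i ∘ p) x (X x) • H i x, hU, hxU, ?_, ?_, ?_⟩
  · refine (hX.mono (subset_univ _)).sub (SmoothSectionOn.sum fun i _ => SmoothSectionOn.smul ?_ (hH i))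
    exact ((smoothSectionOn_dFun isOpen_univ ((hf i).comp hp).contMDiffOn).apply hX).mono
      (subset_univ _)
  · beta_reduce
    rw [hXv]
    simp only [hc, ContinuousLinearMap.comp_apply]
    rw [hv]
    simp
  · intro x hx
    rw [map_sub, map_sum]
    simp only [map_smul, hHW x hx, hc, ContinuousLinearMap.comp_apply]
    rw [← he (p x) (hUV x hx), sub_self]

end Submersion

/-! ### Reduction of Dirac structures -/

section Reduction

theorem exists_section_through {F : Type*} [NormedAddCommGroup F] [NormedSpace ℝ F] {E : M → Type*}
    [∀ x, AddCommGroup (E x)] [∀ x, Module ℝ (E x)] [TopologicalSpace (TotalSpace F E)]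
    [∀ x, TopologicalSpace (E x)] [FiberBundle F E] [VectorBundle ℝ F E]
    [ContMDiffVectorBundle ∞ F E 𝓘(ℝ, EM)] {r : ℕ} {W : ∀ x, Submodule ℝ (E x)}
    (h : IsSmoothSubbundle EM F r W) {x : M} {u : E x} (hu : u ∈ W x) :
    ∃ (U : Set M) (σ : ∀ x, E x), IsOpen U ∧ x ∈ U ∧ SmoothSectionOn EM F U σ ∧
      (∀ y ∈ U, σ y ∈ W y) ∧ σ x = u := by
  obtain ⟨U, hU, hx, e, he, h'⟩ := h x
  rw [← (h' x hx).2] at hu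
  obtain ⟨c, hc⟩ := (Submodule.mem_span_range_iff_exists_fun ℝ).1 hu
  refine ⟨U, fun y => ∑ i, c i • e i y, hU, hx, SmoothSectionOn.sum fun i _ =>
    SmoothSectionOn.smul contMDiffOn_const (he i), fun y hy => ?_, hc⟩
  rw [← (h' y hy).2]
  exact Submodule.sum_mem _ fun i _ => Submodule.smul_mem _ _ (Submodule.subset_span ⟨i, rfl⟩)

/-- Functions with vanishing differential along a distribution are constant on its leaves. -/
theorem eq_of_leaves {D : ∀ x : M, Submodule ℝ (Tan EM x)} {G : M → ℝ}
    (hG : ContMDiff 𝓘(ℝ, EM) 𝓘(ℝ, ℝ) ∞ G) (h : ∀ x, ∀ v ∈ D x, dFun EM G x v = 0) {x y : M}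
    (hxy : leaves D x y) : G x = G y := by
  induction hxy with
  | rel x y hxy =>
    obtain ⟨γ, hγ, hd, rfl, rfl⟩ := hxy
    have h1 : ∀ t, HasDerivAt (G ∘ γ) 0 t := fun t => by
      let D : ℝ →L[ℝ] ℝ := (mfderiv 𝓘(ℝ, EM) 𝓘(ℝ, ℝ) G (γ t)).comp
        (mfderiv 𝓘(ℝ, ℝ) 𝓘(ℝ, EM) γ t)
      have h2 : HasFDerivAt (G ∘ γ) D t :=
        (HasMFDerivAt.comp t (hG.mdifferentiable (by simp) (γ t)).hasMFDerivAt
          (hγ.mdifferentiable (by simp) t).hasMFDerivAt).hasFDerivAt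
      have h3 : D 1 = 0 := h (γ t) _ (hd t)
      rw [← h3]
      exact h2.hasDerivAt
    exact is_const_of_deriv_eq_zero (fun t => (h1 t).differentiableAt) (fun t => (h1 t).deriv) 0 1
  | refl x => rfl
  | symm x y _ ih => exact ih.symm
  | trans x y z _ _ ih ih' => exact ih.trans ih'

variable [FiniteDimensional ℝ EM] [T2Space M]
  {EN : Type*} [NormedAddCommGroup EN] [NormedSpace ℝ EN] [FiniteDimensional ℝ EN]
  {N : Type*} [TopologicalSpace N] [T2Space N] [ChartedSpace EN N] [IsManifold 𝓘(ℝ, EN) ∞ N]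
  {L : ∀ x : M, Submodule ℝ (GenTan EM x)} {p : C^∞⟮𝓘(ℝ, EM), M; 𝓘(ℝ, EN), N⟯} {x : M}
  {f g : N → ℝ}

theorem charDist_eq_of_shift (P : PoissonStructure EM M) :
    charDist (shiftImage P L) = charDist L := funext fun _ => charDist_shiftImage P

theorem IsReduction.shiftImage (h : IsReduction L p) (P : PoissonStructure EM M) :
    IsReduction (shiftImage P L) p := by
  obtain ⟨h1, h2, h3, h4, h5⟩ := h
  refine ⟨?_, h2, h3, ?_, ?_⟩
  · rwa [charDist_eq_of_shift]
  · rwa [charFoliation, charDist_eq_of_shift]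
  · rwa [charDist_eq_of_shift]

theorem dFun_comp_apply (hf : ContMDiff 𝓘(ℝ, EN) 𝓘(ℝ, ℝ) ∞ f) (v : Tan EM x) :
    dFun EM (f ∘ p) x v = dFun EN f (p x) (mfderiv 𝓘(ℝ, EM) 𝓘(ℝ, EN) p x v) := by
  rw [dFun_comp p.contMDiff (hf.mdifferentiable (by simp) _)]
  rfl

variable (hL : IsDiracStructure L) (hr : IsReduction L p)

theorem dFun_comp_eq_zero (hr : IsReduction L p) (hf : ContMDiff 𝓘(ℝ, EN) 𝓘(ℝ, ℝ) ∞ f)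
    {v : Tan EM x} (hv : v ∈ charDist L x) : dFun EM (f ∘ p) x v = 0 := by
  rw [dFun_comp_apply hf, (hr.tangent x v).2 hv, map_zero]

theorem sub_mem_charDist {X X' : Tan EM x} {α : Cot EM x} (h : (X, α) ∈ L x)
    (h' : (X', α) ∈ L x) : X - X' ∈ charDist L x := by
  have := sub_mem h h'
  rw [Prod.mk_sub_mk, sub_self] at this
  exact this

/-- A pulled back covector kills ker dp, which is the characteristic distribution, so maximal
isotropy provides a lift. -/
theorem exists_mem_comp (hL : IsDiracStructure L) (hr : IsReduction L p) (β : Cot EN (p x)) :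
    ∃ X, (X, β.comp (mfderiv 𝓘(ℝ, EM) 𝓘(ℝ, EN) p x)) ∈ L x :=
  exists_mem_of_forall_charDist (hL.maximal x) fun v hv => by
    rw [ContinuousLinearMap.comp_apply, (hr.tangent x v).2 hv, map_zero]

/-- Local smooth lifts of basic one-forms. -/
theorem exists_local_lift (hL : IsDiracStructure L) (hr : IsReduction L p)
    {α : ∀ x : M, Cot EM x} (hα : SmoothSectionOn EM (EM →L[ℝ] ℝ) univ α)
    (hd : ∀ x, ∀ v ∈ charDist L x, α x v = 0) (x₀ : M) :
    ∃ (U : Set M) (X : ∀ x : M, Tan EM x), IsOpen U ∧ x₀ ∈ U ∧ SmoothSectionOn EM EM U X ∧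
      ∀ x ∈ U, (X x, α x) ∈ L x := by
  classical
  obtain ⟨f, W, V, H, U, hf, hW, hV, hU, hxU, hUV, hdu, he, -, hH, hHW⟩ :=
    exists_adapted_coordinates p.contMDiff (hr.submersion x₀)
  -- A covector that kills the characteristic distribution is determined by its values on the
  -- horizontal fields `H i`.
  have hex : ∀ x ∈ U, ∀ γ : Cot EM x, (∀ v ∈ charDist L x, γ v = 0) →
      γ = ∑ i, γ (H i x) • dFun EM (f i ∘ p) x := fun x hx γ hγ => by
    ext v
    have h1 : v - ∑ i, dFun EM (f i ∘ p) x v • H i x ∈ charDist L x := by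
      rw [← hr.tangent, map_sub, map_sum]
      simp only [map_smul, hHW x hx, dFun_comp_apply (hf _)]
      rw [← he (p x) (hUV x hx), sub_self]
    have h2 := hγ _ h1
    rw [map_sub, map_sum, sub_eq_zero] at h2
    rw [h2, _root_.sum_apply]
    exact Finset.sum_congr rfl fun i _ => by
      rw [map_smul, _root_.smul_apply, smul_eq_mul, smul_eq_mul, mul_comm]
  -- Lifts of the basic differentials at `x₀` are extended to smooth sections of `L`. Away from `x₀`
  -- their form parts are no longer these differentials, but they still span the annihilator of the
  -- characteristic distribution nearby.
  have h0 : ∀ j, ∃ Z, (Z, dFun EM (f j ∘ p) x₀) ∈ L x₀ := fun j =>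
    exists_mem_of_forall_charDist (hL.maximal x₀) fun v hv => dFun_comp_eq_zero hr (hf j) hv
  choose Z₀ hZ₀ using h0
  choose O Z hO hxO hZ hZL hZx using fun j =>
    exists_section_through hL.isSmoothSubbundle (hZ₀ j)
  have hUO : IsOpen (U ∩ ⋂ j, O j) := hU.inter (isOpen_iInter_of_finite hO)
  have hxUO : x₀ ∈ U ∩ ⋂ j, O j := ⟨hxU, mem_iInter.2 hxO⟩
  have hsub : ∀ j, U ∩ ⋂ j, O j ⊆ O j := fun j y hy => mem_iInter.1 hy.2 j
  have hsm : ∀ i j, ContMDiffOn 𝓘(ℝ, EM) 𝓘(ℝ, ℝ) ∞ (fun x => (Z j x).2 (H i x)) (U ∩ ⋂ j, O j) :=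
    fun i j => ((hZ j).snd.mono (hsub j)).apply ((hH i).mono inter_subset_left)
  obtain ⟨T, hTU, hT, hxT, hdet⟩ := exists_open_det_ne_zero (EM := EM)
    (A := fun x => Matrix.of fun i j => (Z j x).2 (H i x)) hUO hxUO hsm (by
      have : (Matrix.of fun i j => (Z j x₀).2 (H i x₀)) = 1 := by
        ext i j
        rw [Matrix.of_apply, Matrix.one_apply, hZx, dFun_comp_apply (hf j), hHW x₀ hxU,
          hdu _ (hUV x₀ hxU)]
        exact if_congr eq_comm rfl rfl
      simp [this])
  have hinv := contMDiffOn_inv_apply (fun i j => (hsm i j).mono hTU) hdet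
  -- `C` solves the linear system for the combination of the `Z k` whose form part agrees with `α`
  -- on all `H i`. By `hex` the two forms are then equal.
  let C : M → Matrix _ _ ℝ := fun x => (Matrix.of fun i j => (Z j x).2 (H i x))⁻¹
  have hcs : ∀ k, ContMDiffOn 𝓘(ℝ, EM) 𝓘(ℝ, ℝ) ∞ (fun x => ∑ j, C x k j * α x (H j x)) T :=
    fun k => contMDiffOn_finsetSum fun j _ => (hinv k j).mul
      ((hα.mono (subset_univ _)).apply ((hH j).mono (hTU.trans inter_subset_left)))
  have hS : SmoothSectionOn EM (GenModel EM) T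
      (fun x => ∑ k, (∑ j, C x k j * α x (H j x)) • Z k x) :=
    SmoothSectionOn.sum fun k _ => SmoothSectionOn.smul (hcs k) ((hZ k).mono (hTU.trans (hsub k)))
  have hSL : ∀ x ∈ T, (∑ k, (∑ j, C x k j * α x (H j x)) • Z k x) ∈ L x := fun x hx =>
    Submodule.sum_mem _ fun k _ => Submodule.smul_mem _ _ (hZL k x (hsub k (hTU hx)))
  refine ⟨T, _, hT, hxT, hS.fst, fun x hx => ?_⟩
  convert hSL x hx using 1
  refine Prod.ext rfl ?_
  have hxU' : x ∈ U := (hTU hx).1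
  refine (hex x hxU' (α x) (hd x)).trans (Eq.trans ?_ (hex x hxU' _ fun v hv =>
    apply_eq_zero_of_mem_charDist (hL.maximal x).prop (hSL x hx) hv).symm)
  refine Finset.sum_congr rfl fun i _ => congrArg (· • _) ?_
  have h2 := Matrix.mul_nonsing_inv _ (isUnit_iff_ne_zero.2 (hdet x hx))
  have h3 : ∀ j, ∑ k, (Z k x).2 (H i x) * C x k j = if i = j then 1 else 0 := fun j => by
    have h3 := congrFun (congrFun h2 i) j
    rwa [Matrix.mul_apply, Matrix.one_apply] at h3
  rw [Prod.snd_sum, _root_.sum_apply]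
  simp only [Prod.smul_snd, _root_.smul_apply, smul_eq_mul, Finset.sum_mul]
  rw [Finset.sum_comm]
  have h4 : ∀ j, ∑ k, C x k j * α x (H j x) * (Z k x).2 (H i x)
      = (if i = j then 1 else 0) * α x (H j x) := fun j => by
    rw [← h3, Finset.sum_mul]
    exact Finset.sum_congr rfl fun k _ => by ring
  simp only [h4]
  simp

/-- For a fixed covector the admissible vectors form an affine, hence convex, set, so local lifts
are glued by a partition of unity. -/
theorem exists_lift [SigmaCompactSpace M] (hL : IsDiracStructure L) (hr : IsReduction L p)
    {α : ∀ x : M, Cot EM x} (hα : SmoothSectionOn EM (EM →L[ℝ] ℝ) univ α)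
    (hd : ∀ x, ∀ v ∈ charDist L x, α x v = 0) :
    ∃ X : ∀ x : M, Tan EM x, SmoothSectionOn EM EM univ X ∧ ∀ x, (X x, α x) ∈ L x := by
  have hconv : ∀ x, Convex ℝ {X : Tan EM x | (X, α x) ∈ L x} := by
    intro x X hX Y hY a b _ _ hab
    have h1 := add_mem (Submodule.smul_mem _ a hX) (Submodule.smul_mem _ b hY)
    have h2 : a • (X, α x) + b • (Y, α x) = (a • X + b • Y, α x) := by
      rw [Prod.smul_mk, Prod.smul_mk, Prod.mk_add_mk, ← add_smul, hab, one_smul]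
    rw [h2] at h1
    exact h1
  obtain ⟨s, hs⟩ := exists_contMDiffSection_forall_mem_convex_of_local (n := (⊤ : ℕ∞)) 𝓘(ℝ, EM)
    (F_fiber := EM) (fun x => Tan EM x) (fun x => {X | (X, α x) ∈ L x}) hconv fun x₀ => by
      obtain ⟨U, X, hU, hx, hX, h⟩ := exists_local_lift hL hr hα hd x₀
      exact ⟨U, hU.mem_nhds hx, X, hX, h⟩
  exact ⟨fun x => s x, s.contMDiff.contMDiffOn, hs⟩

/-- Integrability, for sections with exact form part. -/
theorem lieVec_mem (hL : IsDiracStructure L) {U : Set M} (hU : IsOpen U) (hx : x ∈ U)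
    {X Y : ∀ x : M, Tan EM x} {F G : M → ℝ} (hF : ContMDiffOn 𝓘(ℝ, EM) 𝓘(ℝ, ℝ) ∞ F U)
    (hG : ContMDiffOn 𝓘(ℝ, EM) 𝓘(ℝ, ℝ) ∞ G U) (hX : SmoothSectionOn EM EM U X)
    (hY : SmoothSectionOn EM EM U Y) (h : ∀ y ∈ U, (X y, dFun EM F y) ∈ L y)
    (h' : ∀ y ∈ U, (Y y, dFun EM G y) ∈ L y) :
    (lieVec X Y x, dFun EM (fun y => dFun EM G y (X y)) x) ∈ L x := by
  have hs := smoothSectionOn_gen_iff (σ := fun y => (X y, dFun EM F y)).2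
    ⟨hX, smoothSectionOn_dFun hU hF⟩
  have hs' := smoothSectionOn_gen_iff (σ := fun y => (Y y, dFun EM G y)).2
    ⟨hY, smoothSectionOn_dFun hU hG⟩
  have h1 := hL.integrable U hU _ _ hs hs' h h' x hx
  rw [courantBracket_eq_dorfman hU hx hs hs' fun y hy =>
    (hL.maximal y).prop _ (h y hy) _ (h' y hy)] at h1
  convert h1 using 1
  refine Prod.ext rfl ?_
  change _ = lieForm X (dFun EM G) x - dForm (dFun EM F) x (Y x)
  -- Exact forms are closed, so only the differential of X(G) survives in the form part of the
  -- Dorfman bracket.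
  rw [lieForm, dForm_dFun hU hx hF, dForm_dFun hU hx hG]
  change _ = 0 + dFun EM (fun y => dFun EM G y (X y)) x - 0
  rw [zero_add, sub_zero]

/-- Extend `v` to a vertical field V, a section of `L` with zero form part. Its bracket with the
lift has form part d(V(f ∘ p)) = 0, so [V, X] is again vertical. Then V(X(g ∘ p)) = [V, X](g ∘ p) +
X(V(g ∘ p)) = 0. -/
theorem dFun_lift_eq_zero (hL : IsDiracStructure L) (hr : IsReduction L p)
    (hf : ContMDiff 𝓘(ℝ, EN) 𝓘(ℝ, ℝ) ∞ f) (hg : ContMDiff 𝓘(ℝ, EN) 𝓘(ℝ, ℝ) ∞ g)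
    {X : ∀ x : M, Tan EM x} (hX : SmoothSectionOn EM EM univ X)
    (h : ∀ x, (X x, dFun EM (f ∘ p) x) ∈ L x) {v : Tan EM x} (hv : v ∈ charDist L x) :
    dFun EM (fun y => dFun EM (g ∘ p) y (X y)) x v = 0 := by
  obtain ⟨U, V, hU, hx, hV, rfl, hVp⟩ := exists_vertical_field p.contMDiff (hr.submersion x)
    ((hr.tangent x v).2 hv)
  have hc : ∀ {f : N → ℝ}, ContMDiff 𝓘(ℝ, EN) 𝓘(ℝ, ℝ) ∞ f →
      (fun y => dFun EM (f ∘ p) y (V y)) =ᶠ[𝓝 x] fun _ => 0 := fun hf => by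
    filter_upwards [hU.mem_nhds hx] with y hy
    exact dFun_comp_eq_zero hr hf ((hr.tangent y _).1 (hVp y hy))
  have hXU := hX.mono (subset_univ U)
  have hfp := (hf.comp p.contMDiff).contMDiffOn (s := U)
  have hgp := (hg.comp p.contMDiff).contMDiffOn (s := U)
  have h1 := lieVec_mem hL hU hx (F := fun _ => 0) (contMDiffOn_const) hfp hV hXU
    (fun y hy => by
      rw [dFun_const]
      exact (hr.tangent y _).1 (hVp y hy)) (fun y _ => h y)
  rw [dFun_congr (hc hf), dFun_const] at h1
  have h2 := dFun_comp_eq_zero hr hg (v := lieVec V X x) h1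
  rw [dFun_lieVec hU hx hgp hV hXU, dFun_congr (hc hg), dFun_const] at h2
  simpa using h2

/-- The bracket of functions on the leaf space. -/
theorem exists_reduced_bracket [SigmaCompactSpace M] (hL : IsDiracStructure L)
    (hr : IsReduction L p) (hf : ContMDiff 𝓘(ℝ, EN) 𝓘(ℝ, ℝ) ∞ f)
    (hg : ContMDiff 𝓘(ℝ, EN) 𝓘(ℝ, ℝ) ∞ g) :
    ∃ B : N → ℝ, ContMDiff 𝓘(ℝ, EN) 𝓘(ℝ, ℝ) ∞ B ∧ ∀ x X, (X, dFun EM (f ∘ p) x) ∈ L x →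
      B (p x) = dFun EM (g ∘ p) x X := by
  have hfp := hf.comp p.contMDiff
  have hgp := hg.comp p.contMDiff
  obtain ⟨X, hX, h⟩ := exists_lift hL hr (smoothSectionOn_dFun isOpen_univ hfp.contMDiffOn)
    (fun x v hv => dFun_comp_eq_zero hr hf hv)
  have hG : ContMDiff 𝓘(ℝ, EM) 𝓘(ℝ, ℝ) ∞ (fun y => dFun EM (g ∘ p) y (X y)) :=
    contMDiffOn_univ.1 ((smoothSectionOn_dFun isOpen_univ hgp.contMDiffOn).apply hX)
  -- A function with vanishing derivative along the characteristic distribution is constant on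
  -- leaves, and the leaves are the fibres of `p`.
  have hc : ∀ x y, p x = p y → dFun EM (g ∘ p) x (X x) = dFun EM (g ∘ p) y (X y) := fun x y hxy =>
    eq_of_leaves hG (fun x v hv => dFun_lift_eq_zero hL hr hf hg hX h hv) ((hr.fibres x y).1 hxy)
  -- An arbitrary preimage serves here. Smoothness is recovered from that of `B ∘ p`, because `p` is
  -- a submersion.
  let B : N → ℝ := fun y => dFun EM (g ∘ p) (Function.surjInv hr.surjective y)
    (X (Function.surjInv hr.surjective y))
  have hB : B ∘ p = fun y => dFun EM (g ∘ p) y (X y) := funext fun x =>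
    hc _ _ (Function.surjInv_eq hr.surjective _)
  refine ⟨B, contMDiff_of_comp p.contMDiff hr.surjective hr.submersion (hB ▸ hG), fun x X' hX' => ?_⟩
  have h1 := dFun_comp_eq_zero hr hg (sub_mem_charDist (h x) hX')
  rw [map_sub, sub_eq_zero] at h1
  exact (congrFun hB x).trans h1

end Reduction

/-! ### The Poisson structure on the leaf space and its uniqueness. -/

section ReducedPoisson

variable [FiniteDimensional ℝ EM] [T2Space M] [SigmaCompactSpace M]
  {EN : Type*} [NormedAddCommGroup EN] [NormedSpace ℝ EN] [FiniteDimensional ℝ EN]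
  {N : Type*} [TopologicalSpace N] [T2Space N] [ChartedSpace EN N] [IsManifold 𝓘(ℝ, EN) ∞ N]
  {L : ∀ x : M, Submodule ℝ (GenTan EM x)} {p : C^∞⟮𝓘(ℝ, EM), M; 𝓘(ℝ, EN), N⟯} {x : M}

/-- The value at a covector β over p(x) is p_*X for any lift X of p^*β at x. It is independent of
the chosen point of the fibre because the brackets of functions descend to functions on `N`. -/
theorem exists_reduced_sharp (hL : IsDiracStructure L) (hr : IsReduction L p) :
    ∃ sharp : ∀ y : N, Cot EN y → Tan EN y, ∀ f g : N → ℝ, ContMDiff 𝓘(ℝ, EN) 𝓘(ℝ, ℝ) ∞ f →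
      ContMDiff 𝓘(ℝ, EN) 𝓘(ℝ, ℝ) ∞ g → ∀ x X, (X, dFun EM (f ∘ p) x) ∈ L x →
      dFun EN g (p x) (sharp (p x) (dFun EN f (p x))) = dFun EM (g ∘ p) x X := by
  have h0 : ∀ f g : N → ℝ, ∃ B : N → ℝ, ContMDiff 𝓘(ℝ, EN) 𝓘(ℝ, ℝ) ∞ f →
      ContMDiff 𝓘(ℝ, EN) 𝓘(ℝ, ℝ) ∞ g → ∀ x X, (X, dFun EM (f ∘ p) x) ∈ L x →
      B (p x) = dFun EM (g ∘ p) x X := fun f g => by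
    by_cases h : ContMDiff 𝓘(ℝ, EN) 𝓘(ℝ, ℝ) ∞ f ∧ ContMDiff 𝓘(ℝ, EN) 𝓘(ℝ, ℝ) ∞ g
    · obtain ⟨B, -, hB⟩ := exists_reduced_bracket hL hr h.1 h.2
      exact ⟨B, fun _ _ => hB⟩
    · exact ⟨0, fun hf hg => absurd ⟨hf, hg⟩ h⟩
  choose B hB using h0
  have h1 : ∀ (y : N) (β : Cot EN y), ∃ w : Tan EN y, ∀ f g : N → ℝ,
      ContMDiff 𝓘(ℝ, EN) 𝓘(ℝ, ℝ) ∞ f → ContMDiff 𝓘(ℝ, EN) 𝓘(ℝ, ℝ) ∞ g → dFun EN f y = β →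
      dFun EN g y w = B f g y := fun y β => by
    obtain ⟨x, rfl⟩ := hr.surjective y
    obtain ⟨X, hX⟩ := exists_mem_comp hL hr β
    refine ⟨mfderiv 𝓘(ℝ, EM) 𝓘(ℝ, EN) p x X, fun f g hf hg hfβ => ?_⟩
    rw [← dFun_comp_apply hg, hB f g hf hg x X]
    rwa [dFun_comp p.contMDiff (hf.mdifferentiable (by simp) _), hfβ]
  choose sharp hs using h1
  exact ⟨sharp, fun f g hf hg x X hX => (hs _ _ f g hf hg rfl).trans (hB f g hf hg x X hX)⟩

/-- Linearity comes from adding and scaling lifts, skewness from isotropy of `L`, and smoothness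
from that of the brackets of coordinate functions. The Jacobi identity comes from integrability. -/
theorem exists_isInducedPoisson (hL : IsDiracStructure L) (hr : IsReduction L p) :
    ∃ PN : PoissonStructure EN N, IsInducedPoisson L p PN := by
  obtain ⟨s, hs⟩ := exists_reduced_sharp hL hr
  have hlift : ∀ {f : N → ℝ}, ContMDiff 𝓘(ℝ, EN) 𝓘(ℝ, ℝ) ∞ f → ∃ X : ∀ x : M, Tan EM x,
      SmoothSectionOn EM EM univ X ∧ ∀ x, (X x, dFun EM (f ∘ p) x) ∈ L x := fun hf =>
    exists_lift hL hr (smoothSectionOn_dFun isOpen_univ (hf.comp p.contMDiff).contMDiffOn)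
      fun x v hv => dFun_comp_eq_zero hr hf hv
  have hpt : ∀ (x : M) (β : Cot EN (p x)) (g : N → ℝ), ContMDiff 𝓘(ℝ, EN) 𝓘(ℝ, ℝ) ∞ g → ∀ X,
      (X, β.comp (mfderiv 𝓘(ℝ, EM) 𝓘(ℝ, EN) p x)) ∈ L x →
      dFun EN g (p x) (s (p x) β) = dFun EM (g ∘ p) x X := fun x β g hg X hX => by
    obtain ⟨f, hf, rfl⟩ := exists_fun_dFun_eq β
    exact hs f g hf hg x X (by rwa [dFun_comp p.contMDiff (hf.mdifferentiable (by simp) _)])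
  have hsm : ∀ f g : N → ℝ, ContMDiff 𝓘(ℝ, EN) 𝓘(ℝ, ℝ) ∞ f → ContMDiff 𝓘(ℝ, EN) 𝓘(ℝ, ℝ) ∞ g →
      ContMDiff 𝓘(ℝ, EN) 𝓘(ℝ, ℝ) ∞ (fun y => dFun EN g y (s y (dFun EN f y))) :=
    fun f g hf hg => by
    obtain ⟨B, hB, h⟩ := exists_reduced_bracket hL hr hf hg
    have : (fun y => dFun EN g y (s y (dFun EN f y))) = B := funext fun y => by
      obtain ⟨x, rfl⟩ := hr.surjective y
      obtain ⟨X, -, hX⟩ := hlift hf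
      rw [hs f g hf hg x _ (hX x), h x _ (hX x)]
    rwa [this]
  let sharp : ∀ y : N, Cot EN y →ₗ[ℝ] Tan EN y := fun y =>
    { toFun := s y
      map_add' := fun β β' => by
        obtain ⟨x, rfl⟩ := hr.surjective y
        obtain ⟨X, hX⟩ := exists_mem_comp hL hr β
        obtain ⟨X', hX'⟩ := exists_mem_comp hL hr β'
        refine tan_ext fun g hg => ?_
        have := add_mem hX hX'
        rw [map_add, hpt x β g hg X hX, hpt x β' g hg X' hX', hpt x (β + β') g hg (X + X'), map_add]
        exact this
      map_smul' := fun c β => by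
        obtain ⟨x, rfl⟩ := hr.surjective y
        obtain ⟨X, hX⟩ := exists_mem_comp hL hr β
        refine tan_ext fun g hg => ?_
        have := Submodule.smul_mem _ c hX
        rw [RingHom.id_apply, map_smul, hpt x β g hg X hX, hpt x (c • β) g hg (c • X), map_smul]
        exact this }
  have hsharp : ∀ y β, sharp y β = s y β := fun _ _ => rfl
  refine ⟨⟨sharp, ?_, ?_, ?_⟩, ?_⟩
  · intro U hU α hα
    refine smoothSectionOn_field_of_apply fun g hg y hy => ?_
    obtain ⟨f, W, V, hf, hW, hV, hyV, -, -, he⟩ := exists_coordinates_expand (EM := EN) y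
    have h1 : ContMDiffOn 𝓘(ℝ, EN) 𝓘(ℝ, ℝ) ∞
        (fun z => ∑ i, α z (W i z) * dFun EN g z (s z (dFun EN (f i) z))) U :=
      contMDiffOn_finsetSum fun i _ => (hα.apply ((hW i).mono (subset_univ _))).mul
        (hsm (f i) g (hf i) hg).contMDiffOn
    refine ((h1.mono inter_subset_left).congr (s := U ∩ V) fun z hz => ?_).contMDiffAt
      ((hU.inter hV).mem_nhds ⟨hy, hyV⟩) |>.contMDiffWithinAt
    conv_lhs => rw [he z hz.2 (α z)]
    rw [map_sum, map_sum]
    exact Finset.sum_congr rfl fun i _ => by rw [map_smul, map_smul, smul_eq_mul, hsharp]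
  · intro y α β
    obtain ⟨x, rfl⟩ := hr.surjective y
    obtain ⟨f, hf, rfl⟩ := exists_fun_dFun_eq α
    obtain ⟨g, hg, rfl⟩ := exists_fun_dFun_eq β
    obtain ⟨X, -, hX⟩ := hlift hf
    obtain ⟨Y, -, hY⟩ := hlift hg
    rw [hsharp, hsharp, hs f g hf hg x _ (hX x), hs g f hg hf x _ (hY x)]
    have := (hL.maximal x).prop _ (hX x) _ (hY x)
    simp only [pairing] at this
    linarith
  · intro f g h hf hg hh br y
    obtain ⟨x, rfl⟩ := hr.surjective y
    have hfp := (hf.comp p.contMDiff).contMDiffOn (s := univ)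
    have hgp := (hg.comp p.contMDiff).contMDiffOn (s := univ)
    have hhp := (hh.comp p.contMDiff).contMDiffOn (s := univ)
    obtain ⟨X, hX, hXL⟩ := hlift hf
    obtain ⟨Y, hY, hYL⟩ := hlift hg
    have hbs : ∀ {a b : N → ℝ}, ContMDiff 𝓘(ℝ, EN) 𝓘(ℝ, ℝ) ∞ a →
        ContMDiff 𝓘(ℝ, EN) 𝓘(ℝ, ℝ) ∞ b → ContMDiff 𝓘(ℝ, EN) 𝓘(ℝ, ℝ) ∞ (br a b) :=
      fun ha hb => hsm _ _ ha hb
    have hb : ∀ {a b : N → ℝ}, ContMDiff 𝓘(ℝ, EN) 𝓘(ℝ, ℝ) ∞ a →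
        ContMDiff 𝓘(ℝ, EN) 𝓘(ℝ, ℝ) ∞ b → ∀ (z : M) (Z : Tan EM z),
        (Z, dFun EM (a ∘ p) z) ∈ L z → br a b (p z) = dFun EM (b ∘ p) z Z :=
      fun ha hb z Z hZ => hs _ _ ha hb z Z hZ
    have hneg : ∀ {a b : N → ℝ}, ContMDiff 𝓘(ℝ, EN) 𝓘(ℝ, ℝ) ∞ a →
        ContMDiff 𝓘(ℝ, EN) 𝓘(ℝ, ℝ) ∞ b → br a b = fun y => - br b a y := fun {a b} ha hb' => by
      funext y
      obtain ⟨z, rfl⟩ := hr.surjective y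
      obtain ⟨A, -, hA⟩ := hlift ha
      obtain ⟨B, -, hB⟩ := hlift hb'
      rw [hb ha hb' z _ (hA z), hb hb' ha z _ (hB z)]
      have := (hL.maximal z).prop _ (hA z) _ (hB z)
      simp only [pairing] at this
      linarith
    have hfun : ∀ {b : N → ℝ}, ContMDiff 𝓘(ℝ, EN) 𝓘(ℝ, ℝ) ∞ b →
        br f b ∘ p = fun z => dFun EM (b ∘ p) z (X z) := fun hb' =>
      funext fun z => hb hf hb' z _ (hXL z)
    have hfun' : ∀ {b : N → ℝ}, ContMDiff 𝓘(ℝ, EN) 𝓘(ℝ, ℝ) ∞ b →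
        br g b ∘ p = fun z => dFun EM (b ∘ p) z (Y z) := fun hb' =>
      funext fun z => hb hg hb' z _ (hYL z)
    -- The bracket of lifts of `f` and `g` is a lift of {f, g}. Hence {{f, g}, h} is the commutator
    -- of the two derivations applied to `h`, which is the Jacobi identity.
    have h1 := lieVec_mem hL isOpen_univ (mem_univ x) hfp hgp hX hY (fun y _ => hXL y)
      (fun y _ => hYL y)
    rw [← hfun hg] at h1
    have h2 := hb (hbs hf hg) hh x _ h1
    rw [dFun_lieVec isOpen_univ (mem_univ x) hhp hX hY, ← hfun hh, ← hfun' hh,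
      ← hb hf (hbs hg hh) x _ (hXL x), ← hb hg (hbs hf hh) x _ (hYL x)] at h2
    rw [hneg hh (hbs hf hg)]
    beta_reduce
    rw [h2]
    have h3 : br g (br h f) (p x) = - br g (br f h) (p x) := by
      rw [hneg hh hf, hb hg (hbs hf hh) x _ (hYL x)]
      have h4 : ContMDiff 𝓘(ℝ, EN) 𝓘(ℝ, ℝ) ∞ (fun y => - br f h y) := (hbs hf hh).neg
      rw [hb hg h4 x _ (hYL x)]
      have h5 : (fun y => - br f h y) ∘ p = fun y => - (br f h ∘ p) y := rfl
      rw [h5, dFun_neg]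
      rfl
    rw [h3]
    ring
  · intro f hf
    refine ⟨hlift hf, fun X hX h g hg x => hs f g hf hg x _ (h x)⟩

/-- Every covector is the value of some df. The global lift in the definition differs from the given
one by a characteristic vector, on which functions pulled back from `N` have zero derivative.
Uniqueness of the structure is an immediate consequence. -/
theorem sharp_eq_of_isInducedPoisson (hr : IsReduction L p) {PN : PoissonStructure EN N}
    (h : IsInducedPoisson L p PN) {β : Cot EN (p x)} {X : Tan EM x}
    (hX : (X, β.comp (mfderiv 𝓘(ℝ, EM) 𝓘(ℝ, EN) p x)) ∈ L x) :
    PN.sharp (p x) β = mfderiv 𝓘(ℝ, EM) 𝓘(ℝ, EN) p x X := by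
  obtain ⟨f, hf, rfl⟩ := exists_fun_dFun_eq β
  obtain ⟨⟨Y, hY, hYL⟩, h'⟩ := h f hf
  rw [← dFun_comp p.contMDiff (hf.mdifferentiable (by simp) _)] at hX
  refine tan_ext fun g hg => ?_
  have h1 := dFun_comp_eq_zero hr hg (sub_mem_charDist (hYL x) hX)
  rw [map_sub, sub_eq_zero] at h1
  rw [← dFun_comp_apply hg, ← h1, ← h' Y hY hYL g hg x]
  rfl

theorem existsUnique_isInducedPoisson (hL : IsDiracStructure L) (hr : IsReduction L p) :
    ∃! PN : PoissonStructure EN N, IsInducedPoisson L p PN := by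
  obtain ⟨PN, hPN⟩ := exists_isInducedPoisson hL hr
  refine ⟨PN, hPN, fun Q hQ => ?_⟩
  have h : Q.sharp = PN.sharp := by
    funext y
    obtain ⟨x, rfl⟩ := hr.surjective y
    ext β
    obtain ⟨X, hX⟩ := exists_mem_comp hL hr β
    rw [sharp_eq_of_isInducedPoisson hr hQ hX, sharp_eq_of_isInducedPoisson hr hPN hX]
  cases Q
  cases PN
  simp only at h
  subst h
  rfl

end ReducedPoisson

/-! ### Pulled back covectors -/

section PullbackForms

variable {EN : Type*} [NormedAddCommGroup EN] [NormedSpace ℝ EN]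
  {N : Type*} [TopologicalSpace N] [ChartedSpace EN N] [IsManifold 𝓘(ℝ, EN) ∞ N]
  {p : C^∞⟮𝓘(ℝ, EM), M; 𝓘(ℝ, EN), N⟯} {U : Set M}

theorem smoothSectionOn_pullAmbient_iff {σ : ∀ x, PullAmbient EM (Cot EN : N → Type _) p x} :
    SmoothSectionOn EM (EM × (EN →L[ℝ] ℝ)) U σ ↔
      SmoothSectionOn EM EM U (fun x => (σ x).1) ∧
        SmoothSectionOn EM (EN →L[ℝ] ℝ) (E := (p : M → N) *ᵖ (Cot EN : N → Type _)) U
          (fun x => (σ x).2) := by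
  constructor
  · intro h
    constructor
    · intro y hy
      exact Bundle.contMDiffWithinAt_section.2
        ((ContinuousLinearMap.fst ℝ EM (EN →L[ℝ] ℝ)).contMDiff.contMDiffAt.comp_contMDiffWithinAt y
          (Bundle.contMDiffWithinAt_section.1 (h y hy)))
    · intro y hy
      exact Bundle.contMDiffWithinAt_section.2
        ((ContinuousLinearMap.snd ℝ EM (EN →L[ℝ] ℝ)).contMDiff.contMDiffAt.comp_contMDiffWithinAt y
          (Bundle.contMDiffWithinAt_section.1 (h y hy)))
  · rintro ⟨h1, h2⟩ y hy
    exact Bundle.contMDiffWithinAt_section.2 ((Bundle.contMDiffWithinAt_section.1 (h1 y hy)).prodMk_space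
      (Bundle.contMDiffWithinAt_section.1 (h2 y hy)))

theorem SmoothSectionOn.pullback {β : ∀ y : N, Cot EN y} {V : Set N} (hV : IsOpen V)
    (h : SmoothSectionOn EN (EN →L[ℝ] ℝ) V β) (hUV : ∀ x ∈ U, p x ∈ V) :
    SmoothSectionOn EM (EN →L[ℝ] ℝ) (E := (p : M → N) *ᵖ (Cot EN : N → Type _)) U
      (fun x => β (p x)) := fun x hx =>
  Bundle.contMDiffWithinAt_section.2 ((((Bundle.contMDiffWithinAt_section).1
    (h (p x) (hUV x hx))).contMDiffAt (hV.mem_nhds (hUV x hx))).comp_contMDiffWithinAt x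
      p.contMDiff.contMDiffAt.contMDiffWithinAt)

variable [FiniteDimensional ℝ EM] [T2Space M] [FiniteDimensional ℝ EN] [T2Space N]

/-- A family of covectors along a submersion is smooth if and only if its pullback is. -/
theorem smoothSectionOn_comp_mfderiv_iff
    (hs : ∀ x, Function.Surjective (mfderiv 𝓘(ℝ, EM) 𝓘(ℝ, EN) p x)) (hU : IsOpen U)
    {β : ∀ x, Cot EN (p x)} :
    SmoothSectionOn EM (EN →L[ℝ] ℝ) (E := (p : M → N) *ᵖ (Cot EN : N → Type _)) U β ↔ SmoothSectionOn EM (EM →L[ℝ] ℝ) U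
      (fun x => (β x).comp (mfderiv 𝓘(ℝ, EM) 𝓘(ℝ, EN) p x)) := by
  constructor
  · intro h
    refine smoothSectionOn_of_local fun x₀ hx₀ => ?_
    obtain ⟨f, W, V, H, O, hf, hW, hV, hO, hxO, hOV, hd, -, he, -, -⟩ :=
      exists_adapted_coordinates p.contMDiff (hs x₀)
    have hli : LinearIndependent ℝ fun i => (dFun EN (f i) (p x₀) : (p *ᵖ (Cot EN)) x₀) := by
      rw [Fintype.linearIndependent_iff]
      intro g hg i
      have h1 := congrArg (fun u : Cot EN (p x₀) => u (W i (p x₀))) hg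
      have h2 : (∑ j, g j • dFun EN (f j) (p x₀)) (W i (p x₀)) = 0 := h1
      simpa [hd _ (hOV x₀ hxO)] using h2
    -- The coefficients of `β` in the pulled back coordinate frame are extracted by smooth dual
    -- forms, so their smoothness follows from that of `β` as a section of the pullback bundle.
    obtain ⟨T, hTO, hT, hxT, l, hl, hld⟩ := exists_dual_forms (hU.inter hO) ⟨hx₀, hxO⟩
      (fun i => SmoothSectionOn.pullback (p := p) hV
        ((smoothSectionOn_dFun isOpen_univ (hf i).contMDiffOn).mono (subset_univ V))
        fun x hx => hOV x hx.2) hli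
    refine ⟨T, hT, hxT, ?_⟩
    have h1 : SmoothSectionOn EM (EM →L[ℝ] ℝ) T (fun x => ∑ i, l i x (β x) • dFun EM (f i ∘ p) x) :=
      SmoothSectionOn.sum fun i _ => SmoothSectionOn.smul
        (hl i T β hT subset_rfl (h.mono (hTO.trans inter_subset_left)))
        ((smoothSectionOn_dFun isOpen_univ ((hf i).comp p.contMDiff).contMDiffOn).mono
          (subset_univ _))
    refine h1.congr fun x hx => ?_
    have h3 : ∀ i, l i x (β x) = β x (W i (p x)) := fun i => by
      let m : Cot EN (p x) →ₗ[ℝ] ℝ := l i x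
      have h2 : ∀ j, m (dFun EN (f j) (p x)) = if i = j then 1 else 0 := hld x hx i
      change m (β x) = _
      conv_lhs => rw [he (p x) (hOV x (hTO hx).2) (β x), map_sum]
      simp [h2]
    ext v
    rw [_root_.sum_apply]
    simp only [h3, _root_.smul_apply, dFun_comp_apply (hf _)]
    have h4 := DFunLike.congr_fun (he (p x) (hOV x (hTO hx).2) (β x))
      (mfderiv 𝓘(ℝ, EM) 𝓘(ℝ, EN) p x v)
    rw [_root_.sum_apply] at h4
    exact h4
  · intro h
    refine smoothSectionOn_of_local fun x₀ hx₀ => ?_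
    obtain ⟨f, W, V, H, O, hf, hW, hV, hO, hxO, hOV, hd, -, he, hH, hHW⟩ :=
      exists_adapted_coordinates p.contMDiff (hs x₀)
    -- Conversely, the coefficients are the values of the pulled back form on the horizontal lifts
    -- `H i`.
    have h1 : SmoothSectionOn EM (EN →L[ℝ] ℝ) (E := (p : M → N) *ᵖ (Cot EN : N → Type _)) (U ∩ O)
        (fun x => ∑ i, ((β x).comp
          (mfderiv 𝓘(ℝ, EM) 𝓘(ℝ, EN) p x)) (H i x) •
            (dFun EN (f i) (p x) : (p *ᵖ (Cot EN)) x)) :=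
      SmoothSectionOn.sum fun i _ => SmoothSectionOn.smul
        ((h.mono inter_subset_left).apply ((hH i).mono inter_subset_right))
        (SmoothSectionOn.pullback (p := p) hV
          ((smoothSectionOn_dFun isOpen_univ (hf i).contMDiffOn).mono (subset_univ V))
          fun x hx => hOV x hx.2)
    refine ⟨U ∩ O, hU.inter hO, ⟨hx₀, hxO⟩, h1.congr fun x hx => ?_⟩
    simp only [ContinuousLinearMap.comp_apply, hHW x hx.2]
    exact he (p x) (hOV x hx.2) _

end PullbackForms

/-! ### Compatibility of the exterior derivative with pullback. -/

section PullbackDerivative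

variable [FiniteDimensional ℝ EM] {U : Set M} {x : M}

theorem SmoothSectionOn.mdiff_apply {α : ∀ x : M, Cot EM x} {X : ∀ x : M, Tan EM x}
    (hU : IsOpen U) (hx : x ∈ U) (hα : SmoothSectionOn EM (EM →L[ℝ] ℝ) U α)
    (hX : SmoothSectionOn EM EM U X) :
    MDifferentiableAt 𝓘(ℝ, EM) 𝓘(ℝ, ℝ) (fun y => α y (X y)) x :=
  ((hα.apply hX).contMDiffAt (hU.mem_nhds hx)).mdifferentiableAt (by simp)

theorem dForm_sum_smul [T2Space M] {ι : Type*} (s : Finset ι) {g : ι → M → ℝ}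
    {w : ι → ∀ x : M, Cot EM x}
    (hU : IsOpen U) (hx : x ∈ U) (hg : ∀ i, ContMDiffOn 𝓘(ℝ, EM) 𝓘(ℝ, ℝ) ∞ (g i) U)
    (hw : ∀ i, SmoothSectionOn EM (EM →L[ℝ] ℝ) U (w i)) (u v : Tan EM x) :
    dForm (fun y => ∑ i ∈ s, g i y • w i y) x u v = ∑ i ∈ s, (g i x * dForm (w i) x u v
      + dFun EM (g i) x u * w i x v - dFun EM (g i) x v * w i x u) := by
  classical
  induction s using Finset.induction_on with
  | empty =>
    simp only [Finset.sum_empty]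
    have h1 := dForm_dFun (EM := EM) hU hx (f := fun _ => (0 : ℝ)) contMDiffOn_const
    have h2 : dFun EM (fun _ : M => (0 : ℝ)) = fun _ => 0 := funext fun y => dFun_const 0
    rw [h2] at h1
    rw [h1]
    rfl
  | insert a s ha ih =>
    simp only [Finset.sum_insert ha]
    have h1 : SmoothSectionOn EM (EM →L[ℝ] ℝ) U (fun y => g a y • w a y) :=
      SmoothSectionOn.smul (hg a) (hw a)
    have h2 : SmoothSectionOn EM (EM →L[ℝ] ℝ) U (fun y => ∑ i ∈ s, g i y • w i y) :=
      SmoothSectionOn.sum fun i _ => SmoothSectionOn.smul (hg i) (hw i)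
    rw [dForm_add (h1.mdifferentiableAt hU hx) (h2.mdifferentiableAt hU hx),
      _root_.add_apply, ih, dForm_smul hU hx (hg a) (hw a)]

variable [T2Space M] {EN : Type*} [NormedAddCommGroup EN] [NormedSpace ℝ EN]
  [FiniteDimensional ℝ EN]
  {N : Type*} [TopologicalSpace N] [T2Space N] [ChartedSpace EN N] [IsManifold 𝓘(ℝ, EN) ∞ N]
  {p : C^∞⟮𝓘(ℝ, EM), M; 𝓘(ℝ, EN), N⟯}

theorem dFun_comp_apply_of_mem {V : Set N} (hV : IsOpen V) (hx : p x ∈ V) {f : N → ℝ}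
    (hf : ContMDiffOn 𝓘(ℝ, EN) 𝓘(ℝ, ℝ) ∞ f V) (v : Tan EM x) :
    dFun EM (fun y => f (p y)) x v = dFun EN f (p x) (mfderiv 𝓘(ℝ, EM) 𝓘(ℝ, EN) p x v) :=
  DFunLike.congr_fun (dFun_comp p.contMDiff
    ((hf.contMDiffAt (hV.mem_nhds hx)).mdifferentiableAt (by simp))) v

/-- The exterior derivative commutes with pullback. -/
theorem dForm_comp_mfderiv {V : Set N} (hV : IsOpen V) (hx : p x ∈ V) {β : ∀ y : N, Cot EN y}
    (hβ : SmoothSectionOn EN (EN →L[ℝ] ℝ) V β) (u v : Tan EM x) :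
    dForm (fun y => (β (p y)).comp (mfderiv 𝓘(ℝ, EM) 𝓘(ℝ, EN) p y)) x u v
      = dForm β (p x) (mfderiv 𝓘(ℝ, EM) 𝓘(ℝ, EN) p x u)
        (mfderiv 𝓘(ℝ, EM) 𝓘(ℝ, EN) p x v) := by
  obtain ⟨f, W, O, hf, hW, hO, hxO, -, -, he⟩ := exists_coordinates_expand (EM := EN) (p x)
  have hVO := hV.inter hO
  have hc : ∀ i, ContMDiffOn 𝓘(ℝ, EN) 𝓘(ℝ, ℝ) ∞ (fun y => β y (W i y)) (V ∩ O) := fun i =>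
    (hβ.mono inter_subset_left).apply ((hW i).mono (subset_univ _))
  have hp : IsOpen (p ⁻¹' (V ∩ O)) := hVO.preimage p.contMDiff.continuous
  have hcp : ∀ i, ContMDiffOn 𝓘(ℝ, EM) 𝓘(ℝ, ℝ) ∞ (fun y => β (p y) (W i (p y)))
      (p ⁻¹' (V ∩ O)) := fun i => (hc i).comp p.contMDiff.contMDiffOn fun y hy => hy
  have hdf : ∀ i, SmoothSectionOn EN (EN →L[ℝ] ℝ) (V ∩ O) (dFun EN (f i)) := fun i =>
    smoothSectionOn_dFun hVO (hf i).contMDiffOn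
  have hdfp : ∀ i, SmoothSectionOn EM (EM →L[ℝ] ℝ) (p ⁻¹' (V ∩ O)) (dFun EM (f i ∘ p)) := fun i =>
    smoothSectionOn_dFun hp ((hf i).comp p.contMDiff).contMDiffOn
  -- Expanding in coordinate differentials, which are closed on both manifolds, leaves only
  -- derivatives of coefficients. For these the claim is the chain rule.
  have h1 : ∀ᶠ y in 𝓝 (p x), β y = ∑ i, β y (W i y) • dFun EN (f i) y := by
    filter_upwards [hO.mem_nhds hxO] with y hy using he y hy _
  have h2 : ∀ᶠ y in 𝓝 x, (β (p y)).comp (mfderiv 𝓘(ℝ, EM) 𝓘(ℝ, EN) p y)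
      = ∑ i, β (p y) (W i (p y)) • dFun EM (f i ∘ p) y := by
    filter_upwards [hp.mem_nhds ⟨hx, hxO⟩] with y hy
    ext w
    rw [_root_.sum_apply, ContinuousLinearMap.comp_apply]
    conv_lhs => rw [he (p y) hy.2 (β (p y)), _root_.sum_apply]
    exact Finset.sum_congr rfl fun i _ => by
      rw [_root_.smul_apply, _root_.smul_apply, dFun_comp_apply (hf i)]
  rw [dForm_congr h1, dForm_congr h2, dForm_sum_smul _ hVO ⟨hx, hxO⟩ hc hdf,
    dForm_sum_smul _ hp ⟨hx, hxO⟩ hcp hdfp]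
  refine Finset.sum_congr rfl fun i _ => ?_
  rw [dForm_dFun hVO ⟨hx, hxO⟩ (hf i).contMDiffOn,
    dForm_dFun hp ⟨hx, hxO⟩ ((hf i).comp p.contMDiff).contMDiffOn,
    dFun_comp_apply_of_mem hVO ⟨hx, hxO⟩ (hc i), dFun_comp_apply_of_mem hVO ⟨hx, hxO⟩ (hc i),
    dFun_comp_apply (hf i), dFun_comp_apply (hf i)]
  simp

end PullbackDerivative

/-! ### The pullback algebroid of the reduced Poisson manifold -/

section FormBracket

variable [FiniteDimensional ℝ EM] [T2Space M] {x : M}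

theorem dForm_map_sum {α : ∀ x : M, Cot EM x} {ι : Type*} (s : Finset ι) (c : ι → ℝ)
    (v : ι → Tan EM x) (u : Tan EM x) :
    dForm α x (∑ i ∈ s, c i • v i) u = ∑ i ∈ s, c i * dForm α x (v i) u := by
  let T : Tan EM x →ₗ[ℝ] Cot EM x :=
    { toFun := dForm α x
      map_add' := dForm_map_add
      map_smul' := dForm_map_smul }
  have h : T (∑ i ∈ s, c i • v i) = ∑ i ∈ s, c i • T (v i) := by
    rw [map_sum]
    exact Finset.sum_congr rfl fun i _ => map_smul T _ _
  refine (DFunLike.congr_fun h u).trans ?_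
  rw [_root_.sum_apply]
  rfl

/-- The two Lie derivatives each contribute dπ(α, β), by skewness, and the last term of the bracket
removes one of them. -/
theorem formBracket_apply (P : PoissonStructure EM M) {α β : ∀ x : M, Cot EM x} (u : Tan EM x) :
    P.formBracket α β x u = dForm β x (P.sharp x (α x)) u - dForm α x (P.sharp x (β x)) u
      + dFun EM (fun y => β y (P.sharp y (α y))) x u := by
  have h1 : dFun EM (fun y => α y (P.sharp y (β y))) x
      = - dFun EM (fun y => β y (P.sharp y (α y))) x := by
    rw [← dFun_neg]
    exact congrArg (fun f => dFun EM f x) (funext fun y => P.skew y (β y) (α y))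
  have h2 : P.formBracket α β x u = (dForm β x (P.sharp x (α x)) u
      + dFun EM (fun y => β y (P.sharp y (α y))) x u) - (dForm α x (P.sharp x (β x)) u
      + dFun EM (fun y => α y (P.sharp y (β y))) x u)
      - dFun EM (fun y => β y (P.sharp y (α y))) x u := rfl
  rw [h2, h1, _root_.neg_apply]
  ring

end FormBracket

theorem map_combination {V W ι κ : Type*} [AddCommGroup V] [Module ℝ V] [AddCommGroup W]
    [Module ℝ W] [Fintype ι] [Fintype κ] (J : V →ₗ[ℝ] W) (a : ι → κ → ℝ) (u : ι → κ → V)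
    (b : κ → ℝ) (v : κ → V) (c : ι → ℝ) (w : ι → V) :
    J (∑ i, ∑ j, a i j • u i j + ∑ j, b j • v j - ∑ i, c i • w i)
      = ∑ i, ∑ j, a i j • J (u i j) + ∑ j, b j • J (v j) - ∑ i, c i • J (w i) := by
  simp only [map_sub, map_add, map_sum, map_smul]

section ReducedPullback

variable [FiniteDimensional ℝ EM] [T2Space M] [SigmaCompactSpace M]
  {EN : Type*} [NormedAddCommGroup EN] [NormedSpace ℝ EN] [FiniteDimensional ℝ EN]
  {N : Type*} [TopologicalSpace N] [T2Space N] [ChartedSpace EN N] [IsManifold 𝓘(ℝ, EN) ∞ N]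
  {L : ∀ x : M, Submodule ℝ (GenTan EM x)} {p : C^∞⟮𝓘(ℝ, EM), M; 𝓘(ℝ, EN), N⟯} {x : M}
  {PN : PoissonStructure EN N}

theorem mem_pullbackFiber_cotangent {X : Tan EM x} {β : Cot EN (p x)} :
    ((X, β) : PullAmbient EM (Cot EN : N → Type _) p x) ∈ pullbackFiber p (cotangentAlgebroid PN) x
      ↔ PN.sharp (p x) β = mfderiv 𝓘(ℝ, EM) 𝓘(ℝ, EN) p x X := by
  constructor
  · rintro ⟨v, hv, h⟩
    have h1 : (v : Cot EN (p x)) = β := hv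
    rw [← h1]
    exact h
  · exact fun h => ⟨⟨β, trivial⟩, rfl, h⟩

/-- For the converse, compare X with some lift of the same covector. Both project to the same
vector, so their difference is characteristic and lies in `L`. -/
theorem mem_comp_mfderiv_iff (hL : IsDiracStructure L) (hr : IsReduction L p)
    (hi : IsInducedPoisson L p PN) {X : Tan EM x} {β : Cot EN (p x)} :
    (X, β.comp (mfderiv 𝓘(ℝ, EM) 𝓘(ℝ, EN) p x)) ∈ L x
      ↔ PN.sharp (p x) β = mfderiv 𝓘(ℝ, EM) 𝓘(ℝ, EN) p x X := by
  refine ⟨sharp_eq_of_isInducedPoisson hr hi, fun h => ?_⟩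
  obtain ⟨X', hX'⟩ := exists_mem_comp hL hr β
  have h1 := sharp_eq_of_isInducedPoisson hr hi hX'
  have h2 : X - X' ∈ charDist L x := (hr.tangent x _).1 (by rw [map_sub, ← h, ← h1, sub_self])
  have h3 := add_mem (show ((X - X', 0) : GenTan EM x) ∈ L x from h2) hX'
  rwa [Prod.mk_add_mk, sub_add_cancel, zero_add] at h3

theorem comp_mfderiv_injective (hr : IsReduction L p) {β γ : Cot EN (p x)}
    (h : β.comp (mfderiv 𝓘(ℝ, EM) 𝓘(ℝ, EN) p x) = γ.comp (mfderiv 𝓘(ℝ, EM) 𝓘(ℝ, EN) p x)) :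
    β = γ := by
  ext w
  obtain ⟨v, rfl⟩ := hr.submersion x w
  exact DFunLike.congr_fun h v

/-- By isotropy the form part kills ker dp, so it factors through the surjection dp. -/
theorem exists_eq_comp_mfderiv (hL : IsDiracStructure L) (hr : IsReduction L p)
    {u : GenTan EM x} (hu : u ∈ L x) :
    ∃ β : Cot EN (p x), β.comp (mfderiv 𝓘(ℝ, EM) 𝓘(ℝ, EN) p x) = u.2 := by
  have h1 : ∀ v, mfderiv 𝓘(ℝ, EM) 𝓘(ℝ, EN) p x v = 0 → u.2 v = 0 := fun v hv =>
    apply_eq_zero_of_mem_charDist (hL.maximal x).prop hu ((hr.tangent x v).1 hv)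
  obtain ⟨s, hs⟩ := (mfderiv 𝓘(ℝ, EM) 𝓘(ℝ, EN) p x).toLinearMap.exists_rightInverse_of_surjective
    (LinearMap.range_eq_top.2 (hr.submersion x))
  have : FiniteDimensional ℝ (Tan EN (p x)) := inferInstanceAs (FiniteDimensional ℝ EN)
  have : T2Space (Tan EN (p x)) := inferInstanceAs (T2Space EN)
  refine ⟨LinearMap.toContinuousLinearMap (u.2.toLinearMap.comp s), ?_⟩
  ext v
  have h2 : mfderiv 𝓘(ℝ, EM) 𝓘(ℝ, EN) p x (s (mfderiv 𝓘(ℝ, EM) 𝓘(ℝ, EN) p x v))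
      = mfderiv 𝓘(ℝ, EM) 𝓘(ℝ, EN) p x v := LinearMap.congr_fun hs _
  have h3 := h1 (s (mfderiv 𝓘(ℝ, EM) 𝓘(ℝ, EN) p x v) - v) (by rw [map_sub, h2, sub_self])
  rw [map_sub, sub_eq_zero] at h3
  exact h3

/-- A reducible Dirac structure is isomorphic to the pullback of the reduced cotangent bundle. -/
theorem exists_reducedEquiv (hL : IsDiracStructure L) (hr : IsReduction L p)
    (hi : IsInducedPoisson L p PN) :
    ∃ Θ : ∀ x, L x ≃ₗ[ℝ] pullbackFiber p (cotangentAlgebroid PN) x, ∀ x v,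
      (Θ x v).1.1 = v.1.1 ∧
        ((Θ x v).1.2 : Cot EN (p x)).comp (mfderiv 𝓘(ℝ, EM) 𝓘(ℝ, EN) p x) = v.1.2 := by
  have key : ∀ x, ∃ Θ : L x ≃ₗ[ℝ] pullbackFiber p (cotangentAlgebroid PN) x, ∀ v,
      (Θ v).1.1 = v.1.1 ∧
        ((Θ v).1.2 : Cot EN (p x)).comp (mfderiv 𝓘(ℝ, EM) 𝓘(ℝ, EN) p x) = v.1.2 := by
    intro x
    -- The inverse (X, β) ↦ (X, p^*β) needs no choice, so the equivalence is built in this direction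
    -- and then reversed.
    let Ξ : pullbackFiber p (cotangentAlgebroid PN) x →ₗ[ℝ] L x :=
      { toFun := fun w => ⟨(w.1.1, (w.1.2 : Cot EN (p x)).comp (mfderiv 𝓘(ℝ, EM) 𝓘(ℝ, EN) p x)),
          (mem_comp_mfderiv_iff hL hr hi).2 (mem_pullbackFiber_cotangent.1 w.2)⟩
        map_add' := fun w w' => rfl
        map_smul' := fun c w => rfl }
    have h1 : Function.Bijective Ξ := by
      constructor
      · rintro ⟨⟨X, β⟩, h⟩ ⟨⟨X', β'⟩, h'⟩ he
        have h2 := congrArg Subtype.val he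
        have h3 : X = X' := congrArg Prod.fst h2
        have h4 : (β : Cot EN (p x)) = β' := comp_mfderiv_injective hr (congrArg Prod.snd h2)
        exact Subtype.ext (Prod.ext h3 h4)
      · rintro ⟨u, hu⟩
        obtain ⟨β, hβ⟩ := exists_eq_comp_mfderiv hL hr hu
        have h2 : (u.1, β.comp (mfderiv 𝓘(ℝ, EM) 𝓘(ℝ, EN) p x)) ∈ L x := by
          rw [hβ]
          exact hu
        exact ⟨⟨(u.1, β), mem_pullbackFiber_cotangent.2 ((mem_comp_mfderiv_iff hL hr hi).1 h2)⟩,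
          Subtype.ext (Prod.ext rfl hβ)⟩
    refine ⟨(LinearEquiv.ofBijective Ξ h1).symm, fun v => ?_⟩
    have h2 : Ξ ((LinearEquiv.ofBijective Ξ h1).symm v) = v :=
      (LinearEquiv.ofBijective Ξ h1).apply_symm_apply v
    have h3 := congrArg Subtype.val h2
    exact ⟨congrArg Prod.fst h3, congrArg Prod.snd h3⟩
  choose Θ hΘ using key
  exact ⟨Θ, hΘ⟩

variable {Θ : ∀ x, L x ≃ₗ[ℝ] pullbackFiber p (cotangentAlgebroid PN) x}

theorem coe_symm_reducedEquiv (hΘ : ∀ x v, (Θ x v).1.1 = v.1.1 ∧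
      ((Θ x v).1.2 : Cot EN (p x)).comp (mfderiv 𝓘(ℝ, EM) 𝓘(ℝ, EN) p x) = v.1.2)
    (w : pullbackFiber p (cotangentAlgebroid PN) x) : (((Θ x).symm w : L x) : GenTan EM x)
      = (w.1.1, (w.1.2 : Cot EN (p x)).comp (mfderiv 𝓘(ℝ, EM) 𝓘(ℝ, EN) p x)) := by
  obtain ⟨v, rfl⟩ := (Θ x).surjective w
  rw [LinearEquiv.symm_apply_apply]
  exact Prod.ext (hΘ x v).1.symm (hΘ x v).2.symm

/-- The bracket transported from a Dirac structure. -/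
def transportBracket (Θ : ∀ x, L x ≃ₗ[ℝ] pullbackFiber p (cotangentAlgebroid PN) x)
    (σ τ : ∀ x, pullbackFiber p (cotangentAlgebroid PN) x) (x : M) :
    pullbackFiber p (cotangentAlgebroid PN) x :=
  Θ x ((diracAlgebroid L).bracket (fun y => (Θ y).symm (σ y)) (fun y => (Θ y).symm (τ y)) x)

theorem isIso_transportBracket (hr : IsReduction L p) (hΘ : ∀ x v, (Θ x v).1.1 = v.1.1 ∧
      ((Θ x v).1.2 : Cot EN (p x)).comp (mfderiv 𝓘(ℝ, EM) 𝓘(ℝ, EN) p x) = v.1.2) :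
    PreLieAlgebroid.IsIso (diracAlgebroid L)
      (pullbackAlgebroid p (cotangentAlgebroid PN) (transportBracket Θ)) Θ := by
  refine ⟨fun U hU σ => ?_, fun x v => (hΘ x v).1, fun U hU σ τ _ _ x _ => ?_⟩
  · refine smoothSectionOn_gen_iff.trans (Iff.trans ?_ smoothSectionOn_pullAmbient_iff.symm)
    refine and_congr ?_ ?_
    · exact iff_of_eq (congrArg (SmoothSectionOn EM EM U) (funext fun x => (hΘ x (σ x)).1.symm))
    · refine Iff.trans ?_ (smoothSectionOn_comp_mfderiv_iff hr.submersion hU).symm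
      exact iff_of_eq (congrArg (SmoothSectionOn EM (EM →L[ℝ] ℝ) U)
        (funext fun x => (hΘ x (σ x)).2.symm))
  · have h : ∀ υ : ∀ x, L x, (fun y => (Θ y).symm (Θ y (υ y))) = υ := fun υ =>
      funext fun y => (Θ y).symm_apply_apply (υ y)
    exact congrArg (Θ x) (congrArg₂ (fun a b => (diracAlgebroid L).bracket a b x) (h σ) (h τ)).symm

theorem isLieAlgebroid_transportBracket (hL : IsDiracStructure L) (hr : IsReduction L p)
    (hΘ : ∀ x v, (Θ x v).1.1 = v.1.1 ∧
      ((Θ x v).1.2 : Cot EN (p x)).comp (mfderiv 𝓘(ℝ, EM) 𝓘(ℝ, EN) p x) = v.1.2) :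
    (pullbackAlgebroid p (cotangentAlgebroid PN) (transportBracket Θ)).IsLieAlgebroid := by
  have hI := isIso_transportBracket hr hΘ
  refine hI.isLieAlgebroid (Nat.add_sub_cancel_left _ _).symm hL.isLieAlgebroid ?_
  intro U hU σ σ' τ τ' hσ hτ h1 h2 x hx
  refine congrArg (Θ x) ?_
  refine hL.isLieAlgebroid.bracket_local U hU _ _ _ _ ((hI.smooth_symm hU σ).2 hσ)
    ((hI.smooth_symm hU τ).2 hτ) ?_ ?_ x hx
  · exact fun y hy => congrArg (Θ y).symm (h1 y hy)
  · exact fun y hy => congrArg (Θ y).symm (h2 y hy)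

/-- The bracket of forms with basic components, in terms of the brackets of the components. -/
theorem lieForm_sub_dForm_pullback (hr : IsReduction L p) {U : Set M} {V : Set N} (hU : IsOpen U) (hV : IsOpen V)
    (hUV : ∀ x ∈ U, p x ∈ V) (hx : x ∈ U) {k l : ℕ} {f : Fin k → M → ℝ}
    {α : Fin k → ∀ y : N, Cot EN y} {g : Fin l → M → ℝ} {β : Fin l → ∀ y : N, Cot EN y}
    {X Y : ∀ x : M, Tan EM x}
    (hf : ∀ i, ContMDiffOn 𝓘(ℝ, EM) 𝓘(ℝ, ℝ) ∞ (f i) U)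
    (hα : ∀ i, SmoothSectionOn EN (EN →L[ℝ] ℝ) V (α i))
    (hg : ∀ j, ContMDiffOn 𝓘(ℝ, EM) 𝓘(ℝ, ℝ) ∞ (g j) U)
    (hβ : ∀ j, SmoothSectionOn EN (EN →L[ℝ] ℝ) V (β j))
    (hX : ∀ y ∈ U, mfderiv 𝓘(ℝ, EM) 𝓘(ℝ, EN) p y (X y)
      = ∑ i, f i y • PN.sharp (p y) (α i (p y)))
    (hY : ∀ y ∈ U, mfderiv 𝓘(ℝ, EM) 𝓘(ℝ, EN) p y (Y y)
      = ∑ j, g j y • PN.sharp (p y) (β j (p y))) (u : Tan EM x) :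
    lieForm X (fun y => ∑ j, g j y • (β j (p y)).comp (mfderiv 𝓘(ℝ, EM) 𝓘(ℝ, EN) p y)) x u
      - dForm (fun y => ∑ i, f i y • (α i (p y)).comp (mfderiv 𝓘(ℝ, EM) 𝓘(ℝ, EN) p y)) x (Y x) u
      = (∑ i, ∑ j, (f i x * g j x) • PN.formBracket (α i) (β j) (p x)
        + ∑ j, dFun EM (g j) x (X x) • β j (p x)
        - ∑ i, dFun EM (f i) x (Y x) • α i (p x)) (mfderiv 𝓘(ℝ, EM) 𝓘(ℝ, EN) p x u) := by
  have hαp : ∀ i, SmoothSectionOn EM (EM →L[ℝ] ℝ) U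
      (fun y => (α i (p y)).comp (mfderiv 𝓘(ℝ, EM) 𝓘(ℝ, EN) p y)) := fun i =>
    (smoothSectionOn_comp_mfderiv_iff hr.submersion hU).1 ((hα i).pullback hV hUV)
  have hβp : ∀ j, SmoothSectionOn EM (EM →L[ℝ] ℝ) U
      (fun y => (β j (p y)).comp (mfderiv 𝓘(ℝ, EM) 𝓘(ℝ, EN) p y)) := fun j =>
    (smoothSectionOn_comp_mfderiv_iff hr.submersion hU).1 ((hβ j).pullback hV hUV)
  have hπ : ∀ i j, ContMDiffOn 𝓘(ℝ, EN) 𝓘(ℝ, ℝ) ∞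
      (fun y => β j y (PN.sharp y (α i y))) V := fun i j =>
    (hβ j).apply (PN.smooth V hV _ (hα i))
  have hπp : ∀ i j, ContMDiffOn 𝓘(ℝ, EM) 𝓘(ℝ, ℝ) ∞
      (fun y => β j (p y) (PN.sharp (p y) (α i (p y)))) U := fun i j =>
    (hπ i j).comp p.contMDiff.contMDiffOn hUV
  have hd : ∀ {h : M → ℝ}, ContMDiffOn 𝓘(ℝ, EM) 𝓘(ℝ, ℝ) ∞ h U →
      MDifferentiableAt 𝓘(ℝ, EM) 𝓘(ℝ, ℝ) h x := fun h =>
    (h.contMDiffAt (hU.mem_nhds hx)).mdifferentiableAt (by simp)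
  -- Since `X` projects to the combination of the fields π♯α_i, its pairing with the second form is
  -- the sum of the f_i g_j π(α_i, β_j).
  have hBX : dFun EM (fun y => (∑ j, g j y • (β j (p y)).comp
      (mfderiv 𝓘(ℝ, EM) 𝓘(ℝ, EN) p y)) (X y)) x = dFun EM (fun y => ∑ i, ∑ j, f i y * g j y *
        β j (p y) (PN.sharp (p y) (α i (p y)))) x := by
    refine dFun_congr ?_
    filter_upwards [hU.mem_nhds hx] with y hy
    rw [_root_.sum_apply, Finset.sum_comm]
    refine Finset.sum_congr rfl fun j _ => ?_
    rw [_root_.smul_apply, ContinuousLinearMap.comp_apply, hX y hy, map_sum, Finset.smul_sum]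
    refine Finset.sum_congr rfl fun i _ => ?_
    rw [map_smul, smul_eq_mul, smul_eq_mul]
    ring
  have hBX' : dFun EM (fun y => (∑ j, g j y • (β j (p y)).comp
      (mfderiv 𝓘(ℝ, EM) 𝓘(ℝ, EN) p y)) (X y)) x u = ∑ i, ∑ j, (f i x * g j x *
        dFun EN (fun y => β j y (PN.sharp y (α i y))) (p x) (mfderiv 𝓘(ℝ, EM) 𝓘(ℝ, EN) p x u)
        + (f i x * dFun EM (g j) x u + g j x * dFun EM (f i) x u)
          * β j (p x) (PN.sharp (p x) (α i (p x)))) := by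
    have hm : ∀ i j, MDifferentiableAt 𝓘(ℝ, EM) 𝓘(ℝ, ℝ) (fun y => f i y * g j y) x :=
      fun i j => (hd (hf i)).mul (hd (hg j))
    have hm' : ∀ i j, MDifferentiableAt 𝓘(ℝ, EM) 𝓘(ℝ, ℝ)
        (fun y => f i y * g j y * β j (p y) (PN.sharp (p y) (α i (p y)))) x :=
      fun i j => (hm i j).mul (hd (hπp i j))
    rw [hBX, dFun_sum fun i _ => mdifferentiableAt_finset_sum fun j _ => hm' i j,
      _root_.sum_apply]
    refine Finset.sum_congr rfl fun i _ => ?_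
    rw [dFun_sum fun j _ => hm' i j, _root_.sum_apply]
    refine Finset.sum_congr rfl fun j _ => ?_
    rw [dFun_mul (hm i j) (hd (hπp i j)), dFun_mul (hd (hf i)) (hd (hg j)),
      ← dFun_comp_apply_of_mem hV (hUV x hx) (hπ i j)]
    simp only [_root_.add_apply, _root_.smul_apply, smul_eq_mul]
    ring
  have h1 : ∀ j, β j (p x) (mfderiv 𝓘(ℝ, EM) 𝓘(ℝ, EN) p x (X x))
      = ∑ i, f i x * β j (p x) (PN.sharp (p x) (α i (p x))) := fun j => by
    rw [hX x hx, map_sum]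
    exact Finset.sum_congr rfl fun i _ => map_smul _ _ _
  have h2 : ∀ i, α i (p x) (mfderiv 𝓘(ℝ, EM) 𝓘(ℝ, EN) p x (Y x))
      = - ∑ j, g j x * β j (p x) (PN.sharp (p x) (α i (p x))) := fun i => by
    rw [hY x hx, map_sum, ← Finset.sum_neg_distrib]
    refine Finset.sum_congr rfl fun j _ => ?_
    rw [map_smul, PN.skew, smul_eq_mul, mul_neg]
  generalize hw : mfderiv 𝓘(ℝ, EM) 𝓘(ℝ, EN) p x u = w at hBX' ⊢
  have h3 : ∀ j, dForm (β j) (p x) (mfderiv 𝓘(ℝ, EM) 𝓘(ℝ, EN) p x (X x)) w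
      = ∑ i, f i x * dForm (β j) (p x) (PN.sharp (p x) (α i (p x))) w := fun j => by
    rw [hX x hx]
    exact dForm_map_sum _ _ _ _
  have h4 : ∀ i, dForm (α i) (p x) (mfderiv 𝓘(ℝ, EM) 𝓘(ℝ, EN) p x (Y x)) w
      = ∑ j, g j x * dForm (α i) (p x) (PN.sharp (p x) (β j (p x))) w := fun i => by
    rw [hY x hx]
    exact dForm_map_sum _ _ _ _
  have h5 : ∀ i j, PN.formBracket (α i) (β j) (p x) w
      = dForm (β j) (p x) (PN.sharp (p x) (α i (p x))) w
        - dForm (α i) (p x) (PN.sharp (p x) (β j (p x))) w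
        + dFun EN (fun y => β j y (PN.sharp y (α i y))) (p x) w := fun i j =>
    formBracket_apply PN w
  -- The derivatives of the coefficients along `u` cancel: those of g_j between dB(X, u) and
  -- d(B(X))(u), where B is the second form, and those of f_i by skewness (`h2`). The derivatives
  -- along `X` and `Y` are the correction terms of the pullback bracket.
  rw [lieForm, _root_.add_apply, hBX', dForm_sum_smul _ hU hx hg hβp, dForm_sum_smul _ hU hx hf hαp]
  simp only [dForm_comp_mfderiv hV (hUV x hx) (hα _), dForm_comp_mfderiv hV (hUV x hx) (hβ _),
    ContinuousLinearMap.comp_apply, hw, h1, h2, h3, h4, _root_.sub_apply, _root_.add_apply,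
    _root_.sum_apply, _root_.smul_apply, h5, smul_eq_mul, Finset.sum_add_distrib,
    Finset.sum_sub_distrib, mul_add, mul_sub, add_mul, mul_neg, Finset.sum_neg_distrib,
    Finset.mul_sum]
  rw [Finset.sum_comm (s := (Finset.univ : Finset (Fin l))) (t := (Finset.univ : Finset (Fin k)))
      (f := fun j i => g j x * (f i x * dForm (β j) (p x) (PN.sharp (p x) (α i (p x))) w)),
    Finset.sum_comm (s := (Finset.univ : Finset (Fin l))) (t := (Finset.univ : Finset (Fin k)))
      (f := fun j i => dFun EM (g j) x u * (f i x * β j (p x) (PN.sharp (p x) (α i (p x)))))]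
  have e1 : ∀ a b c : ℝ, a * (b * c) = b * a * c := fun a b c => by ring
  simp only [e1, mul_comm (g _ x) (f _ x)]
  ring

/-- A transported bracket makes sense without any decomposition into pulled back sections, so the
formula only has to be verified for each given decomposition. It becomes a Dorfman bracket of
explicit sections, compared after the injective map p^*. -/
theorem isPullbackBracket_transportBracket (hL : IsDiracStructure L) (hr : IsReduction L p)
    (hΘ : ∀ x v, (Θ x v).1.1 = v.1.1 ∧
      ((Θ x v).1.2 : Cot EN (p x)).comp (mfderiv 𝓘(ℝ, EM) 𝓘(ℝ, EN) p x) = v.1.2) :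
    IsPullbackBracket p (cotangentAlgebroid PN) (transportBracket Θ) := by
  intro U V hU hV hUV k l f α g β σ τ hf hα hg hβ hX hY hσ hτ x hx
  have hαp : ∀ {n : ℕ} {c : Fin n → M → ℝ} {α : Fin n → ∀ y, (cotangentAlgebroid PN).fiber y},
      (∀ i, ContMDiffOn 𝓘(ℝ, EM) 𝓘(ℝ, ℝ) ∞ (c i) U) →
      (∀ i, (cotangentAlgebroid PN).SmoothOn V (α i)) →
      SmoothSectionOn EM (EM →L[ℝ] ℝ) U (fun y => ∑ i, c i y • ((α i (p y) : Cot EN (p y)).comp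
        (mfderiv 𝓘(ℝ, EM) 𝓘(ℝ, EN) p y))) := fun {n c α} hc hα =>
    SmoothSectionOn.sum fun i _ => SmoothSectionOn.smul (hc i)
      ((smoothSectionOn_comp_mfderiv_iff hr.submersion hU).1
        (SmoothSectionOn.pullback hV (hα i) hUV))
  have hcoe : ∀ {n : ℕ} {c : Fin n → M → ℝ} {α : Fin n → ∀ y, (cotangentAlgebroid PN).fiber y}
      {υ : ∀ x, pullbackFiber p (cotangentAlgebroid PN) x},
      (∀ x ∈ U, pullbackProj p (cotangentAlgebroid PN) x (υ x) = ∑ i, c i x • α i (p x)) →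
      ∀ y ∈ U, ((υ y).1.2 : Cot EN (p y)) = ∑ i, c i y • (α i (p y) : Cot EN (p y)) :=
    fun {n c α υ} h y hy => by
      have h1 := congrArg (Submodule.subtype (⊤ : Submodule ℝ (Cot EN (p y)))) (h y hy)
      have h2 := map_sum (Submodule.subtype (⊤ : Submodule ℝ (Cot EN (p y))))
        (fun i => c i y • α i (p y)) Finset.univ
      exact h1.trans h2
  have hsec : ∀ {n : ℕ} {c : Fin n → M → ℝ} {α : Fin n → ∀ y, (cotangentAlgebroid PN).fiber y}
      {υ : ∀ x, pullbackFiber p (cotangentAlgebroid PN) x},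
      (∀ x ∈ U, pullbackProj p (cotangentAlgebroid PN) x (υ x) = ∑ i, c i x • α i (p x)) →
      ∀ y ∈ U, (((Θ y).symm (υ y) : L y) : GenTan EM y) = ((υ y).1.1, ∑ i, c i y •
        ((α i (p y) : Cot EN (p y)).comp (mfderiv 𝓘(ℝ, EM) 𝓘(ℝ, EN) p y))) :=
    fun {n c α υ} h y hy => by
      rw [coe_symm_reducedEquiv hΘ, hcoe h y hy]
      refine Prod.ext rfl ?_
      ext v
      simp [_root_.sum_apply]
  have hanc : ∀ {n : ℕ} {c : Fin n → M → ℝ} {α : Fin n → ∀ y, (cotangentAlgebroid PN).fiber y}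
      {υ : ∀ x, pullbackFiber p (cotangentAlgebroid PN) x},
      (∀ x ∈ U, pullbackProj p (cotangentAlgebroid PN) x (υ x) = ∑ i, c i x • α i (p x)) →
      ∀ y ∈ U, mfderiv 𝓘(ℝ, EM) 𝓘(ℝ, EN) p y (υ y).1.1
        = ∑ i, c i y • PN.sharp (p y) (α i (p y) : Cot EN (p y)) := fun {n c α υ} h y hy => by
      rw [← mem_pullbackFiber_cotangent.1 (υ y).2]
      refine (congrArg (PN.sharp (p y)) (hcoe h y hy)).trans ?_
      rw [map_sum]
      exact Finset.sum_congr rfl fun i _ => map_smul _ _ _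
  have hsm : ∀ {n : ℕ} {c : Fin n → M → ℝ} {α : Fin n → ∀ y, (cotangentAlgebroid PN).fiber y}
      {υ : ∀ x, pullbackFiber p (cotangentAlgebroid PN) x},
      (∀ i, ContMDiffOn 𝓘(ℝ, EM) 𝓘(ℝ, ℝ) ∞ (c i) U) →
      (∀ i, (cotangentAlgebroid PN).SmoothOn V (α i)) →
      SmoothSectionOn EM EM U (fun x => (υ x).1.1) →
      (∀ x ∈ U, pullbackProj p (cotangentAlgebroid PN) x (υ x) = ∑ i, c i x • α i (p x)) →
      (diracAlgebroid L).SmoothOn U (fun y => (Θ y).symm (υ y)) :=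
    fun {n c α υ} hc hα hX h => smoothSectionOn_gen_iff.2
      ⟨hX.congr fun y hy => congrArg Prod.fst (hsec h y hy),
        (hαp hc hα).congr fun y hy => congrArg Prod.snd (hsec h y hy)⟩
  have hev : ∀ᶠ y in 𝓝 x, y ∈ U := hU.mem_nhds hx
  have hd : (((Θ x).symm (transportBracket Θ σ τ x) : L x) : GenTan EM x)
      = dorfman (fun y => ((σ y).1.1, ∑ i, f i y •
          ((α i (p y) : Cot EN (p y)).comp (mfderiv 𝓘(ℝ, EM) 𝓘(ℝ, EN) p y))))
        (fun y => ((τ y).1.1, ∑ i, g i y •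
          ((β i (p y) : Cot EN (p y)).comp (mfderiv 𝓘(ℝ, EM) 𝓘(ℝ, EN) p y)))) x := by
    refine (congrArg Subtype.val ((Θ x).symm_apply_apply _)).trans ?_
    refine (hL.coe_bracket hU hx (hsm hf hα hX hσ) (hsm hg hβ hY hτ)).trans ?_
    exact dorfman_congr (hev.mono fun y hy => hsec hσ y hy) (hev.mono fun y hy => hsec hτ y hy)
  rw [coe_symm_reducedEquiv hΘ] at hd
  refine ⟨congrArg Prod.fst hd, Subtype.ext ?_⟩
  let J : (cotangentAlgebroid PN).fiber (p x) →ₗ[ℝ] Cot EN (p x) :=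
    Submodule.subtype (⊤ : Submodule ℝ (Cot EN (p x)))
  have hJ : J (∑ i, ∑ j, (f i x * g j x) • (cotangentAlgebroid PN).bracket (α i) (β j) (p x)
        + ∑ j, dFun EM (g j) x (σ x).1.1 • β j (p x)
        - ∑ i, dFun EM (f i) x (τ x).1.1 • α i (p x))
      = ∑ i, ∑ j, (f i x * g j x) • J ((cotangentAlgebroid PN).bracket (α i) (β j) (p x))
        + ∑ j, dFun EM (g j) x (σ x).1.1 • J (β j (p x))
        - ∑ i, dFun EM (f i) x (τ x).1.1 • J (α i (p x)) :=
    map_combination J (fun i j => f i x * g j x)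
      (fun i j => (cotangentAlgebroid PN).bracket (α i) (β j) (p x))
      (fun j => dFun EM (g j) x (σ x).1.1) (fun j => β j (p x))
      (fun i => dFun EM (f i) x (τ x).1.1) (fun i => α i (p x))
  refine comp_mfderiv_injective hr ((congrArg Prod.snd hd).trans (Eq.trans ?_
    (congrArg (fun γ : Cot EN (p x) => γ.comp (mfderiv 𝓘(ℝ, EM) 𝓘(ℝ, EN) p x)) hJ.symm)))
  ext u
  exact lieForm_sub_dForm_pullback (PN := PN) hr hU hV hUV hx hf hα hg hβ (hanc hσ) (hanc hτ) u

end ReducedPullback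

/-! ### Determinants and alternating maps -/

section Alternating

variable {V W : Type*} [AddCommGroup V] [Module ℝ V] [AddCommGroup W] [Module ℝ W] {n : ℕ}

/-- Every term other than the diagonal one repeats a vector. -/
theorem alternating_update_sum (f : V [⋀^Fin n]→ₗ[ℝ] W) (e : Fin n → V) (c : Fin n → ℝ)
    (i : Fin n) : f (Function.update e i (∑ k, c k • e k)) = c i • f e := by
  rw [f.map_update_sum, Finset.sum_eq_single i]
  · rw [f.map_update_smul, Function.update_eq_self]
  · intro k _ hk
    rw [f.map_update_smul, f.map_update_self e hk.symm, smul_zero]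
  · simp

/-- Both sides are alternating in the rows of `a`, so it suffices to compare them on permutations of
the standard basis. -/
theorem alternating_matrix (f : V [⋀^Fin n]→ₗ[ℝ] W) (e : Fin n → V)
    (a : Matrix (Fin n) (Fin n) ℝ) : f (fun i => ∑ k, a i k • e k) = a.det • f e := by
  have h : f.compLinearMap (Fintype.linearCombination ℝ e)
      = (LinearMap.toSpanSingleton ℝ W (f e)).compAlternatingMap Matrix.detRowAlternating := by
    refine Module.Basis.ext_alternating (Pi.basisFun ℝ (Fin n)) fun v hv => ?_
    obtain ⟨s, rfl⟩ : ∃ s : Equiv.Perm (Fin n), v = s :=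
      ⟨Equiv.ofBijective v (Finite.injective_iff_bijective.1 hv), rfl⟩
    have h1 : (fun i => Fintype.linearCombination ℝ e (Pi.basisFun ℝ (Fin n) (s i))) = e ∘ s := by
      funext i
      simp [Fintype.linearCombination_apply_single]
    have h2 : (Matrix.detRowAlternating fun i => Pi.basisFun ℝ (Fin n) (s i) : ℝ)
        = ((Equiv.Perm.sign s : ℤ) : ℝ) := by
      have h3 := (Matrix.detRowAlternating (n := Fin n) (R := ℝ)).map_perm
        (fun i => Pi.basisFun ℝ (Fin n) i) s
      have h4 : (Matrix.detRowAlternating fun i => Pi.basisFun ℝ (Fin n) i : ℝ) = 1 := by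
        have : (fun i => Pi.basisFun ℝ (Fin n) i) = (1 : Matrix (Fin n) (Fin n) ℝ) := by
          ext i j
          simp [Matrix.one_apply, Pi.single_apply, eq_comm]
        rw [this]
        exact Matrix.det_one
      rw [h4] at h3
      refine h3.trans ?_
      simp [Units.smul_def]
    rw [AlternatingMap.compLinearMap_apply, h1, f.map_perm, LinearMap.compAlternatingMap_apply, h2,
      LinearMap.toSpanSingleton_apply, Units.smul_def, Int.cast_smul_eq_zsmul]
  have h1 := DFunLike.congr_fun h a
  exact h1

theorem det_updateRow_eq (a : Matrix (Fin n) (Fin n) ℝ) (i : Fin n) (w : Fin n → ℝ) :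
    (a.updateRow i w).det = ∑ k, w k * a.adjugate k i := by
  rw [← Matrix.cramer_transpose_apply, Matrix.cramer_eq_adjugate_mulVec, ← Matrix.adjugate_transpose,
    Matrix.mulVec, dotProduct]
  exact Finset.sum_congr rfl fun k _ => by rw [Matrix.transpose_apply, mul_comm]

/-- Cofactor expansion gives tr(a C adj a), and cyclicity of the trace together with (adj a) a = det
a gives the result. This is the infinitesimal multiplicativity of the determinant. -/
theorem sum_det_updateRow_mul (a C : Matrix (Fin n) (Fin n) ℝ) :
    ∑ i, (a.updateRow i ((a * C) i)).det = a.det * C.trace := by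
  have h : ∑ i, (a.updateRow i ((a * C) i)).det = ((a * C) * a.adjugate).trace := by
    rw [Matrix.trace]
    exact Finset.sum_congr rfl fun i _ => by rw [det_updateRow_eq, Matrix.diag_apply, Matrix.mul_apply]
  rw [h, Matrix.trace_mul_comm, ← Matrix.mul_assoc, Matrix.adjugate_mul, Matrix.smul_mul,
    Matrix.one_mul, Matrix.trace_smul, smul_eq_mul]

/-- In the applications `d` and `d'` are the derivatives of the frames `e` and `e'` along a section,
and `b` is the derivative of the transition matrix `a`. The factor is then the derivative of det a
plus det a times tr C. -/
theorem alternating_change (f : V [⋀^Fin n]→ₗ[ℝ] W) (e e' d d' : Fin n → V)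
    (a b C : Matrix (Fin n) (Fin n) ℝ) (he : ∀ i, e' i = ∑ k, a i k • e k)
    (hd : ∀ i, d i = ∑ k, C i k • e k)
    (hd' : ∀ i, d' i = ∑ k, (b i k • e k + a i k • d k)) :
    ∑ i, f (Function.update e' i (d' i))
      = (∑ i, (a.updateRow i (b i)).det + a.det * C.trace) • f e := by
  rw [← sum_det_updateRow_mul, ← Finset.sum_add_distrib, Finset.sum_smul]
  refine Finset.sum_congr rfl fun i _ => ?_
  have h1 : Function.update e' i (d' i) = fun j => ∑ k, (a.updateRow i (b i + (a * C) i)) j k • e k := by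
    funext j
    by_cases hj : j = i
    · subst hj
      rw [Function.update_self, hd']
      simp only [Matrix.updateRow_self, Pi.add_apply, add_smul, Finset.sum_add_distrib]
      congr 1
      simp only [hd, Finset.smul_sum, Matrix.mul_apply, Finset.sum_smul, smul_smul]
      exact Finset.sum_comm
    · rw [Function.update_of_ne hj, he]
      simp only [Matrix.updateRow_ne hj]
  rw [h1, alternating_matrix, Matrix.det_updateRow_add]

end Alternating

/-! ### Derivatives of products and determinants of functions. -/

section DetDerivative

theorem mdifferentiableAt_finset_prod {ι : Type*} {s : Finset ι} {h : ι → M → ℝ} {x : M}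
    (hh : ∀ i ∈ s, MDifferentiableAt 𝓘(ℝ, EM) 𝓘(ℝ, ℝ) (h i) x) :
    MDifferentiableAt 𝓘(ℝ, EM) 𝓘(ℝ, ℝ) (fun y => ∏ i ∈ s, h i y) x := by
  classical
  induction s using Finset.induction_on with
  | empty => simpa using mdifferentiableAt_const
  | insert a s ha ih =>
    simp only [Finset.prod_insert ha]
    exact (hh a (Finset.mem_insert_self a s)).mul (ih fun i hi => hh i (Finset.mem_insert_of_mem hi))

theorem dFun_prod {n : ℕ} {s : Finset (Fin n)} {h : Fin n → M → ℝ} {x : M}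
    (hh : ∀ i ∈ s, MDifferentiableAt 𝓘(ℝ, EM) 𝓘(ℝ, ℝ) (h i) x) (v : Tan EM x) :
    dFun EM (fun y => ∏ i ∈ s, h i y) x v
      = ∑ i ∈ s, ∏ j ∈ s, if j = i then dFun EM (h j) x v else h j x := by
  induction s using Finset.induction_on with
  | empty =>
    simp only [Finset.prod_empty, Finset.sum_empty]
    rw [dFun_const]
    rfl
  | insert a s ha ih =>
    have h1 := fun i hi => hh i (Finset.mem_insert_of_mem (a := i) (b := a) (s := s) hi)
    simp only [Finset.prod_insert ha, Finset.sum_insert ha]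
    rw [dFun_mul (hh a (Finset.mem_insert_self a s)) (mdifferentiableAt_finset_prod h1),
      _root_.add_apply, _root_.smul_apply, _root_.smul_apply, ih h1]
    have h2 : ∀ i ∈ s, a ≠ i := fun i hi h => ha (h ▸ hi)
    have h3 : ∏ j ∈ s, (if j = a then dFun EM (h j) x v else h j x) = ∏ j ∈ s, h j x :=
      Finset.prod_congr rfl fun j hj => if_neg (h2 j hj).symm
    have h4 : ∀ i ∈ s, (if a = i then dFun EM (h a) x v else h a x) * ∏ j ∈ s,
        (if j = i then dFun EM (h j) x v else h j x)
        = h a x * ∏ j ∈ s, (if j = i then dFun EM (h j) x v else h j x) := fun i hi => by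
      rw [if_neg (h2 i hi)]
    rw [if_pos trivial, h3, Finset.sum_congr rfl h4, ← Finset.mul_sum]
    simp only [smul_eq_mul]
    ring

/-- Written row by row, the derivative has the shape of the first term in `alternating_change`. -/
theorem dFun_det {n : ℕ} {a : M → Matrix (Fin n) (Fin n) ℝ} {x : M}
    (ha : ∀ i j, MDifferentiableAt 𝓘(ℝ, EM) 𝓘(ℝ, ℝ) (fun y => a y i j) x) (v : Tan EM x) :
    dFun EM (fun y => (a y).det) x v
      = ∑ i, ((a x).updateRow i fun j => dFun EM (fun y => a y i j) x v).det := by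
  have h0 : (fun y => (a y).det) = fun y => ∑ s : Equiv.Perm (Fin n),
      ((Equiv.Perm.sign s : ℤ) : ℝ) * ∏ i, a y i (s i) := by
    funext y
    rw [← Matrix.det_transpose, Matrix.det_apply']
    rfl
  have h1 : ∀ s : Equiv.Perm (Fin n), MDifferentiableAt 𝓘(ℝ, EM) 𝓘(ℝ, ℝ)
      (fun y => ∏ i, a y i (s i)) x := fun s => mdifferentiableAt_finset_prod fun i _ => ha i (s i)
  have h1' : ∀ s : Equiv.Perm (Fin n), MDifferentiableAt 𝓘(ℝ, EM) 𝓘(ℝ, ℝ)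
      (fun y => ((Equiv.Perm.sign s : ℤ) : ℝ) * ∏ i, a y i (s i)) x := fun s =>
    mdifferentiableAt_const.mul (h1 s)
  rw [h0, dFun_sum fun s _ => h1' s, _root_.sum_apply]
  have h2 : ∀ i, ((a x).updateRow i fun j => dFun EM (fun y => a y i j) x v).det
      = ∑ s : Equiv.Perm (Fin n), ((Equiv.Perm.sign s : ℤ) : ℝ) * ∏ j,
        if j = i then dFun EM (fun y => a y j (s j)) x v else a x j (s j) := fun i => by
    rw [← Matrix.det_transpose, Matrix.det_apply']
    refine Finset.sum_congr rfl fun s _ => congrArg _ (Finset.prod_congr rfl fun j _ => ?_)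
    rw [Matrix.transpose_apply, Matrix.updateRow_apply]
    split_ifs with h
    · rw [h]
    · rfl
  simp only [h2]
  rw [Finset.sum_comm]
  refine Finset.sum_congr rfl fun s _ => ?_
  rw [dFun_const_mul _ (h1 s), _root_.smul_apply, dFun_prod fun i _ => ha i (s i), smul_eq_mul,
    Finset.mul_sum]

end DetDerivative

/-! ### The canonical representation in frames -/

section LieDerivative

variable [FiniteDimensional ℝ EM] [T2Space M] {U : Set M} {x : M}

theorem lieForm_sum_smul_left {ι : Type*} (s : Finset ι) {f : ι → M → ℝ}
    {X : ι → ∀ x : M, Tan EM x} {β : ∀ x : M, Cot EM x} (hU : IsOpen U) (hx : x ∈ U)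
    (hf : ∀ i, ContMDiffOn 𝓘(ℝ, EM) 𝓘(ℝ, ℝ) ∞ (f i) U)
    (hX : ∀ i, SmoothSectionOn EM EM U (X i)) (hβ : SmoothSectionOn EM (EM →L[ℝ] ℝ) U β) :
    lieForm (fun y => ∑ i ∈ s, f i y • X i y) β x
      = ∑ i ∈ s, (f i x • lieForm (X i) β x + β x (X i x) • dFun EM (f i) x) := by
  have h1 : (fun y => β y (∑ i ∈ s, f i y • X i y)) = fun y => ∑ i ∈ s, f i y * β y (X i y) := by
    funext y
    rw [map_sum]
    exact Finset.sum_congr rfl fun i _ => map_smul _ _ _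
  have hd : ∀ i, MDifferentiableAt 𝓘(ℝ, EM) 𝓘(ℝ, ℝ) (f i) x := fun i =>
    ((hf i).contMDiffAt (hU.mem_nhds hx)).mdifferentiableAt (by simp)
  have hd' : ∀ i, MDifferentiableAt 𝓘(ℝ, EM) 𝓘(ℝ, ℝ) (fun y => f i y * β y (X i y)) x := fun i =>
    (hd i).mul (hβ.mdiff_apply hU hx (hX i))
  ext u
  rw [lieForm, h1, dFun_sum fun i _ => hd' i, _root_.add_apply, dForm_map_sum, _root_.sum_apply,
    _root_.sum_apply, ← Finset.sum_add_distrib]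
  refine Finset.sum_congr rfl fun i _ => ?_
  rw [dFun_mul (hd i) (hβ.mdiff_apply hU hx (hX i)), lieForm]
  simp only [_root_.add_apply, _root_.smul_apply, smul_eq_mul]
  ring

theorem lieForm_sum_smul {ι : Type*} (s : Finset ι) {f : ι → M → ℝ}
    {β : ι → ∀ x : M, Cot EM x} {X : ∀ x : M, Tan EM x} (hU : IsOpen U) (hx : x ∈ U)
    (hf : ∀ i, ContMDiffOn 𝓘(ℝ, EM) 𝓘(ℝ, ℝ) ∞ (f i) U)
    (hX : SmoothSectionOn EM EM U X) (hβ : ∀ i, SmoothSectionOn EM (EM →L[ℝ] ℝ) U (β i)) :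
    lieForm X (fun y => ∑ i ∈ s, f i y • β i y) x
      = ∑ i ∈ s, (dFun EM (f i) x (X x) • β i x + f i x • lieForm X (β i) x) := by
  have h1 : (fun y => (∑ i ∈ s, f i y • β i y) (X y)) = fun y => ∑ i ∈ s, f i y * β i y (X y) := by
    funext y
    rw [_root_.sum_apply]
    rfl
  have hd : ∀ i, MDifferentiableAt 𝓘(ℝ, EM) 𝓘(ℝ, ℝ) (f i) x := fun i =>
    ((hf i).contMDiffAt (hU.mem_nhds hx)).mdifferentiableAt (by simp)
  have hd' : ∀ i, MDifferentiableAt 𝓘(ℝ, EM) 𝓘(ℝ, ℝ) (fun y => f i y * β i y (X y)) x := fun i =>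
    (hd i).mul ((hβ i).mdiff_apply hU hx hX)
  ext u
  rw [lieForm, h1, dFun_sum fun i _ => hd' i, _root_.add_apply, dForm_sum_smul s hU hx hf hβ,
    _root_.sum_apply, _root_.sum_apply, ← Finset.sum_add_distrib]
  refine Finset.sum_congr rfl fun i _ => ?_
  rw [dFun_mul (hd i) ((hβ i).mdiff_apply hU hx hX), lieForm]
  simp only [_root_.add_apply, _root_.smul_apply, smul_eq_mul]
  ring

theorem exists_form_coefficients {n : ℕ} {θ : Fin n → ∀ x : M, Cot EM x}
    (hθ : ∀ j, SmoothSectionOn EM (EM →L[ℝ] ℝ) U (θ j))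
    (hl : ∀ x ∈ U, LinearIndependent ℝ fun j => θ j x)
    (hs : ∀ x ∈ U, Submodule.span ℝ (range fun j => θ j x) = ⊤) (hU : IsOpen U)
    {β : ∀ x : M, Cot EM x} (hβ : SmoothSectionOn EM (EM →L[ℝ] ℝ) U β) :
    ∃ c : Fin n → M → ℝ, (∀ i, ContMDiffOn 𝓘(ℝ, EM) 𝓘(ℝ, ℝ) ∞ (c i) U) ∧
      ∀ x ∈ U, β x = ∑ i, c i x • θ i x := by
  -- A device to reuse the coefficient lemma for T*M. The rank, anchor and bracket are placeholders
  -- that do not enter `IsFrame`.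
  let A : PreLieAlgebroid EM (EM →L[ℝ] ℝ) (Cot EM : M → Type _) :=
    { rank := 0
      fiber := fun _ => ⊤
      anchor := fun _ => 0
      bracket := fun _ _ _ => 0 }
  have hF : A.IsFrame U fun j x => (⟨θ j x, trivial⟩ : (⊤ : Submodule ℝ (Cot EM x))) := by
    refine ⟨hθ, fun x hx => ?_, fun x hx => ?_⟩
    · exact LinearIndependent.of_comp (Submodule.subtype (⊤ : Submodule ℝ (Cot EM x))) (hl x hx)
    · refine Submodule.map_injective_of_injective
        (Submodule.subtype_injective (⊤ : Submodule ℝ (Cot EM x))) ?_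
      have h2 := hs x hx
      have h1 : (Submodule.subtype (⊤ : Submodule ℝ (Cot EM x))) '' (range fun j =>
          (⟨θ j x, trivial⟩ : (⊤ : Submodule ℝ (Cot EM x)))) = range fun j => θ j x := by
        rw [← range_comp]
        rfl
      have h3 : Submodule.map (Submodule.subtype (⊤ : Submodule ℝ (Cot EM x))) ⊤ = ⊤ := by simp
      refine Eq.trans ?_ h3.symm
      refine Eq.trans (Submodule.map_span _ _) ?_
      exact (congrArg (Submodule.span ℝ) h1).trans h2
  obtain ⟨c, hc, h⟩ := hF.exists_coefficients hU (σ := fun x => ⟨β x, trivial⟩) hβ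
  refine ⟨c, hc, fun x hx => ?_⟩
  have h1 := congrArg (Submodule.subtype (⊤ : Submodule ℝ (Cot EM x))) (h x hx)
  exact h1.trans (map_sum (Submodule.subtype (⊤ : Submodule ℝ (Cot EM x)))
    (fun i => c i x • (⟨θ i x, trivial⟩ : (⊤ : Submodule ℝ (Cot EM x)))) Finset.univ)

/-- This is the Jacobi identity of the Dorfman bracket when the first two sections have no form
part. -/
theorem lieForm_lieVec {X Y : ∀ x : M, Tan EM x} {β : ∀ x : M, Cot EM x} (hU : IsOpen U)
    (hx : x ∈ U) (hX : SmoothSectionOn EM EM U X) (hY : SmoothSectionOn EM EM U Y)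
    (hβ : SmoothSectionOn EM (EM →L[ℝ] ℝ) U β) :
    lieForm (lieVec X Y) β x = lieForm X (lieForm Y β) x - lieForm Y (lieForm X β) x := by
  have h0 : ∀ y : M, dForm (fun y => (0 : Cot EM y)) y = 0 := fun y => by
    have h1 := dForm_dFun (EM := EM) isOpen_univ (mem_univ y) (f := fun _ => (0 : ℝ))
      contMDiffOn_const
    have h2 : dFun EM (fun _ : M => (0 : ℝ)) = fun _ => 0 := funext fun y => dFun_const 0
    rwa [h2] at h1
  have h1 : ∀ (Z W : ∀ x : M, Tan EM x) (γ : ∀ x : M, Cot EM x),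
      dorfman (fun y => (Z y, 0)) (fun y => (W y, γ y))
        = fun y => (lieVec Z W y, lieForm Z γ y) := fun Z W γ => by
    funext y
    refine Prod.ext rfl ?_
    change lieForm Z γ y - dForm (fun y => (0 : Cot EM y)) y (W y) = lieForm Z γ y
    rw [h0, Pi.zero_apply, sub_zero]
  have h2 : ∀ Z W : ∀ x : M, Tan EM x,
      dorfman (fun y => (Z y, 0)) (fun y => (W y, (0 : Cot EM y)))
        = fun y => (lieVec Z W y, 0) := fun Z W => by
    rw [h1]
    funext y
    refine Prod.ext rfl ?_
    change dForm (fun y => (0 : Cot EM y)) y (Z y) + dFun EM (fun y => (0 : Cot EM y) (Z y)) y = 0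
    rw [h0, Pi.zero_apply, zero_add]
    exact dFun_const 0
  have hs : ∀ {Z : ∀ x : M, Tan EM x} {γ : ∀ x : M, Cot EM x}, SmoothSectionOn EM EM U Z →
      SmoothSectionOn EM (EM →L[ℝ] ℝ) U γ →
      SmoothSectionOn EM (GenModel EM) U (fun y => (Z y, γ y)) := fun hZ hγ =>
    smoothSectionOn_gen_iff.2 ⟨hZ, hγ⟩
  have h := dorfman_leibniz hU hx (hs hX smoothSectionOn_zero) (hs hY smoothSectionOn_zero)
    (hs hX hβ)
  rw [h1, h2, h1, h1, h1, h1] at h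
  have h3 := congrArg Prod.snd h
  exact eq_sub_of_add_eq h3.symm

end LieDerivative

namespace PreLieAlgebroid

section

variable [FiniteDimensional ℝ EM] [T2Space M] {F : Type*} [NormedAddCommGroup F] [NormedSpace ℝ F]
  {E : M → Type*}
  [∀ x, AddCommGroup (E x)] [∀ x, Module ℝ (E x)] [TopologicalSpace (TotalSpace F E)]
  [∀ x, TopologicalSpace (E x)] [FiberBundle F E]
  {A : PreLieAlgebroid EM F E} {U : Set M} {x : M} {σ : ∀ x, A.fiber x}
  {e e' : Fin A.rank → ∀ x, A.fiber x} {θ θ' : Fin (Module.finrank ℝ EM) → ∀ x : M, Cot EM x}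

theorem AreFrames.isFrame (h : A.AreFrames U e θ) : A.IsFrame U e :=
  ⟨h.smooth, h.linearIndependent, h.span⟩

theorem AreFrames.mono (h : A.AreFrames U e θ) {V : Set M} (hV : V ⊆ U) : A.AreFrames V e θ :=
  ⟨fun i => SmoothSectionOn.mono (h.smooth i) hV, fun x hx => h.linearIndependent x (hV hx),
    fun x hx => h.span x (hV hx), fun j => (h.smooth' j).mono hV,
    fun x hx => h.linearIndependent' x (hV hx), fun x hx => h.span' x (hV hx)⟩

/-- In each wedge only the diagonal coefficients survive. All later work on the canonical
representation is done with these two traces. -/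
theorem nablaGen_eq {C : Matrix (Fin A.rank) (Fin A.rank) ℝ}
    {D : Matrix (Fin (Module.finrank ℝ EM)) (Fin (Module.finrank ℝ EM)) ℝ}
    (hC : ∀ i, A.bracket σ (e i) x = ∑ k, C i k • e k x)
    (hD : ∀ j, lieForm (fun y => A.anchor y (σ y)) (θ j) x = ∑ k, D j k • θ k x) :
    A.nablaGen σ e θ x = (C.trace + D.trace) • A.gen e θ x := by
  simp only [nablaGen, gen, hC, hD]
  have h1 := fun i => alternating_update_sum (exteriorPower.ιMulti ℝ A.rank) (fun k => e k x) (C i) i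
  have h2 := fun j => alternating_update_sum (exteriorPower.ιMulti ℝ (Module.finrank ℝ EM))
    (fun k => θ k x) (D j) j
  simp only [h1, h2]
  rw [← Finset.sum_smul, ← Finset.sum_smul, ← TensorProduct.smul_tmul', TensorProduct.tmul_smul,
    ← add_smul]
  rfl

theorem gen_change {a : Matrix (Fin A.rank) (Fin A.rank) ℝ}
    {b : Matrix (Fin (Module.finrank ℝ EM)) (Fin (Module.finrank ℝ EM)) ℝ}
    (ha : ∀ i, e' i x = ∑ k, a i k • e k x) (hb : ∀ j, θ' j x = ∑ k, b j k • θ k x) :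
    A.gen e' θ' x = (a.det * b.det) • A.gen e θ x := by
  simp only [gen, ha, hb]
  have h1 := alternating_matrix (exteriorPower.ιMulti ℝ A.rank) (fun k => e k x) a
  have h2 := alternating_matrix (exteriorPower.ιMulti ℝ (Module.finrank ℝ EM)) (fun k => θ k x) b
  rw [h1, h2, TensorProduct.smul_tmul_smul]

/-- The product of the determinants relative to the two bases. It allows scalars to be compared on
multiples of the generator. -/
theorem AreFrames.exists_functional (h : A.AreFrames U e θ) (hx : x ∈ U) :
    ∃ T : A.CanLine x →ₗ[ℝ] ℝ, T (A.gen e θ x) = 1 := by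
  let b := Module.Basis.mk (h.linearIndependent x hx) (h.span x hx).ge
  let b' := Module.Basis.mk (h.linearIndependent' x hx) (h.span' x hx).ge
  refine ⟨LinearMap.mul' ℝ ℝ ∘ₗ TensorProduct.map (exteriorPower.alternatingMapLinearEquiv b.det)
    (exteriorPower.alternatingMapLinearEquiv b'.det), ?_⟩
  have h2 : b.det (fun i => e i x) = 1 := by
    have : (fun i => e i x) = b := by simp [b]
    rw [this, Module.Basis.det_self]
  have h3 : b'.det (fun i => θ i x) = 1 := by
    have : (fun i => θ i x) = b' := by simp [b']
    rw [this, Module.Basis.det_self]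
  simp [gen, h2, h3]

theorem AreFrames.gen_ne_zero (h : A.AreFrames U e θ) (hx : x ∈ U) : A.gen e θ x ≠ 0 := by
  obtain ⟨T, hT⟩ := h.exists_functional hx
  intro h0
  rw [h0, map_zero] at hT
  exact zero_ne_one hT

theorem AreFrames.smul_gen_injective (h : A.AreFrames U e θ) (hx : x ∈ U) {s t : ℝ}
    (hst : s • A.gen e θ x = t • A.gen e θ x) : s = t := by
  obtain ⟨T, hT⟩ := h.exists_functional hx
  have h1 := congrArg T hst
  rwa [map_smul, map_smul, hT, smul_eq_mul, smul_eq_mul, mul_one, mul_one] at h1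

theorem IsLieAlgebroid.bracket_sum (hA : A.IsLieAlgebroid) [VectorBundle ℝ F E]
    [ContMDiffVectorBundle ∞ F E 𝓘(ℝ, EM)] {ι : Type*} (s : Finset ι) {f : ι → M → ℝ}
    {τ : ι → ∀ x, A.fiber x} (hU : IsOpen U) (hx : x ∈ U) (hσ : A.SmoothOn U σ)
    (hf : ∀ i, ContMDiffOn 𝓘(ℝ, EM) 𝓘(ℝ, ℝ) ∞ (f i) U) (hτ : ∀ i, A.SmoothOn U (τ i)) :
    A.bracket σ (fun y => ∑ i ∈ s, f i y • τ i y) x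
      = ∑ i ∈ s, (f i x • A.bracket σ (τ i) x + dFun EM (f i) x (A.anchor x (σ x)) • τ i x) := by
  classical
  induction s using Finset.induction_on with
  | empty =>
    simp only [Finset.sum_empty]
    have h1 := hA.leibniz U hU σ σ (fun _ => 0) hσ hσ contMDiffOn_const x hx
    rw [dFun_const] at h1
    simpa using h1
  | insert a s ha ih =>
    simp only [Finset.sum_insert ha]
    have h1 : A.SmoothOn U (fun y => f a y • τ a y) := SmoothSectionOn.smul (hf a) (hτ a)
    have h2 : A.SmoothOn U (fun y => ∑ i ∈ s, f i y • τ i y) := by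
      refine SmoothSectionOn.congr
        (SmoothSectionOn.sum (s := s) fun i _ => SmoothSectionOn.smul (hf i) (hτ i)) fun y _ => ?_
      rw [Submodule.coe_sum]
      rfl
    rw [hA.bracket_add U hU _ _ _ hσ h1 h2 x hx, ih, hA.leibniz U hU _ _ _ hσ (hτ a) (hf a) x hx]

/-- The smooth matrices of a section acting on frames. -/
theorem AreFrames.exists_matrices (hA : A.IsLieAlgebroid) [FiniteDimensional ℝ F]
    [VectorBundle ℝ F E] [ContMDiffVectorBundle ∞ F E 𝓘(ℝ, EM)] (h : A.AreFrames U e θ)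
    (hU : IsOpen U) (hσ : A.SmoothOn U σ) :
    ∃ (C : M → Matrix (Fin A.rank) (Fin A.rank) ℝ)
      (D : M → Matrix (Fin (Module.finrank ℝ EM)) (Fin (Module.finrank ℝ EM)) ℝ),
      (∀ i j, ContMDiffOn 𝓘(ℝ, EM) 𝓘(ℝ, ℝ) ∞ (fun x => C x i j) U) ∧
      (∀ i j, ContMDiffOn 𝓘(ℝ, EM) 𝓘(ℝ, ℝ) ∞ (fun x => D x i j) U) ∧
      (∀ x ∈ U, ∀ i, A.bracket σ (e i) x = ∑ k, C x i k • e k x) ∧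
      ∀ x ∈ U, ∀ j, lieForm (fun y => A.anchor y (σ y)) (θ j) x = ∑ k, D x j k • θ k x := by
  choose C hC hC' using fun i => h.isFrame.exists_coefficients hU
    (hA.bracket_smooth U hU σ (e i) hσ (h.smooth i))
  choose D hD hD' using fun j => exists_form_coefficients h.smooth' h.linearIndependent' h.span' hU
    (SmoothSectionOn.lieForm hU (hA.anchor_smooth U hU σ hσ) (h.smooth' j))
  exact ⟨fun x i k => C i k x, fun x j k => D j k x, fun i j => hC i j, fun i j => hD i j,
    fun x hx i => hC' i x hx, fun x hx j => hD' j x hx⟩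

/-- The canonical representation in two frames. -/
theorem AreFrames.exists_change (hA : A.IsLieAlgebroid) [FiniteDimensional ℝ F]
    [VectorBundle ℝ F E] [ContMDiffVectorBundle ∞ F E 𝓘(ℝ, EM)] (h : A.AreFrames U e θ)
    (h' : A.AreFrames U e' θ') (hU : IsOpen U) :
    ∃ J : M → ℝ, ContMDiffOn 𝓘(ℝ, EM) 𝓘(ℝ, ℝ) ∞ J U ∧ ∀ x ∈ U, J x ≠ 0 ∧
      A.gen e' θ' x = J x • A.gen e θ x ∧ ∀ (σ : ∀ x, A.fiber x) (δ : ℝ), A.SmoothOn U σ →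
        A.nablaGen σ e θ x = δ • A.gen e θ x →
        A.nablaGen σ e' θ' x = (dFun EM J x (A.anchor x (σ x)) + J x * δ) • A.gen e θ x := by
  choose a ha ha' using fun i => h.isFrame.exists_coefficients hU (h'.smooth i)
  choose b hb hb' using fun j => exists_form_coefficients h.smooth' h.linearIndependent' h.span' hU
    (h'.smooth' j)
  let a₀ : M → Matrix (Fin A.rank) (Fin A.rank) ℝ := fun x i k => a i k x
  let b₀ : M → Matrix (Fin (Module.finrank ℝ EM)) (Fin (Module.finrank ℝ EM)) ℝ :=
    fun x i k => b i k x
  have hda : ContMDiffOn 𝓘(ℝ, EM) 𝓘(ℝ, ℝ) ∞ (fun x => (a₀ x).det) U := contMDiffOn_det ha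
  have hdb : ContMDiffOn 𝓘(ℝ, EM) 𝓘(ℝ, ℝ) ∞ (fun x => (b₀ x).det) U := contMDiffOn_det hb
  have hgen : ∀ x ∈ U, A.gen e' θ' x = ((a₀ x).det * (b₀ x).det) • A.gen e θ x := fun x hx =>
    gen_change (a := a₀ x) (b := b₀ x) (fun i => ha' i x hx) fun j => hb' j x hx
  -- `J` is the product of the two transition determinants. It cannot vanish, since the second
  -- generator does not.
  refine ⟨fun x => (a₀ x).det * (b₀ x).det, hda.mul hdb, fun x hx => ⟨fun h0 => ?_, hgen x hx, ?_⟩⟩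
  · have h1 := (hgen x hx).trans (congrArg (fun t : ℝ => t • A.gen e θ x) h0)
    rw [zero_smul] at h1
    exact h'.gen_ne_zero hx h1
  intro σ δ hσ hδ
  have hd : ∀ {g : M → ℝ}, ContMDiffOn 𝓘(ℝ, EM) 𝓘(ℝ, ℝ) ∞ g U →
      MDifferentiableAt 𝓘(ℝ, EM) 𝓘(ℝ, ℝ) g x := fun h =>
    (h.contMDiffAt (hU.mem_nhds hx)).mdifferentiableAt (by simp)
  obtain ⟨C, D, -, -, hC, hD⟩ := h.exists_matrices hA hU hσ
  have hδ' : δ = (C x).trace + (D x).trace := by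
    rw [nablaGen_eq (hC x hx) (hD x hx)] at hδ
    exact h.smul_gen_injective hx hδ.symm
  have hev : ∀ᶠ y in 𝓝 x, y ∈ U := hU.mem_nhds hx
  have e1 : ∀ i, A.bracket σ (e' i) x = ∑ k, (dFun EM (a i k) x (A.anchor x (σ x)) • e k x
      + a₀ x i k • A.bracket σ (e k) x) := fun i => by
    rw [hA.bracket_local U hU σ σ (e' i) _ hσ (h'.smooth i) (fun _ _ => rfl) (ha' i) x hx,
      hA.bracket_sum _ hU hx hσ (ha i) h.smooth]
    exact Finset.sum_congr rfl fun k _ => add_comm _ _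
  have e2 : ∀ j, lieForm (fun y => A.anchor y (σ y)) (θ' j) x
      = ∑ k, (dFun EM (b j k) x (A.anchor x (σ x)) • θ k x
      + b₀ x j k • lieForm (fun y => A.anchor y (σ y)) (θ k) x) := fun j => by
    rw [lieForm_congr (Filter.Eventually.of_forall fun _ => rfl) (hev.mono (hb' j)),
      lieForm_sum_smul _ hU hx (hb j) (hA.anchor_smooth U hU σ hσ) h.smooth']
  -- The Leibniz rule on each wedge factor gives the derivative of its transition determinant plus a
  -- trace. The product rule for `J` assembles the two.
  have k1 := alternating_change (exteriorPower.ιMulti ℝ A.rank) (fun k => e k x)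
    (fun k => e' k x) (fun k => A.bracket σ (e k) x) (fun k => A.bracket σ (e' k) x) (a₀ x)
    (fun i k => dFun EM (a i k) x (A.anchor x (σ x))) (C x) (fun i => ha' i x hx) (hC x hx) e1
  have k2 := alternating_change (exteriorPower.ιMulti ℝ (Module.finrank ℝ EM)) (fun k => θ k x)
    (fun k => θ' k x) (fun k => lieForm (fun y => A.anchor y (σ y)) (θ k) x)
    (fun k => lieForm (fun y => A.anchor y (σ y)) (θ' k) x) (b₀ x)
    (fun i k => dFun EM (b i k) x (A.anchor x (σ x))) (D x) (fun i => hb' i x hx) (hD x hx) e2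
  have k3 := alternating_matrix (exteriorPower.ιMulti ℝ A.rank) (fun k => e k x) (a₀ x)
  have k4 := alternating_matrix (exteriorPower.ιMulti ℝ (Module.finrank ℝ EM)) (fun k => θ k x)
    (b₀ x)
  have k5 : (fun i => e' i x) = fun i => ∑ k, a₀ x i k • e k x := funext fun i => ha' i x hx
  have k6 : (fun i => θ' i x) = fun i => ∑ k, b₀ x i k • θ k x := funext fun i => hb' i x hx
  rw [← k5] at k3
  rw [← k6] at k4
  rw [dFun_mul (hd hda) (hd hdb), nablaGen, k1, k2, k3, k4, _root_.add_apply, _root_.smul_apply,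
    _root_.smul_apply, dFun_det fun i j => hd (ha i j), dFun_det fun i j => hd (hb i j), hδ',
    TensorProduct.smul_tmul_smul, TensorProduct.smul_tmul_smul, ← add_smul]
  refine congrArg (fun t : ℝ => t • A.gen e θ x) ?_
  simp only [smul_eq_mul]
  ring

end

end PreLieAlgebroid

/-! ### Characteristic cocycles -/

section DLog

variable {U : Set M} {x : M}

/-- `Real.log` is log|·|, so the sign of `f` does not matter and ratios of sections need not be
positive. -/
theorem dFun_log {f : M → ℝ} (hf : MDifferentiableAt 𝓘(ℝ, EM) 𝓘(ℝ, ℝ) f x) (h0 : f x ≠ 0) :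
    dFun EM (fun y => Real.log (f y)) x = (f x)⁻¹ • dFun EM f x := by
  have h1 := HasMFDerivAt.comp x (Real.hasDerivAt_log h0).hasFDerivAt.hasMFDerivAt hf.hasMFDerivAt
  ext v
  refine (DFunLike.congr_fun h1.mfderiv v).trans ?_
  exact mul_comm (dFun EM f x v) (f x)⁻¹

theorem contMDiffOn_log {f : M → ℝ} (hf : ContMDiffOn 𝓘(ℝ, EM) 𝓘(ℝ, ℝ) ∞ f U)
    (h0 : ∀ x ∈ U, f x ≠ 0) : ContMDiffOn 𝓘(ℝ, EM) 𝓘(ℝ, ℝ) ∞ (fun y => Real.log (f y)) U :=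
  fun x hx => ContMDiffAt.comp_contMDiffWithinAt (g := Real.log) (I' := 𝓘(ℝ, ℝ)) x
    (Real.contDiffAt_log.2 (h0 x hx)).contMDiffAt (hf x hx)

end DLog

namespace PreLieAlgebroid

section

variable [FiniteDimensional ℝ EM] [T2Space M] {F : Type*} [NormedAddCommGroup F] [NormedSpace ℝ F]
  {E : M → Type*} [FiniteDimensional ℝ F]
  [∀ x, AddCommGroup (E x)] [∀ x, Module ℝ (E x)] [TopologicalSpace (TotalSpace F E)]
  [∀ x, TopologicalSpace (E x)] [FiberBundle F E] [VectorBundle ℝ F E]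
  [ContMDiffVectorBundle ∞ F E 𝓘(ℝ, EM)]
  {A : PreLieAlgebroid EM F E} {U : Set M} {x : M} {σ τ : ∀ x, A.fiber x}
  {e : Fin A.rank → ∀ x, A.fiber x} {θ : Fin (Module.finrank ℝ EM) → ∀ x : M, Cot EM x}
  {μ : ∀ x, A.CanLine x}

/-- Neither tensor factor alone is linear over functions in the section. The bracket [s_i e_i, e_k]
adds -ρ(e_i)(s_i) to the first trace, the Lie derivative of forms along s_i ρ(e_i) adds +ρ(e_i)(s_i)
to the second, and the two cancel. This is why the two lines are tensored. -/
theorem AreFrames.nablaGen_combination (hA : A.IsLieAlgebroid) (h : A.AreFrames U e θ)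
    (hU : IsOpen U) (hx : x ∈ U) (hσ : A.SmoothOn U σ) {s : Fin A.rank → M → ℝ}
    (hs : ∀ i, ContMDiffOn 𝓘(ℝ, EM) 𝓘(ℝ, ℝ) ∞ (s i) U)
    (hσs : ∀ y ∈ U, σ y = ∑ i, s i y • e i y) {δ : Fin A.rank → ℝ}
    (hδ : ∀ i, A.nablaGen (e i) e θ x = δ i • A.gen e θ x) :
    A.nablaGen σ e θ x = (∑ i, s i x * δ i) • A.gen e θ x := by
  choose C D _ _ hC hD using fun i => h.exists_matrices hA hU (h.smooth i)
  have hδ' : ∀ i, δ i = (C i x).trace + (D i x).trace := fun i => by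
    have h1 := hδ i
    rw [nablaGen_eq (hC i x hx) (hD i x hx)] at h1
    exact h.smul_gen_injective hx h1.symm
  have hc : ∀ i, ∃ c : Fin (Module.finrank ℝ EM) → ℝ, ∑ j, c j • θ j x = dFun EM (s i) x := fun i =>
    (Submodule.mem_span_range_iff_exists_fun ℝ).1 (by rw [h.span' x hx]; trivial)
  choose c hc using hc
  have e1 : ∀ k, A.bracket σ (e k) x = ∑ l, ((∑ i, s i x * C i x k l)
      - dFun EM (s l) x (A.anchor x (e k x))) • e l x := fun k => by
    have h1 : A.SmoothOn U (fun y => ∑ i, s i y • e i y) :=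
      SmoothSectionOn.congr hσ fun y hy => congrArg Subtype.val (hσs y hy).symm
    rw [hA.bracket_local U hU σ _ (e k) (e k) hσ (h.smooth k) hσs (fun _ _ => rfl) x hx,
      hA.bracket_skew U hU _ _ h1 (h.smooth k) x hx,
      hA.bracket_sum _ hU hx (h.smooth k) hs h.smooth, ← Finset.sum_neg_distrib]
    have h2 : ∀ i, A.bracket (e k) (e i) x = - ∑ l, C i x k l • e l x := fun i => by
      rw [hA.bracket_skew U hU _ _ (h.smooth k) (h.smooth i) x hx, hC i x hx]
    simp only [h2, smul_neg, neg_add, neg_neg, sub_smul, Finset.sum_smul, Finset.smul_sum,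
      Finset.sum_add_distrib, Finset.sum_sub_distrib, smul_smul, Finset.sum_neg_distrib]
    rw [Finset.sum_comm, sub_eq_add_neg]
  have hX := fun i => hA.anchor_smooth U hU _ (h.smooth i)
  have hev : ∀ᶠ y in 𝓝 x, y ∈ U := hU.mem_nhds hx
  have e2 : ∀ j, lieForm (fun y => A.anchor y (σ y)) (θ j) x = ∑ l, ∑ i, (s i x * D i x j l
      + θ j x (A.anchor x (e i x)) * c i l) • θ l x := fun j => by
    have h1 : ∀ᶠ y in 𝓝 x, A.anchor y (σ y) = ∑ i, s i y • A.anchor y (e i y) :=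
      hev.mono fun y hy => by
        rw [hσs y hy, map_sum]
        exact Finset.sum_congr rfl fun i _ => map_smul _ _ _
    rw [lieForm_congr h1 (Filter.Eventually.of_forall fun _ => rfl),
      lieForm_sum_smul_left _ hU hx hs hX (h.smooth' j), Finset.sum_comm]
    refine Finset.sum_congr rfl fun i _ => ?_
    rw [hD i x hx, ← hc, Finset.smul_sum, Finset.smul_sum, ← Finset.sum_add_distrib]
    exact Finset.sum_congr rfl fun l _ => by rw [smul_smul, smul_smul, add_smul]
  simp only [← Finset.sum_smul] at e2
  have h1 : ∀ i, ∑ j, θ j x (A.anchor x (e i x)) * c i j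
      = dFun EM (s i) x (A.anchor x (e i x)) := fun i => by
    rw [← hc, _root_.sum_apply]
    exact Finset.sum_congr rfl fun j _ => mul_comm _ _
  let Cσ : Matrix (Fin A.rank) (Fin A.rank) ℝ := fun k l => (∑ i, s i x * C i x k l)
    - dFun EM (s l) x (A.anchor x (e k x))
  let Dσ : Matrix (Fin (Module.finrank ℝ EM)) (Fin (Module.finrank ℝ EM)) ℝ := fun j l =>
    ∑ i, (s i x * D i x j l + θ j x (A.anchor x (e i x)) * c i l)
  rw [nablaGen_eq (C := Cσ) (D := Dσ) e1 e2]
  refine congrArg (fun t : ℝ => t • A.gen e θ x) ?_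
  have t1 : Cσ.trace = ∑ k, ((∑ i, s i x * C i x k k) - dFun EM (s k) x (A.anchor x (e k x))) := rfl
  have t2 : Dσ.trace = ∑ j, ∑ i, (s i x * D i x j j + θ j x (A.anchor x (e i x)) * c i j) := rfl
  have t3 : ∀ i, δ i = ∑ k, C i x k k + ∑ j, D i x j j := hδ'
  simp only [t1, t2, t3, Finset.sum_sub_distrib, Finset.sum_add_distrib, mul_add]
  have e3 : ∑ j, ∑ i, θ j x (A.anchor x (e i x)) * c i j
      = ∑ i, dFun EM (s i) x (A.anchor x (e i x)) := by
    rw [Finset.sum_comm]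
    exact Finset.sum_congr rfl fun i _ => h1 i
  rw [e3, Finset.sum_comm, Finset.sum_comm (f := fun j i => s i x * D i x j j)]
  simp only [Finset.mul_sum]
  ring

/-- The value at a point of the characteristic form of a nonvanishing section. -/
theorem IsNonvanishing.exists_functional (hA : A.IsLieAlgebroid) (hμ : A.IsNonvanishing μ) (x : M) :
    ∃ η : A.fiber x →ₗ[ℝ] ℝ, ∀ U : Set M, IsOpen U → x ∈ U → ∀ e θ, A.AreFrames U e θ →
      ∀ f : M → ℝ, ContMDiffOn 𝓘(ℝ, EM) 𝓘(ℝ, ℝ) ∞ f U → (∀ x ∈ U, μ x = f x • A.gen e θ x) →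
      ∀ σ, A.SmoothOn U σ → dFun EM f x (A.anchor x (σ x)) • A.gen e θ x
        + f x • A.nablaGen σ e θ x = η (σ x) • μ x := by
  obtain ⟨U₀, hU₀, hx₀, e₀, θ₀, h₀, f₀, hf₀, hμ₀⟩ := hμ x
  let b := Module.Basis.mk (h₀.linearIndependent x hx₀) (h₀.span x hx₀).ge
  choose C D _ _ hC hD using fun i => h₀.exists_matrices hA hU₀ (h₀.smooth i)
  let δ : Fin A.rank → ℝ := fun i => (C i x).trace + (D i x).trace
  have hδ : ∀ i, A.nablaGen (e₀ i) e₀ θ₀ x = δ i • A.gen e₀ θ₀ x := fun i =>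
    nablaGen_eq (hC i x hx₀) (hD i x hx₀)
  -- This is d log|f₀| along the anchor plus the linear form with the values `δ i` on the frame. The
  -- rest of the proof checks it in every other frame.
  refine ⟨(f₀ x)⁻¹ • (dFun EM f₀ x).toLinearMap.comp (A.anchor x) + ∑ i, δ i • b.coord i, ?_⟩
  intro U hU hx e θ h f hf hμf σ hσ
  have hW := hU.inter hU₀
  have hxW : x ∈ U ∩ U₀ := ⟨hx, hx₀⟩
  have hσW : A.SmoothOn (U ∩ U₀) σ := SmoothSectionOn.mono hσ inter_subset_left
  have h₀W := h₀.mono (V := U ∩ U₀) inter_subset_right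
  obtain ⟨s, hs, hσs⟩ := h₀W.isFrame.exists_coefficients hW hσW
  obtain ⟨J, hJ, hJ'⟩ := h₀W.exists_change hA (h.mono (V := U ∩ U₀) inter_subset_left) hW
  have h1 := h₀W.nablaGen_combination hA hW hxW hσW hs hσs hδ
  obtain ⟨hJ0, hJg, hJn⟩ := hJ' x hxW
  have h2 := hJn σ _ hσW h1
  -- The coefficient changes by the same factor `J` as the generator, so the derivatives of `J`
  -- match by the product rule.
  have h3 : ∀ y ∈ U ∩ U₀, f₀ y = f y * J y := fun y hy => by
    refine h₀W.smul_gen_injective hy ?_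
    rw [← (hμ₀ y hy.2).2, hμf y hy.1, (hJ' y hy).2.1, smul_smul]
  have h4 : dFun EM f₀ x = dFun EM (fun y => f y * J y) x :=
    dFun_congr (Filter.Eventually.mono (hW.mem_nhds hxW) h3)
  have hd : ∀ {g : M → ℝ}, ContMDiffOn 𝓘(ℝ, EM) 𝓘(ℝ, ℝ) ∞ g (U ∩ U₀) →
      MDifferentiableAt 𝓘(ℝ, EM) 𝓘(ℝ, ℝ) g x := fun h =>
    (h.contMDiffAt (hW.mem_nhds hxW)).mdifferentiableAt (by simp)
  rw [dFun_mul (hd (hf.mono inter_subset_left)) (hd hJ)] at h4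
  have h5 : ∑ i, δ i * b.coord i (σ x) = ∑ i, s i x * δ i := by
    refine Finset.sum_congr rfl fun i _ => ?_
    have hb : ∀ j, b.coord i (e₀ j x) = if j = i then 1 else 0 := fun j => by
      have : e₀ j x = b j := by simp [b]
      rw [this, Module.Basis.coord_apply, Module.Basis.repr_self, Finsupp.single_apply]
    rw [hσs x hxW, map_sum]
    simp only [map_smul, hb, smul_eq_mul, mul_ite, mul_one, mul_zero]
    rw [Finset.sum_ite_eq' Finset.univ i fun j => s j x]
    simp [mul_comm]
  rw [hJg, h2, (hμ₀ x hx₀).2, smul_smul, smul_smul, smul_smul, ← add_smul]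
  refine congrArg (fun t : ℝ => t • A.gen e₀ θ₀ x) ?_
  have h6 : ((f₀ x)⁻¹ • (dFun EM f₀ x).toLinearMap.comp (A.anchor x) + ∑ i, δ i • b.coord i) (σ x)
      = (f₀ x)⁻¹ * dFun EM f₀ x (A.anchor x (σ x)) + ∑ i, δ i * b.coord i (σ x) := by
    rw [LinearMap.add_apply, LinearMap.sum_apply]
    rfl
  rw [h6, h5, add_mul, mul_right_comm, inv_mul_cancel₀ (hμ₀ x hx₀).1, one_mul, h4, h3 x hxW]
  simp only [_root_.add_apply, _root_.smul_apply, smul_eq_mul]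
  ring

end

end PreLieAlgebroid

/-! ### Closedness of the characteristic cocycle. -/

namespace PreLieAlgebroid

section

variable [FiniteDimensional ℝ EM] [T2Space M] {F : Type*} [NormedAddCommGroup F] [NormedSpace ℝ F]
  {E : M → Type*} [FiniteDimensional ℝ F]
  [∀ x, AddCommGroup (E x)] [∀ x, Module ℝ (E x)] [TopologicalSpace (TotalSpace F E)]
  [∀ x, TopologicalSpace (E x)] [FiberBundle F E] [VectorBundle ℝ F E]
  [ContMDiffVectorBundle ∞ F E 𝓘(ℝ, EM)]
  {A : PreLieAlgebroid EM F E} {U : Set M} {x : M} {σ τ : ∀ x, A.fiber x}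
  {e : Fin A.rank → ∀ x, A.fiber x} {θ : Fin (Module.finrank ℝ EM) → ∀ x : M, Cot EM x}
  {μ : ∀ x, A.CanLine x}

theorem dFun_trace {n : ℕ} {C : M → Matrix (Fin n) (Fin n) ℝ} (hU : IsOpen U) (hx : x ∈ U)
    (hC : ∀ i j, ContMDiffOn 𝓘(ℝ, EM) 𝓘(ℝ, ℝ) ∞ (fun x => C x i j) U) (v : Tan EM x) :
    dFun EM (fun y => (C y).trace) x v
      = Matrix.trace (Matrix.of fun i j => dFun EM (fun y => C y i j) x v) := by
  have h : (fun y => (C y).trace) = fun y => ∑ i, C y i i := rfl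
  rw [h, dFun_sum fun i _ =>
    ((hC i i).contMDiffAt (hU.mem_nhds hx)).mdifferentiableAt (by simp), _root_.sum_apply]
  rfl

/-- The traces of the matrices of a bracket. -/
theorem AreFrames.exists_matrices_bracket (hA : A.IsLieAlgebroid) (hρ : A.AnchorHom)
    (h : A.AreFrames U e θ) (hU : IsOpen U) (hx : x ∈ U) (hσ : A.SmoothOn U σ)
    (hτ : A.SmoothOn U τ)
    {C C' : M → Matrix (Fin A.rank) (Fin A.rank) ℝ}
    {D D' : M → Matrix (Fin (Module.finrank ℝ EM)) (Fin (Module.finrank ℝ EM)) ℝ}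
    (sC : ∀ i j, ContMDiffOn 𝓘(ℝ, EM) 𝓘(ℝ, ℝ) ∞ (fun x => C x i j) U)
    (sD : ∀ i j, ContMDiffOn 𝓘(ℝ, EM) 𝓘(ℝ, ℝ) ∞ (fun x => D x i j) U)
    (hC : ∀ x ∈ U, ∀ i, A.bracket σ (e i) x = ∑ k, C x i k • e k x)
    (hD : ∀ x ∈ U, ∀ j, lieForm (fun y => A.anchor y (σ y)) (θ j) x = ∑ k, D x j k • θ k x)
    (sC' : ∀ i j, ContMDiffOn 𝓘(ℝ, EM) 𝓘(ℝ, ℝ) ∞ (fun x => C' x i j) U)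
    (sD' : ∀ i j, ContMDiffOn 𝓘(ℝ, EM) 𝓘(ℝ, ℝ) ∞ (fun x => D' x i j) U)
    (hC' : ∀ x ∈ U, ∀ i, A.bracket τ (e i) x = ∑ k, C' x i k • e k x)
    (hD' : ∀ x ∈ U, ∀ j, lieForm (fun y => A.anchor y (τ y)) (θ j) x = ∑ k, D' x j k • θ k x) :
    A.nablaGen (A.bracket σ τ) e θ x
      = (dFun EM (fun y => (C' y).trace + (D' y).trace) x (A.anchor x (σ x))
        - dFun EM (fun y => (C y).trace + (D y).trace) x (A.anchor x (τ x))) • A.gen e θ x := by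
  -- The iterated action has matrix C'C plus the derivative of C' along the first section. The
  -- matrix of the bracket is the difference of two such, by the Jacobi identity on `A` and by
  -- `lieForm_lieVec` on forms (`key'`).
  have key : ∀ {σ τ : ∀ x, A.fiber x} {C C' : M → Matrix (Fin A.rank) (Fin A.rank) ℝ},
      A.SmoothOn U σ → A.SmoothOn U τ →
      (∀ i j, ContMDiffOn 𝓘(ℝ, EM) 𝓘(ℝ, ℝ) ∞ (fun x => C' x i j) U) →
      (∀ x ∈ U, ∀ i, A.bracket σ (e i) x = ∑ k, C x i k • e k x) →
      (∀ x ∈ U, ∀ i, A.bracket τ (e i) x = ∑ k, C' x i k • e k x) → ∀ i,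
      A.bracket σ (A.bracket τ (e i)) x = ∑ l, ((C' x * C x) i l
        + dFun EM (fun y => C' y i l) x (A.anchor x (σ x))) • e l x := by
    intro σ τ C C' hσ hτ sC' hC hC' i
    rw [hA.bracket_local U hU σ σ _ _ hσ (hA.bracket_smooth U hU _ _ hτ (h.smooth i))
      (fun _ _ => rfl) (fun y hy => hC' y hy i) x hx, hA.bracket_sum _ hU hx hσ (sC' i) h.smooth]
    simp only [hC x hx, add_smul, Finset.sum_add_distrib, Matrix.mul_apply, Finset.sum_smul,
      Finset.smul_sum, smul_smul]
    rw [Finset.sum_comm]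
  have key' : ∀ {X Y : ∀ x : M, Tan EM x}
      {D D' : M → Matrix (Fin (Module.finrank ℝ EM)) (Fin (Module.finrank ℝ EM)) ℝ},
      SmoothSectionOn EM EM U X →
      (∀ i j, ContMDiffOn 𝓘(ℝ, EM) 𝓘(ℝ, ℝ) ∞ (fun x => D' x i j) U) →
      (∀ x ∈ U, ∀ j, lieForm X (θ j) x = ∑ k, D x j k • θ k x) →
      (∀ x ∈ U, ∀ j, lieForm Y (θ j) x = ∑ k, D' x j k • θ k x) → ∀ i,
      lieForm X (lieForm Y (θ i)) x = ∑ l, ((D' x * D x) i l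
        + dFun EM (fun y => D' y i l) x (X x)) • θ l x := by
    intro X Y D D' hX sD' hD hD' i
    rw [lieForm_congr (Filter.Eventually.of_forall fun _ => rfl)
      (Filter.Eventually.mono (hU.mem_nhds hx) fun y hy => hD' y hy i),
      lieForm_sum_smul _ hU hx (sD' i) hX h.smooth']
    simp only [hD x hx, add_smul, Finset.sum_add_distrib, Matrix.mul_apply, Finset.sum_smul,
      Finset.smul_sum, smul_smul]
    rw [Finset.sum_comm, add_comm]
  have hX := hA.anchor_smooth U hU σ hσ
  have hY := hA.anchor_smooth U hU τ hτ
  have e1 : ∀ i, A.bracket (A.bracket σ τ) (e i) x = ∑ l,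
      (((C' x * C x) + Matrix.of fun i l => dFun EM (fun y => C' y i l) x (A.anchor x (σ x)))
        - ((C x * C' x) + Matrix.of fun i l => dFun EM (fun y => C y i l) x (A.anchor x (τ x))))
        i l • e l x := fun i => by
    have h1 := hA.jacobi U hU σ τ (e i) hσ hτ (h.smooth i) x hx
    rw [hA.bracket_skew U hU (e i) _ (h.smooth i) (hA.bracket_smooth U hU _ _ hσ hτ) x hx,
      ← sub_eq_add_neg, sub_eq_zero] at h1
    have h2 : A.bracket τ (A.bracket (e i) σ) x = - A.bracket τ (A.bracket σ (e i)) x := by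
      have hs := hA.bracket_smooth U hU _ _ hσ (h.smooth i)
      have h3 := hA.leibniz U hU τ (A.bracket σ (e i)) (fun _ => -1) hτ hs contMDiffOn_const x hx
      rw [dFun_const, _root_.zero_apply, zero_smul, add_zero, neg_one_smul] at h3
      rw [← h3]
      refine hA.bracket_local U hU _ _ _ _ hτ (hA.bracket_smooth U hU _ _ (h.smooth i) hσ)
        (fun _ _ => rfl) (fun y hy => ?_) x hx
      rw [neg_one_smul]
      exact hA.bracket_skew U hU _ _ (h.smooth i) hσ y hy
    rw [← h1, h2, key hσ hτ sC' hC hC' i, key hτ hσ sC hC' hC i, ← sub_eq_add_neg,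
      ← Finset.sum_sub_distrib]
    exact Finset.sum_congr rfl fun l _ => (sub_smul _ _ _).symm
  have e2 : ∀ j, lieForm (fun y => A.anchor y (A.bracket σ τ y)) (θ j) x = ∑ l,
      (((D' x * D x) + Matrix.of fun i l => dFun EM (fun y => D' y i l) x (A.anchor x (σ x)))
        - ((D x * D' x) + Matrix.of fun i l => dFun EM (fun y => D y i l) x (A.anchor x (τ x))))
        j l • θ l x := fun j => by
    rw [lieForm_congr (Filter.Eventually.mono (hU.mem_nhds hx) fun y hy => hρ U hU σ τ hσ hτ y hy)
      (Filter.Eventually.of_forall fun _ => rfl), lieForm_lieVec hU hx hX hY (h.smooth' j),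
      key' hX sD' hD hD' j, key' hY sD hD' hD j, ← Finset.sum_sub_distrib]
    exact Finset.sum_congr rfl fun l _ => (sub_smul _ _ _).symm
  have hd : ∀ {n : ℕ} {C : M → Matrix (Fin n) (Fin n) ℝ},
      (∀ i j, ContMDiffOn 𝓘(ℝ, EM) 𝓘(ℝ, ℝ) ∞ (fun x => C x i j) U) →
      MDifferentiableAt 𝓘(ℝ, EM) 𝓘(ℝ, ℝ) (fun y => (C y).trace) x := fun hC =>
    mdifferentiableAt_finset_sum fun i _ =>
      ((hC i i).contMDiffAt (hU.mem_nhds hx)).mdifferentiableAt (by simp)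
  rw [nablaGen_eq e1 e2, dFun_add (hd sC') (hd sD'), dFun_add (hd sC) (hd sD),
    _root_.add_apply, _root_.add_apply, dFun_trace hU hx sC, dFun_trace hU hx sD,
    dFun_trace hU hx sC', dFun_trace hU hx sD']
  refine congrArg (fun t : ℝ => t • A.gen e θ x) ?_
  -- Traces of commutators vanish, so only the derivatives of the traces remain. This is the
  -- flatness of the canonical representation.
  simp only [Matrix.trace_sub, Matrix.trace_add, Matrix.trace_mul_comm (C' x),
    Matrix.trace_mul_comm (D' x)]
  ring

/-- A nonvanishing section of the canonical line has a closed characteristic form. -/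
theorem IsNonvanishing.exists_isCocycle (hA : A.IsLieAlgebroid) (hρ : A.AnchorHom)
    (hμ : A.IsNonvanishing μ) : ∃ η : A.closedForms, A.IsCocycle μ η := by
  choose η hη using fun x => hμ.exists_functional hA x
  -- In frames the form is d log|f| along the anchor plus the trace factor `δ`. Smoothness and
  -- closedness are both read off this expression.
  have key : ∀ {U : Set M} {e θ} {f : M → ℝ}, IsOpen U → A.AreFrames U e θ →
      ContMDiffOn 𝓘(ℝ, EM) 𝓘(ℝ, ℝ) ∞ f U → (∀ x ∈ U, f x ≠ 0 ∧ μ x = f x • A.gen e θ x) →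
      ∀ {σ : ∀ x, A.fiber x}, A.SmoothOn U σ → ∀ {x : M}, x ∈ U → ∀ {δ : ℝ},
      A.nablaGen σ e θ x = δ • A.gen e θ x →
      η x (σ x) = dFun EM (fun y => Real.log (f y)) x (A.anchor x (σ x)) + δ := by
    intro U e θ f hU h hf hμf σ hσ x hx δ hδ
    have h1 := hη x U hU hx e θ h f hf (fun y hy => (hμf y hy).2) σ hσ
    rw [hδ, (hμf x hx).2, smul_smul, smul_smul, ← add_smul] at h1
    have h2 := h.smul_gen_injective hx h1
    have h0 := (hμf x hx).1
    rw [dFun_log ((hf.contMDiffAt (hU.mem_nhds hx)).mdifferentiableAt (by simp)) h0,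
      _root_.smul_apply, smul_eq_mul]
    field_simp
    linarith
  refine ⟨⟨η, ⟨fun U hU σ hσ x hx => ?_, fun U hU σ τ hσ hτ x hx => ?_⟩⟩,
    fun U hU e θ h f hf hμf σ hσ x hx => hη x U hU hx e θ h f hf hμf σ hσ⟩
  · obtain ⟨U₀, hU₀, hx₀, e, θ, h, f, hf, hμf⟩ := hμ x
    have hW := hU.inter hU₀
    have hσW : A.SmoothOn (U ∩ U₀) σ := SmoothSectionOn.mono hσ inter_subset_left
    obtain ⟨C, D, sC, sD, hC, hD⟩ := (h.mono (V := U ∩ U₀) inter_subset_right).exists_matrices hA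
      hW hσW
    have h1 : ContMDiffOn 𝓘(ℝ, EM) 𝓘(ℝ, ℝ) ∞ (fun y => dFun EM (fun y => Real.log (f y)) y
        (A.anchor y (σ y)) + (∑ i, C y i i + ∑ j, D y j j)) (U ∩ U₀) := by
      refine ContMDiffOn.add ?_ ((contMDiffOn_finsetSum fun i _ => sC i i).add
        (contMDiffOn_finsetSum fun i _ => sD i i))
      exact (smoothSectionOn_dFun hW ((contMDiffOn_log hf fun y hy => (hμf y hy).1).mono
        inter_subset_right)).apply (hA.anchor_smooth _ hW _ hσW)
    refine (ContMDiffOn.congr h1 fun y hy => ?_).contMDiffAt (hW.mem_nhds ⟨hx, hx₀⟩)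
      |>.contMDiffWithinAt
    exact key hW (h.mono inter_subset_right) (hf.mono inter_subset_right)
      (fun y hy => hμf y hy.2) hσW hy (nablaGen_eq (hC y hy) (hD y hy))
  · obtain ⟨U₀, hU₀, hx₀, e, θ, h, f, hf, hμf⟩ := hμ x
    have hW := hU.inter hU₀
    have hxW : x ∈ U ∩ U₀ := ⟨hx, hx₀⟩
    have hσW : A.SmoothOn (U ∩ U₀) σ := SmoothSectionOn.mono hσ inter_subset_left
    have hτW : A.SmoothOn (U ∩ U₀) τ := SmoothSectionOn.mono hτ inter_subset_left
    have hhW := h.mono (V := U ∩ U₀) inter_subset_right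
    have hfW : ContMDiffOn 𝓘(ℝ, EM) 𝓘(ℝ, ℝ) ∞ f (U ∩ U₀) := hf.mono inter_subset_right
    have hμW : ∀ y ∈ U ∩ U₀, f y ≠ 0 ∧ μ y = f y • A.gen e θ y := fun y hy => hμf y hy.2
    obtain ⟨C, D, sC, sD, hC, hD⟩ := hhW.exists_matrices hA hW hσW
    obtain ⟨C', D', sC', sD', hC', hD'⟩ := hhW.exists_matrices hA hW hτW
    have hl : ContMDiffOn 𝓘(ℝ, EM) 𝓘(ℝ, ℝ) ∞ (fun y => Real.log (f y)) (U ∩ U₀) :=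
      contMDiffOn_log hfW fun y hy => (hμW y hy).1
    have hX := hA.anchor_smooth _ hW σ hσW
    have hY := hA.anchor_smooth _ hW τ hτW
    have hd : ∀ {g : M → ℝ}, ContMDiffOn 𝓘(ℝ, EM) 𝓘(ℝ, ℝ) ∞ g (U ∩ U₀) →
        MDifferentiableAt 𝓘(ℝ, EM) 𝓘(ℝ, ℝ) g x := fun h =>
      (h.contMDiffAt (hW.mem_nhds hxW)).mdifferentiableAt (by simp)
    have ht : ∀ {n : ℕ} {C : M → Matrix (Fin n) (Fin n) ℝ},
        (∀ i j, ContMDiffOn 𝓘(ℝ, EM) 𝓘(ℝ, ℝ) ∞ (fun x => C x i j) (U ∩ U₀)) →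
        ContMDiffOn 𝓘(ℝ, EM) 𝓘(ℝ, ℝ) ∞ (fun y => (C y).trace) (U ∩ U₀) := fun hC =>
      contMDiffOn_finsetSum fun i _ => hC i i
    have g1 : dFun EM (fun y => η y (σ y)) x = dFun EM (fun y => dFun EM (fun y => Real.log (f y)) y
        (A.anchor y (σ y)) + ((C y).trace + (D y).trace)) x :=
      dFun_congr (Filter.Eventually.mono (hW.mem_nhds hxW) fun y hy =>
        key hW hhW hfW hμW hσW hy (nablaGen_eq (hC y hy) (hD y hy)))
    have g2 : dFun EM (fun y => η y (τ y)) x = dFun EM (fun y => dFun EM (fun y => Real.log (f y)) y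
        (A.anchor y (τ y)) + ((C' y).trace + (D' y).trace)) x :=
      dFun_congr (Filter.Eventually.mono (hW.mem_nhds hxW) fun y hy =>
        key hW hhW hfW hμW hτW hy (nablaGen_eq (hC' y hy) (hD' y hy)))
    have g3 := key hW hhW hfW hμW (hA.bracket_smooth _ hW _ _ hσW hτW) hxW
      (hhW.exists_matrices_bracket hA hρ hW hxW hσW hτW sC sD hC hD sC' sD' hC' hD')
    -- The logarithmic part is closed because the anchor preserves brackets. The trace part is
    -- closed by `g3`.
    have g4 := dFun_lieVec hW hxW hl hX hY
    rw [← hρ _ hW σ τ hσW hτW x hxW] at g4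
    have s1 : ContMDiffOn 𝓘(ℝ, EM) 𝓘(ℝ, ℝ) ∞ (fun y => dFun EM (fun y => Real.log (f y)) y
        (A.anchor y (σ y))) (U ∩ U₀) := (smoothSectionOn_dFun hW hl).apply hX
    have s2 : ContMDiffOn 𝓘(ℝ, EM) 𝓘(ℝ, ℝ) ∞ (fun y => dFun EM (fun y => Real.log (f y)) y
        (A.anchor y (τ y))) (U ∩ U₀) := (smoothSectionOn_dFun hW hl).apply hY
    have s3 : ContMDiffOn 𝓘(ℝ, EM) 𝓘(ℝ, ℝ) ∞ (fun y => (C y).trace + (D y).trace) (U ∩ U₀) :=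
      (ht sC).add (ht sD)
    have s4 : ContMDiffOn 𝓘(ℝ, EM) 𝓘(ℝ, ℝ) ∞ (fun y => (C' y).trace + (D' y).trace) (U ∩ U₀) :=
      (ht sC').add (ht sD')
    rw [g1, g2, g3, g4, dFun_add (hd s1) (hd s3), dFun_add (hd s2) (hd s4), _root_.add_apply, _root_.add_apply]
    ring

end

end PreLieAlgebroid

/-! ### Uniqueness of the modular class -/

/-- A derivation acting on `u` by the factor `d` acts on its square by `2 * d`, which is the origin
of the one half in the nonorientable definition. -/
theorem smul_tmul_self_combination {V : Type*} [AddCommMonoid V] [Module ℝ V] (u : V) (a b d : ℝ) :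
    a • (u ⊗ₜ[ℝ] u) + b • ((d • u) ⊗ₜ[ℝ] u + u ⊗ₜ[ℝ] (d • u)) = (a + b * (2 * d)) • (u ⊗ₜ[ℝ] u) := by
  rw [← TensorProduct.smul_tmul', TensorProduct.tmul_smul]
  module

namespace PreLieAlgebroid

section

variable [FiniteDimensional ℝ EM] [T2Space M] {F : Type*} [NormedAddCommGroup F] [NormedSpace ℝ F]
  {E : M → Type*} [FiniteDimensional ℝ F]
  [∀ x, AddCommGroup (E x)] [∀ x, Module ℝ (E x)] [TopologicalSpace (TotalSpace F E)]
  [∀ x, TopologicalSpace (E x)] [FiberBundle F E] [VectorBundle ℝ F E]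
  [ContMDiffVectorBundle ∞ F E 𝓘(ℝ, EM)]
  {A : PreLieAlgebroid EM F E} {U : Set M} {x : M} {σ τ : ∀ x, A.fiber x}
  {e : Fin A.rank → ∀ x, A.fiber x} {θ : Fin (Module.finrank ℝ EM) → ∀ x : M, Cot EM x}
  {μ : ∀ x, A.CanLine x}

/-- A function which is locally the ratio of two smooth densities has logarithmic differential the
difference of their forms. -/
theorem exists_dlog_of_ratio {g : M → ℝ} {η : A.Cochain}
    (h : ∀ x, ∃ (U : Set M) (f : M → ℝ), IsOpen U ∧ x ∈ U ∧ ContMDiffOn 𝓘(ℝ, EM) 𝓘(ℝ, ℝ) ∞ f U ∧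
      (∀ y ∈ U, f y ≠ 0 ∧ g y = f y) ∧ ∀ v, dFun EM f x (A.anchor x v) = η x v * f x) :
    η ∈ A.exactForms := by
  refine ⟨fun y => Real.log (g y), fun x => ?_, fun x v => ?_⟩
  · obtain ⟨U, f, hU, hx, hf, hg, -⟩ := h x
    exact (((contMDiffOn_log hf fun y hy => (hg y hy).1).congr fun y hy => by
      rw [(hg y hy).2]).contMDiffAt (hU.mem_nhds hx))
  · obtain ⟨U, f, hU, hx, hf, hg, hv⟩ := h x
    have h1 : dFun EM (fun y => Real.log (g y)) x = dFun EM (fun y => Real.log (f y)) x :=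
      dFun_congr (Filter.Eventually.mono (hU.mem_nhds hx) fun y hy => congrArg Real.log (hg y hy).2)
    rw [h1, dFun_log ((hf.contMDiffAt (hU.mem_nhds hx)).mdifferentiableAt (by simp)) (hg x hx).1,
      _root_.smul_apply, smul_eq_mul, hv]
    have h0 := (hg x hx).1
    field_simp

theorem IsLieAlgebroid.exists_section (hA : A.IsLieAlgebroid) (v : A.fiber x) :
    ∃ (U : Set M) (σ : ∀ x, A.fiber x), IsOpen U ∧ x ∈ U ∧ A.SmoothOn U σ ∧ σ x = v := by
  obtain ⟨U, hU, hx, e, he⟩ := exists_isFrame hA.subbundle x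
  have hv : v ∈ Submodule.span ℝ (range fun i => e i x) := by
    rw [he.span x hx]
    trivial
  obtain ⟨c, hc⟩ := (Submodule.mem_span_range_iff_exists_fun ℝ).1 hv
  refine ⟨U, fun y => ∑ i, c i • e i y, hU, hx, SmoothSectionOn.congr
    (SmoothSectionOn.sum (s := Finset.univ) fun i _ =>
      SmoothSectionOn.smul (f := fun _ => c i) contMDiffOn_const (he.smooth i)) fun y _ => ?_, hc⟩
  rw [Submodule.coe_sum]
  rfl

/-- A nonvanishing section in the frames of another one. -/
theorem IsNonvanishing.exists_ratio (hA : A.IsLieAlgebroid) (hμ : A.IsNonvanishing μ) (hU : IsOpen U)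
    (hx : x ∈ U) (h : A.AreFrames U e θ) :
    ∃ W ⊆ U, IsOpen W ∧ x ∈ W ∧ ∃ f : M → ℝ, ContMDiffOn 𝓘(ℝ, EM) 𝓘(ℝ, ℝ) ∞ f W ∧
      ∀ y ∈ W, f y ≠ 0 ∧ μ y = f y • A.gen e θ y := by
  obtain ⟨U', hU', hx', e', θ', h', f, hf, hμf⟩ := hμ x
  obtain ⟨J, hJ, hJ'⟩ := (h.mono (V := U ∩ U') inter_subset_left).exists_change hA
    (h'.mono (V := U ∩ U') inter_subset_right) (hU.inter hU')
  refine ⟨U ∩ U', inter_subset_left, hU.inter hU', ⟨hx, hx'⟩, fun y => f y * J y,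
    (hf.mono inter_subset_right).mul hJ, fun y hy => ⟨mul_ne_zero (hμf y hy.2).1 (hJ' y hy).1, ?_⟩⟩
  rw [(hμf y hy.2).2, (hJ' y hy).2.1, smul_smul]

/-- The two sections differ by a nowhere zero function, locally the quotient of their coefficients.
The trace terms are the same for both, so the cocycles differ by its logarithmic differential. -/
theorem IsCocycle.sub_mem_exactForms (hA : A.IsLieAlgebroid) {μ' : ∀ x, A.CanLine x}
    {η η' : A.Cochain} (hμ : A.IsNonvanishing μ) (hη : A.IsCocycle μ η)
    (hμ' : A.IsNonvanishing μ') (hη' : A.IsCocycle μ' η') : η' - η ∈ A.exactForms := by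
  have hloc : ∀ x, ∃ (W : Set M) (e : Fin A.rank → ∀ x, A.fiber x)
      (θ : Fin (Module.finrank ℝ EM) → ∀ x : M, Cot EM x) (f f' : M → ℝ), IsOpen W ∧ x ∈ W ∧
      A.AreFrames W e θ ∧ ContMDiffOn 𝓘(ℝ, EM) 𝓘(ℝ, ℝ) ∞ f W ∧
      ContMDiffOn 𝓘(ℝ, EM) 𝓘(ℝ, ℝ) ∞ f' W ∧ ∀ y ∈ W, f y ≠ 0 ∧ μ y = f y • A.gen e θ y ∧
        f' y ≠ 0 ∧ μ' y = f' y • A.gen e θ y := fun x => by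
    obtain ⟨U, hU, hx, e, θ, h, f, hf, hμf⟩ := hμ x
    obtain ⟨W, hWU, hW, hxW, f', hf', hμf'⟩ := hμ'.exists_ratio hA hU hx h
    exact ⟨W, e, θ, f, f', hW, hxW, h.mono hWU, hf.mono hWU, hf', fun y hy =>
      ⟨(hμf y (hWU hy)).1, (hμf y (hWU hy)).2, (hμf' y hy).1, (hμf' y hy).2⟩⟩
  have hg : ∀ x, ∃ g : ℝ, μ' x = g • μ x := fun x => by
    obtain ⟨W, e, θ, f, f', -, hx, h, -, -, hW⟩ := hloc x
    obtain ⟨h1, h2, h3, h4⟩ := hW x hx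
    exact ⟨f' x / f x, by rw [h4, h2, smul_smul, div_mul_cancel₀ _ h1]⟩
  choose g hg using hg
  refine exists_dlog_of_ratio (g := g) fun x => ?_
  obtain ⟨W, e, θ, f, f', hW, hx, h, hf, hf', hWf⟩ := hloc x
  have hd : ∀ {g : M → ℝ}, ContMDiffOn 𝓘(ℝ, EM) 𝓘(ℝ, ℝ) ∞ g W →
      MDifferentiableAt 𝓘(ℝ, EM) 𝓘(ℝ, ℝ) g x := fun h =>
    (h.contMDiffAt (hW.mem_nhds hx)).mdifferentiableAt (by simp)
  have hq : ContMDiffOn 𝓘(ℝ, EM) 𝓘(ℝ, ℝ) ∞ (fun y => f' y / f y) W :=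
    hf'.div₀ hf fun y hy => (hWf y hy).1
  have hq' : ∀ y ∈ W, f' y = f' y / f y * f y := fun y hy => (div_mul_cancel₀ _ (hWf y hy).1).symm
  refine ⟨W, fun y => f' y / f y, hW, hx, hq, fun y hy => ⟨div_ne_zero (hWf y hy).2.2.1 (hWf y hy).1,
    ?_⟩, fun v => ?_⟩
  · obtain ⟨h1, h2, h3, h4⟩ := hWf y hy
    have h5 := hg y
    rw [h4, h2, smul_smul] at h5
    exact (eq_div_iff h1).2 (h.smul_gen_injective hy h5).symm
  · obtain ⟨O, σ, hO, hxO, hσ, rfl⟩ := hA.exists_section v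
    have hWO := hW.inter hO
    have hσW : A.SmoothOn (W ∩ O) σ := SmoothSectionOn.mono hσ inter_subset_right
    have hhW := h.mono (V := W ∩ O) inter_subset_left
    obtain ⟨C, D, -, -, hC, hD⟩ := hhW.exists_matrices hA hWO hσW
    have hδ := nablaGen_eq (hC x ⟨hx, hxO⟩) (hD x ⟨hx, hxO⟩)
    obtain ⟨h1, h2, h3, h4⟩ := hWf x hx
    have k1 := hη _ hWO e θ hhW f (hf.mono inter_subset_left) (fun y hy => (hWf y hy.1).2.1) σ hσW x
      ⟨hx, hxO⟩
    have k2 := hη' _ hWO e θ hhW f' (hf'.mono inter_subset_left) (fun y hy => (hWf y hy.1).2.2.2) σ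
      hσW x ⟨hx, hxO⟩
    rw [hδ, h2, smul_smul, smul_smul, ← add_smul] at k1
    rw [hδ, h4, smul_smul, smul_smul, ← add_smul] at k2
    have k3 := h.smul_gen_injective hx k1
    have k4 := h.smul_gen_injective hx k2
    have k5 : dFun EM f' x = dFun EM (fun y => f' y / f y * f y) x :=
      dFun_congr (Filter.Eventually.mono (hW.mem_nhds hx) hq')
    rw [dFun_mul (hd hq) (hd hf)] at k5
    rw [k5, _root_.add_apply, _root_.smul_apply, _root_.smul_apply, smul_eq_mul, smul_eq_mul] at k4
    have k6 : (η' - η) x (σ x) = η' x (σ x) - η x (σ x) := rfl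
    rw [k6]
    refine mul_right_cancel₀ h1 ?_
    linear_combination k4 - (f' x / f x) * k3
      + (η' x (σ x) - ((C x).trace + (D x).trace)) * hq' x hx

/-- Here `S` is compared with the square of `μ`, whose cocycle is twice that of `μ`. -/
theorem IsCocycleSq.sub_mem_exactForms (hA : A.IsLieAlgebroid)
    {S : ∀ x, A.CanLine x ⊗[ℝ] A.CanLine x} {η η' : A.Cochain} (hμ : A.IsNonvanishing μ)
    (hη : A.IsCocycle μ η) (hS : A.IsNonvanishingSq S) (hη' : A.IsCocycleSq S η') :
    η' - (2 : ℝ) • η ∈ A.exactForms := by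
  have hloc : ∀ x, ∃ (W : Set M) (e : Fin A.rank → ∀ x, A.fiber x)
      (θ : Fin (Module.finrank ℝ EM) → ∀ x : M, Cot EM x) (f f' : M → ℝ), IsOpen W ∧ x ∈ W ∧
      A.AreFrames W e θ ∧ ContMDiffOn 𝓘(ℝ, EM) 𝓘(ℝ, ℝ) ∞ f W ∧
      ContMDiffOn 𝓘(ℝ, EM) 𝓘(ℝ, ℝ) ∞ f' W ∧ ∀ y ∈ W, f y ≠ 0 ∧ μ y = f y • A.gen e θ y ∧
        f' y ≠ 0 ∧ S y = f' y • (A.gen e θ y ⊗ₜ[ℝ] A.gen e θ y) := fun x => by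
    obtain ⟨U, hU, hx, e, θ, h, f', hf', hμf'⟩ := hS x
    obtain ⟨W, hWU, hW, hxW, f, hf, hμf⟩ := hμ.exists_ratio hA hU hx h
    exact ⟨W, e, θ, f, f', hW, hxW, h.mono hWU, hf, hf'.mono hWU, fun y hy =>
      ⟨(hμf y hy).1, (hμf y hy).2, (hμf' y (hWU hy)).1, (hμf' y (hWU hy)).2⟩⟩
  have hinj : ∀ {U : Set M} {e θ} {y : M}, A.AreFrames U e θ → y ∈ U → ∀ {s t : ℝ},
      s • (A.gen e θ y ⊗ₜ[ℝ] A.gen e θ y) = t • (A.gen e θ y ⊗ₜ[ℝ] A.gen e θ y) → s = t :=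
    fun {U e θ y} h hy {s t} hst => by
    obtain ⟨T, hT⟩ := h.exists_functional hy
    have h1 := congrArg (LinearMap.mul' ℝ ℝ ∘ₗ TensorProduct.map T T) hst
    simpa [hT] using h1
  have hg : ∀ x, ∃ g : ℝ, S x = g • (μ x ⊗ₜ[ℝ] μ x) := fun x => by
    obtain ⟨W, e, θ, f, f', -, hx, h, -, -, hW⟩ := hloc x
    obtain ⟨h1, h2, h3, h4⟩ := hW x hx
    exact ⟨f' x / (f x * f x), by
      rw [h4, h2, TensorProduct.smul_tmul_smul, smul_smul, div_mul_cancel₀ _ (mul_ne_zero h1 h1)]⟩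
  choose g hg using hg
  refine exists_dlog_of_ratio (g := g) fun x => ?_
  obtain ⟨W, e, θ, f, f', hW, hx, h, hf, hf', hWf⟩ := hloc x
  have hd : ∀ {g : M → ℝ}, ContMDiffOn 𝓘(ℝ, EM) 𝓘(ℝ, ℝ) ∞ g W →
      MDifferentiableAt 𝓘(ℝ, EM) 𝓘(ℝ, ℝ) g x := fun h =>
    (h.contMDiffAt (hW.mem_nhds hx)).mdifferentiableAt (by simp)
  have hff : ∀ y ∈ W, f y * f y ≠ 0 := fun y hy => mul_ne_zero (hWf y hy).1 (hWf y hy).1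
  have hq : ContMDiffOn 𝓘(ℝ, EM) 𝓘(ℝ, ℝ) ∞ (fun y => f' y / (f y * f y)) W :=
    hf'.div₀ (hf.mul hf) hff
  have hq' : ∀ y ∈ W, f' y = f' y / (f y * f y) * (f y * f y) := fun y hy =>
    (div_mul_cancel₀ _ (hff y hy)).symm
  refine ⟨W, fun y => f' y / (f y * f y), hW, hx, hq, fun y hy =>
    ⟨div_ne_zero (hWf y hy).2.2.1 (hff y hy), ?_⟩, fun v => ?_⟩
  · obtain ⟨h1, h2, h3, h4⟩ := hWf y hy
    have h5 := hg y
    rw [h4, h2, TensorProduct.smul_tmul_smul, smul_smul] at h5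
    exact (eq_div_iff (hff y hy)).2 (hinj h hy h5).symm
  · obtain ⟨O, σ, hO, hxO, hσ, rfl⟩ := hA.exists_section v
    have hWO := hW.inter hO
    have hσW : A.SmoothOn (W ∩ O) σ := SmoothSectionOn.mono hσ inter_subset_right
    have hhW := h.mono (V := W ∩ O) inter_subset_left
    obtain ⟨C, D, -, -, hC, hD⟩ := hhW.exists_matrices hA hWO hσW
    have hδ := nablaGen_eq (hC x ⟨hx, hxO⟩) (hD x ⟨hx, hxO⟩)
    obtain ⟨h1, h2, h3, h4⟩ := hWf x hx
    have k1 := hη _ hWO e θ hhW f (hf.mono inter_subset_left) (fun y hy => (hWf y hy.1).2.1) σ hσW x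
      ⟨hx, hxO⟩
    have k2 := hη' _ hWO e θ hhW f' (hf'.mono inter_subset_left) (fun y hy => (hWf y hy.1).2.2.2) σ
      hσW x ⟨hx, hxO⟩
    rw [hδ, h2, smul_smul, smul_smul, ← add_smul] at k1
    rw [hδ, h4] at k2
    replace k2 := (smul_tmul_self_combination _ _ _ _).symm.trans (k2.trans (smul_smul _ _ _))
    have k3 := h.smul_gen_injective hx k1
    have k4 := hinj h hx k2
    have k5 : dFun EM f' x = dFun EM (fun y => f' y / (f y * f y) * (f y * f y)) x :=
      dFun_congr (Filter.Eventually.mono (hW.mem_nhds hx) hq')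
    have k7 : MDifferentiableAt 𝓘(ℝ, EM) 𝓘(ℝ, ℝ) (fun y => f y * f y) x := (hd hf).mul (hd hf)
    rw [dFun_mul (hd hq) k7, dFun_mul (hd hf) (hd hf)] at k5
    rw [k5, _root_.add_apply, _root_.smul_apply, _root_.smul_apply, smul_eq_mul, smul_eq_mul,
      _root_.add_apply, _root_.smul_apply, smul_eq_mul] at k4
    have k6 : (η' - (2 : ℝ) • η) x (σ x) = η' x (σ x) - 2 * η x (σ x) := rfl
    rw [k6]
    refine mul_right_cancel₀ (hff x hx) ?_
    linear_combination k4 - 2 * (f' x / (f x * f x)) * f x * k3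
      + (η' x (σ x) - 2 * ((C x).trace + (D x).trace)) * hq' x hx

/-- As soon as a nonvanishing section exists, the two alternatives of `IsModularClass` determine the
same class, because 2 is invertible. -/
theorem isModularClass_iff (hA : A.IsLieAlgebroid) (hμ : A.IsNonvanishing μ) (η : A.closedForms)
    (hη : A.IsCocycle μ η) (c : A.H1) : A.IsModularClass c ↔ c = A.toH1 η := by
  constructor
  · rintro (⟨μ', hμ', η', hη', rfl⟩ | ⟨S, hS, η', hη', hc⟩)
    · exact (Submodule.Quotient.eq _).2 (hη.sub_mem_exactForms hA hμ hμ' hη')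
    · have h1 : (2 : ℝ) • c = (2 : ℝ) • A.toH1 η := by
        rw [hc]
        exact (Submodule.Quotient.eq _).2 (IsCocycleSq.sub_mem_exactForms hA hμ hη hS hη')
      have h2 := congrArg (fun u => (2⁻¹ : ℝ) • u) h1
      simpa [smul_smul] using h2
  · rintro rfl
    exact Or.inl ⟨μ, hμ, η, hη, rfl⟩

theorem modularClass_eq (hA : A.IsLieAlgebroid) (hμ : A.IsNonvanishing μ) (η : A.closedForms)
    (hη : A.IsCocycle μ η) : A.modularClass = A.toH1 η :=
  (isModularClass_iff hA hμ η hη _).1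
    (Classical.epsilon_spec (p := A.IsModularClass) ⟨_, (isModularClass_iff hA hμ η hη _).2 rfl⟩)

end

end PreLieAlgebroid

/-! ### Adapted frames along a submersion -/

namespace PreLieAlgebroid

section Adapted

variable {F : Type*} [NormedAddCommGroup F] [NormedSpace ℝ F]
  {E : M → Type*}
  [∀ x, AddCommGroup (E x)] [∀ x, Module ℝ (E x)] [TopologicalSpace (TotalSpace F E)]
  [∀ x, TopologicalSpace (E x)] [FiberBundle F E]
  {EN : Type*} [NormedAddCommGroup EN] [NormedSpace ℝ EN]
  {N : Type*} [TopologicalSpace N] [ChartedSpace EN N] [IsManifold 𝓘(ℝ, EN) ∞ N]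
  {F' : Type*} [NormedAddCommGroup F'] [NormedSpace ℝ F'] {E' : N → Type*}
  [∀ x, AddCommGroup (E' x)] [∀ x, Module ℝ (E' x)] [TopologicalSpace (TotalSpace F' E')]
  [∀ x, TopologicalSpace (E' x)] [FiberBundle F' E']

/-- Frames of an algebroid `B` over `M` and of `T*M` adapted to frames of an algebroid `A` over `N`
and of `T*N`, along `p : M → N` and a bundle map `Ψ : B → A`. -/
structure IsAdapted (A : PreLieAlgebroid EN F' E') (B : PreLieAlgebroid EM F E)
    (p : C^∞⟮𝓘(ℝ, EM), M; 𝓘(ℝ, EN), N⟯) (Ψ : ∀ x, B.fiber x →ₗ[ℝ] A.fiber (p x)) {k : ℕ}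
    (U : Set M) (V : Set N) (e : Fin A.rank ⊕ Fin k → ∀ x, B.fiber x)
    (θ : Fin (Module.finrank ℝ EN) ⊕ Fin k → ∀ x : M, Cot EM x) (α : Fin A.rank → ∀ y, A.fiber y)
    (ϑ : Fin (Module.finrank ℝ EN) → ∀ y : N, Cot EN y) : Prop where
  isOpen : IsOpen U
  isOpen' : IsOpen V
  maps : ∀ x ∈ U, p x ∈ V
  frames : A.AreFrames V α ϑ
  smooth : ∀ t, B.SmoothOn U (e t)
  smooth' : ∀ t, SmoothSectionOn EM (EM →L[ℝ] ℝ) U (θ t)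
  proj_inl : ∀ x ∈ U, ∀ i, Ψ x (e (Sum.inl i) x) = α i (p x)
  proj_inr : ∀ x ∈ U, ∀ a, Ψ x (e (Sum.inr a) x) = 0
  form_inl : ∀ x ∈ U, ∀ j, θ (Sum.inl j) x = (ϑ j (p x)).comp (mfderiv 𝓘(ℝ, EM) 𝓘(ℝ, EN) p x)
  form_inr : ∀ x ∈ U, ∀ a b, θ (Sum.inr a) x (B.anchor x (e (Sum.inr b) x)) = if a = b then 1 else 0

variable {A : PreLieAlgebroid EN F' E'} {B : PreLieAlgebroid EM F E}
  {p : C^∞⟮𝓘(ℝ, EM), M; 𝓘(ℝ, EN), N⟯} {Ψ : ∀ x, B.fiber x →ₗ[ℝ] A.fiber (p x)} {k : ℕ}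
  {U : Set M} {V : Set N} {e : Fin A.rank ⊕ Fin k → ∀ x, B.fiber x}
  {θ : Fin (Module.finrank ℝ EN) ⊕ Fin k → ∀ x : M, Cot EM x} {α : Fin A.rank → ∀ y, A.fiber y}
  {ϑ : Fin (Module.finrank ℝ EN) → ∀ y : N, Cot EN y}
  {U' : Set M} {V' : Set N} {e' : Fin A.rank ⊕ Fin k → ∀ x, B.fiber x}
  {θ' : Fin (Module.finrank ℝ EN) ⊕ Fin k → ∀ x : M, Cot EM x} {α' : Fin A.rank → ∀ y, A.fiber y}
  {ϑ' : Fin (Module.finrank ℝ EN) → ∀ y : N, Cot EN y} {x : M}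
  (ε : Fin A.rank ⊕ Fin k ≃ Fin B.rank)
  (ε' : Fin (Module.finrank ℝ EN) ⊕ Fin k ≃ Fin (Module.finrank ℝ EM))

theorem IsAdapted.form_inl_apply (h : IsAdapted A B p Ψ U V e θ α ϑ)
    (hΨ : ∀ x v, mfderiv 𝓘(ℝ, EM) 𝓘(ℝ, EN) p x (B.anchor x v) = A.anchor (p x) (Ψ x v))
    (hx : x ∈ U) (j : Fin (Module.finrank ℝ EN)) (a : Fin k) :
    θ (Sum.inl j) x (B.anchor x (e (Sum.inr a) x)) = 0 := by
  rw [h.form_inl x hx, ContinuousLinearMap.comp_apply, hΨ, h.proj_inr x hx, map_zero, map_zero]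

theorem IsAdapted.linearIndependent (h : IsAdapted A B p Ψ U V e θ α ϑ) (hx : x ∈ U) :
    LinearIndependent ℝ fun t => e t x := by
  rw [Fintype.linearIndependent_iff]
  intro c hc
  rw [Fintype.sum_sum_type] at hc
  have h1 : ∀ i, c (Sum.inl i) = 0 := by
    refine Fintype.linearIndependent_iff.1 (h.frames.linearIndependent _ (h.maps x hx)) _ ?_
    have h2 := congrArg (Ψ x) hc
    simpa [h.proj_inl x hx, h.proj_inr x hx] using h2
  have h2 : ∀ a, c (Sum.inr a) = 0 := fun a => by
    have h3 := congrArg (fun v => θ (Sum.inr a) x (B.anchor x v)) hc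
    simpa [h1, h.form_inr x hx] using h3
  rintro (i | a)
  · exact h1 i
  · exact h2 a

theorem IsAdapted.linearIndependent' (h : IsAdapted A B p Ψ U V e θ α ϑ)
    (hΨ : ∀ x v, mfderiv 𝓘(ℝ, EM) 𝓘(ℝ, EN) p x (B.anchor x v) = A.anchor (p x) (Ψ x v))
    (hs : ∀ x, Function.Surjective (mfderiv 𝓘(ℝ, EM) 𝓘(ℝ, EN) p x)) (hx : x ∈ U) :
    LinearIndependent ℝ fun t => θ t x := by
  rw [Fintype.linearIndependent_iff]
  intro c hc
  rw [Fintype.sum_sum_type] at hc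
  have h2 : ∀ a, c (Sum.inr a) = 0 := fun a => by
    have h3 := congrArg (fun v : Cot EM x => v (B.anchor x (e (Sum.inr a) x))) hc
    simpa [_root_.sum_apply, h.form_inl_apply hΨ hx, h.form_inr x hx] using h3
  have h1 : ∀ i, c (Sum.inl i) = 0 := by
    refine Fintype.linearIndependent_iff.1 (h.frames.linearIndependent' _ (h.maps x hx)) _ ?_
    ext w
    obtain ⟨v, rfl⟩ := hs x w
    have h3 := congrArg (fun u : Cot EM x => u v) hc
    simpa [_root_.sum_apply, h.form_inl x hx, h2] using h3
  rintro (i | a)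
  · exact h1 i
  · exact h2 a

theorem finrank_fiber (hB : B.IsLieAlgebroid) (x : M) :
    Module.finrank ℝ (B.fiber x) = B.rank ∧ FiniteDimensional ℝ (B.fiber x) := by
  obtain ⟨U, hU, hx, e, he⟩ := exists_isFrame hB.subbundle x
  let b := Module.Basis.mk (he.linearIndependent x hx) (he.span x hx).ge
  exact ⟨by rw [Module.finrank_eq_card_basis b, Fintype.card_fin], Module.Basis.finiteDimensional_of_finite b⟩

variable [FiniteDimensional ℝ EM]

theorem IsAdapted.areFrames (h : IsAdapted A B p Ψ U V e θ α ϑ) (hB : B.IsLieAlgebroid)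
    (hΨ : ∀ x v, mfderiv 𝓘(ℝ, EM) 𝓘(ℝ, EN) p x (B.anchor x v) = A.anchor (p x) (Ψ x v))
    (hs : ∀ x, Function.Surjective (mfderiv 𝓘(ℝ, EM) 𝓘(ℝ, EN) p x)) :
    B.AreFrames U (fun i => e (ε.symm i)) (fun j => θ (ε'.symm j)) := by
  have h1 : ∀ x ∈ U, LinearIndependent ℝ fun i => e (ε.symm i) x := fun x hx =>
    (h.linearIndependent hx).comp _ ε.symm.injective
  have h2 : ∀ x ∈ U, LinearIndependent ℝ fun i => θ (ε'.symm i) x := fun x hx =>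
    (h.linearIndependent' hΨ hs hx).comp _ ε'.symm.injective
  refine ⟨fun i => h.smooth _, h1, fun x hx => ?_, fun i => h.smooth' _, h2, fun x hx => ?_⟩
  · have := (finrank_fiber hB x).2
    refine (h1 x hx).span_eq_top_of_card_eq_finrank' ?_
    rw [Fintype.card_fin, (finrank_fiber hB x).1]
  · have hf : FiniteDimensional ℝ (Cot EM x) := inferInstanceAs (FiniteDimensional ℝ (EM →L[ℝ] ℝ))
    refine (h2 x hx).span_eq_top_of_card_eq_finrank' ?_
    have h3 : Module.finrank ℝ (Cot EM x) = Module.finrank ℝ EM :=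
      (LinearEquiv.finrank_eq (LinearMap.toContinuousLinearMap (𝕜 := ℝ) (E := EM) (F' := ℝ))).symm.trans
        Subspace.dual_finrank_eq
    rw [Fintype.card_fin, h3]

theorem IsAdapted.exists_expand (h : IsAdapted A B p Ψ U V e θ α ϑ) (hB : B.IsLieAlgebroid)
    (hΨ : ∀ x v, mfderiv 𝓘(ℝ, EM) 𝓘(ℝ, EN) p x (B.anchor x v) = A.anchor (p x) (Ψ x v))
    (hs : ∀ x, Function.Surjective (mfderiv 𝓘(ℝ, EM) 𝓘(ℝ, EN) p x)) (hx : x ∈ U)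
    (ε : Fin A.rank ⊕ Fin k ≃ Fin B.rank)
    (ε' : Fin (Module.finrank ℝ EN) ⊕ Fin k ≃ Fin (Module.finrank ℝ EM)) :
    (∀ v : B.fiber x, ∃ c : Fin A.rank ⊕ Fin k → ℝ, v = ∑ t, c t • e t x) ∧
      ∀ w : Cot EM x, ∃ c : Fin (Module.finrank ℝ EN) ⊕ Fin k → ℝ, w = ∑ t, c t • θ t x := by
  have hF := h.areFrames ε ε' hB hΨ hs
  constructor
  · intro v
    have hv : v ∈ Submodule.span ℝ (range fun i => e (ε.symm i) x) := by
      rw [hF.span x hx]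
      trivial
    obtain ⟨c, hc⟩ := (Submodule.mem_span_range_iff_exists_fun ℝ).1 hv
    refine ⟨fun t => c (ε t), ?_⟩
    rw [← hc, ← Equiv.sum_comp ε]
    simp
  · intro v
    have hv : v ∈ Submodule.span ℝ (range fun i => θ (ε'.symm i) x) := by
      rw [hF.span' x hx]
      trivial
    obtain ⟨c, hc⟩ := (Submodule.mem_span_range_iff_exists_fun ℝ).1 hv
    refine ⟨fun t => c (ε' t), ?_⟩
    rw [← hc, ← Equiv.sum_comp ε']
    simp

variable [FiniteDimensional ℝ EN] [T2Space M] [T2Space N]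

/-- Changes of adapted frames have the same factor upstairs and downstairs. -/
theorem IsAdapted.gen_change (h : IsAdapted A B p Ψ U V e θ α ϑ)
    (h' : IsAdapted A B p Ψ U' V' e' θ' α' ϑ') (hB : B.IsLieAlgebroid)
    (hΨ : ∀ x v, mfderiv 𝓘(ℝ, EM) 𝓘(ℝ, EN) p x (B.anchor x v) = A.anchor (p x) (Ψ x v))
    (hs : ∀ x, Function.Surjective (mfderiv 𝓘(ℝ, EM) 𝓘(ℝ, EN) p x)) (hx : x ∈ U) (hx' : x ∈ U') :
    ∃ J : ℝ, A.gen α' ϑ' (p x) = J • A.gen α ϑ (p x) ∧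
      B.gen (fun i => e' (ε.symm i)) (fun j => θ' (ε'.symm j)) x
        = J • B.gen (fun i => e (ε.symm i)) (fun j => θ (ε'.symm j)) x := by
  obtain ⟨hE, hT⟩ := h.exists_expand hB hΨ hs hx ε ε'
  choose a ha using fun t => hE (e' t x)
  choose b hb using fun t => hT (θ' t x)
  have hαi := Fintype.linearIndependent_iff.1 (h.frames.linearIndependent _ (h.maps x hx))
  have hϑi := Fintype.linearIndependent_iff.1 (h.frames.linearIndependent' _ (h.maps x hx))
  have hΨa : ∀ t, Ψ x (e' t x) = ∑ l, a t (Sum.inl l) • α l (p x) := fun t => by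
    rw [ha, Fintype.sum_sum_type, map_add, map_sum, map_sum]
    simp [h.proj_inl x hx, h.proj_inr x hx]
  -- `Ψ` kills the vertical sections of both frames, so the transition matrix of sections is block
  -- triangular.
  have ha0 : ∀ b l, a (Sum.inr b) (Sum.inl l) = 0 := fun b => by
    refine hαi _ ?_
    rw [← hΨa, h'.proj_inr x hx']
  have hα' : ∀ i, α' i (p x) = ∑ l, a (Sum.inl i) (Sum.inl l) • α l (p x) := fun i => by
    rw [← hΨa, h'.proj_inl x hx']
  have hbv : ∀ t d, θ' t x (B.anchor x (e (Sum.inr d) x)) = b t (Sum.inr d) := fun t d => by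
    rw [hb, Fintype.sum_sum_type]
    simp [_root_.sum_apply, h.form_inl_apply hΨ hx, h.form_inr x hx]
  -- Pulled back forms vanish on vertical vectors, so the transition matrix of forms is block
  -- triangular the other way.
  have hb0 : ∀ j d, b (Sum.inl j) (Sum.inr d) = 0 := fun j d => by
    rw [← hbv, h'.form_inl x hx', ContinuousLinearMap.comp_apply, hΨ, h.proj_inr x hx, map_zero,
      map_zero]
  have hϑ' : ∀ j, ϑ' j (p x) = ∑ l, b (Sum.inl j) (Sum.inl l) • ϑ l (p x) := fun j => by
    ext w
    obtain ⟨v, rfl⟩ := hs x w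
    have h3 := congrArg (fun u : Cot EM x => u v) (hb (Sum.inl j))
    simp only [Fintype.sum_sum_type, hb0, zero_smul, Finset.sum_const_zero, add_zero,
      h'.form_inl x hx', h.form_inl x hx] at h3
    refine h3.trans ?_
    rw [_root_.sum_apply, _root_.sum_apply]
    rfl
  let c : Matrix (Fin k) (Fin k) ℝ := fun i j => a (Sum.inr i) (Sum.inr j)
  let d : Matrix (Fin k) (Fin k) ℝ := fun i j => b (Sum.inr i) (Sum.inr j)
  -- In both frames the extra forms are dual to the vertical vectors. The vertical blocks are
  -- therefore inverse transposes and their determinants cancel.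
  have hcd : d * c.transpose = 1 := by
    ext i j
    have h3 := h'.form_inr x hx' i j
    rw [ha (Sum.inr j), Fintype.sum_sum_type] at h3
    simp only [ha0, zero_smul, Finset.sum_const_zero, zero_add, map_sum, map_smul, hbv,
      smul_eq_mul] at h3
    rw [Matrix.mul_apply, Matrix.one_apply, ← h3]
    exact Finset.sum_congr rfl fun l _ => mul_comm _ _
  let a₁ : Matrix (Fin A.rank) (Fin A.rank) ℝ := fun i j => a (Sum.inl i) (Sum.inl j)
  let b₁ : Matrix (Fin (Module.finrank ℝ EN)) (Fin (Module.finrank ℝ EN)) ℝ :=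
    fun i j => b (Sum.inl i) (Sum.inl j)
  let a₂ : Matrix (Fin A.rank) (Fin k) ℝ := fun i j => a (Sum.inl i) (Sum.inr j)
  let b₂ : Matrix (Fin k) (Fin (Module.finrank ℝ EN)) ℝ := fun i j => b (Sum.inr i) (Sum.inl j)
  have hda : Matrix.det (n := Fin A.rank ⊕ Fin k) a = a₁.det * c.det := by
    have : (a : Matrix _ _ ℝ) = Matrix.fromBlocks a₁ a₂ 0 c := by
      ext (i | i) (j | j)
      · rfl
      · rfl
      · exact ha0 i j
      · rfl
    exact (congrArg Matrix.det this).trans (Matrix.det_fromBlocks_zero₂₁ _ _ _)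
  have hdb : Matrix.det (n := Fin (Module.finrank ℝ EN) ⊕ Fin k) b = b₁.det * d.det := by
    have : (b : Matrix _ _ ℝ) = Matrix.fromBlocks b₁ 0 b₂ d := by
      ext (i | i) (j | j)
      · rfl
      · exact hb0 i j
      · rfl
      · rfl
    exact (congrArg Matrix.det this).trans (Matrix.det_fromBlocks_zero₁₂ _ _ _)
  have hcd' : d.det * c.det = 1 := by
    rw [← Matrix.det_transpose c, ← Matrix.det_mul, hcd, Matrix.det_one]
  refine ⟨a₁.det * b₁.det, PreLieAlgebroid.gen_change hα' hϑ', ?_⟩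
  have h4 := PreLieAlgebroid.gen_change (A := B) (x := x) (e := fun i => e (ε.symm i))
    (e' := fun i => e' (ε.symm i)) (θ := fun i => θ (ε'.symm i)) (θ' := fun i => θ' (ε'.symm i))
    (a := Matrix.submatrix a ε.symm ε.symm) (b := Matrix.submatrix b ε'.symm ε'.symm)
    (fun i => (ha _).trans (Equiv.sum_comp ε.symm fun t => a (ε.symm i) t • e t x).symm)
    (fun i => (hb _).trans (Equiv.sum_comp ε'.symm fun t => b (ε'.symm i) t • θ t x).symm)
  have h5 := (Matrix.det_submatrix_equiv_self ε.symm (Matrix.of a)).trans hda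
  have h6 := (Matrix.det_submatrix_equiv_self ε'.symm (Matrix.of b)).trans hdb
  refine h4.trans (congrArg (fun r : ℝ => r • B.gen (fun i => e (ε.symm i))
    (fun j => θ (ε'.symm j)) x) ?_)
  refine (congrArg₂ (fun r s : ℝ => r * s) h5 h6).trans ?_
  linear_combination (a₁.det * b₁.det) * hcd'

end Adapted

end PreLieAlgebroid

/-- Cartan's formula reduces this to the naturality of the exterior derivative and the chain rule.
-/
theorem lieForm_comp_mfderiv {EN : Type*} [NormedAddCommGroup EN] [NormedSpace ℝ EN]
    {N : Type*} [TopologicalSpace N] [ChartedSpace EN N] [IsManifold 𝓘(ℝ, EN) ∞ N]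
    [FiniteDimensional ℝ EM] [FiniteDimensional ℝ EN] [T2Space M] [T2Space N]
    {p : C^∞⟮𝓘(ℝ, EM), M; 𝓘(ℝ, EN), N⟯} {U : Set M} {V : Set N} (hU : IsOpen U) (hV : IsOpen V)
    (hUV : ∀ x ∈ U, p x ∈ V) {x : M} (hx : x ∈ U) {X : ∀ x : M, Tan EM x} {Y : ∀ y : N, Tan EN y}
    {β : ∀ y : N, Cot EN y} (hX : ∀ y ∈ U, mfderiv 𝓘(ℝ, EM) 𝓘(ℝ, EN) p y (X y) = Y (p y))
    (hY : SmoothSectionOn EN EN V Y) (hβ : SmoothSectionOn EN (EN →L[ℝ] ℝ) V β) :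
    lieForm X (fun y => (β (p y)).comp (mfderiv 𝓘(ℝ, EM) 𝓘(ℝ, EN) p y)) x
      = (lieForm Y β (p x)).comp (mfderiv 𝓘(ℝ, EM) 𝓘(ℝ, EN) p x) := by
  have h1 : dFun EM (fun y => (β (p y)).comp (mfderiv 𝓘(ℝ, EM) 𝓘(ℝ, EN) p y) (X y)) x
      = dFun EM (fun y => β (p y) (Y (p y))) x :=
    dFun_congr (Filter.Eventually.mono (hU.mem_nhds hx) fun y hy =>
      congrArg (β (p y)) (hX y hy))
  ext v
  change dForm _ x (X x) v + dFun EM _ x v = dForm β (p x) (Y (p x)) _ + dFun EN _ (p x) _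
  rw [h1, dForm_comp_mfderiv hV (hUV x hx) hβ, hX x hx,
    dFun_comp_apply_of_mem hV (hUV x hx) (f := fun z => β z (Y z)) (hβ.apply hY)]
  rfl

/-! ### The canonical representation in adapted frames. -/

namespace PreLieAlgebroid

section Adapted

variable {F : Type*} [NormedAddCommGroup F] [NormedSpace ℝ F]
  {E : M → Type*}
  [∀ x, AddCommGroup (E x)] [∀ x, Module ℝ (E x)] [TopologicalSpace (TotalSpace F E)]
  [∀ x, TopologicalSpace (E x)] [FiberBundle F E]
  {EN : Type*} [NormedAddCommGroup EN] [NormedSpace ℝ EN]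
  {N : Type*} [TopologicalSpace N] [ChartedSpace EN N] [IsManifold 𝓘(ℝ, EN) ∞ N]
  {F' : Type*} [NormedAddCommGroup F'] [NormedSpace ℝ F'] {E' : N → Type*}
  [∀ x, AddCommGroup (E' x)] [∀ x, Module ℝ (E' x)] [TopologicalSpace (TotalSpace F' E')]
  [∀ x, TopologicalSpace (E' x)] [FiberBundle F' E']
  [VectorBundle ℝ F' E'] [ContMDiffVectorBundle ∞ F' E' 𝓘(ℝ, EN)]
  [FiniteDimensional ℝ EM] [FiniteDimensional ℝ EN] [T2Space M] [T2Space N]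
  {A : PreLieAlgebroid EN F' E'} {B : PreLieAlgebroid EM F E}
  {p : C^∞⟮𝓘(ℝ, EM), M; 𝓘(ℝ, EN), N⟯} {Ψ : ∀ x, B.fiber x →ₗ[ℝ] A.fiber (p x)} {k : ℕ}
  {U : Set M} {V : Set N} {e : Fin A.rank ⊕ Fin k → ∀ x, B.fiber x}
  {θ : Fin (Module.finrank ℝ EN) ⊕ Fin k → ∀ x : M, Cot EM x} {α : Fin A.rank → ∀ y, A.fiber y}
  {ϑ : Fin (Module.finrank ℝ EN) → ∀ y : N, Cot EN y} {x : M}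
  (ε : Fin A.rank ⊕ Fin k ≃ Fin B.rank)
  (ε' : Fin (Module.finrank ℝ EN) ⊕ Fin k ≃ Fin (Module.finrank ℝ EM))

/-- The bundle map `Ψ : B → A` over `p` is compatible with anchors and, on projectable sections,
with brackets. -/
structure IsMorphism (A : PreLieAlgebroid EN F' E') (B : PreLieAlgebroid EM F E)
    (p : C^∞⟮𝓘(ℝ, EM), M; 𝓘(ℝ, EN), N⟯) (Ψ : ∀ x, B.fiber x →ₗ[ℝ] A.fiber (p x)) : Prop where
  anchor : ∀ x v, mfderiv 𝓘(ℝ, EM) 𝓘(ℝ, EN) p x (B.anchor x v) = A.anchor (p x) (Ψ x v)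
  bracket : ∀ (U : Set M) (V : Set N), IsOpen U → IsOpen V → (∀ x ∈ U, p x ∈ V) →
    ∀ σ τ γ β, B.SmoothOn U σ → B.SmoothOn U τ → A.SmoothOn V γ → A.SmoothOn V β →
    (∀ x ∈ U, Ψ x (σ x) = γ (p x)) → (∀ x ∈ U, Ψ x (τ x) = β (p x)) →
    ∀ x ∈ U, Ψ x (B.bracket σ τ x) = A.bracket γ β (p x)

/-- Only diagonal blocks enter the traces. Those of the lifted sections and forms equal the ones
downstairs, and the contributions of the vertical sections and their dual forms cancel. -/
theorem IsAdapted.nablaGen (h : IsAdapted A B p Ψ U V e θ α ϑ) (hA : A.IsLieAlgebroid)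
    (hB : B.IsLieAlgebroid) (hρ : B.AnchorHom) (hΨ : IsMorphism A B p Ψ)
    (hs : ∀ x, Function.Surjective (mfderiv 𝓘(ℝ, EM) 𝓘(ℝ, EN) p x)) (hx : x ∈ U)
    {σ : ∀ x, B.fiber x} {γ : ∀ y, A.fiber y} (hσ : B.SmoothOn U σ) (hγ : A.SmoothOn V γ)
    (hσγ : ∀ y ∈ U, Ψ y (σ y) = γ (p y)) {δ : ℝ}
    (hδ : A.nablaGen γ α ϑ (p x) = δ • A.gen α ϑ (p x)) :
    B.nablaGen σ (fun i => e (ε.symm i)) (fun j => θ (ε'.symm j)) x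
      = δ • B.gen (fun i => e (ε.symm i)) (fun j => θ (ε'.symm j)) x := by
  have hpx := h.maps x hx
  have hC : ∀ i, ∃ c : Fin A.rank → ℝ, ∑ l, c l • α l (p x) = A.bracket γ (α i) (p x) := fun i =>
    (Submodule.mem_span_range_iff_exists_fun ℝ).1 (by rw [h.frames.span _ hpx]; trivial)
  have hD : ∀ j, ∃ c : Fin (Module.finrank ℝ EN) → ℝ, ∑ l, c l • ϑ l (p x)
      = lieForm (fun y => A.anchor y (γ y)) (ϑ j) (p x) := fun i =>
    (Submodule.mem_span_range_iff_exists_fun ℝ).1 (by rw [h.frames.span' _ hpx]; trivial)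
  choose C hC using hC
  choose D hD using hD
  let C₀ : Matrix (Fin A.rank) (Fin A.rank) ℝ := C
  let D₀ : Matrix (Fin (Module.finrank ℝ EN)) (Fin (Module.finrank ℝ EN)) ℝ := D
  have hδ' : δ = C₀.trace + D₀.trace := by
    rw [nablaGen_eq (C := C₀) (D := D₀) (fun i => (hC i).symm) fun j => (hD j).symm] at hδ
    exact (h.frames.smul_gen_injective hpx hδ).symm
  obtain ⟨hE, hT⟩ := h.exists_expand hB hΨ.anchor hs hx ε ε'
  choose c hc using fun t => hE (B.bracket σ (e t) x)
  choose d hd using fun t => hT (lieForm (fun y => B.anchor y (σ y)) (θ t) x)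
  have hαi := Fintype.linearIndependent_iff.1 (h.frames.linearIndependent _ hpx)
  have hθi := Fintype.linearIndependent_iff.1 (h.linearIndependent' hΨ.anchor hs hx)
  have hΨc : ∀ t, Ψ x (B.bracket σ (e t) x) = ∑ l, c t (Sum.inl l) • α l (p x) := fun t => by
    rw [hc, Fintype.sum_sum_type, map_add, map_sum, map_sum]
    simp [h.proj_inl x hx, h.proj_inr x hx]
  have hcl : ∀ i l, c (Sum.inl i) (Sum.inl l) = C i l := fun i l => by
    refine sub_eq_zero.1 (hαi (fun l => c (Sum.inl i) (Sum.inl l) - C i l) ?_ l)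
    simp only [sub_smul, Finset.sum_sub_distrib]
    rw [← hΨc, hC, hΨ.bracket U V h.isOpen h.isOpen' h.maps σ _ γ (α i) hσ (h.smooth _) hγ
      (h.frames.smooth i) hσγ (fun y hy => h.proj_inl y hy i) x hx, sub_self]
  have hcr : ∀ b l, c (Sum.inr b) (Sum.inl l) = 0 := fun b => by
    refine hαi _ ?_
    -- A vertical section projects to zero, so its bracket with `σ` projects to [γ, 0]. The empty
    -- sum shows that this vanishes.
    have h1 := hA.bracket_sum (∅ : Finset (Fin 0)) (f := fun _ _ => 0) (τ := fun _ => γ) h.isOpen'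
      hpx hγ (fun _ => contMDiffOn_const) fun _ => hγ
    rw [← hΨc, hΨ.bracket U V h.isOpen h.isOpen' h.maps σ _ γ (fun _ => 0) hσ (h.smooth _) hγ
      smoothSectionOn_zero hσγ (fun y hy => h.proj_inr y hy b) x hx]
    simpa using h1
  have hX := hB.anchor_smooth U h.isOpen σ hσ
  have hdl : ∀ j l, d (Sum.inl j) (Sum.inl l) = D j l := fun j l => by
    refine sub_eq_zero.1 (hθi (fun t => d (Sum.inl j) t - Sum.elim (D j) 0 t) ?_ (Sum.inl l))
    simp only [sub_smul, Finset.sum_sub_distrib]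
    rw [← hd, sub_eq_zero, lieForm_congr (Filter.Eventually.of_forall fun _ => rfl)
      (Filter.Eventually.mono (h.isOpen.mem_nhds hx) fun y hy => h.form_inl y hy j),
      lieForm_comp_mfderiv h.isOpen h.isOpen' h.maps hx
        (fun y hy => (hΨ.anchor y (σ y)).trans (congrArg (A.anchor (p y)) (hσγ y hy)))
        (hA.anchor_smooth V h.isOpen' γ hγ) (h.frames.smooth' j), ← hD, Fintype.sum_sum_type]
    ext v
    simp [_root_.sum_apply, h.form_inl x hx]
  -- Differentiate the constant pairing of a vertical vector with its dual form along `σ`.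
  have hcd : ∀ a, c (Sum.inr a) (Sum.inr a) + d (Sum.inr a) (Sum.inr a) = 0 := fun a => by
    have h1 := lieForm_apply h.isOpen hx hX (h.smooth' (Sum.inr a))
      (hB.anchor_smooth U h.isOpen _ (h.smooth (Sum.inr a)))
    have h2 : dFun EM (fun y => θ (Sum.inr a) y (B.anchor y (e (Sum.inr a) y))) x = 0 :=
      (dFun_congr (Filter.Eventually.mono (h.isOpen.mem_nhds hx) fun y hy => by
        rw [h.form_inr y hy, if_pos rfl])).trans (dFun_const 1)
    rw [h2, ← hρ U h.isOpen σ _ hσ (h.smooth _) x hx, hc, hd] at h1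
    simp only [Fintype.sum_sum_type, hcr, zero_smul, Finset.sum_const_zero, zero_add, map_sum,
      map_smul, _root_.add_apply, _root_.sum_apply, _root_.smul_apply, h.form_inr x hx,
      h.form_inl_apply hΨ.anchor hx, smul_eq_mul, mul_ite, mul_one, mul_zero,
      Finset.sum_ite_eq, Finset.sum_ite_eq', Finset.mem_univ, if_true, _root_.zero_apply,
      zero_sub] at h1
    linarith
  rw [nablaGen_eq (C := Matrix.submatrix (Matrix.of c) ε.symm ε.symm)
    (D := Matrix.submatrix (Matrix.of d) ε'.symm ε'.symm)
    (fun i => (hc _).trans (Equiv.sum_comp ε.symm fun t => c (ε.symm i) t • e t x).symm)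
    (fun i => (hd _).trans (Equiv.sum_comp ε'.symm fun t => d (ε'.symm i) t • θ t x).symm), hδ']
  refine congrArg (fun r : ℝ => r • B.gen (fun i => e (ε.symm i))
    (fun j => θ (ε'.symm j)) x) ?_
  have h1 : (Matrix.submatrix (Matrix.of c) ε.symm ε.symm).trace = ∑ t, c t t :=
    Equiv.sum_comp ε.symm fun t => c t t
  have h2 : (Matrix.submatrix (Matrix.of d) ε'.symm ε'.symm).trace = ∑ t, d t t :=
    Equiv.sum_comp ε'.symm fun t => d t t
  have h3 : C₀.trace = ∑ i, C i i := rfl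
  have h4 : D₀.trace = ∑ i, D i i := rfl
  have h5 : ∑ a, c (Sum.inr a) (Sum.inr a) + ∑ a, d (Sum.inr a) (Sum.inr a) = 0 := by
    rw [← Finset.sum_add_distrib]
    exact Finset.sum_eq_zero fun a _ => hcd a
  rw [h1, h2, h3, h4, Fintype.sum_sum_type, Fintype.sum_sum_type]
  simp only [hcl, hdl]
  linarith

end Adapted

end PreLieAlgebroid

/-! ### Pullback of sections of the canonical line and of their cocycles. -/

namespace PreLieAlgebroid

section Adapted

variable {F : Type*} [NormedAddCommGroup F] [NormedSpace ℝ F]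
  {E : M → Type*}
  [∀ x, AddCommGroup (E x)] [∀ x, Module ℝ (E x)] [TopologicalSpace (TotalSpace F E)]
  [∀ x, TopologicalSpace (E x)] [FiberBundle F E]
  [VectorBundle ℝ F E] [ContMDiffVectorBundle ∞ F E 𝓘(ℝ, EM)] [FiniteDimensional ℝ F]
  {EN : Type*} [NormedAddCommGroup EN] [NormedSpace ℝ EN]
  {N : Type*} [TopologicalSpace N] [ChartedSpace EN N] [IsManifold 𝓘(ℝ, EN) ∞ N]
  {F' : Type*} [NormedAddCommGroup F'] [NormedSpace ℝ F'] {E' : N → Type*}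
  [∀ x, AddCommGroup (E' x)] [∀ x, Module ℝ (E' x)] [TopologicalSpace (TotalSpace F' E')]
  [∀ x, TopologicalSpace (E' x)] [FiberBundle F' E'] [FiniteDimensional ℝ F']
  [VectorBundle ℝ F' E'] [ContMDiffVectorBundle ∞ F' E' 𝓘(ℝ, EN)]
  [FiniteDimensional ℝ EM] [FiniteDimensional ℝ EN] [T2Space M] [T2Space N]
  {A : PreLieAlgebroid EN F' E'} {B : PreLieAlgebroid EM F E}
  {p : C^∞⟮𝓘(ℝ, EM), M; 𝓘(ℝ, EN), N⟯} {Ψ : ∀ x, B.fiber x →ₗ[ℝ] A.fiber (p x)} {k : ℕ}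
  {U : Set M} {V : Set N} {e : Fin A.rank ⊕ Fin k → ∀ x, B.fiber x}
  {θ : Fin (Module.finrank ℝ EN) ⊕ Fin k → ∀ x : M, Cot EM x} {α : Fin A.rank → ∀ y, A.fiber y}
  {ϑ : Fin (Module.finrank ℝ EN) → ∀ y : N, Cot EN y} {x : M}
  (ε : Fin A.rank ⊕ Fin k ≃ Fin B.rank)
  (ε' : Fin (Module.finrank ℝ EN) ⊕ Fin k ≃ Fin (Module.finrank ℝ EM))
  {μ : ∀ y, A.CanLine y} {ν : ∀ x, B.CanLine x}

theorem IsAdapted.mono (h : IsAdapted A B p Ψ U V e θ α ϑ) {W : Set N} (hW : IsOpen W)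
    (hWV : W ⊆ V) : IsAdapted A B p Ψ (U ∩ p ⁻¹' W) W e θ α ϑ :=
  ⟨h.isOpen.inter (hW.preimage p.contMDiff.continuous), hW, fun _ hx => hx.2, h.frames.mono hWV,
    fun t => SmoothSectionOn.mono (h.smooth t) inter_subset_left,
    fun t => (h.smooth' t).mono inter_subset_left, fun x hx => h.proj_inl x hx.1,
    fun x hx => h.proj_inr x hx.1, fun x hx => h.form_inl x hx.1, fun x hx => h.form_inr x hx.1⟩

/-- The canonical line of `A` pulls back to that of `B`, and `ν` corresponds to `μ`. -/
def IsPullbackSection (A : PreLieAlgebroid EN F' E') (B : PreLieAlgebroid EM F E)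
    (p : C^∞⟮𝓘(ℝ, EM), M; 𝓘(ℝ, EN), N⟯) (Ψ : ∀ x, B.fiber x →ₗ[ℝ] A.fiber (p x)) {k : ℕ}
    (ε : Fin A.rank ⊕ Fin k ≃ Fin B.rank)
    (ε' : Fin (Module.finrank ℝ EN) ⊕ Fin k ≃ Fin (Module.finrank ℝ EM))
    (μ : ∀ y, A.CanLine y) (ν : ∀ x, B.CanLine x) : Prop :=
  ∀ (U : Set M) (V : Set N) (e : Fin A.rank ⊕ Fin k → ∀ x, B.fiber x)
    (θ : Fin (Module.finrank ℝ EN) ⊕ Fin k → ∀ x : M, Cot EM x) (α : Fin A.rank → ∀ y, A.fiber y)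
    (ϑ : Fin (Module.finrank ℝ EN) → ∀ y : N, Cot EN y), IsAdapted A B p Ψ U V e θ α ϑ →
    ∀ x ∈ U, ∀ t : ℝ, μ (p x) = t • A.gen α ϑ (p x) →
      ν x = t • B.gen (fun i => e (ε.symm i)) (fun j => θ (ε'.symm j)) x

/-- The section is defined at each point by some adapted frame. Since changes of adapted frames have
the same factor on both manifolds, the choice is irrelevant, and smoothness follows from a single
frame near the point. -/
theorem exists_isPullbackSection (hA : A.IsLieAlgebroid) (hB : B.IsLieAlgebroid)
    (hΨ : ∀ x v, mfderiv 𝓘(ℝ, EM) 𝓘(ℝ, EN) p x (B.anchor x v) = A.anchor (p x) (Ψ x v))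
    (hs : ∀ x, Function.Surjective (mfderiv 𝓘(ℝ, EM) 𝓘(ℝ, EN) p x))
    (hex : ∀ x₀, ∃ (U : Set M) (V : Set N) (e : Fin A.rank ⊕ Fin k → ∀ x, B.fiber x)
      (θ : Fin (Module.finrank ℝ EN) ⊕ Fin k → ∀ x : M, Cot EM x) (α : Fin A.rank → ∀ y, A.fiber y)
      (ϑ : Fin (Module.finrank ℝ EN) → ∀ y : N, Cot EN y), x₀ ∈ U ∧ IsAdapted A B p Ψ U V e θ α ϑ)
    (hμ : A.IsNonvanishing μ) :
    ∃ ν, IsPullbackSection A B p Ψ ε ε' μ ν ∧ B.IsNonvanishing ν := by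
  choose U V e θ α ϑ hx h using hex
  have ht : ∀ x, ∃ t : ℝ, μ (p x) = t • A.gen (α x) (ϑ x) (p x) := fun x => by
    obtain ⟨W, -, -, hxW, f, -, hf⟩ := hμ.exists_ratio hA (h x).isOpen' ((h x).maps x (hx x))
      (h x).frames
    exact ⟨f (p x), (hf _ hxW).2⟩
  choose t ht using ht
  have hν : IsPullbackSection A B p Ψ ε ε' μ
      fun x => t x • B.gen (fun i => e x (ε.symm i)) (fun j => θ x (ε'.symm j)) x := by
    intro U' V' e' θ' α' ϑ' h' x hx' s hs'
    obtain ⟨J, hJ, hJ'⟩ := h'.gen_change ε ε' (h x) hB hΨ hs hx' (hx x)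
    have h1 := ht x
    rw [hs', hJ, smul_smul] at h1
    change t x • B.gen (fun i => e x (ε.symm i)) (fun j => θ x (ε'.symm j)) x = _
    rw [hJ', smul_smul, h'.frames.smul_gen_injective (h'.maps x hx') h1]
  refine ⟨_, hν, fun x => ?_⟩
  obtain ⟨W, hWV, hW, hxW, f, hf, hfμ⟩ := hμ.exists_ratio hA (h x).isOpen' ((h x).maps x (hx x))
    (h x).frames
  have h' := (h x).mono hW hWV
  refine ⟨_, h'.isOpen, ⟨hx x, hxW⟩, _, _, h'.areFrames ε ε' hB hΨ hs, fun y => f (p y),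
    hf.comp p.contMDiff.contMDiffOn h'.maps, fun y hy => ⟨(hfμ _ hy.2).1, ?_⟩⟩
  exact hν _ _ _ _ _ _ h' y hy _ (hfμ _ hy.2).2

/-- In adapted frames the two sections have coefficients f and f ∘ p and the same trace factor, so
the two cocycle equations become the same scalar equation. -/
theorem IsCocycle.eq_comp (hA : A.IsLieAlgebroid) (hB : B.IsLieAlgebroid) (hρ : B.AnchorHom)
    (hΨ : IsMorphism A B p Ψ)
    (hs : ∀ x, Function.Surjective (mfderiv 𝓘(ℝ, EM) 𝓘(ℝ, EN) p x))
    (h : IsAdapted A B p Ψ U V e θ α ϑ) (hx : x ∈ U) (hμ : A.IsNonvanishing μ)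
    (hν : IsPullbackSection A B p Ψ ε ε' μ ν) {η : A.Cochain} {ξ : B.Cochain}
    (hη : A.IsCocycle μ η) (hξ : B.IsCocycle ν ξ) (v : B.fiber x) :
    ξ x v = η (p x) (Ψ x v) := by
  obtain ⟨W, hWV, hW, hxW, f, hf, hfμ⟩ := hμ.exists_ratio hA h.isOpen' (h.maps x hx) h.frames
  have h' := h.mono hW hWV
  have hx' : x ∈ U ∩ p ⁻¹' W := ⟨hx, hxW⟩
  obtain ⟨c, rfl⟩ := (h'.exists_expand hB hΨ.anchor hs hx' ε ε').1 v
  -- With constant coefficients the extension of the given vector is projectable, and its image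
  -- comes from the section `γ` on `N`.
  let σ : ∀ x, B.fiber x := fun y => ∑ t, c t • e t y
  let γ : ∀ y, A.fiber y := fun y => ∑ i, c (Sum.inl i) • α i y
  have hσ : B.SmoothOn (U ∩ p ⁻¹' W) σ := SmoothSectionOn.congr
    (SmoothSectionOn.sum (s := Finset.univ) fun t _ =>
      SmoothSectionOn.smul (f := fun _ => c t) contMDiffOn_const (h'.smooth t)) fun y _ => by
    rw [Submodule.coe_sum]
    rfl
  have hγ : A.SmoothOn W γ := SmoothSectionOn.congr
    (SmoothSectionOn.sum (s := Finset.univ) fun i _ =>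
      SmoothSectionOn.smul (f := fun _ => c (Sum.inl i)) contMDiffOn_const
        (h'.frames.smooth i)) fun y _ => by
    rw [Submodule.coe_sum]
    rfl
  have hσγ : ∀ y ∈ U ∩ p ⁻¹' W, Ψ y (σ y) = γ (p y) := fun y hy => by
    simp only [σ, γ]
    rw [Fintype.sum_sum_type, map_add, map_sum, map_sum]
    simp [h'.proj_inl y hy, h'.proj_inr y hy]
  obtain ⟨C, D, -, -, hC, hD⟩ := h'.frames.exists_matrices hA hW hγ
  have hδ := nablaGen_eq (hC _ hxW) (hD _ hxW)
  have hδ' := h'.nablaGen ε ε' hA hB hρ hΨ hs hx' hσ hγ hσγ hδ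
  have h1 := hη W hW α ϑ h'.frames f hf (fun y hy => (hfμ y hy).2) γ hγ (p x) hxW
  have h2 := hξ _ h'.isOpen _ _ (h'.areFrames ε ε' hB hΨ.anchor hs) (fun y => f (p y))
    (hf.comp p.contMDiff.contMDiffOn h'.maps)
    (fun y hy => hν _ _ _ _ _ _ h' y hy _ (hfμ _ hy.2).2) σ hσ x hx'
  rw [hδ, (hfμ _ hxW).2, smul_smul, smul_smul, ← add_smul] at h1
  rw [hδ', hν _ _ _ _ _ _ h' x hx' _ (hfμ _ hxW).2, smul_smul, smul_smul, ← add_smul] at h2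
  have h3 := h'.frames.smul_gen_injective hxW h1
  have h4 := (h'.areFrames ε ε' hB hΨ.anchor hs).smul_gen_injective hx' h2
  rw [dFun_comp_apply_of_mem hW hxW hf, hΨ.anchor, hσγ x hx', h3] at h4
  have h5 := mul_right_cancel₀ (hfμ _ hxW).1 h4
  change ξ x (σ x) = η (p x) (Ψ x (σ x))
  rw [hσγ x hx', h5]

end Adapted

end PreLieAlgebroid

/-! ### Existence of adapted frames. -/

/-- Local frames of the vertical bundle of a submersion, with dual forms. -/
theorem exists_vertical_frame {EN : Type*} [NormedAddCommGroup EN] [NormedSpace ℝ EN]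
    {N : Type*} [TopologicalSpace N] [ChartedSpace EN N] [IsManifold 𝓘(ℝ, EN) ∞ N]
    [FiniteDimensional ℝ EM] [FiniteDimensional ℝ EN] [T2Space M] [T2Space N]
    {p : C^∞⟮𝓘(ℝ, EM), M; 𝓘(ℝ, EN), N⟯}
    (hs : ∀ x, Function.Surjective (mfderiv 𝓘(ℝ, EM) 𝓘(ℝ, EN) p x)) {U : Set M} {x₀ : M}
    (hU : IsOpen U) (hx : x₀ ∈ U) :
    ∃ U' ⊆ U, IsOpen U' ∧ x₀ ∈ U' ∧
      ∃ (Y : Fin (Module.finrank ℝ EM - Module.finrank ℝ EN) → ∀ x : M, Tan EM x)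
        (κ : Fin (Module.finrank ℝ EM - Module.finrank ℝ EN) → ∀ x : M, Cot EM x),
        (∀ a, SmoothSectionOn EM EM U' (Y a)) ∧
        (∀ a, ∀ x ∈ U', mfderiv 𝓘(ℝ, EM) 𝓘(ℝ, EN) p x (Y a x) = 0) ∧
        (∀ a, SmoothSectionOn EM (EM →L[ℝ] ℝ) U' (κ a)) ∧
        ∀ x ∈ U', ∀ a c, κ a x (Y c x) = if a = c then 1 else 0 := by
  let D : EM →ₗ[ℝ] EN := (mfderiv 𝓘(ℝ, EM) 𝓘(ℝ, EN) p x₀).toLinearMap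
  have hk : Module.finrank ℝ (LinearMap.ker D) = Module.finrank ℝ EM - Module.finrank ℝ EN := by
    have h1 := LinearMap.finrank_range_add_finrank_ker D
    have h2 : Function.Surjective D := hs x₀
    rw [LinearMap.range_eq_top.2 h2, finrank_top] at h1
    omega
  -- A basis of the kernel at `x₀` is extended to local vertical fields. Independence at `x₀` is
  -- enough for smooth dual forms nearby.
  let b := Module.finBasisOfFinrankEq ℝ (LinearMap.ker D) hk
  have hb : LinearIndependent ℝ fun a => (b a : EM) :=
    b.linearIndependent.map' (LinearMap.ker D).subtype (Submodule.ker_subtype _)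
  have hbD : ∀ a, mfderiv 𝓘(ℝ, EM) 𝓘(ℝ, EN) p x₀ ((b a : EM) : Tan EM x₀) = 0 := fun a => (b a).2
  choose O Y hO hxO hY hYb hYv using fun a =>
    exists_vertical_field p.contMDiff (hs x₀) (hbD a)
  have hYU : ∀ a, SmoothSectionOn EM EM (U ∩ ⋂ a, O a) (Y a) := fun a =>
    (hY a).mono (inter_subset_right.trans (iInter_subset _ a))
  have hli : LinearIndependent ℝ fun a => Y a x₀ := by
    have h1 : (fun a => Y a x₀) = fun a => ((b a : EM) : Tan EM x₀) := funext hYb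
    rw [h1]
    exact hb
  obtain ⟨U', hU', hoU', hxU', l, hlsm, hld⟩ := exists_dual_forms (F := EM)
    (E := (TangentSpace 𝓘(ℝ, EM) : M → Type _)) (hU.inter (isOpen_iInter_of_finite hO))
    ⟨hx, mem_iInter.2 hxO⟩ hYU hli
  let κ : Fin (Module.finrank ℝ EM - Module.finrank ℝ EN) → ∀ x : M, EM →L[ℝ] ℝ := fun a x =>
    LinearMap.toContinuousLinearMap (l a x : EM →ₗ[ℝ] ℝ)
  refine ⟨U', hU'.trans inter_subset_left, hoU', hxU', Y, κ, fun a => (hYU a).mono hU',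
    fun a x hx => hYv a x (mem_iInter.1 (hU' hx).2 a), fun a => ?_, hld⟩
  exact smoothSectionOn_form_of_apply fun Z hZ => hlsm a U' Z hoU' subset_rfl (hZ.mono (subset_univ _))

/-- Coordinates give frames of the cotangent algebroid and of the cotangent bundle. -/
theorem areFrames_dFun (P : PoissonStructure EM M) {f : Fin (Module.finrank ℝ EM) → M → ℝ}
    {W : Fin (Module.finrank ℝ EM) → ∀ x : M, Tan EM x} {V : Set M}
    (hf : ∀ i, ContMDiff 𝓘(ℝ, EM) 𝓘(ℝ, ℝ) ∞ (f i))
    (hd : ∀ y ∈ V, ∀ i j, dFun EM (f i) y (W j y) = if i = j then 1 else 0)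
    (ha : ∀ y ∈ V, ∀ α : Cot EM y, α = ∑ i, α (W i y) • dFun EM (f i) y) :
    (cotangentAlgebroid P).AreFrames V (fun i y => ⟨dFun EM (f i) y, trivial⟩)
      fun i => dFun EM (f i) := by
  have hdf : ∀ i, SmoothSectionOn EM (EM →L[ℝ] ℝ) V (dFun EM (f i)) := fun i =>
    (smoothSectionOn_dFun isOpen_univ (hf i).contMDiffOn).mono (subset_univ _)
  have hli : ∀ y ∈ V, LinearIndependent ℝ fun i => dFun EM (f i) y := fun y hy => by
    rw [Fintype.linearIndependent_iff]
    intro c hc j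
    have h1 := congrArg (fun u : Cot EM y => u (W j y)) hc
    simpa [_root_.sum_apply, hd y hy] using h1
  refine ⟨hdf, fun y hy => ?_, fun y hy => ?_, hdf, hli, fun y hy => ?_⟩
  · exact LinearIndependent.of_comp (Submodule.subtype ⊤) (hli y hy)
  · rw [eq_top_iff]
    intro β _
    refine (Submodule.mem_span_range_iff_exists_fun ℝ).2
      ⟨fun i => (β : Cot EM y) (W i y), Subtype.ext ?_⟩
    rw [Submodule.coe_sum]
    exact (ha y hy β).symm
  · rw [eq_top_iff]
    intro β _
    exact (Submodule.mem_span_range_iff_exists_fun ℝ).2 ⟨_, (ha y hy β).symm⟩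

namespace PreLieAlgebroid

section Pullback

variable {F : Type*} [NormedAddCommGroup F] [NormedSpace ℝ F]
  {E : M → Type*}
  [∀ x, AddCommGroup (E x)] [∀ x, Module ℝ (E x)] [TopologicalSpace (TotalSpace F E)]
  [∀ x, TopologicalSpace (E x)] [FiberBundle F E]
  {EN : Type*} [NormedAddCommGroup EN] [NormedSpace ℝ EN]
  {N : Type*} [TopologicalSpace N] [ChartedSpace EN N] [IsManifold 𝓘(ℝ, EN) ∞ N]
  {B : PreLieAlgebroid EM F E} {p : C^∞⟮𝓘(ℝ, EM), M; 𝓘(ℝ, EN), N⟯}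

section

variable {F' : Type*} [NormedAddCommGroup F'] [NormedSpace ℝ F'] {E' : N → Type*}
  [∀ x, AddCommGroup (E' x)] [∀ x, Module ℝ (E' x)] [TopologicalSpace (TotalSpace F' E')]
  [∀ x, TopologicalSpace (E' x)] [FiberBundle F' E']
  {A : PreLieAlgebroid EN F' E'}
  {br : (∀ x, pullbackFiber p A x) → (∀ x, pullbackFiber p A x) → ∀ x, pullbackFiber p A x}
  {Θ : ∀ x, B.fiber x ≃ₗ[ℝ] (pullbackAlgebroid p A br).fiber x}

theorem anchor_pullbackProj (x : M) (w : pullbackFiber p A x) :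
    A.anchor (p x) (pullbackProj p A x w) = mfderiv 𝓘(ℝ, EM) 𝓘(ℝ, EN) p x w.1.1 := by
  obtain ⟨v, hv, h⟩ := w.2
  have h1 : pullbackProj p A x w = v := Subtype.ext hv.symm
  rw [h1, h]

/-- A projectable section is a single pulled back section with coefficient 1, so the derivative
terms of the pullback bracket vanish. -/
theorem IsIso.isMorphism (hI : IsIso B (pullbackAlgebroid p A br) Θ)
    (hbr : IsPullbackBracket p A br) (hB : B.IsLieAlgebroid) :
    IsMorphism A B p (fun x => (pullbackProj p A x).comp (Θ x).toLinearMap) := by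
  refine ⟨fun x v => ?_, fun U V hU hV hUV σ τ γ β hσ hτ hγ hβ h1 h2 x hx => ?_⟩
  · have h := hI.anchor x v
    rw [← h]
    exact (anchor_pullbackProj x (Θ x v)).symm
  · have hs : ∀ υ, B.SmoothOn U υ → SmoothSectionOn EM EM U (fun x => (Θ x (υ x)).1.1) :=
      fun υ hυ => (hB.anchor_smooth U hU υ hυ).congr fun y _ => hI.anchor y (υ y)
    have h3 := (hbr U V hU hV hUV 1 1 (fun _ _ => 1) (fun _ => γ) (fun _ _ => 1) (fun _ => β)
      (fun x => Θ x (σ x)) (fun x => Θ x (τ x)) (fun _ => contMDiffOn_const) (fun _ => hγ)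
      (fun _ => contMDiffOn_const) (fun _ => hβ) (hs σ hσ) (hs τ hτ)
      (fun y hy => Eq.trans (h1 y hy) (by simp)) (fun y hy => Eq.trans (h2 y hy) (by simp)) x hx).2
    have h4 := hI.bracket U hU σ τ hσ hτ x hx
    refine (congrArg (pullbackProj p A x) h4).trans (h3.trans ?_)
    have h5 : dFun EM (fun _ : M => (1 : ℝ)) x = 0 := dFun_const 1
    simp [h5]

end

variable [FiniteDimensional ℝ EM] [FiniteDimensional ℝ EN] [T2Space M] [T2Space N]
  {PN : PoissonStructure EN N}
  {br : (∀ x, pullbackFiber p (cotangentAlgebroid PN) x) →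
    (∀ x, pullbackFiber p (cotangentAlgebroid PN) x) →
    ∀ x, pullbackFiber p (cotangentAlgebroid PN) x}
  {Θ : ∀ x, B.fiber x ≃ₗ[ℝ] (pullbackAlgebroid p (cotangentAlgebroid PN) br).fiber x}

theorem IsIso.exists_section_pullback
    (hI : IsIso B (pullbackAlgebroid p (cotangentAlgebroid PN) br) Θ) {U : Set M} {V : Set N}
    (hU : IsOpen U) (hV : IsOpen V) (hUV : ∀ x ∈ U, p x ∈ V) {X : ∀ x : M, Tan EM x}
    {β : ∀ y : N, Cot EN y} (hX : SmoothSectionOn EM EM U X)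
    (hβ : SmoothSectionOn EN (EN →L[ℝ] ℝ) V β)
    (h : ∀ x ∈ U, PN.sharp (p x) (β (p x)) = mfderiv 𝓘(ℝ, EM) 𝓘(ℝ, EN) p x (X x)) :
    ∃ σ : ∀ x, B.fiber x, B.SmoothOn U σ ∧ ∀ x ∈ U, B.anchor x (σ x) = X x ∧
      (pullbackProj p (cotangentAlgebroid PN) x (Θ x (σ x)) : Cot EN (p x)) = β (p x) := by
  -- Outside `U` the pair need not lie in the pullback fibre, and zero is used instead.
  have h1 : ∀ x, ∃ w : pullbackFiber p (cotangentAlgebroid PN) x, x ∈ U →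
      w.1.1 = X x ∧ w.1.2 = β (p x) := fun x => by
    by_cases hx : x ∈ U
    · exact ⟨⟨(X x, β (p x)), ⟨β (p x), trivial⟩, rfl, h x hx⟩, fun _ => ⟨rfl, rfl⟩⟩
    · exact ⟨0, fun hx' => absurd hx' hx⟩
  choose w hw using h1
  have h2 : ∀ x, Θ x ((Θ x).symm (w x)) = w x := fun x => (Θ x).apply_symm_apply (w x)
  refine ⟨fun x => (Θ x).symm (w x), (hI.smooth_symm hU w).2 ?_, fun x hx => ⟨?_, ?_⟩⟩
  · refine smoothSectionOn_pullAmbient_iff.2 ⟨hX.congr fun x hx => (hw x hx).1, ?_⟩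
    exact (hβ.pullback hV hUV).congr fun x hx => (hw x hx).2
  · rw [← hI.anchor, h2]
    exact (hw x hx).1
  · rw [h2]
    exact (hw x hx).2

/-- Frames adapted to a pullback of a cotangent algebroid exist locally. -/
theorem IsIso.exists_isAdapted
    (hI : IsIso B (pullbackAlgebroid p (cotangentAlgebroid PN) br) Θ)
    (hs : ∀ x, Function.Surjective (mfderiv 𝓘(ℝ, EM) 𝓘(ℝ, EN) p x)) (x₀ : M) :
    ∃ (U : Set M) (V : Set N)
      (e : Fin (cotangentAlgebroid PN).rank ⊕ Fin (Module.finrank ℝ EM - Module.finrank ℝ EN) →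
        ∀ x, B.fiber x)
      (θ : Fin (Module.finrank ℝ EN) ⊕ Fin (Module.finrank ℝ EM - Module.finrank ℝ EN) →
        ∀ x : M, Cot EM x)
      (α : Fin (cotangentAlgebroid PN).rank → ∀ y, (cotangentAlgebroid PN).fiber y)
      (ϑ : Fin (Module.finrank ℝ EN) → ∀ y : N, Cot EN y), x₀ ∈ U ∧
        IsAdapted (cotangentAlgebroid PN) B p
          (fun x => (pullbackProj p (cotangentAlgebroid PN) x).comp (Θ x).toLinearMap)
          U V e θ α ϑ := by
  classical
  obtain ⟨f, W, V, H, U, hf, hW, hV, hU, hxU, hUV, hd, hv, ha, hH, hHW⟩ :=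
    exists_adapted_coordinates p.contMDiff (hs x₀)
  have hdf : ∀ i, SmoothSectionOn EN (EN →L[ℝ] ℝ) V (dFun EN (f i)) := fun i =>
    (smoothSectionOn_dFun isOpen_univ (hf i).contMDiffOn).mono (subset_univ _)
  have hfr := areFrames_dFun PN hf hd ha
  -- The section pairs the differential of `f i` with the horizontal lift of its Hamiltonian field.
  have hl : ∀ i, ∃ σ : ∀ x, B.fiber x, B.SmoothOn U σ ∧ ∀ x ∈ U,
      (pullbackProj p (cotangentAlgebroid PN) x (Θ x (σ x)) : Cot EN (p x))
        = dFun EN (f i) (p x) := fun i => by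
    have hS := PN.smooth V hV _ (hdf i)
    obtain ⟨σ, h1, h2⟩ := hI.exists_section_pullback hU hV hUV
      (X := fun x => ∑ l, dFun EN (f l) (p x) (PN.sharp (p x) (dFun EN (f i) (p x))) • H l x)
      (SmoothSectionOn.sum fun l _ => SmoothSectionOn.smul
        (((hdf l).apply hS).comp p.contMDiff.contMDiffOn hUV) (hH l)) (hdf i) fun x hx => by
        rw [map_sum]
        simp only [map_smul, hHW x hx]
        exact hv (p x) (hUV x hx) _
    exact ⟨σ, h1, fun x hx => (h2 x hx).2⟩
  choose σ hσ hσ' using hl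
  obtain ⟨U', hUU, hoU', hxU', Y, κ, hYU, hYv, hκ, hld⟩ := exists_vertical_frame hs hU hxU
  have hU'V : ∀ x ∈ U', p x ∈ V := fun x hx => hUV x (hUU hx)
  -- The pair (Y a, 0) lies in the pullback because `Y a` is vertical.
  have hτ : ∀ a, ∃ τ : ∀ x, B.fiber x, B.SmoothOn U' τ ∧ ∀ x ∈ U', B.anchor x (τ x) = Y a x ∧
      (pullbackProj p (cotangentAlgebroid PN) x (Θ x (τ x)) : Cot EN (p x)) = 0 := fun a =>
    hI.exists_section_pullback hoU' hV hU'V (X := Y a) (β := fun _ => 0) (hYU a)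
      smoothSectionOn_zero fun x hx => by
        rw [hYv a x hx, map_zero]
  choose τ hτs hτ' using hτ
  refine ⟨U', V, Sum.elim σ τ,
    Sum.elim (fun j x => (dFun EN (f j) (p x)).comp (mfderiv 𝓘(ℝ, EM) 𝓘(ℝ, EN) p x)) κ, _,
    fun i => dFun EN (f i), hxU', hoU', hV, hU'V, hfr, ?_, ?_, fun x hx i => ?_,
    fun x hx a => ?_, fun x hx j => rfl, fun x hx a c => ?_⟩
  · rintro (i | a)
    · exact SmoothSectionOn.mono (hσ i) hUU
    · exact hτs a
  · rintro (j | a)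
    · exact (smoothSectionOn_comp_mfderiv_iff hs hoU').1 ((hdf j).pullback hV hU'V)
    · exact hκ a
  · exact Subtype.ext (hσ' i x (hUU hx))
  · exact Subtype.ext (hτ' a x hx).2
  · exact (congrArg (κ a x) (hτ' c x hx).1).trans (hld x hx a c)

end Pullback

end PreLieAlgebroid

/-- The canonical line of a cotangent algebroid has a nonvanishing section. -/
theorem exists_isNonvanishing_cotangentAlgebroid [FiniteDimensional ℝ EM] [T2Space M]
    [SigmaCompactSpace M] (P : PoissonStructure EM M) :
    ∃ μ, (cotangentAlgebroid P).IsNonvanishing μ := by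
  choose f W V hf hW hV hx hd _ ha using fun x₀ : M => exists_coordinates_expand (EM := EM) x₀
  let A := cotangentAlgebroid P
  let α : M → Fin (Module.finrank ℝ EM) → ∀ y, A.fiber y :=
    fun x i y => ⟨dFun EM (f x i) y, trivial⟩
  let g : M → ∀ y, A.CanLine y := fun x => A.gen (α x) fun i => dFun EM (f x i)
  have hfr : ∀ x, A.AreFrames (V x) (α x) fun i => dFun EM (f x i) := fun x =>
    areFrames_dFun P (hf x) (hd x) (ha x)
  obtain ⟨ρ, hρ⟩ := SmoothPartitionOfUnity.exists_isSubordinate 𝓘(ℝ, EM) isClosed_univ V hV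
    fun x _ => mem_iUnion.2 ⟨x, hx x⟩
  let J : M → M → M → ℝ := fun x x' y =>
    (Matrix.of fun i j => dFun EM (f x' i) y (W x j y)).det
  have hJ : ∀ x x', ContMDiff 𝓘(ℝ, EM) 𝓘(ℝ, ℝ) ∞ (J x x') := fun x x' =>
    contMDiffOn_univ.1 (contMDiffOn_det fun i j =>
      (smoothSectionOn_dFun isOpen_univ (hf x' i).contMDiffOn).apply (hW x j))
  -- For a cotangent algebroid both tensor factors are top forms and change by the same determinant,
  -- so the generators change by a square.
  have hg : ∀ x x', ∀ y ∈ V x, g x' y = (J x x' y * J x x' y) • g x y := fun x x' y hy => by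
    refine PreLieAlgebroid.gen_change (A := A) (fun i => Subtype.ext ?_) fun i => ha x y hy _
    rw [Submodule.coe_sum]
    exact ha x y hy _
  have hJ0 : ∀ x x', ∀ y ∈ V x, y ∈ V x' → J x x' y ≠ 0 := fun x x' y hy hy' h0 => by
    refine (hfr x').gen_ne_zero hy' ?_
    have h1 := hg x x' y hy
    rw [h0, zero_mul, zero_smul] at h1
    exact h1
  -- The weighted generators are nonnegative multiples of any one of them, and at least one multiple
  -- is positive. The sum therefore never vanishes, without any orientability.
  refine ⟨fun y => ∑ᶠ x, ρ x y • g x y, fun x => ⟨V x, hV x, hx x, α x, _, hfr x,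
    fun y => ∑ᶠ x', ρ x' y • (J x x' y * J x x' y), ?_, fun y hy => ⟨?_, ?_⟩⟩⟩
  · exact (ρ.contMDiff_finsum_smul fun x' y _ =>
      ((hJ x x').mul (hJ x x')).contMDiffAt).contMDiffOn
  · have hfin : (Function.support fun x' => ρ x' y).Finite := ρ.locallyFinite.point_finite y
    obtain ⟨x', hx'⟩ := ρ.exists_pos_of_mem (mem_univ y)
    have h1 : 0 < ∑ᶠ x', ρ x' y * (J x x' y * J x x' y) :=
      finsum_pos (fun x' => mul_nonneg (ρ.nonneg x' y) (mul_self_nonneg _))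
        ⟨x', mul_pos hx' (mul_self_pos.2 (hJ0 x x' y hy (hρ x' (subset_tsupport _ hx'.ne'))))⟩
        (hfin.subset fun i hi => left_ne_zero_of_mul hi)
    exact h1.ne'
  · have hfin : (Function.support fun x' => ρ x' y).Finite := ρ.locallyFinite.point_finite y
    have h1 : (Function.support fun x' => ρ x' y • (J x x' y * J x x' y)).Finite :=
      hfin.subset fun i hi => left_ne_zero_of_mul hi
    refine Eq.trans ?_ (finsum_smul' h1 (g x y)).symm
    exact finsum_congr fun x' =>
      (congrArg (fun u => ρ x' y • u) (hg x x' y hy)).trans (smul_smul _ _ _)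

/-! ### The modular class of a pullback of a cotangent algebroid. -/

namespace PreLieAlgebroid

section

variable {F : Type*} [NormedAddCommGroup F] [NormedSpace ℝ F]
  {E : M → Type*}
  [∀ x, AddCommGroup (E x)] [∀ x, Module ℝ (E x)] [TopologicalSpace (TotalSpace F E)]
  [∀ x, TopologicalSpace (E x)] [FiberBundle F E]
  {B : PreLieAlgebroid EM F E}

theorem IsIso.trans {F' : Type*} [NormedAddCommGroup F'] [NormedSpace ℝ F'] {E' : M → Type*}
    [∀ x, AddCommGroup (E' x)] [∀ x, Module ℝ (E' x)] [TopologicalSpace (TotalSpace F' E')]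
    [∀ x, TopologicalSpace (E' x)] [FiberBundle F' E'] {C : PreLieAlgebroid EM F' E'}
    {F'' : Type*} [NormedAddCommGroup F''] [NormedSpace ℝ F''] {E'' : M → Type*}
    [∀ x, AddCommGroup (E'' x)] [∀ x, Module ℝ (E'' x)] [TopologicalSpace (TotalSpace F'' E'')]
    [∀ x, TopologicalSpace (E'' x)] [FiberBundle F'' E''] {D : PreLieAlgebroid EM F'' E''}
    {Θ : ∀ x, B.fiber x ≃ₗ[ℝ] C.fiber x} {Ξ : ∀ x, C.fiber x ≃ₗ[ℝ] D.fiber x}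
    (h : IsIso B C Θ) (h' : IsIso C D Ξ) : IsIso B D fun x => (Θ x).trans (Ξ x) :=
  ⟨fun U hU σ => (h.smooth_iff U hU σ).trans (h'.smooth_iff U hU _),
    fun x v => (h'.anchor x (Θ x v)).trans (h.anchor x v),
    fun U hU σ τ hσ hτ x hx => (congrArg (Ξ x) (h.bracket U hU σ τ hσ hτ x hx)).trans
      (h'.bracket U hU _ _ ((h.smooth_iff U hU σ).1 hσ) ((h.smooth_iff U hU τ).1 hτ) x hx)⟩

variable [FiniteDimensional ℝ EM] [T2Space M]

/-- Once the anchor preserves brackets, closedness of `d_B f` is the formula for a bracket of fields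
acting on `f`. -/
theorem exactForms_le_closedForms (hB : B.IsLieAlgebroid) (hρ : B.AnchorHom) :
    B.exactForms ≤ B.closedForms := by
  rintro η ⟨f, hf, h⟩
  have h1 : ∀ σ : ∀ x, B.fiber x, (fun y => η y (σ y))
      = fun y => dFun EM f y (B.anchor y (σ y)) := fun σ => funext fun y => h y (σ y)
  refine ⟨fun U hU σ hσ => ?_, fun U hU σ τ hσ hτ x hx => ?_⟩
  · rw [h1]
    exact ((smoothSectionOn_dFun isOpen_univ hf.contMDiffOn).mono (subset_univ _)).apply
      (hB.anchor_smooth U hU σ hσ)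
  · rw [h1, h1, h, hρ U hU σ τ hσ hτ x hx, dFun_lieVec hU hx (hf.contMDiffOn)
      (hB.anchor_smooth U hU σ hσ) (hB.anchor_smooth U hU τ hτ), sub_self]

variable [VectorBundle ℝ F E] [ContMDiffVectorBundle ∞ F E 𝓘(ℝ, EM)] [FiniteDimensional ℝ F]
  {EN : Type*} [NormedAddCommGroup EN] [NormedSpace ℝ EN] [FiniteDimensional ℝ EN]
  {N : Type*} [TopologicalSpace N] [ChartedSpace EN N] [IsManifold 𝓘(ℝ, EN) ∞ N]
  [T2Space N] {p : C^∞⟮𝓘(ℝ, EM), M; 𝓘(ℝ, EN), N⟯}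
  {PN : PoissonStructure EN N}
  {br : (∀ x, pullbackFiber p (cotangentAlgebroid PN) x) →
    (∀ x, pullbackFiber p (cotangentAlgebroid PN) x) →
    ∀ x, pullbackFiber p (cotangentAlgebroid PN) x}
  {Θ : ∀ x, B.fiber x ≃ₗ[ℝ] (pullbackAlgebroid p (cotangentAlgebroid PN) br).fiber x}

/-- The characteristic form of the pullback of a nonvanishing section is the pullback of its
characteristic form. -/
theorem IsIso.exists_isCocycle_pullback
    (hI : IsIso B (pullbackAlgebroid p (cotangentAlgebroid PN) br) Θ)
    (hbr : IsPullbackBracket p (cotangentAlgebroid PN) br) (hB : B.IsLieAlgebroid)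
    (hρ : B.AnchorHom) (hr : B.rank = Module.finrank ℝ EM)
    (hs : ∀ x, Function.Surjective (mfderiv 𝓘(ℝ, EM) 𝓘(ℝ, EN) p x))
    {μ : ∀ y, (cotangentAlgebroid PN).CanLine y} (hμ : (cotangentAlgebroid PN).IsNonvanishing μ)
    {η : (cotangentAlgebroid PN).Cochain} (hη : (cotangentAlgebroid PN).IsCocycle μ η) :
    ∃ ν, B.IsNonvanishing ν ∧ ∃ ξ : B.closedForms, B.IsCocycle ν ξ ∧
      ∀ x v, ξ.1 x v = η (p x) (pullbackProj p (cotangentAlgebroid PN) x (Θ x v)) := by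
  -- The inequality between the dimensions, needed to index adapted frames, comes from the
  -- surjection dp at a point of `M`.
  rcases isEmpty_or_nonempty M with hM | ⟨⟨x₀⟩⟩
  · have hν : B.IsNonvanishing fun x => isEmptyElim x := fun x => isEmptyElim x
    obtain ⟨ξ, hξ⟩ := hν.exists_isCocycle hB hρ
    exact ⟨_, hν, ξ, hξ, fun x => isEmptyElim x⟩
  · have hle : Module.finrank ℝ EN ≤ Module.finrank ℝ EM :=
      LinearMap.finrank_le_finrank_of_surjective
        (f := ((mfderiv 𝓘(ℝ, EM) 𝓘(ℝ, EN) p x₀).toLinearMap : EM →ₗ[ℝ] EN)) (hs x₀)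
    let ε' : Fin (Module.finrank ℝ EN) ⊕ Fin (Module.finrank ℝ EM - Module.finrank ℝ EN)
        ≃ Fin (Module.finrank ℝ EM) :=
      finSumFinEquiv.trans (finCongr (Nat.add_sub_cancel' hle))
    let ε : Fin (cotangentAlgebroid PN).rank ⊕ Fin (Module.finrank ℝ EM - Module.finrank ℝ EN)
        ≃ Fin B.rank := ε'.trans (finCongr hr.symm)
    have hA := isLieAlgebroid_cotangentAlgebroid PN
    have hΨ := hI.isMorphism hbr hB
    obtain ⟨ν, hμν, hν⟩ := exists_isPullbackSection ε ε' hA hB hΨ.anchor hs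
      (hI.exists_isAdapted hs) hμ
    obtain ⟨ξ, hξ⟩ := hν.exists_isCocycle hB hρ
    refine ⟨ν, hν, ξ, hξ, fun x v => ?_⟩
    obtain ⟨U, V, e, θ, α, ϑ, hx, h⟩ := hI.exists_isAdapted hs x
    exact IsCocycle.eq_comp ε ε' hA hB hρ hΨ hs h hx hμ hμν hη hξ v

/-- The modular class of an algebroid isomorphic to a pullback of a cotangent algebroid. -/
theorem IsIso.isPullbackClass_modularClass [SigmaCompactSpace N]
    (hI : IsIso B (pullbackAlgebroid p (cotangentAlgebroid PN) br) Θ)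
    (hbr : IsPullbackBracket p (cotangentAlgebroid PN) br) (hB : B.IsLieAlgebroid)
    (hρ : B.AnchorHom) (hr : B.rank = Module.finrank ℝ EM)
    (hs : ∀ x, Function.Surjective (mfderiv 𝓘(ℝ, EM) 𝓘(ℝ, EN) p x)) :
    (∃! c, (cotangentAlgebroid PN).IsModularClass c) ∧ (∃! c, B.IsModularClass c) ∧
      IsPullbackClass p (cotangentAlgebroid PN) B
        (fun x => (pullbackProj p (cotangentAlgebroid PN) x).comp (Θ x).toLinearMap)
        (cotangentAlgebroid PN).modularClass B.modularClass := by
  have hA := isLieAlgebroid_cotangentAlgebroid PN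
  obtain ⟨μ, hμ⟩ := exists_isNonvanishing_cotangentAlgebroid PN
  obtain ⟨η₀, hη₀⟩ := hμ.exists_isCocycle hA (anchorHom_cotangentAlgebroid PN)
  obtain ⟨ν, hν, ξ, hξ, hξη⟩ := hI.exists_isCocycle_pullback hbr hB hρ hr hs hμ hη₀
  refine ⟨⟨_, (isModularClass_iff hA hμ η₀ hη₀ _).2 rfl,
      fun c hc => (isModularClass_iff hA hμ η₀ hη₀ c).1 hc⟩,
    ⟨_, (isModularClass_iff hB hν ξ hξ _).2 rfl,
      fun c hc => (isModularClass_iff hB hν ξ hξ c).1 hc⟩, fun η hη => ?_⟩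
  rw [modularClass_eq hA hμ η₀ hη₀] at hη
  have h0 : η - η₀ ∈ (cotangentAlgebroid PN).exactForms.submoduleOf
      (cotangentAlgebroid PN).closedForms := (Submodule.Quotient.eq _).1 hη
  obtain ⟨f, hf, hηf⟩ := h0
  let ζ : B.Cochain := fun x => (η.1 (p x)).comp
    ((pullbackProj p (cotangentAlgebroid PN) x).comp (Θ x).toLinearMap)
  -- Another representative on `N` differs from `η₀` by the differential of some f. Its pullback
  -- then differs from that of `η₀` by the differential of f ∘ p.
  have hex : ζ - ξ.1 ∈ B.exactForms := by
    refine ⟨f ∘ p, hf.comp p.contMDiff, fun x v => ?_⟩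
    have h1 := hηf (p x) (pullbackProj p (cotangentAlgebroid PN) x (Θ x v))
    rw [dFun_comp_apply hf, ← hI.anchor x v]
    refine Eq.trans (congrArg (fun t => _ - t) (hξη x v)) (h1.trans ?_)
    exact congrArg (dFun EN f (p x)) (anchor_pullbackProj x (Θ x v))
  have hcl := B.closedForms.add_mem (exactForms_le_closedForms hB hρ hex) ξ.2
  rw [sub_add_cancel] at hcl
  exact ⟨hcl, (modularClass_eq hB hν ξ hξ).symm ▸ (Submodule.Quotient.eq _).2 hex⟩

end

end PreLieAlgebroid

end DiracGeometry

end

/-! ### The main theorem. -/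

open DiracGeometry

theorem mainTheorem6
    {EM : Type*} [NormedAddCommGroup EM] [NormedSpace ℝ EM] [FiniteDimensional ℝ EM]
    {M : Type*} [TopologicalSpace M] [T2Space M] [SigmaCompactSpace M] [ChartedSpace EM M]
    [IsManifold 𝓘(ℝ, EM) ∞ M]
    (P : PoissonStructure EM M) (L : ∀ x : M, Submodule ℝ (GenTan EM x))
    (hL : IsDiracStructurePoisson P L) :
    -- the image of `L` is an ordinary Dirac structure with the same characteristic foliation
    IsDiracStructure (shiftImage P L) ∧
    (∀ x, charDist (shiftImage P L) x = charDist L x) ∧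
    charFoliation (shiftImage P L) = charFoliation L ∧
    -- `X + α ↦ X + π♯ α + α` is an isomorphism of Lie algebroids onto the image
    (diracAlgebroidPoisson P L).IsLieAlgebroid ∧
    (diracAlgebroid (shiftImage P L)).IsLieAlgebroid ∧
    (∃ Θ : ∀ x, (diracAlgebroidPoisson P L).fiber x ≃ₗ[ℝ] (diracAlgebroid (shiftImage P L)).fiber x,
      (∀ x v, (Θ x v : GenTan EM x) = shift P x v) ∧
      PreLieAlgebroid.IsIso (diracAlgebroidPoisson P L) (diracAlgebroid (shiftImage P L)) Θ) ∧
    -- the reducible case, with leaf space `p : M → N`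
    ∀ {EN : Type*} [NormedAddCommGroup EN] [NormedSpace ℝ EN] [FiniteDimensional ℝ EN]
      {N : Type*} [TopologicalSpace N] [T2Space N] [SigmaCompactSpace N] [ChartedSpace EN N]
      [IsManifold 𝓘(ℝ, EN) ∞ N] (p : C^∞⟮𝓘(ℝ, EM), M; 𝓘(ℝ, EN), N⟯), IsReduction L p →
    (∃! PN : PoissonStructure EN N, IsInducedPoisson (shiftImage P L) p PN) ∧
    ∀ PN : PoissonStructure EN N, IsInducedPoisson (shiftImage P L) p PN →
      (cotangentAlgebroid PN).IsLieAlgebroid ∧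
      ∃ br, IsPullbackBracket p (cotangentAlgebroid PN) br ∧
        (pullbackAlgebroid p (cotangentAlgebroid PN) br).IsLieAlgebroid ∧
        ∃ Θ : ∀ x, (diracAlgebroidPoisson P L).fiber x ≃ₗ[ℝ]
            (pullbackAlgebroid p (cotangentAlgebroid PN) br).fiber x,
          PreLieAlgebroid.IsIso (diracAlgebroidPoisson P L)
            (pullbackAlgebroid p (cotangentAlgebroid PN) br) Θ ∧
          (∀ x v, ((pullbackProj p (cotangentAlgebroid PN) x (Θ x v) : Cot EN (p x)).comp
            (mfderiv 𝓘(ℝ, EM) 𝓘(ℝ, EN) p x) : Cot EM x) = (v : GenTan EM x).2) ∧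
          -- the modular class of `L` is well defined and is the pullback of that of `T*(M/F)`
          (∃! c, (cotangentAlgebroid PN).IsModularClass c) ∧
          (∃! c, (diracAlgebroidPoisson P L).IsModularClass c) ∧
          IsPullbackClass p (cotangentAlgebroid PN) (diracAlgebroidPoisson P L)
            (fun x => (pullbackProj p (cotangentAlgebroid PN) x).comp (Θ x).toLinearMap)
            (cotangentAlgebroid PN).modularClass (diracAlgebroidPoisson P L).modularClass := by
  have hD := hL.isDiracStructure
  refine ⟨hD, fun _ => charDist_shiftImage P, congrArg leaves (charDist_eq_of_shift P), hL.isLieAlgebroid,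
    hD.isLieAlgebroid, ⟨shiftImageEquiv P L, fun x v => rfl, hL.isIso⟩, ?_⟩
  intro EN _ _ _ N _ _ _ _ _ p hr
  have hr' := hr.shiftImage P
  refine ⟨existsUnique_isInducedPoisson hD hr', fun PN hi => ?_⟩
  obtain ⟨Ξ, hΞ⟩ := exists_reducedEquiv hD hr' hi
  -- The isomorphism is the shift followed by X + p^*β ↦ (X, β).
  have hI := hL.isIso.trans (isIso_transportBracket hr' hΞ)
  have hbr := isPullbackBracket_transportBracket hD hr' hΞ
  exact ⟨isLieAlgebroid_cotangentAlgebroid PN, transportBracket Ξ, hbr,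
    isLieAlgebroid_transportBracket hD hr' hΞ, _, hI,
    fun x v => (hΞ x (shiftImageEquiv P L x v)).2,
    hI.isPullbackClass_modularClass hbr hL.isLieAlgebroid hL.anchorHom rfl hr.submersion⟩
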